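/- **Notation.** Fix $\eta\in\mathbb C$ with $\operatorname{Im}\eta>0$. Put $q^z=e^{\pi i\eta z}$, $[z]=\frac{q^z-q^{-z}}{q-q^{-1}}$, $[z]_k=[z][z+1]\cdots[z+k-1]$, $[k]!=[1]\cdots[k]$. Fix integers $n\ge 1$, $\mathbf m\ge 0$, and let $\mathcal Z^n[\mathbf m]$ be the set of $\vec m\in(\mathbb Z_{\ge0})^n$ with $m_1+\dots+m_n=\mathbf m$. Let $\vec\Lambda\in\mathbb C^n$ satisfy $\Lambda_1+\dots+\Lambda_n=2\mathbf m$, and let $\lambda\in\mathbb C$. **Trace matrix.** $\mathcal U_q(\mathfrak{sl}_2)$ is generated by $\mathbf E,\mathbf F,q^{x\mathbf h}$ ($x\in\mathbb C$) with $q^{0\mathbf h}=1$, $q^{x\mathbf h}q^{y\mathbf h}=q^{(x+y)\mathbf h}$, $q^{x\mathbf h}\mathbf E=q^{2x}\mathbf Eq^{x\mathbf h}$, $q^{x\mathbf h}\mathbf F=q^{-2x}\mathbf Fq^{x\mathbf h}$, $\mathbf{EF}-\mathbf{FE}=\frac{q^{\mathbf h}-q^{-\mathbf h}}{q-q^{-1}}$,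 and $\Delta(\mathbf E)=\mathbf E\otimes1+q^{\mathbf h}\otimes\mathbf E$, $\Delta(\mathbf F)=\mathbf F\otimes q^{-\mathbf h}+1\otimes\mathbf F$, $\Delta(q^{x\mathbf h})=q^{x\mathbf h}\otimes q^{x\mathbf h}$. The Verma module $M_\mu$ has basis $v_\mu^{(k)}$, $k\ge0$, with $\mathbf Ev^{(k)}_\mu=[\mu-k+1]v^{(k-1)}_\mu$, $\mathbf Fv_\mu^{(k)}=[k+1]v_\mu^{(k+1)}$, $q^{x\mathbf h}v_\mu^{(k)}=q^{(\mu-2k)x}v_\mu^{(k)}$ (with $v_\mu^{(-1)}=0$). The dual module $M_\Lambda^*$ has basis $u_k$, $k\ge 0$, with $\mathbf Eu_k=[k]u_{k-1}$, $\mathbf Fu_k=[\Lambda-k]u_{k+1}$, $q^{x\mathbf h}u_k=q^{(\Lambda-2k)x}u_k$. Let $\Phi_m^\Lambda(\lambda):M_{\lambda-1}\to M_{\lambda-\Lambda+2m-1}\otimes M_\Lambda^*$ be the intertwining operator with $$v_{\lambda-1}^{(0)}\mapsto\sum_{i=0}^mq^{i(\lambda-\Lambda+2m-i)}[-\lambda+\Lambda-2m+i+1]_{m-i}\,v^{(i)}_{\lambda-\Lambda+2m-1}\otimes\mathbf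 E^iu_m .$$ For $\vec m\in\mathcal Z^n[\mathbf m]$ let $\Phi_{\vec m}^{\vec\Lambda}(\lambda):M_{\lambda-1}\to M_{\lambda-1}\otimes M_{\Lambda_1}^*\otimes\dots\otimes M_{\Lambda_n}^*$ be the composition $$\Big(\Phi_{m_1}^{\Lambda_1}\big(\lambda-\textstyle\sum_{i\ge2}(\Lambda_i-2m_i)\big)\otimes1^{n-1}\Big)\cdots\Big(\Phi_{m_{n-1}}^{\Lambda_{n-1}}(\lambda-\Lambda_n+2m_n)\otimes1\Big)\Phi_{m_n}^{\Lambda_n}(\lambda).$$ The entry $\mathcal F_{\vec m}^{\vec m'}(\lambda,x;\vec\Lambda)$ (row $\vec m$, column $\vec m'$) of the universal trace matrix $\mathcal F$ is the coefficient of $u_{m'_1}\otimes\dots\otimes u_{m'_n}$ in $$q^{-\mathbf m(\mathbf m+1)/2}(q-q^{-1})^{\mathbf m}(q^x-q^{-x})\operatorname{Tr}\big|_{M_{\lambda-1}}\big(\Phi_{\vec m}^{\vec\Lambda}(\lambda)q^{x\mathbf h}\big),$$ a series which converges for $|q^{2x}|$ large and is continued meromorphically to $x\in\mathbb C$. **Hypergeometric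 matrices.** For $\vec t=(t_1,\dots,t_{\mathbf m})$ put $$\Omega(\vec t;\vec\Lambda)=\prod_{i=1}^{\mathbf m}\prod_{k=1}^n\frac1{(t_i-q^{\Lambda_k})(q^{\Lambda_k}t_i-1)}\prod_{i<j}\frac{(t_i-t_j)^2}{(qt_i-q^{-1}t_j)(q^{-1}t_i-qt_j)} .$$ For $\vec\sigma=(\sigma_0,\dots,\sigma_n)\in\mathcal Z^{n+1}[\mathbf m]$ let $\vec t_{\vec\sigma}$ be the string of $\sigma_0$ zeros followed, for $k=1,\dots,n$, by $q^{-\Lambda_k+2(\sigma_k-1)},\dots,q^{-\Lambda_k+2},q^{-\Lambda_k}$. For symmetric polynomials $f,g$ in $\vec t$ the hypergeometric pairing is $$\mathcal I_{\vec\Lambda}(f,g)=\sum_{\vec\sigma\in\mathcal Z^{n+1}[\mathbf m]}\frac{q^{\sigma_0(\sigma_0-1)/2}}{[\sigma_0]!}f(\vec t_{\vec\sigma})g(\vec t_{\vec\sigma})\operatorname{Res}_{\vec t=\vec t_{\vec\sigma}}\frac{\Omega(\vec t;\vec\Lambda)}{t_1\cdots t_{\mathbf m}},$$ where $\operatorname{Res}_{\vec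 t=\vec a}=\operatorname{Res}_{t_1=a_1}\operatorname{Res}_{t_2=a_2}\cdots\operatorname{Res}_{t_{\mathbf m}=a_{\mathbf m}}$ is the iterated residue. With sums over all ordered partitions of $\{1,\dots,\mathbf m\}$ into disjoint $I_1,\dots,I_n$ with $\#I_k=m_k$, and with $c_{\vec m}=[m_1]!\cdots[m_n]!/[\mathbf m]!$, define the symmetric polynomials $$\omega_{\vec m}=c_{\vec m}\sum_{I_1,\dots,I_n}\prod_{k<l}\prod_{i\in I_k,\,j\in I_l}\frac{qt_i-q^{-1}t_j}{t_i-t_j}\prod_{k=1}^n\prod_{i\in I_k}\Big(q^{\sum_{l\le k}m_l}\,t_i\prod_{l<k}(q^{\Lambda_l}t_i-1)\prod_{l>k}(t_i-q^{\Lambda_l})\Big),$$ $$\mathcal W_{\vec m}(\lambda)=c_{\vec m}\sum_{I_1,\dots,I_n}\prod_{k<l}\prod_{i\in I_k,\,j\in I_l}\frac{qt_i-q^{-1}t_j}{t_i-t_j}\prod_{k=1}^n\prod_{i\in I_k}\Big(\big(q^{-\lambda+m_k+\sum_{l\ge k}(\Lambda_l-2m_l)}t_i-q^{\lambda+m_k+\sum_{l\le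 k}(\Lambda_l-2m_l)}\big)\prod_{l<k}(q^{\Lambda_l}t_i-1)\prod_{l>k}(t_i-q^{\Lambda_l})\Big),$$ $$\mathcal W^{\vec m}(x)=c_{\vec m}\sum_{I_1,\dots,I_n}\prod_{l<k}\prod_{i\in I_k,\,j\in I_l}\frac{qt_i-q^{-1}t_j}{t_i-t_j}\prod_{k=1}^n\prod_{i\in I_k}\Big(\big(q^{-x+m_k+\sum_{l\le k}(\Lambda_l-2m_l)}t_i-q^{x+m_k+\sum_{l\ge k}(\Lambda_l-2m_l)}\big)\prod_{l>k}(q^{\Lambda_l}t_i-1)\prod_{l<k}(t_i-q^{\Lambda_l})\Big).$$ The hypergeometric qKZ and qKZB matrices have the entries (row $\vec m$, column $\vec m'$) $$\mathcal H_{\vec m}^{\vec m'}(x;\vec\Lambda)=\mathcal I_{\vec\Lambda}\big(\omega_{\vec m},\mathcal W^{\vec m'}(x)\big),\qquad \mathbb H_{\vec m}^{\vec m'}(\lambda,x;\vec\Lambda)=q^{\lambda x}\,\mathcal I_{\vec\Lambda}\big(\mathcal W_{\vec m}(\lambda),\mathcal W^{\vec m'}(x)\big).$$ They are meromorphic in $\vec\Lambda$: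 call $\vec\Lambda$ (on the hyperplane $\sum_i\Lambda_i=2\mathbf m$) generic if $q^{\Lambda_j+\Lambda_k}\ne q^{2s}$ for all $j,k$ and all integers $0\le s<\mathbf m$, and $q^{\Lambda_j-\Lambda_k}\ne q^{2s}$ for all $j\ne k$ and all integers $|s|\le\mathbf m$. For generic $\vec\Lambda$ the entries are given by the residue sums above. At any other point of the hyperplane they are defined as the limits of these along generic points of the hyperplane. Call $\mathcal H$ (respectively $\mathbb H(\lambda,\cdot\,;\cdot)$) regular at $\vec\Lambda$ if $\vec\Lambda$ is generic or if these limits exist for every $x\in\mathbb C$. **Theorem 4.5.** Let $\Lambda_1+\dots+\Lambda_n=2\mathbf m$ and $\lambda\in\mathbb C$. The trace series defining $\mathcal F(\lambda,x;\vec\Lambda)$ converges for $|q^{2x}|$ sufficiently large and its sum continues to a meromorphic matrix function of $x\in\mathbb C$. If $\mathcal H$ and $\mathbb H(\lambda,\cdot\,;\cdot)$ are regular at $\vec\Lambda$, then for every $x\in\mathbb C$ which is not a pole of $\mathcal F(\lambda,\cdot\,;\vec\Lambda)$, $$\mathbb H(\lambda,x;\vec\Lambda)=\mathcal F(\lambda,x;\vec\Lambda)\,\mathcal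 H(x;\vec\Lambda).$$ -/

import Mathlib

open scoped TensorProduct Topology
open Filter

noncomputable section

namespace HyperQKZ

/-! ### q-numbers -/

/-- `q ^ z = exp (π i η z)`. -/
def qpow (η z : ℂ) : ℂ := Complex.exp (Real.pi * Complex.I * η * z)

/-- `[z] = (q ^ z - q ^ (-z)) / (q - q⁻¹)`. -/
def qnum (η z : ℂ) : ℂ := (qpow η z - qpow η (-z)) / (qpow η 1 - qpow η (-1))

/-- `[z]_k = [z] [z + 1] ... [z + k - 1]`. -/
def qpoch (η z : ℂ) (k : ℕ) : ℂ := ∏ i ∈ Finset.range k, qnum η (z + i)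

/-- `[k]! = [1] [2] ... [k]`. -/
def qfact (η : ℂ) (k : ℕ) : ℂ := ∏ i ∈ Finset.range k, qnum η ((i : ℂ) + 1)

theorem qpow_zero (η : ℂ) : qpow η 0 = 1 := by simp [qpow]

theorem qpow_add (η a b : ℂ) : qpow η (a + b) = qpow η a * qpow η b := by
  simp only [qpow, ← Complex.exp_add]
  congr 1
  ring

theorem qpow_ne_zero (η a : ℂ) : qpow η a ≠ 0 := Complex.exp_ne_zero _

theorem qpow_neg (η a : ℂ) : qpow η (-a) = (qpow η a)⁻¹ := by
  refine eq_inv_of_mul_eq_one_left ?_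
  rw [← qpow_add, neg_add_cancel, qpow_zero]

theorem qpow_natCast_ne {η : ℂ} (hη : 0 < η.im) (k : ℕ) :
    qpow η ((k : ℂ) + 1) ≠ qpow η (-((k : ℂ) + 1)) := by
  intro h
  have h2 := congrArg norm h
  simp only [qpow, Complex.norm_exp] at h2
  have h3 := Real.exp_injective h2
  have hp := mul_pos Real.pi_pos hη
  have hk : (0 : ℝ) < (k : ℝ) + 1 := by positivity
  simp at h3
  rcases h3 with h3 | h3
  · linarith
  · exact hη.ne' h3

theorem q_sub_ne_zero {η : ℂ} (hη : 0 < η.im) : qpow η 1 - qpow η (-1) ≠ 0 := by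
  have h := qpow_natCast_ne hη 0
  simp only [Nat.cast_zero, zero_add] at h
  exact sub_ne_zero.mpr h

theorem qnum_succ_ne_zero {η : ℂ} (hη : 0 < η.im) (k : ℕ) : qnum η ((k : ℂ) + 1) ≠ 0 :=
  div_ne_zero (sub_ne_zero.mpr (qpow_natCast_ne hη k)) (q_sub_ne_zero hη)

theorem qfact_succ (η : ℂ) (k : ℕ) : qfact η (k + 1) = qfact η k * qnum η ((k : ℂ) + 1) :=
  Finset.prod_range_succ _ _

theorem qfact_ne_zero {η : ℂ} (hη : 0 < η.im) (k : ℕ) : qfact η k ≠ 0 :=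
  Finset.prod_ne_zero_iff.mpr fun i _ => qnum_succ_ne_zero hη i

theorem qnum_zero (η : ℂ) : qnum η 0 = 0 := by simp [qnum]

/-- `[a + 1] [b - a] - [a] [b - a + 1] = [b - 2 a]`. -/
theorem qnum_identity {η : ℂ} (hη : 0 < η.im) (a b : ℂ) :
    qnum η (a + 1) * qnum η (b - a) - qnum η a * qnum η (b - a + 1) = qnum η (b - 2 * a) := by
  have h := q_sub_ne_zero hη
  have h1 := qpow_ne_zero η 1
  have ha := qpow_ne_zero η a
  have hb := qpow_ne_zero η b
  have e1 : b - a = b + -a := by ring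
  have e2 : b - 2 * a = b + -a + -a := by ring
  simp only [qnum, e1, e2, neg_add, neg_neg, qpow_add, qpow_neg] at h ⊢
  rw [div_mul_div_comm, div_mul_div_comm, div_sub_div_same,
    div_eq_div_iff (mul_ne_zero h h) h]
  field_simp
  ring

/-! ### Modules over the quantum group -/

/-- A module over `U_q(sl_2)`: operators `E`, `F` and `K x = q ^ (x h)`, `x ∈ ℂ`, satisfying the
defining relations of the algebra. -/
structure QModule (η : ℂ) (V : Type*) [AddCommGroup V] [Module ℂ V] where
  E : Module.End ℂ V
  F : Module.End ℂ V
  K : ℂ → Module.End ℂ V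
  K_zero : K 0 = 1
  K_add : ∀ x y, K (x + y) = K x * K y
  K_E : ∀ x, K x * E = qpow η (2 * x) • (E * K x)
  K_F : ∀ x, K x * F = qpow η (-2 * x) • (F * K x)
  E_F : E * F - F * E = (qpow η 1 - qpow η (-1))⁻¹ • (K 1 - K (-1))

/-- A linear map intertwining two `U_q(sl_2)`-module structures. -/
structure IsIntertwiner {η : ℂ} {V W : Type*} [AddCommGroup V] [Module ℂ V]
    [AddCommGroup W] [Module ℂ W] (ρ : QModule η V) (σ : QModule η W) (A : V →ₗ[ℂ] W) : Prop where
  map_E : ∀ v, A (ρ.E v) = σ.E (A v)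
  map_F : ∀ v, A (ρ.F v) = σ.F (A v)
  map_K : ∀ x v, A (ρ.K x v) = σ.K x (A v)

/-- The common underlying space of all Verma modules and all contragredient dual Verma modules;
`bv k` is the basis vector `v^(k)`, respectively `u_k`. -/
abbrev VermaSpace : Type := ℕ →₀ ℂ

/-- The standard basis vectors. -/
abbrev bv (k : ℕ) : VermaSpace := Finsupp.single k 1

/-- The linear map with prescribed values on the standard basis. -/
abbrev onBasis {V : Type*} [AddCommGroup V] [Module ℂ V] (f : ℕ → V) : VermaSpace →ₗ[ℂ] V :=
  Finsupp.linearCombination ℂ f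

theorem onBasis_bv {V : Type*} [AddCommGroup V] [Module ℂ V] (f : ℕ → V) (k : ℕ) :
    onBasis f (bv k) = f k := by simp [onBasis, bv]

theorem ext_bv {V : Type*} [AddCommGroup V] [Module ℂ V] {A B : VermaSpace →ₗ[ℂ] V}
    (h : ∀ k, A (bv k) = B (bv k)) : A = B := by
  ext k
  simpa using h k

/-- The Verma module `M_μ`:
`E v^(k) = [μ - k + 1] v^(k-1)`, `F v^(k) = [k + 1] v^(k+1)`, `q^(xh) v^(k) = q^((μ - 2k) x) v^(k)`
(with `v^(-1) = 0`). -/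
def verma (η : ℂ) (hη : 0 < η.im) (μ : ℂ) : QModule η VermaSpace where
  E := onBasis fun k => if k = 0 then 0 else qnum η (μ - k + 1) • bv (k - 1)
  F := onBasis fun k => qnum η ((k : ℂ) + 1) • bv (k + 1)
  K x := onBasis fun k => qpow η ((μ - 2 * k) * x) • bv k
  K_zero := by
    refine ext_bv fun k => ?_
    simp only [onBasis_bv]
    simp [qpow_zero]
  K_add x y := by
    refine ext_bv fun k => ?_
    simp only [onBasis_bv, Module.End.mul_apply, map_smul, smul_smul, mul_add, qpow_add]
    rw [mul_comm]
  K_E x := by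
    refine ext_bv fun k => ?_
    rcases k with _ | k
    · simp only [onBasis_bv, Module.End.mul_apply, map_smul, LinearMap.smul_apply]
      simp
    · simp only [onBasis_bv, Module.End.mul_apply, map_smul, LinearMap.smul_apply]
      simp only [Nat.succ_ne_zero, if_false, Nat.add_sub_cancel, map_smul, onBasis_bv, smul_smul]
      congr 1
      rw [mul_comm (qnum _ _), ← mul_assoc, ← qpow_add]
      congr 2
      push_cast
      ring
  K_F x := by
    refine ext_bv fun k => ?_
    simp only [onBasis_bv, Module.End.mul_apply, map_smul, LinearMap.smul_apply, smul_smul]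
    congr 1
    rw [mul_comm (qnum _ _), ← mul_assoc, ← qpow_add]
    congr 2
    push_cast
    ring
  E_F := by
    refine ext_bv fun k => ?_
    have key := qnum_identity hη (k : ℂ) μ
    have hr : (qpow η 1 - qpow η (-1))⁻¹ * (qpow η ((μ - 2 * k) * 1) - qpow η ((μ - 2 * k) * -1))
        = qnum η (μ - 2 * k) := by
      rw [qnum, mul_one, mul_neg_one, div_eq_inv_mul]
    simp only [onBasis_bv, Module.End.mul_apply, map_smul, LinearMap.smul_apply,
      LinearMap.sub_apply, ← sub_smul, smul_smul, hr, ← key]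
    rcases k with _ | k
    · simp [qnum_zero]
    · simp only [Nat.succ_ne_zero, if_false, Nat.add_sub_cancel, map_smul, onBasis_bv, smul_smul,
        ← sub_smul]
      congr 1
      push_cast
      ring_nf

/-- The contragredient dual Verma module `M_Λ^*`:
`E u_k = [k] u_(k-1)`, `F u_k = [Λ - k] u_(k+1)`, `q^(xh) u_k = q^((Λ - 2k) x) u_k`. -/
def dualVerma (η : ℂ) (hη : 0 < η.im) (L : ℂ) : QModule η VermaSpace where
  E := onBasis fun k => qnum η k • bv (k - 1)
  F := onBasis fun k => qnum η (L - k) • bv (k + 1)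
  K x := onBasis fun k => qpow η ((L - 2 * k) * x) • bv k
  K_zero := by
    refine ext_bv fun k => ?_
    simp only [onBasis_bv]
    simp [qpow_zero]
  K_add x y := by
    refine ext_bv fun k => ?_
    simp only [onBasis_bv, Module.End.mul_apply, map_smul, smul_smul, mul_add, qpow_add]
    rw [mul_comm]
  K_E x := by
    refine ext_bv fun k => ?_
    rcases k with _ | k
    · simp only [onBasis_bv, Module.End.mul_apply, map_smul, LinearMap.smul_apply]
      simp [qnum_zero]
    · simp only [onBasis_bv, Module.End.mul_apply, map_smul, LinearMap.smul_apply]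
      simp only [Nat.add_sub_cancel, smul_smul]
      congr 1
      rw [mul_comm (qnum _ _), ← mul_assoc, ← qpow_add]
      congr 2
      push_cast
      ring
  K_F x := by
    refine ext_bv fun k => ?_
    simp only [onBasis_bv, Module.End.mul_apply, map_smul, LinearMap.smul_apply, smul_smul]
    congr 1
    rw [mul_comm (qnum _ _), ← mul_assoc, ← qpow_add]
    congr 2
    push_cast
    ring
  E_F := by
    refine ext_bv fun k => ?_
    have key := qnum_identity hη (k : ℂ) L
    have hr : (qpow η 1 - qpow η (-1))⁻¹ * (qpow η ((L - 2 * k) * 1) - qpow η ((L - 2 * k) * -1))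
        = qnum η (L - 2 * k) := by
      rw [qnum, mul_one, mul_neg_one, div_eq_inv_mul]
    simp only [onBasis_bv, Module.End.mul_apply, map_smul, LinearMap.smul_apply,
      LinearMap.sub_apply, ← sub_smul, smul_smul, hr, ← key]
    rcases k with _ | k
    · simp [qnum_zero, mul_comm]
    · simp only [Nat.add_sub_cancel, ← sub_smul]
      congr 1
      push_cast
      ring_nf

theorem tmap_sub_left {V W : Type*} [AddCommGroup V] [Module ℂ V] [AddCommGroup W] [Module ℂ W]
    (A B : Module.End ℂ V) (C : Module.End ℂ W) :
    (TensorProduct.map (A - B) C : Module.End ℂ (V ⊗[ℂ] W))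
      = TensorProduct.map A C - TensorProduct.map B C := by
  refine TensorProduct.ext' fun v w => ?_
  simp [TensorProduct.sub_tmul]

theorem tmap_sub_right {V W : Type*} [AddCommGroup V] [Module ℂ V] [AddCommGroup W] [Module ℂ W]
    (A : Module.End ℂ V) (B C : Module.End ℂ W) :
    (TensorProduct.map A (B - C) : Module.End ℂ (V ⊗[ℂ] W))
      = TensorProduct.map A B - TensorProduct.map A C := by
  refine TensorProduct.ext' fun v w => ?_
  simp [TensorProduct.tmul_sub]

/-- The tensor product of two modules, through the comultiplication
`Δ(E) = E ⊗ 1 + q^h ⊗ E`, `Δ(F) = F ⊗ q^(-h) + 1 ⊗ F`, `Δ(q^(xh)) = q^(xh) ⊗ q^(xh)`. -/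
def QModule.tensor {η : ℂ} {V W : Type*} [AddCommGroup V] [Module ℂ V]
    [AddCommGroup W] [Module ℂ W] (ρ : QModule η V) (σ : QModule η W) : QModule η (V ⊗[ℂ] W) where
  E := TensorProduct.map ρ.E 1 + TensorProduct.map (ρ.K 1) σ.E
  F := TensorProduct.map ρ.F (σ.K (-1)) + TensorProduct.map 1 σ.F
  K x := TensorProduct.map (ρ.K x) (σ.K x)
  K_zero := by rw [ρ.K_zero, σ.K_zero, TensorProduct.map_one]
  K_add x y := by rw [ρ.K_add, σ.K_add, TensorProduct.map_mul]
  K_E x := by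
    have c : ρ.K x * ρ.K 1 = ρ.K 1 * ρ.K x := by rw [← ρ.K_add, ← ρ.K_add, add_comm]
    simp only [mul_add, add_mul, ← TensorProduct.map_mul, ρ.K_E, σ.K_E, c, one_mul, mul_one,
      TensorProduct.map_smul_left, TensorProduct.map_smul_right, smul_add]
  K_F x := by
    have c : σ.K x * σ.K (-1) = σ.K (-1) * σ.K x := by rw [← σ.K_add, ← σ.K_add, add_comm]
    simp only [mul_add, add_mul, ← TensorProduct.map_mul, ρ.K_F, σ.K_F, c, one_mul, mul_one,
      TensorProduct.map_smul_left, TensorProduct.map_smul_right, smul_add]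
  E_F := by
    have h1 : TensorProduct.map (ρ.K 1 * ρ.F) (σ.E * σ.K (-1))
        = TensorProduct.map (ρ.F * ρ.K 1) (σ.K (-1) * σ.E) := by
      rw [ρ.K_F, σ.K_E, TensorProduct.map_smul_left, TensorProduct.map_smul_right]
      congr 2
      ring
    have h2 : TensorProduct.map (ρ.E * ρ.F) (σ.K (-1)) - TensorProduct.map (ρ.F * ρ.E) (σ.K (-1))
        = (qpow η 1 - qpow η (-1))⁻¹ •
          TensorProduct.map (ρ.K 1 - ρ.K (-1)) (σ.K (-1)) := by
      rw [← TensorProduct.map_smul_left, ← ρ.E_F, tmap_sub_left]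
    have h3 : TensorProduct.map (ρ.K 1) (σ.E * σ.F) - TensorProduct.map (ρ.K 1) (σ.F * σ.E)
        = (qpow η 1 - qpow η (-1))⁻¹ •
          TensorProduct.map (ρ.K 1) (σ.K 1 - σ.K (-1)) := by
      rw [← TensorProduct.map_smul_right, ← σ.E_F, tmap_sub_right]
    have h4 : (TensorProduct.map (ρ.K 1) (σ.K 1) - TensorProduct.map (ρ.K (-1)) (σ.K (-1))
        : Module.End ℂ (V ⊗[ℂ] W))
        = TensorProduct.map (ρ.K 1 - ρ.K (-1)) (σ.K (-1))
          + TensorProduct.map (ρ.K 1) (σ.K 1 - σ.K (-1)) := by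
      rw [tmap_sub_left, tmap_sub_right]
      abel
    rw [h4, smul_add, ← h2, ← h3]
    simp only [mul_add, add_mul, ← TensorProduct.map_mul, one_mul, mul_one, h1]
    abel

/-- The Verma module is freely generated by its highest weight vector over the powers of `F`, and
`v^(k) = F^k v^(0) / [k]!`. Hence a map out of it which commutes with `F` is determined by the image
`s` of the highest weight vector: it sends `v^(k)` to `F^k s / [k]!`. -/
def fromHighest {η : ℂ} {V : Type*} [AddCommGroup V] [Module ℂ V] (σ : QModule η V) (s : V) :
    VermaSpace →ₗ[ℂ] V :=
  onBasis fun k => (qfact η k)⁻¹ • (σ.F ^ k) s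

section fromHighest

variable {η : ℂ} {V : Type*} [AddCommGroup V] [Module ℂ V] (σ : QModule η V) {s : V} {μ : ℂ}

theorem K_pow_highest (hK : ∀ x, σ.K x s = qpow η (μ * x) • s) (x : ℂ) (k : ℕ) :
    σ.K x ((σ.F ^ k) s) = qpow η ((μ - 2 * k) * x) • (σ.F ^ k) s := by
  induction k with
  | zero => simpa using hK x
  | succ k ih =>
    have h := LinearMap.congr_fun (σ.K_F x) ((σ.F ^ k) s)
    simp only [Module.End.mul_apply, LinearMap.smul_apply] at h
    rw [pow_succ', Module.End.mul_apply, h, ih, map_smul, smul_smul, ← qpow_add]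
    congr 2
    push_cast
    ring

theorem E_pow_highest (hη : 0 < η.im) (hK : ∀ x, σ.K x s = qpow η (μ * x) • s) (hE : σ.E s = 0)
    (k : ℕ) : σ.E ((σ.F ^ (k + 1)) s)
      = (qnum η ((k : ℂ) + 1) * qnum η (μ - k)) • (σ.F ^ k) s := by
  have step : ∀ v, σ.E (σ.F v) = σ.F (σ.E v)
      + (qpow η 1 - qpow η (-1))⁻¹ • (σ.K 1 v - σ.K (-1) v) := by
    intro v
    have h := LinearMap.congr_fun σ.E_F v
    simp only [Module.End.mul_apply, LinearMap.smul_apply, LinearMap.sub_apply] at h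
    rw [← h]
    abel
  have hKk : ∀ k : ℕ, (qpow η 1 - qpow η (-1))⁻¹ •
      (σ.K 1 ((σ.F ^ k) s) - σ.K (-1) ((σ.F ^ k) s)) = qnum η (μ - 2 * k) • (σ.F ^ k) s := by
    intro k
    rw [K_pow_highest σ hK, K_pow_highest σ hK, ← sub_smul, smul_smul]
    congr 1
    rw [qnum, mul_one, mul_neg_one, div_eq_inv_mul]
  induction k with
  | zero =>
    rw [pow_succ', Module.End.mul_apply, step, hKk 0]
    have h1 : qnum η ((0 : ℕ) + 1) = 1 := by
      simpa [qnum] using div_self (q_sub_ne_zero hη)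
    rw [h1]
    simp [hE]
  | succ k ih =>
    rw [pow_succ', Module.End.mul_apply, step, ih, hKk, map_smul, ← Module.End.mul_apply,
      ← pow_succ', ← add_smul]
    congr 1
    have key := qnum_identity hη ((k : ℂ) + 1) μ
    push_cast
    rw [← key]
    ring_nf

/-- If `s` is a singular vector of weight `μ`, then `fromHighest` is an intertwining operator. -/
theorem fromHighest_isIntertwiner (hη : 0 < η.im) (hK : ∀ x, σ.K x s = qpow η (μ * x) • s)
    (hE : σ.E s = 0) : IsIntertwiner (verma η hη μ) σ (fromHighest σ s) := by
  refine ⟨fun v => ?_, fun v => ?_, fun x v => ?_⟩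
  · suffices h : fromHighest σ s ∘ₗ (verma η hη μ).E = σ.E ∘ₗ fromHighest σ s from
      LinearMap.congr_fun h v
    refine ext_bv fun k => ?_
    simp only [LinearMap.comp_apply, fromHighest, onBasis_bv, map_smul]
    rcases k with _ | k
    · simp [verma, hE]
    · rw [E_pow_highest σ hη hK hE]
      simp only [verma, onBasis_bv, Nat.succ_ne_zero, if_false, Nat.add_sub_cancel, map_smul,
        smul_smul, qfact_succ]
      congr 1
      have h1 := qfact_ne_zero hη k
      have h2 := qnum_succ_ne_zero hη k
      have e : μ - ((k + 1 : ℕ) : ℂ) + 1 = μ - k := by push_cast; ring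
      rw [e]
      field_simp
  · suffices h : fromHighest σ s ∘ₗ (verma η hη μ).F = σ.F ∘ₗ fromHighest σ s from
      LinearMap.congr_fun h v
    refine ext_bv fun k => ?_
    simp only [LinearMap.comp_apply, fromHighest, onBasis_bv, map_smul, verma, smul_smul]
    rw [← Module.End.mul_apply, ← pow_succ', qfact_succ]
    congr 1
    have h1 := qfact_ne_zero hη k
    have h2 := qnum_succ_ne_zero hη k
    field_simp
  · suffices h : fromHighest σ s ∘ₗ (verma η hη μ).K x = σ.K x ∘ₗ fromHighest σ s from
      LinearMap.congr_fun h v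
    refine ext_bv fun k => ?_
    simp only [LinearMap.comp_apply, fromHighest, onBasis_bv, map_smul, K_pow_highest σ hK]
    simp only [verma, onBasis_bv, map_smul]
    rw [smul_comm]

/-- It is the only intertwining operator which sends the highest weight vector to `s`. -/
theorem fromHighest_unique (hη : 0 < η.im) (A : VermaSpace →ₗ[ℂ] V)
    (hA : IsIntertwiner (verma η hη μ) σ A) (h0 : A (bv 0) = s) : A = fromHighest σ s := by
  refine ext_bv fun k => ?_
  induction k with
  | zero => simp [h0, fromHighest, qfact]
  | succ k ih =>
    have h := qnum_succ_ne_zero hη k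
    have e : bv (k + 1) = (qnum η ((k : ℂ) + 1))⁻¹ • (verma η hη μ).F (bv k) := by
      simp only [verma, onBasis_bv, smul_smul, inv_mul_cancel₀ h, one_smul]
    have h1 := qfact_ne_zero hη k
    nth_rewrite 1 [e]
    rw [map_smul, hA.map_F, ih]
    simp only [fromHighest, onBasis_bv, map_smul, smul_smul, qfact_succ]
    rw [← Module.End.mul_apply, ← pow_succ']
    congr 1
    field_simp

end fromHighest

/-! ### The holomorphic intertwining operators -/

/-- The image of the highest weight vector of `M_(lam - 1)`: with `μ = lam - L + 2 m`,
`∑ i ≤ m, q^(i (μ - i)) [-μ + i + 1]_(m - i) v_(μ - 1)^(i) ⊗ E^i u_m`. -/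
def singularVector (η : ℂ) (hη : 0 < η.im) (L : ℂ) (m : ℕ) (lam : ℂ) :
    VermaSpace ⊗[ℂ] VermaSpace :=
  ∑ i ∈ Finset.range (m + 1),
    (qpow η (i * (lam - L + 2 * m - i)) * qpoch η (-lam + L - 2 * m + i + 1) (m - i)) •
      (bv i ⊗ₜ[ℂ] ((dualVerma η hη L).E ^ i) (bv m))

/-- The module `M_(lam - L + 2 m - 1) ⊗ M_L^*`. -/
def phiTarget (η : ℂ) (hη : 0 < η.im) (L : ℂ) (m : ℕ) (lam : ℂ) :
    QModule η (VermaSpace ⊗[ℂ] VermaSpace) :=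
  (verma η hη (lam - L + 2 * m - 1)).tensor (dualVerma η hη L)

theorem dualVerma_E_pow (η : ℂ) (hη : 0 < η.im) (L : ℂ) (m i : ℕ) :
    ((dualVerma η hη L).E ^ i) (bv m) = (∏ s ∈ Finset.range i, qnum η ((m - s : ℕ) : ℂ)) •
      bv (m - i) := by
  induction i with
  | zero => simp
  | succ i ih =>
    rw [pow_succ', Module.End.mul_apply, ih, map_smul, Finset.prod_range_succ]
    simp only [dualVerma, onBasis_bv, smul_smul]
    rfl

theorem K_singularVector (η : ℂ) (hη : 0 < η.im) (L : ℂ) (m : ℕ) (lam x : ℂ) :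
    (phiTarget η hη L m lam).K x (singularVector η hη L m lam)
      = qpow η ((lam - 1) * x) • singularVector η hη L m lam := by
  simp only [singularVector, map_sum, Finset.smul_sum, map_smul]
  refine Finset.sum_congr rfl fun i hi => ?_
  have him : i ≤ m := Nat.lt_succ_iff.mp (Finset.mem_range.mp hi)
  rw [dualVerma_E_pow, smul_comm (qpow η ((lam - 1) * x))]
  congr 1
  simp only [phiTarget, QModule.tensor, verma, dualVerma, TensorProduct.map_tmul, map_smul,
    onBasis_bv, TensorProduct.tmul_smul, TensorProduct.smul_tmul', smul_smul]
  congr 2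
  rw [mul_left_comm, ← qpow_add, mul_comm]
  congr 2
  push_cast [Nat.cast_sub him]
  ring

theorem qnum_neg (η z : ℂ) : qnum η (-z) = -qnum η z := by
  simp only [qnum, neg_neg]
  ring

theorem E_singularVector (η : ℂ) (hη : 0 < η.im) (L : ℂ) (m : ℕ) (lam : ℂ) :
    (phiTarget η hη L m lam).E (singularVector η hη L m lam) = 0 := by
  set D := dualVerma η hη L with hD
  set c : ℕ → ℂ := fun i =>
    qpow η (i * (lam - L + 2 * m - i)) * qpoch η (-lam + L - 2 * m + i + 1) (m - i) with hc
  set Q : ℕ → VermaSpace ⊗[ℂ] VermaSpace := fun i =>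
    c i • ((verma η hη (lam - L + 2 * m - 1)).E (bv i) ⊗ₜ[ℂ] (D.E ^ i) (bv m)) with hQ
  set P : ℕ → VermaSpace ⊗[ℂ] VermaSpace := fun i =>
    c i • ((verma η hη (lam - L + 2 * m - 1)).K 1 (bv i) ⊗ₜ[ℂ] (D.E ^ (i + 1)) (bv m)) with hP
  have h0 : (phiTarget η hη L m lam).E (singularVector η hη L m lam)
      = ∑ i ∈ Finset.range (m + 1), (Q i + P i) := by
    simp only [singularVector, map_sum, map_smul]
    refine Finset.sum_congr rfl fun i _ => ?_
    simp only [hQ, hP, ← smul_add, phiTarget, QModule.tensor, LinearMap.add_apply,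
      TensorProduct.map_tmul, Module.End.one_apply, pow_succ', Module.End.mul_apply]
    rfl
  have hQ0 : Q 0 = 0 := by
    simp [hQ, verma]
  have hPm : P m = 0 := by
    have : (D.E ^ (m + 1)) (bv m) = 0 := by
      rw [hD, dualVerma_E_pow, Finset.prod_range_succ]
      simp [qnum_zero]
    simp only [hP, this, TensorProduct.tmul_zero, smul_zero]
  have hPQ : ∀ i ∈ Finset.range m, Q (i + 1) + P i = 0 := by
    intro i hi
    have him : i < m := Finset.mem_range.mp hi
    simp only [hQ, hP, verma, onBasis_bv, Nat.succ_ne_zero, if_false, Nat.add_sub_cancel,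
      ← TensorProduct.smul_tmul', smul_smul, ← add_smul]
    refine (congrArg (· • _) ?_).trans (zero_smul ℂ _)
    obtain ⟨d, rfl⟩ := Nat.exists_eq_add_of_lt him
    have e1 : i + d + 1 - i = d + 1 := by omega
    have e2 : i + d + 1 - (i + 1) = d := by omega
    simp only [hc, e1, e2, qpoch, Finset.prod_range_succ']
    have e3 : qnum η (lam - L + 2 * ((i + d + 1 : ℕ) : ℂ) - 1 - ((i + 1 : ℕ) : ℂ) + 1)
        = -qnum η (-lam + L - 2 * ((i + d + 1 : ℕ) : ℂ) + i + 1 + ((0 : ℕ) : ℂ)) := by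
      rw [← qnum_neg]
      congr 1
      push_cast
      ring
    have e4 : ∀ k : ℕ, -lam + L - 2 * ((i + d + 1 : ℕ) : ℂ) + ((i + 1 : ℕ) : ℂ) + 1 + (k : ℂ)
        = -lam + L - 2 * ((i + d + 1 : ℕ) : ℂ) + i + 1 + ((k + 1 : ℕ) : ℂ) := by
      intro k
      push_cast
      ring
    have e5 : qpow η (((i + 1 : ℕ) : ℂ) * (lam - L + 2 * ((i + d + 1 : ℕ) : ℂ) - ((i + 1 : ℕ) : ℂ)))
        = qpow η ((i : ℂ) * (lam - L + 2 * ((i + d + 1 : ℕ) : ℂ) - i))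
          * qpow η ((lam - L + 2 * ((i + d + 1 : ℕ) : ℂ) - 1 - 2 * i) * 1) := by
      rw [← qpow_add]
      congr 1
      push_cast
      ring
    simp only [e3, e4, e5]
    ring
  rw [h0, Finset.sum_add_distrib, Finset.sum_range_succ', Finset.sum_range_succ P, hQ0, hPm,
    add_zero, add_zero, ← Finset.sum_add_distrib]
  exact Finset.sum_eq_zero hPQ

/-- The intertwining operator `Φ_m^L(lam) : M_(lam - 1) → M_(lam - L + 2 m - 1) ⊗ M_L^*` which sends
the highest weight vector to `singularVector`. -/
def Phi (η : ℂ) (hη : 0 < η.im) (L : ℂ) (m : ℕ) (lam : ℂ) :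
    VermaSpace →ₗ[ℂ] VermaSpace ⊗[ℂ] VermaSpace :=
  fromHighest (phiTarget η hη L m lam) (singularVector η hη L m lam)

theorem Phi_isIntertwiner (η : ℂ) (hη : 0 < η.im) (L : ℂ) (m : ℕ) (lam : ℂ) :
    IsIntertwiner (verma η hη (lam - 1)) (phiTarget η hη L m lam) (Phi η hη L m lam) :=
  fromHighest_isIntertwiner _ hη (K_singularVector η hη L m lam) (E_singularVector η hη L m lam)

theorem Phi_unique (η : ℂ) (hη : 0 < η.im) (L : ℂ) (m : ℕ) (lam : ℂ)
    (A : VermaSpace →ₗ[ℂ] VermaSpace ⊗[ℂ] VermaSpace)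
    (hA : IsIntertwiner (verma η hη (lam - 1)) (phiTarget η hη L m lam) A)
    (h0 : A (bv 0) = singularVector η hη L m lam) : A = Phi η hη L m lam :=
  fromHighest_unique (V := VermaSpace ⊗[ℂ] VermaSpace) (phiTarget η hη L m lam) hη A hA h0

/-! ### Compositions and the universal trace matrix -/

/-- `M_(Λ_1)^* ⊗ ... ⊗ M_(Λ_n)^*`, written in its standard monomial basis
`u_μ = u_(μ_1) ⊗ ... ⊗ u_(μ_n)`. -/
abbrev DualTensor (n : ℕ) : Type := (Fin n → ℕ) →₀ ℂ

/-- The identification `M_(Λ_1)^* ⊗ (M_(Λ_2)^* ⊗ ... ) = M_(Λ_1)^* ⊗ M_(Λ_2)^* ⊗ ...`, sending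
`u_a ⊗ u_(b_1, b_2, ...)` to `u_(a, b_1, b_2, ...)`. -/
def consTensor (n : ℕ) : VermaSpace ⊗[ℂ] DualTensor n ≃ₗ[ℂ] DualTensor (n + 1) :=
  (finsuppTensorFinsupp' ℂ ℕ (Fin n → ℕ)).trans
    (Finsupp.domLCongr (Fin.consEquiv fun _ : Fin (n + 1) => ℕ))

/-- The composition of intertwining operators
`(Φ_(μ_1)^(Λ_1)(lam - ∑_(i ≥ 2) (Λ_i - 2 μ_i)) ⊗ 1) ... Φ_(μ_n)^(Λ_n)(lam)`, a map
`M_(lam - 1) → M_(lam - 1 - ∑ (Λ_i - 2 μ_i)) ⊗ M_(Λ_1)^* ⊗ ... ⊗ M_(Λ_n)^*`. -/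
def PhiMulti (η : ℂ) (hη : 0 < η.im) : (n : ℕ) → (Fin n → ℂ) → (Fin n → ℕ) → ℂ →
    (VermaSpace →ₗ[ℂ] VermaSpace ⊗[ℂ] DualTensor n)
  | 0, _, _, _ => (TensorProduct.mk ℂ VermaSpace (DualTensor 0)).flip (Finsupp.single default 1)
  | n + 1, Λ, μ, lam =>
      LinearMap.lTensor VermaSpace (consTensor n).toLinearMap ∘ₗ
        (TensorProduct.assoc ℂ VermaSpace VermaSpace (DualTensor n)).toLinearMap ∘ₗ
        LinearMap.rTensor (DualTensor n)
          (Phi η hη (Λ 0) (μ 0) (lam - ∑ i : Fin n, (Λ i.succ - 2 * μ i.succ))) ∘ₗ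
        PhiMulti η hη n (Fin.tail Λ) (Fin.tail μ) lam

/-- The diagonal coefficient `⟨u_k, A v^(k)⟩ ∈ T` of a `T`-valued operator `A : M → M ⊗ T`; the
trace of `A` over `M` is the sum of these over `k`. -/
def diagCoeff {T : Type*} [AddCommGroup T] [Module ℂ T]
    (A : VermaSpace →ₗ[ℂ] VermaSpace ⊗[ℂ] T) (k : ℕ) : T :=
  TensorProduct.lid ℂ T (LinearMap.rTensor T (Finsupp.lapply k) (A (bv k)))

/-- The set of multi-indices `μ ∈ (ℤ_{≥ 0})^n` with `μ_1 + ... + μ_n = m`. -/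
abbrev Idx (n m : ℕ) : Type := {μ : Fin n → ℕ // μ ∈ Finset.Nat.antidiagonalTuple n m}

/-- The `k`-th term of the series for the `μ'`-coordinate of
`q^(-m(m+1)/2) (q - q⁻¹)^m (q^x - q^(-x)) Tr_{M_(lam - 1)} (Φ_μ^Λ(lam) q^(xh))`. -/
def traceTerm (η : ℂ) (hη : 0 < η.im) {n : ℕ} (m : ℕ) (Λ : Fin n → ℂ) (lam : ℂ)
    (μ μ' : Idx n m) (x : ℂ) (k : ℕ) : ℂ :=
  qpow η (-((m : ℂ) * (m + 1) / 2)) * (qpow η 1 - qpow η (-1)) ^ m * (qpow η x - qpow η (-x)) *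
    diagCoeff (PhiMulti η hη n Λ μ.1 lam ∘ₗ (verma η hη (lam - 1)).K x) k μ'.1

/-- `f` is the meromorphic function of `x ∈ ℂ` which is the sum of the trace series in a domain
`|q^(2x)| > R`. -/
def IsTraceFunction (η : ℂ) (hη : 0 < η.im) {n : ℕ} (m : ℕ) (Λ : Fin n → ℂ) (lam : ℂ)
    (μ μ' : Idx n m) (f : ℂ → ℂ) : Prop :=
  Meromorphic f ∧ ∃ R : ℝ, ∀ x : ℂ, R < ‖qpow η (2 * x)‖ →
    HasSum (traceTerm η hη m Λ lam μ μ' x) (f x)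

open Classical in
/-- The entries of the universal trace matrix as functions of `x`: the meromorphic continuation of
the sum of the trace series, with removable singularities removed. -/
def traceFunction (η : ℂ) (hη : 0 < η.im) {n : ℕ} (m : ℕ) (Λ : Fin n → ℂ) (lam : ℂ)
    (μ μ' : Idx n m) : ℂ → ℂ :=
  if h : ∃ f, IsTraceFunction η hη m Λ lam μ μ' f then
    toMeromorphicNFOn h.choose Set.univ
  else 0

/-- The universal trace matrix; `μ` is the row index and `μ'` the column index. -/
def traceMatrix (η : ℂ) (hη : 0 < η.im) {n : ℕ} (m : ℕ) (Λ : Fin n → ℂ) (lam x : ℂ) :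
    Matrix (Idx n m) (Idx n m) ℂ :=
  Matrix.of fun μ μ' => traceFunction η hη m Λ lam μ μ' x

/-! ### The hypergeometric pairing -/

/-- The residue of `f` at an isolated singularity `a`, as the limit for `r → 0` of
`(2πi)⁻¹ ∮_{|z - a| = r} f(z) dz`. -/
def residue (f : ℂ → ℂ) (a : ℂ) : ℂ :=
  limUnder (𝓝[>] (0 : ℝ)) fun r => (2 * Real.pi * Complex.I)⁻¹ * ∮ z in C(a, r), f z

/-- The iterated residue `Res_{t_1 = a_1} (Res_{t_2 = a_2} ( ... Res_{t_m = a_m} A(t) ... ))`. -/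
def multiResidue : (m : ℕ) → ((Fin m → ℂ) → ℂ) → (Fin m → ℂ) → ℂ
  | 0, A, a => A a
  | m + 1, A, a =>
      residue (fun z => multiResidue m (fun t => A (Fin.cons z t)) (Fin.tail a)) (a 0)

/-- The density `Ω(t; Λ)`. -/
def Omega (η : ℂ) {n m : ℕ} (Λ : Fin n → ℂ) (t : Fin m → ℂ) : ℂ :=
  (∏ i, ∏ k, ((t i - qpow η (Λ k)) * (qpow η (Λ k) * t i - 1))⁻¹) *
    ∏ i, ∏ j ∈ Finset.Ioi i, (t i - t j) ^ 2 /
      ((qpow η 1 * t i - qpow η (-1) * t j) * (qpow η (-1) * t i - qpow η 1 * t j))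

/-- The string `t_σ`: first `σ_0` zeros, and then for `k = 1, ..., n` the block
`q^(-Λ_k + 2 (σ_k - 1)), ..., q^(-Λ_k + 2), q^(-Λ_k)`. -/
def stringList (η : ℂ) {n : ℕ} (Λ : Fin n → ℂ) (σ : Fin (n + 1) → ℕ) : List ℂ :=
  List.replicate (σ 0) 0 ++
    (List.finRange n).flatMap fun k =>
      ((List.range (σ k.succ)).reverse.map fun s => qpow η (-Λ k + 2 * (s : ℂ)))

/-- The string `t_σ` as a point of `ℂ^m`, for `σ_0 + ... + σ_n = m`. -/
def stringPoint (η : ℂ) {n : ℕ} (m : ℕ) (Λ : Fin n → ℂ) (σ : Fin (n + 1) → ℕ) : Fin m → ℂ :=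
  fun i => (stringList η Λ σ).getD i 0

/-- The hypergeometric pairing of two (polynomial) functions on `ℂ^m`. -/
def pairing (η : ℂ) {n m : ℕ} (Λ : Fin n → ℂ) (f g : (Fin m → ℂ) → ℂ) : ℂ :=
  ∑ σ ∈ Finset.Nat.antidiagonalTuple (n + 1) m,
    qpow η ((σ 0 : ℂ) * ((σ 0 : ℂ) - 1) / 2) / qfact η (σ 0) *
      f (stringPoint η m Λ σ) * g (stringPoint η m Λ σ) *
      multiResidue m (fun t => Omega η Λ t / ∏ i, t i) (stringPoint η m Λ σ)

/-! ### The weight functions -/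

/-- The partitions of `{1, ..., m}` into disjoint `I_1, ..., I_n` with `#I_k = μ_k`; such a
partition is recorded by the function `c` with `c i = k` for `i ∈ I_k`. -/
def partitions {n m : ℕ} (μ : Fin n → ℕ) : Finset (Fin m → Fin n) :=
  Finset.univ.filter fun c => ∀ k, (Finset.univ.filter fun i => c i = k).card = μ k

/-- `[μ_1]! ... [μ_n]! / [m]!`. -/
def weightPrefactor (η : ℂ) {n : ℕ} (m : ℕ) (μ : Fin n → ℕ) : ℂ :=
  (∏ k, qfact η (μ k)) / qfact η m

/-- `(q a - q⁻¹ b) / (a - b)`. -/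
def crossFactor (η a b : ℂ) : ℂ := (qpow η 1 * a - qpow η (-1) * b) / (a - b)

/-- A symmetrized rational expression, initially defined at the points `t` with pairwise distinct
coordinates, is extended to all `t ∈ ℂ^m` by continuity. For the weight functions below the
extension is a symmetric polynomial in `t`. -/
def extendPoly {m : ℕ} (f : (Fin m → ℂ) → ℂ) : (Fin m → ℂ) → ℂ :=
  extendFrom {t | Function.Injective t} f

/-- The weight function `ω_μ(t; Λ)`. -/
def omega (η : ℂ) {n m : ℕ} (μ : Fin n → ℕ) (Λ : Fin n → ℂ) : (Fin m → ℂ) → ℂ :=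
  extendPoly fun t => weightPrefactor η m μ * ∑ c ∈ partitions μ,
    (∏ i, ∏ j, if c i < c j then crossFactor η (t i) (t j) else 1) *
    ∏ i, (qpow η (∑ l ∈ Finset.Iic (c i), (μ l : ℂ)) * t i *
      (∏ l ∈ Finset.Iio (c i), (qpow η (Λ l) * t i - 1)) *
      ∏ l ∈ Finset.Ioi (c i), (t i - qpow η (Λ l)))

/-- The weight function `W_μ(t; lam; Λ)`. -/
def weightW (η : ℂ) {n m : ℕ} (μ : Fin n → ℕ) (lam : ℂ) (Λ : Fin n → ℂ) : (Fin m → ℂ) → ℂ :=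
  extendPoly fun t => weightPrefactor η m μ * ∑ c ∈ partitions μ,
    (∏ i, ∏ j, if c i < c j then crossFactor η (t i) (t j) else 1) *
    ∏ i, ((qpow η (-lam + μ (c i) + ∑ l ∈ Finset.Ici (c i), (Λ l - 2 * μ l)) * t i
        - qpow η (lam + μ (c i) + ∑ l ∈ Finset.Iic (c i), (Λ l - 2 * μ l))) *
      (∏ l ∈ Finset.Iio (c i), (qpow η (Λ l) * t i - 1)) *
      ∏ l ∈ Finset.Ioi (c i), (t i - qpow η (Λ l)))

/-- The dual weight function `W^μ(t; x; Λ)`. -/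
def dualWeightW (η : ℂ) {n m : ℕ} (μ : Fin n → ℕ) (x : ℂ) (Λ : Fin n → ℂ) : (Fin m → ℂ) → ℂ :=
  extendPoly fun t => weightPrefactor η m μ * ∑ c ∈ partitions μ,
    (∏ i, ∏ j, if c j < c i then crossFactor η (t i) (t j) else 1) *
    ∏ i, ((qpow η (-x + μ (c i) + ∑ l ∈ Finset.Iic (c i), (Λ l - 2 * μ l)) * t i
        - qpow η (x + μ (c i) + ∑ l ∈ Finset.Ici (c i), (Λ l - 2 * μ l))) *
      (∏ l ∈ Finset.Ioi (c i), (qpow η (Λ l) * t i - 1)) *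
      ∏ l ∈ Finset.Iio (c i), (t i - qpow η (Λ l)))

/-! ### The hypergeometric matrices -/

/-- The points of the hyperplane `Λ_1 + ... + Λ_n = 2 m` at which the poles of the density that
enter the residues at the strings `t_σ` do not collide. -/
def genericWeights (η : ℂ) (n m : ℕ) : Set (Fin n → ℂ) :=
  {Λ | ∑ i, Λ i = 2 * m ∧
    (∀ j k : Fin n, ∀ s : ℕ, s < m → qpow η (Λ j + Λ k) ≠ qpow η (2 * s)) ∧
    ∀ j k : Fin n, j ≠ k → ∀ s : ℤ, |s| ≤ m → qpow η (Λ j - Λ k) ≠ qpow η (2 * s)}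

/-- The matrix of residue sums `I_Λ(ω_μ, W^μ')`. -/
def residueQKZ (η : ℂ) {n : ℕ} (m : ℕ) (x : ℂ) (Λ : Fin n → ℂ) :
    Matrix (Idx n m) (Idx n m) ℂ :=
  Matrix.of fun μ μ' => pairing (m := m) η Λ (omega η μ.1 Λ) (dualWeightW η μ'.1 x Λ)

/-- The matrix of residue sums `q^(lam x) I_Λ(W_μ, W^μ')`. -/
def residueQKZB (η : ℂ) {n : ℕ} (m : ℕ) (lam x : ℂ) (Λ : Fin n → ℂ) :
    Matrix (Idx n m) (Idx n m) ℂ :=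
  Matrix.of fun μ μ' =>
    qpow η (lam * x) * pairing (m := m) η Λ (weightW η μ.1 lam Λ) (dualWeightW η μ'.1 x Λ)

open Classical in
/-- The hypergeometric qKZ matrix. It is meromorphic in `Λ`: it is given by the residue sums at
generic `Λ`, and at the other points (where it is regular) by continuity. -/
def qKZ (η : ℂ) {n : ℕ} (m : ℕ) (x : ℂ) (Λ : Fin n → ℂ) : Matrix (Idx n m) (Idx n m) ℂ :=
  if Λ ∈ genericWeights η n m then residueQKZ η m x Λ
  else extendFrom (genericWeights η n m) (residueQKZ η m x) Λ

open Classical in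
/-- The hypergeometric qKZB matrix, with the same convention. -/
def qKZB (η : ℂ) {n : ℕ} (m : ℕ) (lam x : ℂ) (Λ : Fin n → ℂ) : Matrix (Idx n m) (Idx n m) ℂ :=
  if Λ ∈ genericWeights η n m then residueQKZB η m lam x Λ
  else extendFrom (genericWeights η n m) (residueQKZB η m lam x) Λ

/-- A family `f x` of functions of `Λ`, given by explicit formulas at generic `Λ`, is regular at
`Λ`: either `Λ` is generic, or each `f x` has a finite limit at `Λ` along generic points. -/
def IsRegularAt (η : ℂ) {n : ℕ} (m : ℕ) (f : ℂ → (Fin n → ℂ) → Matrix (Idx n m) (Idx n m) ℂ)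
    (Λ : Fin n → ℂ) : Prop :=
  Λ ∈ genericWeights η n m ∨
    ∀ x, ∃ A, Tendsto (f x) (𝓝[genericWeights η n m] Λ) (𝓝 A)

end HyperQKZ

end

open scoped TensorProduct Topology
open Filter

noncomputable section

namespace HyperQKZ

/-! The shuffle product of functions on finite sets of points, twisted by `crossFactor`, turns both
sides of the identity into two instances of one recursion.

Representation side. The letters `X k = z s_k(z)` and `Y k = s_k(z)` of a site satisfy `X Y = q² Y
X`, and the walls between sites are `X k - q^(Λ k) Y k` on the left and `q^(Λ k) X k - Y k` on the
right. The map `theta` sends `v^(i) ⊗ u_μ` to `g_0^i / [i]!` times normalized powers of the `X k`.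
Under it the operator `F` on the Verma factor alone becomes left multiplication by the first wall
`g_0` (`theta_lowering`), and `F` on the whole tensor product becomes right multiplication by the
last wall `g_n` (`theta_totalF`). A noncommutative binomial formula sends each singular vector to a
power of one letter, so the image of the highest weight vector under the composed intertwiner
becomes `W_μ` up to a factor (`theta_PhiMulti`, `extend_chainFactor`), while `v^(0) ⊗ u_ν` becomes
`ω_ν` up to a factor (`extend_dualMap_single`).

Trace side. Since `v^(k) = F^k v^(0) / [k]!`, the trace is a linear functional `T` of the image of
the highest weight vector alone. With `y = q^(-2x)` a form of cyclicity gives `T((F ⊗ 1) z) = y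
T(Δ(F) z)` (`traceCoeff_succ_lowering`). As `∑ Λ = 2m`, the vectors `v^(0) ⊗ w` that occur have `w`
of weight zero, and there `T` is `(1 - y)⁻¹ w` (`traceCoeff_bv_zero`). The recursion expresses
`v^(i+1) ⊗ w` through `v^(i) ⊗ F w`; solving it gives a closed form, rational in `y` up to an
exponential factor, and hence convergence and continuation.

Hypergeometric side. The functional `f ↦ I(f, W^μ'(x))` satisfies the same recursion, `I(g_0 f, W) =
q^(-2x) I(f g_n, W)` (`pairing_lower_mul`). At the strings, a letter on the left contributes only
through the top point of each string, and the letter `g_n` on the right only through the bottom of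
the zeroth string. What remains is Lagrange interpolation: as a function of one point `W^μ'` is a
polynomial of degree at most `n` whose coefficient of degree `n` is `(-1)^n q^(-2x)` times its
constant term (`exists_insert_polynomial`). By the uniqueness in `eq_transfer_of_functional` the
pairing with `W_μ` is then the combination of the pairings with `ω_ν` whose coefficients are the
trace entries (`residueQKZB_eq`).

This proves the identity at generic weights and at `x` where no denominator vanishes. The general
case is a limit in `Λ`, using density of generic weights in the hyperplane and continuity of the
closed form of the trace, followed by a limit in `x`. The hypergeometric matrices stay continuous in
`x` because, up to `q^(lam x)`, their entries lie in a fixed finite-dimensional, hence closed, space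
of Laurent polynomials in `q^x`. -/

section

/-! ### The shuffle algebra -/

/-- Functions on finite sets of points, with the shuffle product twisted by `crossFactor`. -/
structure Shuffle (η : ℂ) : Type where
  /-- The value on a finite set of points. -/
  toFun : Finset ℂ → ℂ

namespace Shuffle

variable {η : ℂ}

/-- The underlying functions. -/
def equivFun (η : ℂ) : Shuffle η ≃ (Finset ℂ → ℂ) where
  toFun := toFun
  invFun := mk
  left_inv _ := rfl
  right_inv _ := rfl

instance : AddCommGroup (Shuffle η) := (equivFun η).addCommGroup

instance : Module ℂ (Shuffle η) := (equivFun η).module ℂ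

instance : FunLike (Shuffle η) (Finset ℂ) ℂ where
  coe := toFun
  coe_injective _ _ h := (equivFun η).injective h

@[ext] theorem ext {f g : Shuffle η} (h : ∀ S, f S = g S) : f = g := DFunLike.ext _ _ h

/-- `∏ (q a - q⁻¹ b) / (a - b)` over `a ∈ I`, `b ∈ J`. -/
def crossProd (η : ℂ) (I J : Finset ℂ) : ℂ := ∏ a ∈ I, ∏ b ∈ J, crossFactor η a b

instance : Mul (Shuffle η) where
  mul f g := ⟨fun S => ∑ I ∈ S.powerset, f I * g (S \ I) * crossProd η I (S \ I)⟩

instance : One (Shuffle η) where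
  one := ⟨fun S => if S = ∅ then 1 else 0⟩

theorem add_apply (f g : Shuffle η) (S : Finset ℂ) : (f + g) S = f S + g S := rfl
theorem sub_apply (f g : Shuffle η) (S : Finset ℂ) : (f - g) S = f S - g S := rfl
theorem zero_apply (S : Finset ℂ) : (0 : Shuffle η) S = 0 := rfl
theorem smul_apply (c : ℂ) (f : Shuffle η) (S : Finset ℂ) : (c • f) S = c * f S := rfl
theorem one_apply (S : Finset ℂ) : (1 : Shuffle η) S = if S = ∅ then 1 else 0 := rfl
theorem mul_apply (f g : Shuffle η) (S : Finset ℂ) :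
    (f * g) S = ∑ I ∈ S.powerset, f I * g (S \ I) * crossProd η I (S \ I) := rfl

theorem crossProd_union_left {I J K : Finset ℂ} (h : Disjoint I J) :
    crossProd η (I ∪ J) K = crossProd η I K * crossProd η J K :=
  Finset.prod_union h

theorem crossProd_union_right {I J K : Finset ℂ} (h : Disjoint J K) :
    crossProd η I (J ∪ K) = crossProd η I J * crossProd η I K := by
  simp only [crossProd, Finset.prod_union h, Finset.prod_mul_distrib]

/-- Both bracketings are sums over ordered splittings of `S` into three parts, and `crossProd` is
multiplicative under disjoint unions in either argument. -/
theorem mul_assoc' (f g h : Shuffle η) : f * g * h = f * (g * h) := by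
  ext S
  simp only [mul_apply, Finset.sum_mul, Finset.mul_sum]
  rw [Finset.sum_sigma', Finset.sum_sigma']
  refine Finset.sum_bij' (fun p _ => ⟨p.2, p.1 \ p.2⟩) (fun p _ => ⟨p.1 ∪ p.2, p.1⟩) ?_ ?_ ?_ ?_ ?_
  · rintro ⟨I, J⟩ hp
    simp only [Finset.mem_sigma, Finset.mem_powerset] at hp ⊢
    exact ⟨hp.2.trans hp.1, Finset.sdiff_subset_sdiff hp.1 le_rfl⟩
  · rintro ⟨J, K⟩ hp
    simp only [Finset.mem_sigma, Finset.mem_powerset] at hp ⊢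
    exact ⟨Finset.union_subset hp.1 (hp.2.trans Finset.sdiff_subset), Finset.subset_union_left⟩
  · rintro ⟨I, J⟩ hp
    simp only [Finset.mem_sigma, Finset.mem_powerset] at hp
    simp [Finset.union_sdiff_of_subset hp.2]
  · rintro ⟨J, K⟩ hp
    simp only [Finset.mem_sigma, Finset.mem_powerset] at hp
    have hd : Disjoint J K := (Finset.disjoint_of_subset_left hp.2 Finset.sdiff_disjoint).symm
    simp [Finset.union_sdiff_cancel_left hd]
  · rintro ⟨I, J⟩ hp
    simp only [Finset.mem_sigma, Finset.mem_powerset] at hp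
    obtain ⟨hI, hJ⟩ := hp
    have e1 : (S \ J) \ (I \ J) = S \ I := by
      ext x; simp only [Finset.mem_sdiff]; have := @hJ x; tauto
    have e2 : S \ J = (I \ J) ∪ (S \ I) := by
      ext x; simp only [Finset.mem_sdiff, Finset.mem_union]
      have := @hJ x; have := @hI x; tauto
    have d1 : Disjoint J (I \ J) := Finset.disjoint_sdiff
    have d2 : Disjoint (I \ J) (S \ I) :=
      Finset.disjoint_of_subset_left Finset.sdiff_subset Finset.disjoint_sdiff
    have e3 : crossProd η I (S \ I)
        = crossProd η J (S \ I) * crossProd η (I \ J) (S \ I) := by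
      rw [← crossProd_union_left d1, Finset.union_sdiff_of_subset hJ]
    have e4 : crossProd η J (S \ J) = crossProd η J (I \ J) * crossProd η J (S \ I) := by
      rw [← crossProd_union_right d2, ← e2]
    simp only [e1, e3, e4]
    ring

instance : Ring (Shuffle η) :=
  { (inferInstance : AddCommGroup (Shuffle η)), (inferInstance : Mul (Shuffle η)),
    (inferInstance : One (Shuffle η)) with
    left_distrib := fun f g h => by
      ext S; simp only [mul_apply, add_apply, mul_add, add_mul, Finset.sum_add_distrib]
    right_distrib := fun f g h => by
      ext S; simp only [mul_apply, add_apply, add_mul, Finset.sum_add_distrib]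
    zero_mul := fun f => by ext S; simp [mul_apply, zero_apply]
    mul_zero := fun f => by ext S; simp [mul_apply, zero_apply]
    mul_assoc := mul_assoc'
    one_mul := fun f => by
      ext S
      rw [mul_apply, Finset.sum_eq_single ∅] <;> simp +contextual [one_apply, crossProd]
    mul_one := fun f => by
      ext S
      rw [mul_apply, Finset.sum_eq_single S]
      · simp [one_apply, crossProd]
      · intro I hI hne
        have : S \ I ≠ ∅ := fun h => hne (Finset.Subset.antisymm (Finset.mem_powerset.mp hI)
          (Finset.sdiff_eq_empty_iff_subset.mp h))
        simp [one_apply, this]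
      · simp }

instance : Algebra ℂ (Shuffle η) :=
  Algebra.ofModule
    (fun c f g => by
      ext S; simp only [mul_apply, smul_apply, Finset.mul_sum, mul_assoc])
    (fun c f g => by
      ext S; simp only [mul_apply, smul_apply, Finset.mul_sum]
      exact Finset.sum_congr rfl fun I _ => by ring)

/-- The function supported on sets of `k` points, with value `∏ p(z)`. -/
def block (η : ℂ) (p : ℂ → ℂ) (k : ℕ) : Shuffle η :=
  ⟨fun S => if S.card = k then ∏ z ∈ S, p z else 0⟩

theorem block_apply (p : ℂ → ℂ) (k : ℕ) (S : Finset ℂ) :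
    block η p k S = if S.card = k then ∏ z ∈ S, p z else 0 := rfl

/-- The function supported on one-point sets, with value `p(z)`. -/
abbrev letter (η : ℂ) (p : ℂ → ℂ) : Shuffle η := block η p 1

theorem block_zero (p : ℂ → ℂ) : block η p 0 = 1 := by
  ext S
  by_cases h : S = ∅ <;> simp [block_apply, one_apply, h]

theorem letter_sub (p r : ℂ → ℂ) : letter η (p - r) = letter η p - letter η r := by
  ext S
  simp only [block_apply, sub_apply]
  split_ifs with h
  · obtain ⟨z, rfl⟩ := Finset.card_eq_one.mp h
    simp
  · simp

theorem letter_smul (c : ℂ) (p : ℂ → ℂ) : letter η (c • p) = c • letter η p := by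
  ext S
  simp only [block_apply, smul_apply]
  split_ifs with h
  · obtain ⟨z, rfl⟩ := Finset.card_eq_one.mp h
    simp
  · simp

theorem letter_mul (p : ℂ → ℂ) (f : Shuffle η) (S : Finset ℂ) :
    (letter η p * f) S
      = ∑ z ∈ S, p z * f (S.erase z) * ∏ y ∈ S.erase z, crossFactor η z y := by
  rw [mul_apply]
  have h1 : S.powersetCard 1 ⊆ S.powerset := fun I hI => Finset.mem_powerset.mpr (Finset.mem_powersetCard.mp hI).1
  rw [← Finset.sum_subset h1]
  · rw [Finset.powersetCard_one, Finset.sum_map]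
    refine Finset.sum_congr rfl fun z _ => ?_
    simp [block_apply, crossProd, Finset.sdiff_singleton_eq_erase]
  · intro I hI hI'
    have : I.card ≠ 1 := fun h => hI' (Finset.mem_powersetCard.mpr ⟨Finset.mem_powerset.mp hI, h⟩)
    simp [block_apply, this]

theorem mul_letter (p : ℂ → ℂ) (f : Shuffle η) (S : Finset ℂ) :
    (f * letter η p) S
      = ∑ z ∈ S, p z * f (S.erase z) * ∏ y ∈ S.erase z, crossFactor η y z := by
  have h0 : (f * letter η p) S = ∑ I ∈ S.powerset,
      f (S \ I) * letter η p I * crossProd η (S \ I) I := by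
    rw [mul_apply]
    refine Finset.sum_bij' (fun I _ => S \ I) (fun I _ => S \ I) ?_ ?_ ?_ ?_ ?_
    · intro I _; simp
    · intro I _; simp
    · intro I hI; simpa using Finset.mem_powerset.mp hI
    · intro I hI; simpa using Finset.mem_powerset.mp hI
    · intro I hI; simp [Finset.inter_eq_right.mpr (Finset.mem_powerset.mp hI)]
  rw [h0]
  have h1 : S.powersetCard 1 ⊆ S.powerset := fun I hI => Finset.mem_powerset.mpr (Finset.mem_powersetCard.mp hI).1
  rw [← Finset.sum_subset h1]
  · rw [Finset.powersetCard_one, Finset.sum_map]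
    refine Finset.sum_congr rfl fun z _ => ?_
    simp [block_apply, crossProd, Finset.sdiff_singleton_eq_erase, mul_comm (f _)]
  · intro I hI hI'
    have : I.card ≠ 1 := fun h => hI' (Finset.mem_powersetCard.mpr ⟨Finset.mem_powerset.mp hI, h⟩)
    simp [block_apply, this]

end Shuffle

end

/-! ### Sums of cross factors and powers of a letter -/

section

theorem qpow_nsmul (η : ℂ) (z : ℂ) (k : ℕ) : qpow η (k * z) = qpow η z ^ k := by
  induction k with
  | zero => simp [qpow_zero]
  | succ k ih => rw [pow_succ, ← ih, ← qpow_add]; congr 1; push_cast; ring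

theorem qpow_natCast (η : ℂ) (k : ℕ) : qpow η k = qpow η 1 ^ k := by
  simpa using qpow_nsmul η 1 k

theorem qpow_mul_qpow_neg (η z : ℂ) : qpow η z * qpow η (-z) = 1 := by
  rw [← qpow_add, add_neg_cancel, qpow_zero]

theorem qnum_natCast_eq (η : ℂ) (k : ℕ) :
    qnum η k = (qpow η 1 ^ k - qpow η (-1) ^ k) / (qpow η 1 - qpow η (-1)) := by
  rw [qnum, qpow_natCast, ← qpow_nsmul η (-1) k, mul_neg_one]

theorem qnum_one {η : ℂ} (hη : 0 < η.im) : qnum η 1 = 1 := by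
  simpa [qnum] using div_self (q_sub_ne_zero hη)

theorem crossFactor_zero_left (η : ℂ) {b : ℂ} (hb : b ≠ 0) :
    crossFactor η 0 b = qpow η (-1) := by
  simp only [crossFactor]
  field_simp
  ring

theorem crossFactor_zero_right (η : ℂ) {a : ℂ} (ha : a ≠ 0) : crossFactor η a 0 = qpow η 1 := by
  simp only [crossFactor]
  field_simp
  ring

-- Lagrange interpolation of `P = ∏ (q X - q⁻¹ y)` at the nodes `S ∪ {0}`. The top coefficient
-- `q^|S|` is the sum of the values of `P` divided by products of node differences. The node `0`
-- gives `q^(-|S|)`; at `z ∈ S` the factor `y = z` of `P` divided by `z - 0` gives `q - q⁻¹`, and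
-- the other factors are cross factors.
open Polynomial in
theorem sum_prod_crossFactor_of_notMem {η : ℂ} (hη : 0 < η.im) (S : Finset ℂ) (h0 : (0 : ℂ) ∉ S) :
    ∑ z ∈ S, ∏ y ∈ S.erase z, crossFactor η z y = qnum η S.card := by
  have hne := q_sub_ne_zero hη
  set P : ℂ[X] := ∏ y ∈ S, (C (qpow η 1) * X + C (-(qpow η (-1) * y))) with hP
  have hcoeff : P.coeff S.card = qpow η 1 ^ S.card := by
    have := coeff_prod_of_natDegree_le S
      (fun y => C (qpow η 1) * X + C (-(qpow η (-1) * y))) 1 (fun y _ => natDegree_linear_le)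
    rw [mul_one] at this
    rw [hP, this]
    simp
  have hdeg : P.degree < (insert 0 S).card := by
    rw [Finset.card_insert_of_notMem h0]
    refine lt_of_le_of_lt (degree_prod_le _ _) ?_
    refine lt_of_le_of_lt (Finset.sum_le_sum fun y _ => degree_linear_le) ?_
    simp only [Finset.sum_const, nsmul_eq_mul, mul_one]
    exact_mod_cast Nat.lt_succ_self _
  have key := Lagrange.coeff_eq_sum (v := id) (s := insert 0 S) (Set.injOn_id _) hdeg
  rw [Finset.card_insert_of_notMem h0, Nat.add_sub_cancel, hcoeff, Finset.sum_insert h0,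
    Finset.erase_insert h0] at key
  have t0 : P.eval (id 0) / ∏ j ∈ S, (id 0 - id j) = qpow η (-1) ^ S.card := by
    rw [hP, eval_prod, ← Finset.prod_div_distrib, ← Finset.prod_const]
    refine Finset.prod_congr rfl fun y hy => ?_
    have : y ≠ 0 := fun h => h0 (h ▸ hy)
    simp [this]
  have t1 : ∀ z ∈ S, P.eval (id z) / ∏ j ∈ (insert 0 S).erase z, (id z - id j)
      = (qpow η 1 - qpow η (-1)) * ∏ y ∈ S.erase z, crossFactor η z y := by
    intro z hz
    have hz0 : z ≠ 0 := fun h => h0 (h ▸ hz)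
    rw [Finset.erase_insert_of_ne hz0.symm, Finset.prod_insert (by simp [h0]), hP, eval_prod,
      ← Finset.mul_prod_erase S _ hz, mul_div_mul_comm, ← Finset.prod_div_distrib]
    congr 1
    · simp; field_simp; ring
    · refine Finset.prod_congr rfl fun y _ => ?_
      simp [crossFactor]; ring
  rw [t0, Finset.sum_congr rfl t1, ← Finset.mul_sum] at key
  rw [qnum_natCast_eq, eq_div_iff hne, key]
  ring

theorem sum_prod_crossFactor {η : ℂ} (hη : 0 < η.im) (S : Finset ℂ) :
    ∑ z ∈ S, ∏ y ∈ S.erase z, crossFactor η z y = qnum η S.card := by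
  by_cases h0 : (0 : ℂ) ∈ S
  swap
  · exact sum_prod_crossFactor_of_notMem hη S h0
  -- If `0 ∈ S` the interpolation would have a double node. The point `0` is split off instead: its
  -- cross factors are `q⁻¹` on one side and `q` on the other, and `q^(-t) + q [t] = [t + 1]`.
  set T := S.erase 0 with hT
  have hT0 : (0 : ℂ) ∉ T := Finset.notMem_erase 0 S
  have hS : S = insert 0 T := (Finset.insert_erase h0).symm
  have ih := sum_prod_crossFactor_of_notMem hη T hT0
  rw [hS, Finset.sum_insert hT0, Finset.erase_insert hT0, Finset.card_insert_of_notMem hT0]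
  have e1 : ∏ y ∈ T, crossFactor η 0 y = qpow η (-1) ^ T.card := by
    rw [← Finset.prod_const]
    exact Finset.prod_congr rfl fun y hy =>
      crossFactor_zero_left η fun h => hT0 (h ▸ hy)
  have e2 : ∀ z ∈ T, ∏ y ∈ (insert 0 T).erase z, crossFactor η z y
      = qpow η 1 * ∏ y ∈ T.erase z, crossFactor η z y := by
    intro z hz
    have hz0 : z ≠ 0 := fun h => hT0 (h ▸ hz)
    rw [Finset.erase_insert_of_ne hz0.symm, Finset.prod_insert (by simp [hT0]),
      crossFactor_zero_right η hz0]
  rw [e1, Finset.sum_congr rfl e2, ← Finset.mul_sum, ih, qnum_natCast_eq, qnum_natCast_eq]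
  have hne := q_sub_ne_zero hη
  have h1 := qpow_mul_qpow_neg η 1
  field_simp
  ring

namespace Shuffle

variable {η : ℂ}

/-- The product of the values of `p` over `S` is common to all terms, so only the sum of cross
factors remains, and it equals `[|S|]`. -/
theorem letter_mul_block (hη : 0 < η.im) (p : ℂ → ℂ) (k : ℕ) :
    letter η p * block η p k = qnum η ((k : ℂ) + 1) • block η p (k + 1) := by
  ext S
  rw [letter_mul, smul_apply]
  by_cases hS : S.card = k + 1
  · have : ∀ z ∈ S, p z * block η p k (S.erase z) * ∏ y ∈ S.erase z, crossFactor η z y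
        = (∏ y ∈ S, p y) * ∏ y ∈ S.erase z, crossFactor η z y := by
      intro z hz
      rw [block_apply, if_pos (by rw [Finset.card_erase_of_mem hz, hS]; simp),
        Finset.mul_prod_erase S p hz]
    rw [Finset.sum_congr rfl this, ← Finset.mul_sum, sum_prod_crossFactor hη, block_apply,
      if_pos hS, hS]
    push_cast
    ring
  · rw [block_apply, if_neg hS, mul_zero]
    refine Finset.sum_eq_zero fun z hz => ?_
    rw [block_apply, if_neg, mul_zero, zero_mul]
    rw [Finset.card_erase_of_mem hz]
    have := Finset.card_pos.mpr ⟨z, hz⟩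
    omega

/-- Blocks are thus the quantum divided powers of letters. This accounts for the factorials `[m_1]!
... [m_n]!` in the normalization of the weight functions. -/
theorem letter_pow (hη : 0 < η.im) (p : ℂ → ℂ) (k : ℕ) :
    letter η p ^ k = qfact η k • block η p k := by
  induction k with
  | zero => simp [block_zero, qfact]
  | succ k ih =>
    rw [pow_succ', ih, mul_smul_comm, letter_mul_block hη, smul_smul, qfact_succ]

/-- The letters `z p(z)` and `p(z)` span a quantum plane. -/
theorem letter_X_mul_letter_Y (p : ℂ → ℂ) :
    letter η (fun z => z * p z) * letter η p
      = qpow η 2 • (letter η p * letter η fun z => z * p z) := by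
  ext S
  rw [smul_apply, letter_mul, letter_mul]
  by_cases hS : S.card = 2
  · obtain ⟨a, b, hab, rfl⟩ := Finset.card_eq_two.mp hS
    have h1 : ({a, b} : Finset ℂ).erase a = {b} := by
      rw [Finset.erase_insert (by simpa using hab)]
    have h2 : ({a, b} : Finset ℂ).erase b = {a} := by
      rw [Finset.pair_comm, Finset.erase_insert (by simpa using hab.symm)]
    rw [Finset.sum_pair hab, Finset.sum_pair hab, h1, h2]
    simp only [block_apply, Finset.card_singleton, if_true, Finset.prod_singleton, crossFactor]
    have hab' : a - b ≠ 0 := sub_ne_zero.mpr hab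
    have hba : b - a ≠ 0 := sub_ne_zero.mpr hab.symm
    have e : b - a = -(a - b) := by ring
    have h3 := qpow_mul_qpow_neg η 1
    have h4 : qpow η 2 = qpow η 1 * qpow η 1 := by rw [← qpow_add]; norm_num
    rw [e, h4]
    field_simp
    linear_combination (a + b) * qpow η 1 * (b - a) * p a * p b * h3
  · have : ∀ r : ℂ → ℂ, ∀ z ∈ S, letter η r (S.erase z) = 0 := by
      intro r z hz
      rw [letter, block_apply, if_neg]
      rw [Finset.card_erase_of_mem hz]
      have := Finset.card_pos.mpr ⟨z, hz⟩
      omega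
    rw [Finset.sum_eq_zero, Finset.sum_eq_zero, mul_zero]
    · intro z hz; rw [this _ z hz]; ring
    · intro z hz; rw [this _ z hz]; ring

end Shuffle

end

/-! ### Products of several factors as sums over colorings -/

section

namespace Shuffle

variable {η : ℂ}

theorem mul_apply_image {ι : Type*} [Fintype ι] [DecidableEq ι] (f g : Shuffle η) (t : ι → ℂ)
    (ht : Function.Injective t) :
    (f * g) (Finset.univ.image t) = ∑ J : Finset ι, f (J.image t) * g (Jᶜ.image t) *
      ∏ a ∈ J, ∏ b ∈ Jᶜ, crossFactor η (t a) (t b) := by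
  rw [mul_apply, Finset.powerset_image, Finset.sum_image, Finset.powerset_univ]
  · refine Finset.sum_congr rfl fun J _ => ?_
    have : Finset.univ.image t \ J.image t = Jᶜ.image t := by
      rw [← Finset.image_sdiff _ _ ht, Finset.compl_eq_univ_sdiff]
    rw [this, crossProd, Finset.prod_image ht.injOn]
    congr 1
    exact Finset.prod_congr rfl fun a _ => Finset.prod_image ht.injOn
  · intro I _ J _ h
    exact Finset.image_injective ht h

/-- Induction on the number of factors: the first factor takes the points of color `0`, and the rest
is a coloring of the complement. The index type is arbitrary because the induction hypothesis is
applied to the complement as a subtype. -/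
theorem prod_ofFn_apply_image {n : ℕ} : ∀ {ι : Type} [Fintype ι] [DecidableEq ι]
    (f : Fin n → Shuffle η) (t : ι → ℂ) (_ : Function.Injective t),
    (List.ofFn f).prod (Finset.univ.image t) = ∑ c : ι → Fin n,
      (∏ i, ∏ j, if c i < c j then crossFactor η (t i) (t j) else 1) *
      ∏ k, f k ((Finset.univ.filter fun i => c i = k).image t) := by
  induction n with
  | zero =>
    intro ι _ _ f t ht
    rw [List.ofFn_zero, List.prod_nil, one_apply]
    rcases isEmpty_or_nonempty ι with h | h
    · simp
    · rw [if_neg (by simp [Finset.univ_eq_empty_iff])]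
      have : IsEmpty (ι → Fin 0) := ⟨fun c => (c (Classical.arbitrary ι)).elim0⟩
      simp
  | succ n ih =>
    intro ι _ _ f t ht
    rw [List.ofFn_succ, List.prod_cons, mul_apply_image _ _ t ht,
      ← Finset.sum_fiberwise (Finset.univ : Finset (ι → Fin (n + 1)))
        (fun c => Finset.univ.filter fun i => c i = 0)]
    refine Finset.sum_congr rfl fun J _ => ?_
    have himg : Jᶜ.image t = Finset.univ.image fun i : {i // i ∉ J} => t i := by
      ext z; simp
    rw [himg, ih (fun k => f k.succ) (fun i : {i // i ∉ J} => t i)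
      (ht.comp Subtype.val_injective), Finset.mul_sum, Finset.sum_mul]
    have hc : ∀ c ∈ (Finset.univ : Finset (ι → Fin (n + 1))).filter
        (fun c => (Finset.univ.filter fun i => c i = 0) = J), ∀ i, c i = 0 ↔ i ∈ J := by
      intro c hc i
      rw [← (Finset.mem_filter.mp hc).2]
      simp
    refine Finset.sum_bij' (fun c' _ i => if h : i ∈ J then 0 else (c' ⟨i, h⟩).succ)
      (fun c h i => (c i).pred fun h0 => i.2 ((hc c h i).mp h0)) ?_ ?_ ?_ ?_ ?_
    · intro c' _
      refine Finset.mem_filter.mpr ⟨Finset.mem_univ _, ?_⟩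
      ext i
      by_cases h : i ∈ J <;> simp [h]
    · intro c _; exact Finset.mem_univ _
    · intro c' _
      funext i
      simp [i.2]
    · intro c h
      funext i
      by_cases hi : i ∈ J
      · simp [hi, (hc c h i).mpr hi]
      · simp [hi]
    · intro c' _
      set c : ι → Fin (n + 1) := fun i => if h : i ∈ J then 0 else (c' ⟨i, h⟩).succ with hcdef
      have c0 : ∀ i ∈ J, c i = 0 := fun i hi => by simp [hcdef, hi]
      have c1 : ∀ i : {i // i ∉ J}, c i = (c' i).succ := fun i => by simp [hcdef, i.2]
      have sp : ∀ F : ι → ℂ, ∏ i, F i = (∏ i ∈ J, F i) * ∏ i : {i // i ∉ J}, F i := by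
        intro F
        rw [← Finset.prod_mul_prod_compl J F]
        congr 1
        exact Finset.prod_subtype _ (by simp) _
      have e1 : (∏ i, ∏ j, if c i < c j then crossFactor η (t i) (t j) else 1)
          = (∏ a ∈ J, ∏ b ∈ Jᶜ, crossFactor η (t a) (t b)) *
            ∏ i : {i // i ∉ J}, ∏ j : {i // i ∉ J},
              if c' i < c' j then crossFactor η (t i) (t j) else 1 := by
        rw [sp]
        congr 1
        · refine Finset.prod_congr rfl fun a ha => ?_
          rw [sp, Finset.prod_eq_one, one_mul, Finset.prod_subtype Jᶜ (p := fun i => i ∉ J) (by simp)]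
          · refine Finset.prod_congr rfl fun b _ => ?_
            rw [c0 a ha, c1, if_pos (Fin.succ_pos _)]
          · intro b hb
            simp [c0 a ha, c0 b hb]
        · refine Finset.prod_congr rfl fun a _ => ?_
          rw [sp, Finset.prod_eq_one, one_mul]
          · refine Finset.prod_congr rfl fun b _ => ?_
            simp only [c1, Fin.succ_lt_succ_iff]
          · intro b hb
            simp [c0 b hb]
      have e2 : (Finset.univ.filter fun i => c i = 0) = J := by
        ext i
        by_cases h : i ∈ J <;> simp [hcdef, h]
      have e3 : ∀ k : Fin n, (Finset.univ.filter fun i => c i = k.succ).image t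
          = (Finset.univ.filter fun i => c' i = k).image fun i : {i // i ∉ J} => t i := by
        intro k
        ext z
        simp only [Finset.mem_image, Finset.mem_filter, Finset.mem_univ, true_and]
        constructor
        · rintro ⟨i, hi, rfl⟩
          have hiJ : i ∉ J := fun h => by rw [c0 i h] at hi; exact (Fin.succ_ne_zero k hi.symm)
          refine ⟨⟨i, hiJ⟩, ?_, rfl⟩
          have := c1 ⟨i, hiJ⟩
          simp only at this
          rw [this] at hi
          exact Fin.succ_injective _ hi
        · rintro ⟨i, hi, rfl⟩
          exact ⟨i, by rw [c1, hi], rfl⟩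
      rw [e1, Fin.prod_univ_succ, e2, Finset.prod_congr rfl fun k _ => congrArg (f k.succ) (e3 k)]
      ring

end Shuffle

end

section

/-! ### Divisibility by differences of variables -/

section Divisibility

open MvPolynomial

variable {m : ℕ}

/-- The substitution `X a := X b`. -/
def identify (a b : Fin m) : MvPolynomial (Fin m) ℂ →ₐ[ℂ] MvPolynomial (Fin m) ℂ :=
  aeval fun i => if i = a then X b else X i

/-- Modulo `X a - X b` the substitution `X a := X b` is the identity, so `P` is congruent to
`identify a b P`. -/
theorem sub_dvd_iff_identify (a b : Fin m) (P : MvPolynomial (Fin m) ℂ) :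
    X a - X b ∣ P ↔ identify a b P = 0 := by
  constructor
  · rintro ⟨Q, rfl⟩
    simp [identify]
  · intro h
    rw [← Ideal.mem_span_singleton, ← Ideal.Quotient.eq_zero_iff_mem]
    have key : (Ideal.Quotient.mkₐ ℂ (Ideal.span {(X a - X b : MvPolynomial (Fin m) ℂ)})).comp
        (identify a b) = Ideal.Quotient.mkₐ ℂ _ := by
      refine MvPolynomial.algHom_ext fun i => ?_
      by_cases hi : i = a
      · subst hi
        simp only [AlgHom.comp_apply, identify, aeval_X, if_true, Ideal.Quotient.mkₐ_eq_mk]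
        rw [eq_comm, Ideal.Quotient.eq]
        exact Ideal.mem_span_singleton_self _
      · simp [identify, hi]
    have := AlgHom.congr_fun key P
    rw [AlgHom.comp_apply, h, map_zero] at this
    exact this.symm

/-- The differences are pairwise coprime: identifying the two variables of one of them does not kill
another one, unless the two pairs agree up to order, which `hsymm` excludes. -/
theorem prod_sub_dvd (s : Finset (Fin m × Fin m)) (hne : ∀ e ∈ s, e.1 ≠ e.2)
    (hsymm : ∀ e ∈ s, (e.2, e.1) ∉ s) (P : MvPolynomial (Fin m) ℂ)
    (h : ∀ e ∈ s, (X e.1 - X e.2 : MvPolynomial (Fin m) ℂ) ∣ P) :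
    (∏ e ∈ s, (X e.1 - X e.2 : MvPolynomial (Fin m) ℂ)) ∣ P := by
  induction s using Finset.induction_on with
  | empty => simp
  | insert e s he ih =>
    obtain ⟨Q, rfl⟩ := ih (fun e' h' => hne e' (Finset.mem_insert_of_mem h'))
      (fun e' h' h'' => hsymm e' (Finset.mem_insert_of_mem h') (Finset.mem_insert_of_mem h''))
      (fun e' h' => h e' (Finset.mem_insert_of_mem h'))
    have h1 := (sub_dvd_iff_identify _ _ _).mp (h e (Finset.mem_insert_self _ _))
    rw [map_mul, map_prod, mul_eq_zero] at h1
    rcases h1 with h1 | h1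
    · exfalso
      obtain ⟨e', he', h2⟩ := Finset.prod_eq_zero_iff.mp h1
      have hne' := hne e' (Finset.mem_insert_of_mem he')
      have hee' : e' ≠ e := fun h => he (h ▸ he')
      have hsw : (e'.2, e'.1) ≠ e := fun h =>
        hsymm e' (Finset.mem_insert_of_mem he') (h ▸ Finset.mem_insert_self _ _)
      rw [map_sub, sub_eq_zero] at h2
      simp only [identify, aeval_X] at h2
      have inj : Function.Injective (X : Fin m → MvPolynomial (Fin m) ℂ) := X_injective
      obtain ⟨a, b⟩ := e
      obtain ⟨c, d⟩ := e'
      simp only [ne_eq, Prod.mk.injEq, not_and] at h2 hne' hee' hsw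
      split_ifs at h2 with h3 h4 h4
      · exact hne' (h3.trans h4.symm)
      · exact hee' h3 (inj h2).symm
      · exact hsw h4 (inj h2)
      · exact hne' (inj h2)
    · rw [Finset.prod_insert he, mul_comm]
      exact mul_dvd_mul_left _ ((sub_dvd_iff_identify _ _ _).mpr h1)

/-- The pairs of indices `i < j`. -/
def orderedPairs (m : ℕ) : Finset (Fin m × Fin m) :=
  Finset.univ.filter fun e => e.1 < e.2

/-- The Vandermonde polynomial. -/
def vandermondePoly (m : ℕ) : MvPolynomial (Fin m) ℂ :=
  ∏ e ∈ orderedPairs m, (X e.1 - X e.2)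

theorem eval_vandermondePoly (t : Fin m → ℂ) :
    eval t (vandermondePoly m) = ∏ e ∈ orderedPairs m, (t e.1 - t e.2) := by
  simp [vandermondePoly]

theorem eval_vandermondePoly_eq_zero {t : Fin m → ℂ} (ht : ¬ Function.Injective t) :
    eval t (vandermondePoly m) = 0 := by
  rw [eval_vandermondePoly]
  obtain ⟨a, b, hab, hne⟩ := Function.not_injective_iff.mp ht
  rcases lt_or_gt_of_ne hne with h | h
  · exact Finset.prod_eq_zero (i := (a, b)) (by simp [orderedPairs, h]) (by simp [hab])
  · exact Finset.prod_eq_zero (i := (b, a)) (by simp [orderedPairs, h]) (by simp [hab])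

theorem eval_vandermondePoly_ne_zero {t : Fin m → ℂ} (ht : Function.Injective t) :
    eval t (vandermondePoly m) ≠ 0 := by
  rw [eval_vandermondePoly]
  refine Finset.prod_ne_zero_iff.mpr fun e he => sub_ne_zero.mpr fun h => ?_
  exact (Finset.mem_filter.mp he).2.ne (ht h)

theorem vandermondePoly_ne_zero (m : ℕ) : vandermondePoly m ≠ 0 := by
  intro h
  have := eval_vandermondePoly_ne_zero (t := fun i : Fin m => ((i : ℕ) : ℂ))
    (fun i j h => Fin.ext (by simpa using h))
  rw [h, map_zero] at this
  exact this rfl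

theorem eval_vandermondePoly_comp_swap {a b : Fin m} (hab : a ≠ b) (t : Fin m → ℂ) :
    eval (t ∘ Equiv.swap a b) (vandermondePoly m) = -eval t (vandermondePoly m) := by
  have h : ∀ u : Fin m → ℂ, eval u (vandermondePoly m)
      = (∏ e ∈ orderedPairs m, (-1 : ℂ)) * (Matrix.vandermonde u).det := by
    intro u
    rw [eval_vandermondePoly, Matrix.det_vandermonde, Finset.prod_sigma' , eq_comm]
    have : ∏ x ∈ (Finset.univ : Finset (Fin m)).sigma fun i => Finset.Ioi i, (u x.2 - u x.1)
        = ∏ e ∈ orderedPairs m, (u e.2 - u e.1) :=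
      Finset.prod_bij' (fun x _ => (x.1, x.2)) (fun e _ => ⟨e.1, e.2⟩)
        (by simp [orderedPairs]) (by simp [orderedPairs]) (by simp) (by simp) (by simp)
    rw [this, ← Finset.prod_mul_distrib]
    exact Finset.prod_congr rfl fun e _ => by ring
  have h2 : Matrix.vandermonde (t ∘ Equiv.swap a b)
      = (Matrix.vandermonde t).submatrix (Equiv.swap a b) id := by
    ext i j; simp [Matrix.vandermonde]
  rw [h, h, h2, Matrix.det_permute, Equiv.Perm.sign_swap hab]
  simp

/-- A symmetric function whose product with the Vandermonde determinant is polynomial is itself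
polynomial. -/
theorem exists_poly_of_vandermonde_mul (f : (Fin m → ℂ) → ℂ)
    (hf : ∀ t (w : Equiv.Perm (Fin m)), f (t ∘ w) = f t) (N : MvPolynomial (Fin m) ℂ)
    (hN : ∀ t, Function.Injective t → eval t N = eval t (vandermondePoly m) * f t) :
    ∃ Q : MvPolynomial (Fin m) ℂ, ∀ t, Function.Injective t → f t = eval t Q := by
  have hanti : ∀ a b : Fin m, a ≠ b → rename (Equiv.swap a b) N = -N := by
    intro a b hab
    -- The hypothesis speaks only of tuples of distinct points. The additional Vandermonde factor
    -- makes the equation trivial at all other tuples.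
    have : (rename (Equiv.swap a b) N + N) * vandermondePoly m = 0 := by
      refine MvPolynomial.funext fun t => ?_
      rw [map_mul, map_zero, map_add, eval_rename]
      by_cases ht : Function.Injective t
      · rw [hN t ht, hN _ (ht.comp (Equiv.swap a b).injective), hf,
          eval_vandermondePoly_comp_swap hab]
        ring
      · rw [eval_vandermondePoly_eq_zero ht, mul_zero]
    rcases mul_eq_zero.mp this with h | h
    · exact eq_neg_of_add_eq_zero_left h
    · exact absurd h (vandermondePoly_ne_zero m)
  have hdvd : ∀ e ∈ orderedPairs m, (X e.1 - X e.2 : MvPolynomial (Fin m) ℂ) ∣ N := by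
    rintro ⟨a, b⟩ he
    have hab : a ≠ b := (Finset.mem_filter.mp he).2.ne
    rw [sub_dvd_iff_identify]
    have e1 : (identify a b).comp (rename (Equiv.swap a b)) = identify a b := by
      refine MvPolynomial.algHom_ext fun i => ?_
      simp only [AlgHom.comp_apply, rename_X, identify, aeval_X]
      rcases eq_or_ne i a with rfl | hia
      · simp
      · rcases eq_or_ne i b with rfl | hib
        · simp
        · rw [Equiv.swap_apply_of_ne_of_ne hia hib]
    have e2 := AlgHom.congr_fun e1 N
    -- After the identification of `X a` and `X b` the swap has no effect, so the antisymmetric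
    -- polynomial `N` is sent to its own negative.
    rw [AlgHom.comp_apply, hanti a b hab, map_neg] at e2
    exact self_eq_neg.mp e2.symm
  obtain ⟨Q, hQ⟩ := prod_sub_dvd (orderedPairs m)
    (fun e he => (Finset.mem_filter.mp he).2.ne)
    (fun e he he' => lt_asymm (Finset.mem_filter.mp he).2 (Finset.mem_filter.mp he').2) N hdvd
  refine ⟨Q, fun t ht => ?_⟩
  have h1 := hN t ht
  have h2 : eval t N = eval t (vandermondePoly m) * eval t Q := by
    rw [← map_mul, hQ]; rfl
  rw [h2] at h1
  exact (mul_left_cancel₀ (eval_vandermondePoly_ne_zero ht) h1).symm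

theorem prod_prod_sub_dvd_vandermondePoly (J : Finset (Fin m)) :
    (∏ a ∈ J, ∏ b ∈ Jᶜ, (X a - X b : MvPolynomial (Fin m) ℂ)) ∣ vandermondePoly m := by
  rw [← Finset.prod_product']
  refine prod_sub_dvd (J ×ˢ Jᶜ) ?_ ?_ _ ?_
  · rintro ⟨a, b⟩ h
    rw [Finset.mem_product, Finset.mem_compl] at h
    exact fun hab => h.2 (hab ▸ h.1)
  · rintro ⟨a, b⟩ h h'
    rw [Finset.mem_product, Finset.mem_compl] at h h'
    exact h.2 h'.1
  · rintro ⟨a, b⟩ h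
    rw [Finset.mem_product, Finset.mem_compl] at h
    have hab : a ≠ b := fun hab => h.2 (hab ▸ h.1)
    rcases lt_or_gt_of_ne hab with h' | h'
    · exact Finset.dvd_prod_of_mem (fun e : Fin m × Fin m => (X e.1 - X e.2 : MvPolynomial (Fin m) ℂ))
        (a := (a, b)) (by simp [orderedPairs, h'])
    · rw [← neg_sub, neg_dvd]
      exact Finset.dvd_prod_of_mem (fun e : Fin m × Fin m => (X e.1 - X e.2 : MvPolynomial (Fin m) ℂ))
        (a := (b, a)) (by simpa [orderedPairs] using h')

end Divisibility

/-! ### Regular elements of the shuffle algebra -/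

namespace Shuffle

variable {η : ℂ}

open MvPolynomial in
/-- On tuples of distinct points, `f` is given by polynomials. -/
def IsRegular (f : Shuffle η) : Prop :=
  ∀ m, ∃ P : MvPolynomial (Fin m) ℂ, ∀ t, Function.Injective t →
    f (Finset.univ.image t) = eval t P

theorem IsRegular.add {f g : Shuffle η} (hf : IsRegular f) (hg : IsRegular g) :
    IsRegular (f + g) := by
  intro m
  obtain ⟨P, hP⟩ := hf m
  obtain ⟨Q, hQ⟩ := hg m
  exact ⟨P + Q, fun t ht => by rw [add_apply, hP t ht, hQ t ht, map_add]⟩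

theorem IsRegular.smul {f : Shuffle η} (c : ℂ) (hf : IsRegular f) : IsRegular (c • f) := by
  intro m
  obtain ⟨P, hP⟩ := hf m
  exact ⟨MvPolynomial.C c * P, fun t ht => by rw [smul_apply, hP t ht, map_mul, MvPolynomial.eval_C]⟩

theorem isRegular_block (p : Polynomial ℂ) (k : ℕ) :
    IsRegular (block η (fun z => p.eval z) k) := by
  intro m
  by_cases h : m = k
  · subst h
    refine ⟨∏ i, Polynomial.aeval (MvPolynomial.X i) p, fun t ht => ?_⟩
    rw [block_apply, if_pos (by rw [Finset.card_image_of_injective _ ht]; simp),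
      Finset.prod_image ht.injOn, MvPolynomial.eval_prod]
    refine Finset.prod_congr rfl fun i _ => ?_
    rw [← MvPolynomial.coe_aeval_eq_eval, RingHom.coe_coe, ← Polynomial.aeval_algHom_apply]
    simp [Polynomial.coe_aeval_eq_eval]
  · exact ⟨0, fun t ht => by
      rw [block_apply, if_neg (by rw [Finset.card_image_of_injective _ ht]; simpa using h), map_zero]⟩

theorem isRegular_one : IsRegular (1 : Shuffle η) := by
  rw [← block_zero (fun z => (0 : Polynomial ℂ).eval z)]
  exact isRegular_block 0 0

open MvPolynomial in
theorem IsRegular.exists_eval_subset {f : Shuffle η} (hf : IsRegular f) {m : ℕ}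
    (J : Finset (Fin m)) : ∃ P : MvPolynomial (Fin m) ℂ, ∀ t, Function.Injective t →
      f (J.image t) = eval t P := by
  obtain ⟨P, hP⟩ := hf J.card
  refine ⟨rename (J.orderEmbOfFin rfl) P, fun t ht => ?_⟩
  rw [eval_rename, ← hP _ (ht.comp (J.orderEmbOfFin rfl).injective), ← Finset.image_image,
    Finset.image_orderEmbOfFin_univ]

-- The cross factors have only simple poles along coinciding points, and each summand has at most
-- one such factor for each pair. Multiplication by the Vandermonde polynomial therefore clears all
-- denominators, and since the product depends only on the set of points it is symmetric, so the
-- Vandermonde factor can be divided out again.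
open MvPolynomial in
theorem IsRegular.mul {f g : Shuffle η} (hf : IsRegular f) (hg : IsRegular g) :
    IsRegular (f * g) := by
  intro m
  choose P hP using fun J : Finset (Fin m) => hf.exists_eval_subset J
  choose Q hQ using fun J : Finset (Fin m) => hg.exists_eval_subset J
  choose K hK using fun J : Finset (Fin m) => prod_prod_sub_dvd_vandermondePoly J
  refine exists_poly_of_vandermonde_mul (fun t => (f * g) (Finset.univ.image t)) ?_
    (∑ J : Finset (Fin m), P J * Q Jᶜ * K J *
      ∏ a ∈ J, ∏ b ∈ Jᶜ, (C (qpow η 1) * X a - C (qpow η (-1)) * X b)) ?_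
  · intro t w
    congr 1
    rw [← Finset.image_image, Finset.image_univ_equiv]
  · intro t ht
    rw [mul_apply_image _ _ t ht, Finset.mul_sum, map_sum]
    refine Finset.sum_congr rfl fun J _ => ?_
    rw [hK J, hP J t ht, hQ Jᶜ t ht]
    simp only [map_mul, eval_prod, map_sub, eval_C, eval_X, crossFactor, Finset.prod_div_distrib]
    have hne : (∏ a ∈ J, ∏ b ∈ Jᶜ, (t a - t b)) ≠ 0 := by
      refine Finset.prod_ne_zero_iff.mpr fun a ha => Finset.prod_ne_zero_iff.mpr fun b hb => ?_
      refine sub_ne_zero.mpr fun h => ?_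
      exact (Finset.mem_compl.mp hb) (ht h ▸ ha)
    field_simp

/-- The subalgebra of functions given by polynomials. -/
def regular (η : ℂ) : Subalgebra ℂ (Shuffle η) where
  carrier := {f | IsRegular f}
  mul_mem' := IsRegular.mul
  add_mem' := IsRegular.add
  algebraMap_mem' c := by
    rw [Algebra.algebraMap_eq_smul_one]
    exact isRegular_one.smul c

end Shuffle

/-- Tuples of distinct points are dense. -/
theorem dense_injective (m : ℕ) : Dense {t : Fin m → ℂ | Function.Injective t} := by
  intro t
  have hlim : Tendsto (fun ε : ℂ => fun i : Fin m => t i + ε * ((i : ℕ) : ℂ)) (𝓝[≠] 0) (𝓝 t) := by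
    have : Continuous (fun ε : ℂ => fun i : Fin m => t i + ε * ((i : ℕ) : ℂ)) := by fun_prop
    have h := this.tendsto 0
    simp only [zero_mul, add_zero] at h
    exact h.mono_left nhdsWithin_le_nhds
  refine mem_closure_of_tendsto hlim ?_
  have : ∀ i j : Fin m, i ≠ j → ∀ᶠ ε : ℂ in 𝓝[≠] 0,
      t i + ε * ((i : ℕ) : ℂ) ≠ t j + ε * ((j : ℕ) : ℂ) := by
    intro i j hij
    have hne : (((i : ℕ) : ℂ) - ((j : ℕ) : ℂ)) ≠ 0 :=
      sub_ne_zero.mpr fun h => hij (Fin.ext (by exact_mod_cast h))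
    by_cases h0 : t j - t i = 0
    · filter_upwards [self_mem_nhdsWithin] with ε hε h
      have : ε * (((i : ℕ) : ℂ) - ((j : ℕ) : ℂ)) = 0 := by linear_combination h + h0
      exact (mul_ne_zero hε hne) this
    · have : ∀ᶠ ε : ℂ in 𝓝[≠] 0, ε ≠ (t j - t i) / (((i : ℕ) : ℂ) - ((j : ℕ) : ℂ)) :=
        (eventually_ne_nhds (div_ne_zero h0 hne).symm).filter_mono nhdsWithin_le_nhds
      filter_upwards [this] with ε hε h
      exact hε (by rw [eq_div_iff hne]; linear_combination h)
  have h2 : ∀ᶠ ε : ℂ in 𝓝[≠] 0, ∀ i j : Fin m, i ≠ j →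
      t i + ε * ((i : ℕ) : ℂ) ≠ t j + ε * ((j : ℕ) : ℂ) := by
    simp only [eventually_all]
    exact this
  filter_upwards [h2] with ε hε i j h
  by_contra hij
  exact hε i j hij h

theorem extendPoly_eq_eval {m : ℕ} {f : (Fin m → ℂ) → ℂ} {P : MvPolynomial (Fin m) ℂ}
    (h : ∀ t, Function.Injective t → f t = MvPolynomial.eval t P) (t : Fin m → ℂ) :
    extendPoly f t = MvPolynomial.eval t P := by
  refine extendFrom_eq (dense_injective m t) ?_
  have h1 : Tendsto (fun t => MvPolynomial.eval t P) (𝓝[{t | Function.Injective t}] t)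
      (𝓝 (MvPolynomial.eval t P)) :=
    ((MvPolynomial.continuous_eval P).tendsto t).mono_left nhdsWithin_le_nhds
  refine h1.congr' ?_
  filter_upwards [self_mem_nhdsWithin] with u hu using (h u hu).symm

end

section

/-! ### The quantum plane attached to a site -/

section QuantumPlane

variable {η : ℂ} {A : Type*} [Ring A] [Algebra ℂ A] {X Y : A}

theorem pow_mul_of_qcomm (h : X * Y = qpow η 2 • (Y * X)) (j : ℕ) :
    X ^ j * Y = qpow η (2 * j) • (Y * X ^ j) := by
  induction j with
  | zero => simp [qpow_zero]
  | succ j ih =>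
    rw [pow_succ', mul_assoc, ih, mul_smul_comm, ← mul_assoc, h, smul_mul_assoc, smul_smul,
      ← qpow_add, mul_assoc]
    congr 2
    push_cast
    ring

/-- This is `Δ(F) = F ⊗ q^(-h) + 1 ⊗ F` in disguise. Moving the right wall across `X ^ j` turns it
into the left wall with the eigenvalue `q^(2j - L)` of `q^(-h)` on `u_j`, plus a term raising `j`
whose coefficient is proportional to `[L - j]`. -/
theorem pow_mul_right (h : X * Y = qpow η 2 • (Y * X)) (L : ℂ) (j : ℕ) :
    X ^ j * (qpow η L • X - Y) = qpow η (2 * j - L) • ((X - qpow η L • Y) * X ^ j)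
      + (qpow η L - qpow η (2 * j - L)) • X ^ (j + 1) := by
  have e : qpow η (2 * j - L) * qpow η L = qpow η (2 * j) := by rw [← qpow_add]; congr 1; ring
  rw [mul_sub, pow_mul_of_qcomm h, mul_smul_comm, ← pow_succ, sub_mul, smul_mul_assoc, ← pow_succ',
    smul_sub, smul_smul, e, sub_smul]
  abel

theorem pow_mul_left (h : X * Y = qpow η 2 • (Y * X)) (L : ℂ) (j : ℕ) :
    X ^ j * (X - qpow η L • Y) = qpow η (2 * j) • ((X - qpow η L • Y) * X ^ j)
      + (1 - qpow η (2 * j)) • X ^ (j + 1) := by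
  rw [mul_sub, mul_smul_comm, pow_mul_of_qcomm h, ← pow_succ, sub_mul, smul_mul_assoc, ← pow_succ',
    smul_sub, sub_smul, one_smul, smul_comm (qpow η L)]
  abel

/-- The coefficients of the noncommutative binomial formula `binomial_expansion`. -/
def binomCoeff (η u r : ℂ) (i j : ℕ) : ℂ :=
  r ^ i * (qpow η (i * j) * qfact η (i + j) / (qfact η i * qfact η j)) *
    ∏ l ∈ Finset.range j, (u - r * qpow η (2 * l))

theorem binomCoeff_succ_succ (hη : 0 < η.im) (u r : ℂ) (i j : ℕ) :
    binomCoeff η u r (i + 1) (j + 1)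
      = r * qpow η (2 * ((j + 1 : ℕ) : ℂ)) * binomCoeff η u r i (j + 1)
        + (u - r * qpow η (2 * (j : ℂ))) * binomCoeff η u r (i + 1) j := by
  have hi := qfact_ne_zero hη i
  have hj := qfact_ne_zero hη j
  have hi1 := qnum_succ_ne_zero hη i
  have hj1 := qnum_succ_ne_zero hη j
  have e0 : i + 1 + (j + 1) = (i + j + 1) + 1 := by ring
  have e1 : i + (j + 1) = i + j + 1 := by ring
  have e2 : i + 1 + j = i + j + 1 := by ring
  -- The quantum Pascal rule in the normalization of `binomCoeff`: the splitting of `[i + j + 2]`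
  -- into multiples of `[i + 1]` and `[j + 1]`.
  have key : qpow η (((i + 1 : ℕ) : ℂ) * ((j + 1 : ℕ) : ℂ)) * qnum η (((i + j + 1 : ℕ) : ℂ) + 1)
      = qpow η (2 * ((j + 1 : ℕ) : ℂ)) * qpow η ((i : ℂ) * ((j + 1 : ℕ) : ℂ)) * qnum η ((i : ℂ) + 1)
        + qpow η (((i + 1 : ℕ) : ℂ) * (j : ℂ)) * qnum η ((j : ℂ) + 1) := by
    simp only [qnum, mul_div_assoc']
    rw [← add_div]
    congr 1
    simp only [mul_sub, ← qpow_add]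
    push_cast
    ring_nf
  simp only [binomCoeff, e0, e1, e2, qfact_succ, Finset.prod_range_succ, pow_succ]
  generalize u - r * qpow η (2 * (j : ℂ)) = c
  generalize qpow η (((i + 1 : ℕ) : ℂ) * ((j + 1 : ℕ) : ℂ)) = k1 at key ⊢
  generalize qpow η (2 * ((j + 1 : ℕ) : ℂ)) = k2 at key ⊢
  generalize qpow η ((i : ℂ) * ((j + 1 : ℕ) : ℂ)) = k3 at key ⊢
  generalize qpow η (((i + 1 : ℕ) : ℂ) * (j : ℂ)) = k4 at key ⊢
  generalize ∏ l ∈ Finset.range j, (u - r * qpow η (2 * l)) = k5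
  field_simp
  linear_combination r * r ^ i * qfact η (i + j) * qnum η (((i + j : ℕ) : ℂ) + 1) * k5 * c * key

theorem binomCoeff_succ_zero (hη : 0 < η.im) (u r : ℂ) (i : ℕ) :
    binomCoeff η u r (i + 1) 0 = r * binomCoeff η u r i 0 := by
  have hi := qfact_ne_zero hη i
  have hi1 := qfact_ne_zero hη (i + 1)
  have h0 : qfact η 0 = 1 := by simp [qfact]
  simp only [binomCoeff, h0, add_zero, mul_one, Nat.cast_zero, mul_zero, qpow_zero, one_mul,
    div_self hi, div_self hi1, pow_succ]
  ring

theorem binomCoeff_zero_succ (hη : 0 < η.im) (u r : ℂ) (j : ℕ) :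
    binomCoeff η u r 0 (j + 1) = (u - r * qpow η (2 * (j : ℂ))) * binomCoeff η u r 0 j := by
  have hi := qfact_ne_zero hη j
  have hi1 := qfact_ne_zero hη (j + 1)
  have h0 : qfact η 0 = 1 := by simp [qfact]
  simp only [binomCoeff, h0, zero_add, one_mul, Nat.cast_zero, zero_mul, qpow_zero,
    div_self hi, div_self hi1, Finset.prod_range_succ]
  ring

/-- With `a = X - q^L Y` the base is `r a + (u - r) X`. Multiplying `a ^ i X ^ j` by it on the right
and reordering by `pow_mul_left` produces exactly the Pascal recursion for `binomCoeff`. -/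
theorem binomial_expansion (hη : 0 < η.im) (h : X * Y = qpow η 2 • (Y * X)) (L u r : ℂ) (m : ℕ) :
    (u • X - (r * qpow η L) • Y) ^ m = ∑ p ∈ Finset.HasAntidiagonal.antidiagonal m,
      binomCoeff η u r p.1 p.2 • ((X - qpow η L • Y) ^ p.1 * X ^ p.2) := by
  set a := X - qpow η L • Y with ha
  have hlin : u • X - (r * qpow η L) • Y = r • a + (u - r) • X := by
    rw [ha, smul_sub, smul_smul, sub_smul]; abel
  have step : ∀ i j : ℕ, a ^ i * X ^ j * (r • a + (u - r) • X)
      = (r * qpow η (2 * (j : ℂ))) • (a ^ (i + 1) * X ^ j)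
        + (u - r * qpow η (2 * (j : ℂ))) • (a ^ i * X ^ (j + 1)) := by
    intro i j
    rw [mul_add, mul_smul_comm, mul_smul_comm, mul_assoc, mul_assoc, ha, pow_mul_left h, ← ha,
      ← pow_succ, mul_add, mul_smul_comm, mul_smul_comm, smul_add, smul_smul, smul_smul,
      ← mul_assoc, ← pow_succ, add_assoc, ← add_smul]
    congr 2
    ring
  rw [hlin]
  induction m with
  | zero => simp [binomCoeff, qfact, qpow_zero]
  | succ m ih =>
    rw [pow_succ, ih, Finset.sum_mul]
    simp only [smul_mul_assoc, step, smul_add, smul_smul, Finset.sum_add_distrib]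
    set K := binomCoeff η u r
    set T : ℕ → ℕ → A := fun i j => a ^ i * X ^ j
    have h1 : ∑ p ∈ Finset.HasAntidiagonal.antidiagonal m,
          (K p.1 p.2 * (r * qpow η (2 * (p.2 : ℂ)))) • (a ^ (p.1 + 1) * X ^ p.2)
        = ∑ p ∈ Finset.HasAntidiagonal.antidiagonal (m + 1), (if p.1 = 0 then 0 else
            K (p.1 - 1) p.2 * (r * qpow η (2 * (p.2 : ℂ)))) • T p.1 p.2 := by
      rw [Finset.Nat.sum_antidiagonal_succ]
      simp [T]
    have h2 : ∑ p ∈ Finset.HasAntidiagonal.antidiagonal m,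
          (K p.1 p.2 * (u - r * qpow η (2 * (p.2 : ℂ)))) • (a ^ p.1 * X ^ (p.2 + 1))
        = ∑ p ∈ Finset.HasAntidiagonal.antidiagonal (m + 1), (if p.2 = 0 then 0 else
            K p.1 (p.2 - 1) * (u - r * qpow η (2 * ((p.2 - 1 : ℕ) : ℂ)))) • T p.1 p.2 := by
      rw [Finset.Nat.sum_antidiagonal_succ']
      simp [T]
    rw [h1, h2, ← Finset.sum_add_distrib]
    refine Finset.sum_congr rfl fun p hp => ?_
    rw [← add_smul]
    congr 1
    have hp' := Finset.HasAntidiagonal.mem_antidiagonal.mp hp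
    obtain ⟨i, j⟩ := p
    rcases i with _ | i
    · rcases j with _ | j
      · simp at hp'
      · simp only [K, binomCoeff_zero_succ hη]; simp; ring
    · rcases j with _ | j
      · simp only [K, binomCoeff_succ_zero hη]; simp [qpow_zero]; ring
      · simp only [K, binomCoeff_succ_succ hη]; simp; ring

end QuantumPlane

end

section

/-! ### Chains of sites -/

/-- Quantum planes `X k`, `Y k`, `k < n`, together with the elements
`g k = X k - q^(Λ k) Y k` and `g (k + 1) = q^(Λ k) X k - Y k`. -/
structure SiteChain (η : ℂ) {n : ℕ} (Λ : Fin n → ℂ) (A : Type*) [Ring A] [Algebra ℂ A] where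
  X : Fin n → A
  Y : Fin n → A
  g : Fin (n + 1) → A
  comm : ∀ k, X k * Y k = qpow η 2 • (Y k * X k)
  left : ∀ k, g k.castSucc = X k - qpow η (Λ k) • Y k
  right : ∀ k, g k.succ = qpow η (Λ k) • X k - Y k

/-- The normalization of `u_k ↦ X ^ k`. -/
def dualCoeff (η : ℂ) (k : ℕ) : ℂ :=
  qpow η ((k : ℂ) * (k - 1) / 2) * (qpow η 1 - qpow η (-1)) ^ k

theorem dualCoeff_succ (η : ℂ) (k : ℕ) :
    dualCoeff η (k + 1) = qpow η k * (qpow η 1 - qpow η (-1)) * dualCoeff η k := by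
  have : qpow η (((k + 1 : ℕ) : ℂ) * (((k + 1 : ℕ) : ℂ) - 1) / 2)
      = qpow η k * qpow η ((k : ℂ) * (k - 1) / 2) := by
    rw [← qpow_add]; congr 1; push_cast; ring
  simp only [dualCoeff, this, pow_succ]
  ring

/-- The operator `F` of a Verma module, which does not depend on the highest weight. -/
def lowering (η : ℂ) : Module.End ℂ VermaSpace :=
  onBasis fun k => qnum η ((k : ℂ) + 1) • bv (k + 1)

theorem lowering_bv (η : ℂ) (k : ℕ) :
    lowering η (bv k) = qnum η ((k : ℂ) + 1) • bv (k + 1) := onBasis_bv _ _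

/-- The operator `q^(-h)` on a tensor product of dual Verma modules. -/
def dualK (η : ℂ) (hη : 0 < η.im) : (n : ℕ) → (Fin n → ℂ) → Module.End ℂ (DualTensor n)
  | 0, _ => 1
  | n + 1, Λ => (consTensor n).toLinearMap ∘ₗ
      TensorProduct.map ((dualVerma η hη (Λ 0)).K (-1)) (dualK η hη n (Fin.tail Λ)) ∘ₗ
        (consTensor n).symm.toLinearMap

/-- The operator `F` on a tensor product of dual Verma modules. -/
def dualF (η : ℂ) (hη : 0 < η.im) : (n : ℕ) → (Fin n → ℂ) → Module.End ℂ (DualTensor n)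
  | 0, _ => 0
  | n + 1, Λ => (consTensor n).toLinearMap ∘ₗ
      (TensorProduct.map (dualVerma η hη (Λ 0)).F (dualK η hη n (Fin.tail Λ)) +
        TensorProduct.map 1 (dualF η hη n (Fin.tail Λ))) ∘ₗ
        (consTensor n).symm.toLinearMap

/-- The operator `F` on a tensor product of a Verma module and several dual Verma modules. -/
def totalF (η : ℂ) (hη : 0 < η.im) {n : ℕ} (Λ : Fin n → ℂ) :
    Module.End ℂ (VermaSpace ⊗[ℂ] DualTensor n) :=
  TensorProduct.map (lowering η) (dualK η hη n Λ) + TensorProduct.map 1 (dualF η hη n Λ)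

theorem consTensor_tmul_single (n : ℕ) (k : ℕ) (μ : Fin n → ℕ) :
    consTensor n (bv k ⊗ₜ Finsupp.single μ 1) = Finsupp.single (Fin.cons k μ) 1 := by
  simp [consTensor]
  rfl

theorem ext_bv_single {n : ℕ} {V : Type*} [AddCommGroup V] [Module ℂ V]
    {A B : VermaSpace ⊗[ℂ] DualTensor n →ₗ[ℂ] V}
    (h : ∀ k μ, A (bv k ⊗ₜ Finsupp.single μ 1) = B (bv k ⊗ₜ Finsupp.single μ 1)) : A = B := by
  refine TensorProduct.ext (ext_bv fun k => ?_)
  ext μ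
  simpa using h k μ

/-- The operator `F` on a tensor product of a Verma module and a dual Verma module. -/
def pairF (η : ℂ) (hη : 0 < η.im) (L : ℂ) : Module.End ℂ (VermaSpace ⊗[ℂ] VermaSpace) :=
  TensorProduct.map (lowering η) ((dualVerma η hη L).K (-1)) +
    TensorProduct.map 1 (dualVerma η hη L).F

theorem Phi_lowering (η : ℂ) (hη : 0 < η.im) (L : ℂ) (m : ℕ) (lam : ℂ) (v : VermaSpace) :
    Phi η hη L m lam (lowering η v) = pairF η hη L (Phi η hη L m lam v) :=
  (Phi_isIntertwiner η hη L m lam).map_F v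

/-- Each factor of the composition intertwines `F`, and coassociativity assembles these statements
into the iterated coproduct. Only `F` is needed, and on Verma modules it does not depend on the
highest weight, so the weights need not be tracked. -/
theorem PhiMulti_lowering (η : ℂ) (hη : 0 < η.im) : ∀ (n : ℕ) (Λ : Fin n → ℂ) (μ : Fin n → ℕ)
    (lam : ℂ) (v : VermaSpace),
    PhiMulti η hη n Λ μ lam (lowering η v) = totalF η hη Λ (PhiMulti η hη n Λ μ lam v)
  | 0, Λ, μ, lam, v => by
    simp [PhiMulti, totalF, dualK, dualF]
  | n + 1, Λ, μ, lam, v => by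
    set Ph := Phi η hη (Λ 0) (μ 0) (lam - ∑ i : Fin n, (Λ i.succ - 2 * μ i.succ)) with hPh
    set G := LinearMap.lTensor VermaSpace (consTensor n).toLinearMap ∘ₗ
        (TensorProduct.assoc ℂ VermaSpace VermaSpace (DualTensor n)).toLinearMap ∘ₗ
        LinearMap.rTensor (DualTensor n) Ph with hG
    have hstep : G ∘ₗ totalF η hη (Fin.tail Λ) = totalF η hη Λ ∘ₗ G := by
      have hF : ∀ v, Ph (lowering η v) = pairF η hη (Λ 0) (Ph v) := Phi_lowering η hη _ _ _
      have key : ∀ (z : VermaSpace ⊗[ℂ] VermaSpace) (w : DualTensor n),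
          LinearMap.lTensor VermaSpace (consTensor n).toLinearMap
            (TensorProduct.assoc ℂ VermaSpace VermaSpace (DualTensor n)
              (pairF η hη (Λ 0) z ⊗ₜ dualK η hη n (Fin.tail Λ) w
                + z ⊗ₜ dualF η hη n (Fin.tail Λ) w))
          = totalF η hη Λ (LinearMap.lTensor VermaSpace (consTensor n).toLinearMap
            (TensorProduct.assoc ℂ VermaSpace VermaSpace (DualTensor n) (z ⊗ₜ w))) := by
        intro z w
        induction z using TensorProduct.induction_on with
        | zero => simp
        | tmul a b =>
          simp [pairF, totalF, dualK, dualF, TensorProduct.add_tmul, TensorProduct.tmul_add]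
          abel
        | add z z' h h' =>
          simp only [map_add, TensorProduct.add_tmul] at h h' ⊢
          rw [← h, ← h']
          abel
      refine TensorProduct.ext' fun v w => ?_
      simp only [LinearMap.comp_apply, hG]
      rw [totalF, LinearMap.add_apply, TensorProduct.map_tmul, TensorProduct.map_tmul, map_add,
        LinearMap.rTensor_tmul, LinearMap.rTensor_tmul, LinearMap.rTensor_tmul, hF]
      exact key _ _
    have ih := PhiMulti_lowering η hη n (Fin.tail Λ) (Fin.tail μ) lam v
    have e : ∀ v, PhiMulti η hη (n + 1) Λ μ lam v
        = G (PhiMulti η hη n (Fin.tail Λ) (Fin.tail μ) lam v) := fun v => rfl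
    rw [e, e, ih]
    exact LinearMap.congr_fun hstep _

namespace SiteChain

variable {η : ℂ} {A : Type*} [Ring A] [Algebra ℂ A]

/-- The chain without its first site. -/
def tail {n : ℕ} {Λ : Fin (n + 1) → ℂ} (C : SiteChain η Λ A) : SiteChain η (Fin.tail Λ) A where
  X k := C.X k.succ
  Y k := C.Y k.succ
  g k := C.g k.succ
  comm k := C.comm k.succ
  left k := by rw [Fin.succ_castSucc]; exact C.left k.succ
  right k := C.right k.succ

/-- `v^(i) ↦ a ^ i / [i]!`. -/
def vermaMap (η : ℂ) (a : A) : VermaSpace →ₗ[ℂ] A := onBasis fun i => (qfact η i)⁻¹ • a ^ i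

/-- `u_k ↦ X ^ k`, normalized. -/
def siteMap (η : ℂ) (X : A) : VermaSpace →ₗ[ℂ] A := onBasis fun k => dualCoeff η k • X ^ k

/-- `u_μ ↦ ∏ X_k ^ μ_k`, normalized. -/
def dualMap {n : ℕ} {Λ : Fin n → ℂ} (C : SiteChain η Λ A) : DualTensor n →ₗ[ℂ] A :=
  Finsupp.linearCombination ℂ fun μ =>
    (List.ofFn fun k => dualCoeff η (μ k) • C.X k ^ μ k).prod

/-- `v ⊗ u ↦ vermaMap v * dualMap u`. -/
def theta {n : ℕ} {Λ : Fin n → ℂ} (C : SiteChain η Λ A) : VermaSpace ⊗[ℂ] DualTensor n →ₗ[ℂ] A :=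
  LinearMap.mul' ℂ A ∘ₗ TensorProduct.map (vermaMap η (C.g 0)) C.dualMap

theorem theta_tmul {n : ℕ} {Λ : Fin n → ℂ} (C : SiteChain η Λ A) (v : VermaSpace)
    (w : DualTensor n) : C.theta (v ⊗ₜ w) = vermaMap η (C.g 0) v * C.dualMap w := by
  simp [theta]

theorem dualMap_single {n : ℕ} {Λ : Fin n → ℂ} (C : SiteChain η Λ A) (μ : Fin n → ℕ) :
    C.dualMap (Finsupp.single μ 1) = (List.ofFn fun k => dualCoeff η (μ k) • C.X k ^ μ k).prod := by
  simp [dualMap]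

theorem dualMap_cons {n : ℕ} {Λ : Fin (n + 1) → ℂ} (C : SiteChain η Λ A) (u : VermaSpace)
    (w : DualTensor n) :
    C.dualMap (consTensor n (u ⊗ₜ w)) = siteMap η (C.X 0) u * C.tail.dualMap w := by
  have : C.dualMap ∘ₗ (consTensor n).toLinearMap
      = LinearMap.mul' ℂ A ∘ₗ TensorProduct.map (siteMap η (C.X 0)) C.tail.dualMap := by
    refine ext_bv_single fun k μ => ?_
    simp only [LinearMap.comp_apply, LinearEquiv.coe_coe, TensorProduct.map_tmul,
      LinearMap.mul'_apply]
    rw [consTensor_tmul_single, dualMap_single, dualMap_single, siteMap, onBasis_bv,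
      List.ofFn_succ, List.prod_cons]
    rfl
  simpa using LinearMap.congr_fun this (u ⊗ₜ w)

theorem vermaMap_lowering (hη : 0 < η.im) (a : A) (v : VermaSpace) :
    vermaMap η a (lowering η v) = a * vermaMap η a v := by
  have : vermaMap η a ∘ₗ lowering η = LinearMap.mulLeft ℂ a ∘ₗ vermaMap η a := by
    refine ext_bv fun k => ?_
    have h1 := qfact_ne_zero hη k
    have h2 := qnum_succ_ne_zero hη k
    simp only [LinearMap.comp_apply, lowering_bv, map_smul, vermaMap, onBasis_bv,
      LinearMap.mulLeft_apply, ← pow_succ', smul_smul, qfact_succ]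
    congr 1
    field_simp
  exact LinearMap.congr_fun this v

theorem vermaMap_lowering' (hη : 0 < η.im) (a : A) (v : VermaSpace) :
    vermaMap η a (lowering η v) = vermaMap η a v * a := by
  rw [vermaMap_lowering hη]
  have : LinearMap.mulLeft ℂ a ∘ₗ vermaMap η a = LinearMap.mulRight ℂ a ∘ₗ vermaMap η a := by
    refine ext_bv fun k => ?_
    simp only [LinearMap.comp_apply, vermaMap, onBasis_bv, map_smul, LinearMap.mulLeft_apply,
      LinearMap.mulRight_apply, ← pow_succ', ← pow_succ]
  exact LinearMap.congr_fun this v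

/-- This is `pow_mul_right` after normalization: `q^L - q^(2k - L) = q^k (q - q⁻¹) [L - k]`, and the
factor `q^k (q - q⁻¹)` is the quotient of consecutive values of `dualCoeff`. -/
theorem siteMap_mul (hη : 0 < η.im) {X Y : A} (h : X * Y = qpow η 2 • (Y * X)) (L : ℂ)
    (u : VermaSpace) : siteMap η X u * (qpow η L • X - Y)
      = (X - qpow η L • Y) * siteMap η X ((dualVerma η hη L).K (-1) u)
        + siteMap η X ((dualVerma η hη L).F u) := by
  have : LinearMap.mulRight ℂ (qpow η L • X - Y) ∘ₗ siteMap η X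
      = LinearMap.mulLeft ℂ (X - qpow η L • Y) ∘ₗ siteMap η X ∘ₗ (dualVerma η hη L).K (-1)
        + siteMap η X ∘ₗ (dualVerma η hη L).F := by
    refine ext_bv fun k => ?_
    simp only [LinearMap.comp_apply, LinearMap.add_apply, LinearMap.mulRight_apply,
      LinearMap.mulLeft_apply, dualVerma, siteMap, onBasis_bv, map_smul, pow_mul_right h, smul_add, smul_smul, dualCoeff_succ]
    have hne := q_sub_ne_zero hη
    congr 2
    · rw [mul_comm]; congr 2; ring
    · have e1 : qpow η L = qpow η k * qpow η (L - k) := by rw [← qpow_add]; congr 1; ring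
      have e2 : qpow η (2 * k - L) = qpow η k * qpow η (-(L - k)) := by
        rw [← qpow_add]; congr 1; ring
      rw [qnum, e1, e2]
      field_simp
  exact LinearMap.congr_fun this u

/-- The last wall is moved to the left through all sites. Each crossing turns it into the preceding
wall and acts by `q^(-h)`, or stops there and acts by `F`; the sum over all possibilities is the
iterated coproduct of `F`. -/
theorem dualMap_mul_last (hη : 0 < η.im) : ∀ {n : ℕ} {Λ : Fin n → ℂ} (C : SiteChain η Λ A)
    (w : DualTensor n), C.dualMap w * C.g (Fin.last n)
      = C.g 0 * C.dualMap (dualK η hη n Λ w) + C.dualMap (dualF η hη n Λ w)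
  | 0, Λ, C, w => by
    have : LinearMap.mulRight ℂ (C.g (Fin.last 0)) ∘ₗ C.dualMap
        = LinearMap.mulLeft ℂ (C.g 0) ∘ₗ C.dualMap := by
      ext μ
      simp [dualMap]
    simpa [dualK, dualF] using LinearMap.congr_fun this w
  | n + 1, Λ, C, w => by
    obtain ⟨z, rfl⟩ := (consTensor n).surjective w
    induction z using TensorProduct.induction_on with
    | zero => simp
    | add z z' h h' =>
      simp only [map_add, add_mul, mul_add] at h h' ⊢
      rw [h, h']
      abel
    | tmul u w =>
      have ih := dualMap_mul_last hη C.tail w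
      have hg : C.tail.g (Fin.last n) = C.g (Fin.last (n + 1)) := rfl
      have hg0 : C.tail.g 0 = qpow η (Λ 0) • C.X 0 - C.Y 0 := C.right 0
      have hl : C.g 0 = C.X 0 - qpow η (Λ 0) • C.Y 0 := C.left 0
      have hs := siteMap_mul hη (C.comm 0) (Λ 0) u
      rw [hg, hg0] at ih
      simp only [dualK, dualF, LinearMap.comp_apply, LinearEquiv.coe_coe,
        LinearEquiv.symm_apply_apply, LinearMap.add_apply, TensorProduct.map_tmul, map_add,
        Module.End.one_apply, dualMap_cons]
      rw [mul_assoc, ih, mul_add, ← mul_assoc, hs, hl]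
      noncomm_ring

/-- The copy of `g 0` that emerges from the sites commutes with the powers of `g 0` representing the
Verma factor, where it acts as `F`. -/
theorem theta_totalF (hη : 0 < η.im) {n : ℕ} {Λ : Fin n → ℂ} (C : SiteChain η Λ A)
    (x : VermaSpace ⊗[ℂ] DualTensor n) :
    C.theta (totalF η hη Λ x) = C.theta x * C.g (Fin.last n) := by
  induction x using TensorProduct.induction_on with
  | zero => simp
  | add z z' h h' => simp only [map_add, h, h', add_mul]
  | tmul v w =>
    rw [totalF, LinearMap.add_apply, TensorProduct.map_tmul, TensorProduct.map_tmul, map_add,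
      theta_tmul, theta_tmul, theta_tmul, mul_assoc, dualMap_mul_last hη, vermaMap_lowering' hη]
    simp only [Module.End.one_apply]
    noncomm_ring

theorem theta_lowering (hη : 0 < η.im) {n : ℕ} {Λ : Fin n → ℂ} (C : SiteChain η Λ A)
    (v : VermaSpace) (w : DualTensor n) :
    C.theta (lowering η v ⊗ₜ w) = C.g 0 * C.theta (v ⊗ₜ w) := by
  rw [theta_tmul, theta_tmul, vermaMap_lowering hη, mul_assoc]

/-- `v ⊗ u ↦ vermaMap v * siteMap u`. -/
def pairMap (η : ℂ) (a X : A) : VermaSpace ⊗[ℂ] VermaSpace →ₗ[ℂ] A :=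
  LinearMap.mul' ℂ A ∘ₗ TensorProduct.map (vermaMap η a) (siteMap η X)

theorem pairMap_tmul (a X : A) (v u : VermaSpace) :
    pairMap η a X (v ⊗ₜ u) = vermaMap η a v * siteMap η X u := by
  simp [pairMap]

theorem pairMap_pairF (hη : 0 < η.im) {X Y : A} (h : X * Y = qpow η 2 • (Y * X)) (L : ℂ)
    (z : VermaSpace ⊗[ℂ] VermaSpace) :
    pairMap η (X - qpow η L • Y) X (pairF η hη L z)
      = pairMap η (X - qpow η L • Y) X z * (qpow η L • X - Y) := by
  induction z using TensorProduct.induction_on with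
  | zero => simp
  | add z z' h h' => simp only [map_add, h, h', add_mul]
  | tmul v u =>
    rw [pairF, LinearMap.add_apply, TensorProduct.map_tmul, TensorProduct.map_tmul, map_add,
      pairMap_tmul, pairMap_tmul, pairMap_tmul, mul_assoc, siteMap_mul hη h,
      vermaMap_lowering' hη]
    simp only [Module.End.one_apply]
    noncomm_ring

/-- The image of a singular vector. -/
def siteFactor (η lam L : ℂ) (m : ℕ) (X Y : A) : A :=
  (qpow η (-(lam - L + 2 * m) + m) • X - qpow η (lam + m) • Y) ^ m

theorem qfact_eq_prod_mul (η : ℂ) {i m : ℕ} (h : i ≤ m) :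
    qfact η m = (∏ s ∈ Finset.range i, qnum η ((m - s : ℕ) : ℂ)) * qfact η (m - i) := by
  induction i with
  | zero => simp
  | succ i ih =>
    have e : m - i = (m - (i + 1)) + 1 := by omega
    rw [ih (by omega), Finset.prod_range_succ, mul_assoc]
    congr 1
    rw [e, qfact_succ, mul_comm]
    push_cast
    rfl

/-- The singular vector is a binomial expansion. In `binomial_expansion` one takes `u = q^(-(lam - L
+ 2m) + m)` and `r = q^(lam + m - L)`; its terms are those of the defining sum, with `E^i u_m`
evaluated by `dualVerma_E_pow`. -/
theorem pairMap_singularVector (hη : 0 < η.im) {X Y : A} (h : X * Y = qpow η 2 • (Y * X)) (L : ℂ)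
    (m : ℕ) (lam : ℂ) :
    pairMap η (X - qpow η L • Y) X (singularVector η hη L m lam) = siteFactor η lam L m X Y := by
  have hne := q_sub_ne_zero hη
  have e0 : qpow η (lam + m) = qpow η (lam + m - L) * qpow η L := by
    rw [← qpow_add]; congr 1; ring
  rw [siteFactor, e0, binomial_expansion hη h, Finset.Nat.sum_antidiagonal_eq_sum_range_succ_mk,
    singularVector, map_sum]
  refine Finset.sum_congr rfl fun i hi => ?_
  have him : i ≤ m := Nat.lt_succ_iff.mp (Finset.mem_range.mp hi)
  obtain ⟨j, rfl⟩ := Nat.exists_eq_add_of_le him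
  have hf := qfact_eq_prod_mul η him
  rw [dualVerma_E_pow, map_smul, pairMap_tmul, map_smul]
  simp only [Nat.add_sub_cancel_left] at hf ⊢
  simp only [vermaMap, siteMap, onBasis_bv, smul_mul_assoc, mul_smul_comm, smul_smul, binomCoeff]
  congr 1
  rw [hf]
  have h1 := qfact_ne_zero hη i
  have h2 := qfact_ne_zero hη j
  set Q := ∏ s ∈ Finset.range i, qnum η ((i + j - s : ℕ) : ℂ)
  -- Each factor `u - r q^(2l)` is `(q - q⁻¹) q^l` times a quantum number. The quantum numbers
  -- appear in the order opposite to `qpoch`, hence the reflection of the index.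
  have hprod : ∏ l ∈ Finset.range j, (qpow η (-(lam - L + 2 * ((i + j : ℕ) : ℂ)) + ((i + j : ℕ) : ℂ))
        - qpow η (lam + ((i + j : ℕ) : ℂ) - L) * qpow η (2 * (l : ℂ)))
      = dualCoeff η j * qpoch η (-lam + L - 2 * ((i + j : ℕ) : ℂ) + i + 1) j := by
    have : ∀ k : ℕ, ∏ l ∈ Finset.range k, (qpow η 1 - qpow η (-1)) * qpow η (l : ℂ)
        = dualCoeff η k := by
      intro k
      induction k with
      | zero => simp [dualCoeff, qpow_zero]
      | succ k ih => rw [Finset.prod_range_succ, ih, dualCoeff_succ]; ring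
    rw [← this, qpoch, ← Finset.prod_range_reflect (fun l : ℕ => qnum η _), ← Finset.prod_mul_distrib]
    refine Finset.prod_congr rfl fun l hl => ?_
    have hl' : l + 1 ≤ j := Finset.mem_range.mp hl
    have e1 : ((j - 1 - l : ℕ) : ℂ) = j - 1 - l := by
      rw [Nat.sub_sub, Nat.cast_sub (by omega)]; push_cast; ring
    rw [e1, qnum, mul_assoc, mul_div_assoc', mul_div_assoc', mul_div_cancel_left₀ _ hne, mul_sub,
      ← qpow_add, ← qpow_add, ← qpow_add]
    push_cast
    congr 2 <;> ring
  rw [hprod]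
  have e1 : qpow η ((i : ℂ) * (lam - L + 2 * ((i + j : ℕ) : ℂ) - i))
      = qpow η (lam + ((i + j : ℕ) : ℂ) - L) ^ i * qpow η (i * j) := by
    rw [← qpow_nsmul, ← qpow_add]
    congr 1
    push_cast
    ring
  rw [e1]
  field_simp

/-- Each application of `F` becomes right multiplication by the right wall, so `F^k s / [k]!`
becomes the image of the singular vector `s` times a divided power of that wall. An intertwiner thus
replaces the Verma module at the right wall by the one at the left wall. -/
theorem pairMap_Phi (hη : 0 < η.im) {X Y : A} (h : X * Y = qpow η 2 • (Y * X)) (L : ℂ)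
    (m : ℕ) (lam : ℂ) (v : VermaSpace) :
    pairMap η (X - qpow η L • Y) X (Phi η hη L m lam v)
      = siteFactor η lam L m X Y * vermaMap η (qpow η L • X - Y) v := by
  have : pairMap η (X - qpow η L • Y) X ∘ₗ Phi η hη L m lam
      = LinearMap.mulLeft ℂ (siteFactor η lam L m X Y) ∘ₗ vermaMap η (qpow η L • X - Y) := by
    refine ext_bv fun k => ?_
    have hpow : ∀ k : ℕ, pairMap η (X - qpow η L • Y) X
        (((phiTarget η hη L m lam).F ^ k) (singularVector η hη L m lam))
        = siteFactor η lam L m X Y * (qpow η L • X - Y) ^ k := by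
      intro k
      induction k with
      | zero => simp [pairMap_singularVector hη h]
      | succ k ih =>
        rw [pow_succ', Module.End.mul_apply, pow_succ, ← mul_assoc, ← ih]
        exact pairMap_pairF hη h L _
    simp only [LinearMap.comp_apply, Phi, fromHighest, vermaMap, onBasis_bv, map_smul, hpow,
      LinearMap.mulLeft_apply]
  exact LinearMap.congr_fun this v

/-- The product of the images of the singular vectors. -/
def chainFactor {n : ℕ} {Λ : Fin n → ℂ} (C : SiteChain η Λ A) (μ : Fin n → ℕ) (lam : ℂ) : A :=
  (List.ofFn fun k => siteFactor η (lam - ∑ l ∈ Finset.Ioi k, (Λ l - 2 * μ l)) (Λ k) (μ k)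
    (C.X k) (C.Y k)).prod

/-- Iterating `pairMap_Phi`, the Verma module is carried from the last wall to the first one, and
each site crossed contributes one factor on the left. On the highest weight vector only the product
of these factors survives. -/
theorem theta_PhiMulti (hη : 0 < η.im) : ∀ {n : ℕ} {Λ : Fin n → ℂ} (C : SiteChain η Λ A)
    (μ : Fin n → ℕ) (lam : ℂ) (v : VermaSpace),
    C.theta (PhiMulti η hη n Λ μ lam v) = C.chainFactor μ lam * vermaMap η (C.g (Fin.last n)) v
  | 0, Λ, C, μ, lam, v => by
    simp [PhiMulti, chainFactor, theta_tmul, dualMap]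
  | n + 1, Λ, C, μ, lam, v => by
    set Ph := Phi η hη (Λ 0) (μ 0) (lam - ∑ i : Fin n, (Λ i.succ - 2 * μ i.succ)) with hPh
    set G := LinearMap.lTensor VermaSpace (consTensor n).toLinearMap ∘ₗ
        (TensorProduct.assoc ℂ VermaSpace VermaSpace (DualTensor n)).toLinearMap ∘ₗ
        LinearMap.rTensor (DualTensor n) Ph with hG
    set W := siteFactor η (lam - ∑ i : Fin n, (Λ i.succ - 2 * μ i.succ)) (Λ 0) (μ 0) (C.X 0) (C.Y 0)
      with hW
    have hg0 : C.tail.g 0 = qpow η (Λ 0) • C.X 0 - C.Y 0 := C.right 0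
    have hl : C.g 0 = C.X 0 - qpow η (Λ 0) • C.Y 0 := C.left 0
    have hstep : C.theta ∘ₗ G = LinearMap.mulLeft ℂ W ∘ₗ C.tail.theta := by
      have key : ∀ (z : VermaSpace ⊗[ℂ] VermaSpace) (w : DualTensor n),
          C.theta (LinearMap.lTensor VermaSpace (consTensor n).toLinearMap
            (TensorProduct.assoc ℂ VermaSpace VermaSpace (DualTensor n) (z ⊗ₜ w)))
          = pairMap η (C.g 0) (C.X 0) z * C.tail.dualMap w := by
        intro z w
        induction z using TensorProduct.induction_on with
        | zero => simp
        | tmul a b =>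
          rw [TensorProduct.assoc_tmul, LinearMap.lTensor_tmul, theta_tmul, LinearEquiv.coe_coe,
            dualMap_cons, pairMap_tmul, mul_assoc]
        | add z z' h h' =>
          simp only [map_add, TensorProduct.add_tmul, add_mul] at h h' ⊢
          rw [← h, ← h']
      refine TensorProduct.ext' fun v w => ?_
      simp only [LinearMap.comp_apply, hG, LinearMap.mulLeft_apply]
      rw [LinearMap.rTensor_tmul]
      refine (key _ _).trans ?_
      rw [hl, pairMap_Phi hη (C.comm 0), theta_tmul, mul_assoc, hg0]
    have ih := theta_PhiMulti hη C.tail (Fin.tail μ) lam v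
    have e : PhiMulti η hη (n + 1) Λ μ lam v
        = G (PhiMulti η hη n (Fin.tail Λ) (Fin.tail μ) lam v) := rfl
    have e2 := LinearMap.congr_fun hstep (PhiMulti η hη n (Fin.tail Λ) (Fin.tail μ) lam v)
    simp only [LinearMap.comp_apply, LinearMap.mulLeft_apply] at e2
    have e3 : C.chainFactor μ lam = W * C.tail.chainFactor (Fin.tail μ) lam := by
      rw [chainFactor, List.ofFn_succ, List.prod_cons, chainFactor, Fin.sum_Ioi_zero, hW]
      congr 4
      funext k
      rw [Fin.sum_Ioi_succ]
      rfl
    rw [e, e2, ih, e3, mul_assoc]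
    rfl

end SiteChain

end

/-! ### Weight spaces -/

/-- The span of the `u_μ` with `∑ μ = p`. -/
def dualLevel (n p : ℕ) : Submodule ℂ (DualTensor n) :=
  Submodule.span ℂ {w | ∃ μ : Fin n → ℕ, ∑ i, μ i = p ∧ w = Finsupp.single μ 1}

theorem single_mem_dualLevel {n : ℕ} (μ : Fin n → ℕ) :
    Finsupp.single μ 1 ∈ dualLevel n (∑ i, μ i) := Submodule.subset_span ⟨μ, rfl, rfl⟩

theorem dualK_single (η : ℂ) (hη : 0 < η.im) : ∀ {n : ℕ} (Λ : Fin n → ℂ) (μ : Fin n → ℕ),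
    dualK η hη n Λ (Finsupp.single μ 1)
      = qpow η (-∑ i, (Λ i - 2 * μ i)) • Finsupp.single μ (1 : ℂ)
  | 0, Λ, μ => by simp [dualK, qpow_zero]
  | n + 1, Λ, μ => by
    have e : Finsupp.single μ (1 : ℂ) = consTensor n (bv (μ 0) ⊗ₜ Finsupp.single (Fin.tail μ) 1) := by
      rw [consTensor_tmul_single, Fin.cons_self_tail]
    have e2 : qpow η (-∑ i, (Λ i - 2 * μ i)) = qpow η ((Λ 0 - 2 * (μ 0 : ℂ)) * -1)
        * qpow η (-∑ i, (Fin.tail Λ i - 2 * (Fin.tail μ i : ℂ))) := by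
      rw [← qpow_add, Fin.sum_univ_succ]
      congr 1
      simp only [Fin.tail]
      ring
    rw [e2, mul_smul, e, ← map_smul, ← map_smul]
    simp only [dualK, LinearMap.comp_apply, LinearEquiv.coe_coe, LinearEquiv.symm_apply_apply,
      TensorProduct.map_tmul, dualK_single η hη (Fin.tail Λ), dualVerma, onBasis_bv]
    rw [TensorProduct.tmul_smul, ← TensorProduct.smul_tmul', smul_comm]

theorem dualK_of_mem (η : ℂ) (hη : 0 < η.im) {n p : ℕ} (Λ : Fin n → ℂ) {w : DualTensor n}
    (hw : w ∈ dualLevel n p) : dualK η hη n Λ w = qpow η (-(∑ i, Λ i - 2 * p)) • w := by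
  induction hw using Submodule.span_induction with
  | zero => simp
  | add x y _ _ hx hy => rw [map_add, hx, hy, smul_add]
  | smul c x _ hx => rw [map_smul, hx, smul_comm]
  | mem x hx =>
    obtain ⟨μ, hμ, rfl⟩ := hx
    rw [dualK_single, ← hμ, Finset.sum_sub_distrib, ← Finset.mul_sum]
    push_cast
    rfl

theorem consTensor_mem {n p k : ℕ} {w : DualTensor n} (hw : w ∈ dualLevel n p) :
    consTensor n (bv k ⊗ₜ w) ∈ dualLevel (n + 1) (k + p) := by
  induction hw using Submodule.span_induction with
  | zero => simp
  | add x y _ _ hx hy => rw [TensorProduct.tmul_add, map_add]; exact add_mem hx hy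
  | smul c x _ hx => rw [TensorProduct.tmul_smul, map_smul]; exact Submodule.smul_mem _ _ hx
  | mem x hx =>
    obtain ⟨μ, rfl, rfl⟩ := hx
    rw [consTensor_tmul_single]
    exact Submodule.subset_span ⟨Fin.cons k μ, by simp [Fin.sum_univ_succ], rfl⟩

theorem dualF_mem (η : ℂ) (hη : 0 < η.im) : ∀ {n p : ℕ} (Λ : Fin n → ℂ) {w : DualTensor n},
    w ∈ dualLevel n p → dualF η hη n Λ w ∈ dualLevel n (p + 1)
  | 0, p, Λ, w, _ => by simp [dualF]
  | n + 1, p, Λ, w, hw => by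
    induction hw using Submodule.span_induction with
    | zero => simp
    | add x y _ _ hx hy => rw [map_add]; exact add_mem hx hy
    | smul c x _ hx => rw [map_smul]; exact Submodule.smul_mem _ _ hx
    | mem x hx =>
      obtain ⟨μ, rfl, rfl⟩ := hx
      have e : Finsupp.single μ (1 : ℂ)
          = consTensor n (bv (μ 0) ⊗ₜ Finsupp.single (Fin.tail μ) 1) := by
        rw [consTensor_tmul_single, Fin.cons_self_tail]
      have ht := single_mem_dualLevel (Fin.tail μ)
      rw [e]
      simp only [dualF, LinearMap.comp_apply, LinearEquiv.coe_coe, LinearEquiv.symm_apply_apply,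
        LinearMap.add_apply, TensorProduct.map_tmul, dualK_single, dualVerma, onBasis_bv, map_add,
        Module.End.one_apply, TensorProduct.tmul_smul, ← TensorProduct.smul_tmul', map_smul]
      rw [Fin.sum_univ_succ]
      refine add_mem (Submodule.smul_mem _ _ (Submodule.smul_mem _ _ ?_)) ?_
      · rw [add_right_comm]; exact consTensor_mem ht
      · rw [add_assoc]; exact consTensor_mem (dualF_mem η hη _ ht)

/-- The span of the `v^(i) ⊗ u_μ` with `i + ∑ μ = p`. -/
def totalLevel (n p : ℕ) : Submodule ℂ (VermaSpace ⊗[ℂ] DualTensor n) :=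
  Submodule.span ℂ {x | ∃ (i : ℕ) (μ : Fin n → ℕ), i + ∑ k, μ k = p ∧
    x = bv i ⊗ₜ Finsupp.single μ 1}

/-- The span of the `v^(i) ⊗ u_j` with `i + j = p`. -/
def pairLevel (p : ℕ) : Submodule ℂ (VermaSpace ⊗[ℂ] VermaSpace) :=
  Submodule.span ℂ {x | ∃ i j : ℕ, i + j = p ∧ x = bv i ⊗ₜ bv j}

theorem pairF_mem (η : ℂ) (hη : 0 < η.im) (L : ℂ) {p : ℕ} {x : VermaSpace ⊗[ℂ] VermaSpace}
    (hx : x ∈ pairLevel p) : pairF η hη L x ∈ pairLevel (p + 1) := by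
  induction hx using Submodule.span_induction with
  | zero => simp
  | add x y _ _ hx hy => rw [map_add]; exact add_mem hx hy
  | smul c x _ hx => rw [map_smul]; exact Submodule.smul_mem _ _ hx
  | mem x hx =>
    obtain ⟨i, j, rfl, rfl⟩ := hx
    simp only [pairF, LinearMap.add_apply, TensorProduct.map_tmul, lowering_bv, dualVerma,
      onBasis_bv, Module.End.one_apply, TensorProduct.tmul_smul, ← TensorProduct.smul_tmul']
    refine add_mem (Submodule.smul_mem _ _ (Submodule.smul_mem _ _ ?_)) (Submodule.smul_mem _ _ ?_)
    · exact Submodule.subset_span ⟨i + 1, j, by ring, rfl⟩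
    · exact Submodule.subset_span ⟨i, j + 1, by ring, rfl⟩

theorem Phi_bv_mem (η : ℂ) (hη : 0 < η.im) (L : ℂ) (m : ℕ) (lam : ℂ) (i : ℕ) :
    Phi η hη L m lam (bv i) ∈ pairLevel (i + m) := by
  simp only [Phi, fromHighest, onBasis_bv]
  refine Submodule.smul_mem _ _ ?_
  induction i with
  | zero =>
    rw [pow_zero, Module.End.one_apply, singularVector]
    refine Submodule.sum_mem _ fun i hi => Submodule.smul_mem _ _ ?_
    rw [dualVerma_E_pow, TensorProduct.tmul_smul]
    refine Submodule.smul_mem _ _ (Submodule.subset_span ⟨i, m - i, ?_, rfl⟩)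
    have := Finset.mem_range.mp hi
    omega
  | succ i ih =>
    rw [pow_succ', Module.End.mul_apply, add_right_comm]
    exact pairF_mem η hη L ih

theorem PhiMulti_bv_mem (η : ℂ) (hη : 0 < η.im) : ∀ {n : ℕ} (Λ : Fin n → ℂ) (μ : Fin n → ℕ)
    (lam : ℂ) (i : ℕ), PhiMulti η hη n Λ μ lam (bv i) ∈ totalLevel n (i + ∑ k, μ k)
  | 0, Λ, μ, lam, i => by
    exact Submodule.subset_span ⟨i, default, by simp, rfl⟩
  | n + 1, Λ, μ, lam, i => by
    set Ph := Phi η hη (Λ 0) (μ 0) (lam - ∑ i : Fin n, (Λ i.succ - 2 * μ i.succ)) with hPh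
    set H := LinearMap.lTensor VermaSpace (consTensor n).toLinearMap ∘ₗ
        (TensorProduct.assoc ℂ VermaSpace VermaSpace (DualTensor n)).toLinearMap with hH
    have e : PhiMulti η hη (n + 1) Λ μ lam (bv i)
        = H (LinearMap.rTensor (DualTensor n) Ph
          (PhiMulti η hη n (Fin.tail Λ) (Fin.tail μ) lam (bv i))) := rfl
    have ih := PhiMulti_bv_mem η hη (Fin.tail Λ) (Fin.tail μ) lam i
    rw [e, Fin.sum_univ_succ]
    change _ ∈ totalLevel n (i + ∑ k : Fin n, μ k.succ) at ih
    generalize PhiMulti η hη n (Fin.tail Λ) (Fin.tail μ) lam (bv i) = x at ih ⊢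
    induction ih using Submodule.span_induction with
    | zero => simp
    | add x y _ _ hx hy => rw [map_add, map_add]; exact add_mem hx hy
    | smul c x _ hx => rw [map_smul, map_smul]; exact Submodule.smul_mem _ _ hx
    | mem x hx =>
      obtain ⟨a, ν, h, rfl⟩ := hx
      rw [LinearMap.rTensor_tmul]
      have hz := Phi_bv_mem η hη (Λ 0) (μ 0) (lam - ∑ i : Fin n, (Λ i.succ - 2 * μ i.succ)) a
      rw [← hPh] at hz
      generalize Ph (bv a) = z at hz ⊢
      induction hz using Submodule.span_induction with
      | zero => simp
      | add x y _ _ hx hy => rw [TensorProduct.add_tmul, map_add]; exact add_mem hx hy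
      | smul c x _ hx => rw [← TensorProduct.smul_tmul', map_smul]; exact Submodule.smul_mem _ _ hx
      | mem z hz =>
        obtain ⟨b, c, hbc, rfl⟩ := hz
        refine Submodule.subset_span ⟨b, Fin.cons c ν, ?_, ?_⟩
        · simp only [Fin.sum_univ_succ, Fin.cons_zero, Fin.cons_succ]
          omega
        · simp only [hH, LinearMap.comp_apply, LinearEquiv.coe_coe, TensorProduct.assoc_tmul,
            LinearMap.lTensor_tmul, consTensor_tmul_single]

/-! ### The diagonal coefficients -/

/-- The coefficient of `v^(k)`. -/
def vermaCoeff (n k : ℕ) : VermaSpace ⊗[ℂ] DualTensor n →ₗ[ℂ] DualTensor n :=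
  (TensorProduct.lid ℂ (DualTensor n)).toLinearMap ∘ₗ
    LinearMap.rTensor (DualTensor n) (Finsupp.lapply k)

theorem vermaCoeff_tmul {n k i : ℕ} (w : DualTensor n) :
    vermaCoeff n k (bv i ⊗ₜ w) = if i = k then w else 0 := by
  simp [vermaCoeff, Finsupp.single_apply]

/-- The diagonal coefficient at `v^(k)` of the intertwining operator with a given image of the
highest weight vector. -/
def traceCoeff (η : ℂ) (hη : 0 < η.im) {n : ℕ} (Λ : Fin n → ℂ) (k : ℕ) :
    VermaSpace ⊗[ℂ] DualTensor n →ₗ[ℂ] DualTensor n :=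
  (qfact η k)⁻¹ • vermaCoeff n k ∘ₗ totalF η hη Λ ^ k

/-- As `v^(k) = F^k v^(0) / [k]!`, all diagonal coefficients are linear functions of the image of
the highest weight vector alone. -/
theorem diagCoeff_PhiMulti (η : ℂ) (hη : 0 < η.im) {n : ℕ} (Λ : Fin n → ℂ) (μ : Fin n → ℕ)
    (lam : ℂ) (k : ℕ) : vermaCoeff n k (PhiMulti η hη n Λ μ lam (bv k))
      = traceCoeff η hη Λ k (PhiMulti η hη n Λ μ lam (bv 0)) := by
  have h : ∀ k, PhiMulti η hη n Λ μ lam (bv k)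
      = (qfact η k)⁻¹ • (totalF η hη Λ ^ k) (PhiMulti η hη n Λ μ lam (bv 0)) := by
    intro k
    induction k with
    | zero => simp [qfact]
    | succ k ih =>
      have h1 := qnum_succ_ne_zero hη k
      have e : bv (k + 1) = (qnum η ((k : ℂ) + 1))⁻¹ • lowering η (bv k) := by
        rw [lowering_bv, smul_smul, inv_mul_cancel₀ h1, one_smul]
      rw [e, map_smul, PhiMulti_lowering, ih, map_smul, smul_smul, pow_succ', Module.End.mul_apply,
        qfact_succ, mul_inv, mul_comm]
  rw [h k, map_smul]
  rfl

theorem vermaCoeff_lowering_succ (η : ℂ) {n k : ℕ} (A : Module.End ℂ (DualTensor n))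
    (x : VermaSpace ⊗[ℂ] DualTensor n) :
    vermaCoeff n (k + 1) (TensorProduct.map (lowering η) A x)
      = qnum η ((k : ℂ) + 1) • A (vermaCoeff n k x) := by
  have : vermaCoeff n (k + 1) ∘ₗ TensorProduct.map (lowering η) A
      = qnum η ((k : ℂ) + 1) • A ∘ₗ vermaCoeff n k := by
    refine ext_bv_single fun i μ => ?_
    simp only [LinearMap.comp_apply, LinearMap.smul_apply, TensorProduct.map_tmul, lowering_bv,
      ← TensorProduct.smul_tmul', map_smul, vermaCoeff_tmul, add_left_inj]
    split_ifs with h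
    · rw [h]
    · simp
  exact LinearMap.congr_fun this x

theorem vermaCoeff_lowering_zero (η : ℂ) {n : ℕ} (A : Module.End ℂ (DualTensor n))
    (x : VermaSpace ⊗[ℂ] DualTensor n) :
    vermaCoeff n 0 (TensorProduct.map (lowering η) A x) = 0 := by
  have : vermaCoeff n 0 ∘ₗ TensorProduct.map (lowering η) A = 0 := by
    refine ext_bv_single fun i μ => ?_
    simp only [LinearMap.comp_apply, TensorProduct.map_tmul, lowering_bv,
      ← TensorProduct.smul_tmul', map_smul, vermaCoeff_tmul]
    simp
  exact LinearMap.congr_fun this x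

theorem vermaCoeff_map_one {n k : ℕ} (A : Module.End ℂ (DualTensor n))
    (x : VermaSpace ⊗[ℂ] DualTensor n) :
    vermaCoeff n k (TensorProduct.map 1 A x) = A (vermaCoeff n k x) := by
  have : vermaCoeff n k ∘ₗ TensorProduct.map 1 A = A ∘ₗ vermaCoeff n k := by
    refine ext_bv_single fun i μ => ?_
    simp only [LinearMap.comp_apply, TensorProduct.map_tmul, Module.End.one_apply, vermaCoeff_tmul]
    split_ifs <;> simp
  exact LinearMap.congr_fun this x

theorem commute_lowering_totalF (η : ℂ) (hη : 0 < η.im) {n : ℕ} (Λ : Fin n → ℂ) :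
    Commute (TensorProduct.map (lowering η) (1 : Module.End ℂ (DualTensor n))
      : Module.End ℂ (VermaSpace ⊗[ℂ] DualTensor n)) (totalF η hη Λ) := by
  simp only [Commute, SemiconjBy, totalF, mul_add, add_mul, ← TensorProduct.map_mul, one_mul,
    mul_one]

/-- A form of the cyclicity of the trace: `F ⊗ 1` commutes with the total `F`, and reading off the
coefficient of `v^(k+1)` after `F ⊗ 1` gives `[k + 1]` times the coefficient of `v^(k)`. With
`traceCoeff_zero_lowering` the series `∑ y^k traceCoeff k` satisfies the recursion required in
`eq_transfer_of_functional`. -/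
theorem traceCoeff_succ_lowering (η : ℂ) (hη : 0 < η.im) {n : ℕ} (Λ : Fin n → ℂ) (k : ℕ)
    (x : VermaSpace ⊗[ℂ] DualTensor n) :
    traceCoeff η hη Λ (k + 1) (TensorProduct.map (lowering η) 1 x)
      = traceCoeff η hη Λ k (totalF η hη Λ x) := by
  have h1 := qnum_succ_ne_zero hη k
  have h2 := qfact_ne_zero hη k
  simp only [traceCoeff, LinearMap.smul_apply, LinearMap.comp_apply]
  rw [← Module.End.mul_apply (totalF η hη Λ ^ (k + 1)),
    ← ((commute_lowering_totalF η hη Λ).pow_right (k + 1)).eq, Module.End.mul_apply,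
    vermaCoeff_lowering_succ, smul_smul, Module.End.one_apply, pow_succ, Module.End.mul_apply,
    qfact_succ]
  congr 1
  field_simp

theorem traceCoeff_zero_lowering (η : ℂ) (hη : 0 < η.im) {n : ℕ} (Λ : Fin n → ℂ)
    (x : VermaSpace ⊗[ℂ] DualTensor n) :
    traceCoeff η hη Λ 0 (TensorProduct.map (lowering η) 1 x) = 0 := by
  simp [traceCoeff, vermaCoeff_lowering_zero]

/-- The component at `v^(k)` of `F^k (v^(0) ⊗ w)` is reached only by letting every `F` act on the
Verma factor, and each time `q^(-h)` acts on `w` trivially because its weight `∑ Λ - 2m` is zero. -/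
theorem traceCoeff_bv_zero (η : ℂ) (hη : 0 < η.im) {n m : ℕ} {Λ : Fin n → ℂ}
    (hΛ : ∑ i, Λ i = 2 * m) (k : ℕ) {w : DualTensor n} (hw : w ∈ dualLevel n m) :
    traceCoeff η hη Λ k (bv 0 ⊗ₜ w) = w := by
  have hK : dualK η hη n Λ w = w := by
    rw [dualK_of_mem η hη Λ hw, hΛ]; simp [qpow_zero]
  -- The vanishing above `k` is carried along to discard the contribution of `F` acting on `w`.
  have h : ∀ k, (∀ j, k < j → vermaCoeff n j ((totalF η hη Λ ^ k) (bv 0 ⊗ₜ w)) = 0) ∧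
      vermaCoeff n k ((totalF η hη Λ ^ k) (bv 0 ⊗ₜ w)) = qfact η k • w := by
    intro k
    induction k with
    | zero =>
      refine ⟨fun j hj => ?_, ?_⟩
      · rw [pow_zero, Module.End.one_apply, vermaCoeff_tmul, if_neg hj.ne]
      · rw [pow_zero, Module.End.one_apply, vermaCoeff_tmul, if_pos rfl]; simp [qfact]
    | succ k ih =>
      have step : ∀ j, vermaCoeff n (j + 1) ((totalF η hη Λ ^ (k + 1)) (bv 0 ⊗ₜ w))
          = qnum η ((j : ℂ) + 1) • dualK η hη n Λ
              (vermaCoeff n j ((totalF η hη Λ ^ k) (bv 0 ⊗ₜ w)))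
            + dualF η hη n Λ (vermaCoeff n (j + 1) ((totalF η hη Λ ^ k) (bv 0 ⊗ₜ w))) := by
        intro j
        rw [pow_succ', Module.End.mul_apply]
        generalize (totalF η hη Λ ^ k) (bv 0 ⊗ₜ w) = x
        rw [totalF, LinearMap.add_apply, map_add, vermaCoeff_lowering_succ, vermaCoeff_map_one]
      refine ⟨fun j hj => ?_, ?_⟩
      · obtain ⟨j, rfl⟩ : ∃ j', j = j' + 1 := ⟨j - 1, by omega⟩
        rw [step, ih.1 j (by omega), ih.1 (j + 1) (by omega)]
        simp
      · rw [step, ih.1 (k + 1) (by omega), ih.2, map_smul, hK, smul_smul, qfact_succ, mul_comm]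
        simp
  simp only [traceCoeff, LinearMap.smul_apply, LinearMap.comp_apply]
  rw [(h k).2, smul_smul, inv_mul_cancel₀ (qfact_ne_zero hη k), one_smul]

/-- The scalar part of the diagonal coefficients. -/
def traceScalar (η : ℂ) : ℕ → ℕ → ℂ
  | 0, _ => 1
  | _ + 1, 0 => 0
  | i + 1, k + 1 => qpow η (-(2 * ((i : ℂ) + 1))) * traceScalar η (i + 1) k
      + (qnum η ((i : ℂ) + 1))⁻¹ * traceScalar η i k

theorem lowering_tmul (η : ℂ) (hη : 0 < η.im) {n : ℕ} (i : ℕ) (w : DualTensor n) :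
    bv (i + 1) ⊗ₜ w = (qnum η ((i : ℂ) + 1))⁻¹ • TensorProduct.map (lowering η) 1 (bv i ⊗ₜ[ℂ] w) := by
  have h1 := qnum_succ_ne_zero hη i
  rw [TensorProduct.map_tmul, lowering_bv, ← TensorProduct.smul_tmul', smul_smul,
    inv_mul_cancel₀ h1, one_smul, Module.End.one_apply]

theorem totalF_bv_tmul (η : ℂ) (hη : 0 < η.im) {n m p : ℕ} {Λ : Fin n → ℂ}
    (hΛ : ∑ i, Λ i = 2 * m) (i : ℕ) (hp : i + 1 + p = m) {w : DualTensor n}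
    (hw : w ∈ dualLevel n p) : totalF η hη Λ (bv i ⊗ₜ w)
      = (qnum η ((i : ℂ) + 1) * qpow η (-(2 * ((i : ℂ) + 1)))) • (bv (i + 1) ⊗ₜ[ℂ] w)
        + bv i ⊗ₜ[ℂ] dualF η hη n Λ w := by
  -- From `∑ Λ = 2m` and `m = i + 1 + p` the weight of `w` is `2 (i + 1)`; this is the source of the
  -- denominators `1 - q^(-2j) y`.
  have e : qpow η (-(∑ i, Λ i - 2 * p)) = qpow η (-(2 * ((i : ℂ) + 1))) := by
    rw [hΛ, ← hp]; congr 1; push_cast; ring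
  rw [totalF, LinearMap.add_apply, TensorProduct.map_tmul, TensorProduct.map_tmul, lowering_bv,
    dualK_of_mem η hη Λ hw, e, ← TensorProduct.smul_tmul', TensorProduct.tmul_smul, smul_smul]
  rfl

/-- Writing `v^(i+1)` as a multiple of `F v^(i)` and applying cyclicity returns a multiple of
`v^(i+1) ⊗ w` at the coefficient `k`, plus `v^(i) ⊗ F w`. The induction runs over both `i` and `k`,
and the scalars obey the recursion defining `traceScalar`. -/
theorem traceCoeff_bv (η : ℂ) (hη : 0 < η.im) {n m : ℕ} {Λ : Fin n → ℂ}
    (hΛ : ∑ i, Λ i = 2 * m) : ∀ (i p k : ℕ) (_ : i + p = m) {w : DualTensor n},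
    w ∈ dualLevel n p → traceCoeff η hη Λ k (bv i ⊗ₜ w)
      = traceScalar η i k • (dualF η hη n Λ ^ i) w
  | 0, p, k, hp, w, hw => by
    rw [zero_add] at hp
    subst hp
    rw [traceCoeff_bv_zero η hη hΛ k hw]
    simp [traceScalar]
  | i + 1, p, 0, hp, w, hw => by
    rw [lowering_tmul η hη, map_smul, traceCoeff_zero_lowering]
    simp [traceScalar]
  | i + 1, p, k + 1, hp, w, hw => by
    have h1 := qnum_succ_ne_zero hη i
    have ih1 := traceCoeff_bv η hη hΛ (i + 1) p k hp hw
    have ih2 := traceCoeff_bv η hη hΛ i (p + 1) k (by omega) (dualF_mem η hη Λ hw)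
    rw [lowering_tmul η hη, map_smul, traceCoeff_succ_lowering, totalF_bv_tmul η hη hΛ i hp hw,
      map_add, map_smul, ih1, ih2, traceScalar, pow_succ, Module.End.mul_apply, smul_add, smul_smul,
      smul_smul, smul_smul, ← add_smul]
    congr 1
    field_simp

/-! ### Summation of the trace series -/

/-- `y^i / ([i]! ∏_{j = 1}^i (1 - q^(-2 j) y))`. -/
def traceRatio (η : ℂ) (i : ℕ) (y : ℂ) : ℂ :=
  y ^ i / (qfact η i * ∏ j ∈ Finset.range i, (1 - qpow η (-(2 * ((j : ℂ) + 1))) * y))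

theorem traceRatio_succ (η : ℂ) (i : ℕ) (y : ℂ) : traceRatio η (i + 1) y
    = y / (qnum η ((i : ℂ) + 1) * (1 - qpow η (-(2 * ((i : ℂ) + 1))) * y)) * traceRatio η i y := by
  rw [traceRatio, traceRatio, Finset.prod_range_succ, qfact_succ, div_mul_div_comm, pow_succ]
  congr 1 <;> ring

theorem _root_.HasSum.of_eq {f g : ℕ → ℂ} {a b : ℂ} (h : HasSum f a) (hf : ∀ k, g k = f k)
    (hb : b = a) : HasSum g b := by
  rw [hb]
  exact h.congr_fun hf

/-- A bound for the exponential growth of the diagonal coefficients. -/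
def growthBound (η : ℂ) (m : ℕ) : ℝ := 2 + ∑ j ∈ Finset.range m, ‖qpow η (-(2 * ((j : ℂ) + 1)))‖

theorem norm_lt_growthBound (η : ℂ) {m j : ℕ} (hj : j < m) :
    ‖qpow η (-(2 * ((j : ℂ) + 1)))‖ + 1 ≤ growthBound η m := by
  have := Finset.single_le_sum (f := fun j : ℕ => ‖qpow η (-(2 * ((j : ℂ) + 1)))‖)
    (fun _ _ => norm_nonneg _) (Finset.mem_range.mpr hj)
  simp only [growthBound]
  linarith

theorem two_le_growthBound (η : ℂ) (m : ℕ) : 2 ≤ growthBound η m := by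
  have : 0 ≤ ∑ j ∈ Finset.range m, ‖qpow η (-(2 * ((j : ℂ) + 1)))‖ :=
    Finset.sum_nonneg fun _ _ => norm_nonneg _
  simp only [growthBound]
  linarith

/-- The homogeneous part of the recursion multiplies by `q^(-2(i+1))`, which is large as `|q| < 1`.
The extra unit by which `growthBound` exceeds these norms absorbs the inhomogeneous part. -/
theorem traceScalar_bound (η : ℂ) (m : ℕ) : ∀ i ≤ m, ∃ C, 0 ≤ C ∧
    ∀ k, ‖traceScalar η i k‖ ≤ C * growthBound η m ^ k := by
  intro i
  have h2 := two_le_growthBound η m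
  induction i with
  | zero =>
    intro _
    refine ⟨1, zero_le_one, fun k => ?_⟩
    rw [traceScalar, norm_one, one_mul]
    exact one_le_pow₀ (by linarith)
  | succ i ih =>
    intro hi
    obtain ⟨C, hC, h⟩ := ih (by omega)
    have hg := norm_lt_growthBound η (show i < m by omega)
    set ρ := growthBound η m
    set c := ‖qpow η (-(2 * ((i : ℂ) + 1)))‖
    set d := ‖(qnum η ((i : ℂ) + 1))⁻¹‖
    have hd : 0 ≤ d := norm_nonneg _
    refine ⟨d * C, mul_nonneg hd hC, fun k => ?_⟩
    induction k with
    | zero => rw [traceScalar, norm_zero]; positivity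
    | succ k ihk =>
      rw [traceScalar]
      refine (norm_add_le _ _).trans ?_
      rw [norm_mul, norm_mul]
      have h3 : c * ‖traceScalar η (i + 1) k‖ ≤ c * (d * C * ρ ^ k) :=
        mul_le_mul_of_nonneg_left ihk (norm_nonneg _)
      have h4 : d * ‖traceScalar η i k‖ ≤ d * (C * ρ ^ k) := mul_le_mul_of_nonneg_left (h k) hd
      have h5 : 0 ≤ d * C * ρ ^ k := by positivity
      calc _ ≤ c * (d * C * ρ ^ k) + d * (C * ρ ^ k) := add_le_add h3 h4
        _ = (c + 1) * (d * C * ρ ^ k) := by ring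
        _ ≤ ρ * (d * C * ρ ^ k) := mul_le_mul_of_nonneg_right hg h5
        _ = d * C * ρ ^ (k + 1) := by ring

/-- The recursion gives `T (1 - q^(-2(i+1)) y) = y / [i + 1]` times the preceding sum, the term `k =
0` of the new series being zero. Starting from the geometric series this yields the product form. -/
theorem hasSum_traceScalar (η : ℂ) {m : ℕ} {y : ℂ} (hy : growthBound η m * ‖y‖ < 1) :
    ∀ i ≤ m, HasSum (fun k => traceScalar η i k * y ^ k) ((1 - y)⁻¹ * traceRatio η i y) := by
  have h2 := two_le_growthBound η m
  have hy1 : ‖y‖ < 1 := by nlinarith [norm_nonneg y]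
  intro i
  induction i with
  | zero =>
    intro _
    simpa [traceScalar, traceRatio, qfact] using hasSum_geometric_of_norm_lt_one hy1
  | succ i ih =>
    intro hi
    have hs := ih (by omega)
    obtain ⟨C, hC, hb⟩ := traceScalar_bound η m (i + 1) hi
    have hsum : Summable fun k => traceScalar η (i + 1) k * y ^ k := by
      refine Summable.of_norm_bounded (g := fun k => C * (growthBound η m * ‖y‖) ^ k)
        ((summable_geometric_of_lt_one (by positivity) hy).mul_left C) fun k => ?_
      rw [norm_mul, norm_pow, mul_pow, ← mul_assoc]
      exact mul_le_mul_of_nonneg_right (hb k) (by positivity)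
    obtain ⟨T, hT⟩ := hsum
    set c := qpow η (-(2 * ((i : ℂ) + 1)))
    set d := (qnum η ((i : ℂ) + 1))⁻¹ with hd
    have h3 : HasSum (fun k => traceScalar η (i + 1) (k + 1) * y ^ (k + 1))
        (c * y * T + d * y * ((1 - y)⁻¹ * traceRatio η i y)) := by
      refine ((hT.mul_left (c * y)).add (hs.mul_left (d * y))).congr_fun ?_
      intro k
      rw [traceScalar]
      ring
    have h4 : HasSum (fun k => traceScalar η (i + 1) (k + 1) * y ^ (k + 1)) T := by
      have := (hasSum_nat_add_iff' 1).mpr hT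
      simpa [traceScalar] using this
    have h5 := h4.unique h3
    have hc : 1 - c * y ≠ 0 := by
      intro h
      have h6 : c * y = 1 := by linear_combination -h
      have h7 : ‖c‖ * ‖y‖ = 1 := by rw [← norm_mul, h6, norm_one]
      have := norm_lt_growthBound η (show i < m by omega)
      nlinarith [norm_nonneg y]
    have h6 : T = (1 - y)⁻¹ * traceRatio η (i + 1) y := by
      have h7 : T * (1 - c * y) = d * y * ((1 - y)⁻¹ * traceRatio η i y) := by linear_combination h5
      rw [traceRatio_succ, eq_div_of_mul_eq hc h7, hd, div_eq_mul_inv, div_eq_mul_inv, mul_inv]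
      ring
    rw [← h6]
    exact hT

/-- `v^(i) ⊗ w ↦ traceRatio i y • F ^ i w`. -/
def transfer (η : ℂ) (hη : 0 < η.im) {n : ℕ} (Λ : Fin n → ℂ) (y : ℂ) :
    VermaSpace ⊗[ℂ] DualTensor n →ₗ[ℂ] DualTensor n :=
  TensorProduct.lift (onBasis fun i => traceRatio η i y • dualF η hη n Λ ^ i)

theorem transfer_bv (η : ℂ) (hη : 0 < η.im) {n : ℕ} (Λ : Fin n → ℂ) (y : ℂ) (i : ℕ)
    (w : DualTensor n) :
    transfer η hη Λ y (bv i ⊗ₜ w) = traceRatio η i y • (dualF η hη n Λ ^ i) w := by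
  rw [transfer, TensorProduct.lift.tmul, onBasis_bv]
  rfl

theorem hasSum_traceCoeff (η : ℂ) (hη : 0 < η.im) {n m : ℕ} {Λ : Fin n → ℂ}
    (hΛ : ∑ i, Λ i = 2 * m) {y : ℂ} (hy : growthBound η m * ‖y‖ < 1)
    {x : VermaSpace ⊗[ℂ] DualTensor n} (hx : x ∈ totalLevel n m) (ν : Fin n → ℕ) :
    HasSum (fun k => y ^ k * traceCoeff η hη Λ k x ν) ((1 - y)⁻¹ * transfer η hη Λ y x ν) := by
  induction hx using Submodule.span_induction with
  | zero => simp
  | add a b _ _ ha hb => simpa [mul_add] using ha.add hb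
  | smul c a _ ha => simpa [mul_left_comm] using ha.mul_left c
  | mem x hx =>
    obtain ⟨i, μ, hi, rfl⟩ := hx
    have h := (hasSum_traceScalar η hy i (by omega)).mul_right
      ((dualF η hη n Λ ^ i) (Finsupp.single μ 1) ν)
    rw [transfer_bv]
    simp only [traceCoeff_bv η hη hΛ i _ _ hi (single_mem_dualLevel μ), Finsupp.smul_apply,
      smul_eq_mul]
    exact h.of_eq (fun k => by ring) (by ring)

/-- The uniqueness statement shared by the trace and the pairing. On `v^(i) ⊗ w` the relation `hτ`
reads `[i + 1] (1 - q^(-2(i+1)) y) τ(v^(i+1) ⊗ w) = y τ(v^(i) ⊗ F w)`, so `τ` is determined by its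
values at `v^(0) ⊗ w`, with the same scalars as in the trace. -/
theorem eq_transfer_of_functional (η : ℂ) (hη : 0 < η.im) {n m : ℕ} {Λ : Fin n → ℂ}
    (hΛ : ∑ i, Λ i = 2 * m) {y : ℂ}
    (hy : ∀ j < m, 1 - qpow η (-(2 * ((j : ℂ) + 1))) * y ≠ 0)
    (τ : VermaSpace ⊗[ℂ] DualTensor n →ₗ[ℂ] ℂ)
    (hτ : ∀ i w, y * τ (totalF η hη Λ (bv i ⊗ₜ w)) = τ (lowering η (bv i) ⊗ₜ w))
    {x : VermaSpace ⊗[ℂ] DualTensor n} (hx : x ∈ totalLevel n m) :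
    τ x = τ (bv 0 ⊗ₜ transfer η hη Λ y x) := by
  have key : ∀ (i p : ℕ) (_ : i + p = m) (w : DualTensor n), w ∈ dualLevel n p →
      τ (bv i ⊗ₜ w) = traceRatio η i y * τ (bv 0 ⊗ₜ (dualF η hη n Λ ^ i) w) := by
    intro i
    induction i with
    | zero => intro p _ w _; simp [traceRatio, qfact]
    | succ i ih =>
      intro p hp w hw
      have h1 := qnum_succ_ne_zero hη i
      have h2 := hy i (by omega)
      have h3 := hτ i w
      have h4 := ih (p + 1) (by omega) _ (dualF_mem η hη Λ hw)
      rw [totalF_bv_tmul η hη hΛ i hp hw, lowering_bv, ← TensorProduct.smul_tmul', map_add,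
        map_smul, map_smul, h4, smul_eq_mul, smul_eq_mul] at h3
      rw [traceRatio_succ, pow_succ, Module.End.mul_apply]
      rw [div_mul_eq_mul_div, div_mul_eq_mul_div, eq_div_iff (mul_ne_zero h1 h2)]
      linear_combination -h3
  induction hx using Submodule.span_induction with
  | zero => simp
  | add a b _ _ ha hb => simp only [map_add, TensorProduct.tmul_add, ha, hb]
  | smul c a _ ha => simp only [map_smul, TensorProduct.tmul_smul, ha]
  | mem x hx =>
    obtain ⟨i, μ, hi, rfl⟩ := hx
    rw [key i _ hi _ (single_mem_dualLevel μ), transfer_bv, TensorProduct.tmul_smul, map_smul,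
      smul_eq_mul]

theorem transfer_mem (η : ℂ) (hη : 0 < η.im) {n m : ℕ} (Λ : Fin n → ℂ) (y : ℂ)
    {x : VermaSpace ⊗[ℂ] DualTensor n} (hx : x ∈ totalLevel n m) :
    transfer η hη Λ y x ∈ dualLevel n m := by
  induction hx using Submodule.span_induction with
  | zero => simp
  | add a b _ _ ha hb => rw [map_add]; exact add_mem ha hb
  | smul c a _ ha => rw [map_smul]; exact Submodule.smul_mem _ _ ha
  | mem x hx =>
    obtain ⟨i, μ, rfl, rfl⟩ := hx
    rw [transfer_bv]
    refine Submodule.smul_mem _ _ ?_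
    have h : ∀ i p (w : DualTensor n), w ∈ dualLevel n p →
        (dualF η hη n Λ ^ i) w ∈ dualLevel n (i + p) := by
      intro i
      induction i with
      | zero => intro p w hw; simpa using hw
      | succ i ih =>
        intro p w hw
        rw [pow_succ, Module.End.mul_apply, add_assoc, add_comm 1 p]
        exact ih _ _ (dualF_mem η hη Λ hw)
    exact h i _ _ (single_mem_dualLevel μ)

theorem eq_sum_of_mem_dualLevel {n m : ℕ} {w : DualTensor n} (hw : w ∈ dualLevel n m) :
    w = ∑ ν : Idx n m, w ν.1 • Finsupp.single ν.1 1 := by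
  induction hw using Submodule.span_induction with
  | zero => simp
  | add a b _ _ ha hb =>
    nth_rewrite 1 [ha, hb]
    rw [← Finset.sum_add_distrib]
    exact Finset.sum_congr rfl fun ν _ => by rw [Finsupp.add_apply, add_smul]
  | smul c a _ ha =>
    nth_rewrite 1 [ha]
    rw [Finset.smul_sum]
    exact Finset.sum_congr rfl fun ν _ => by rw [Finsupp.smul_apply, smul_smul, smul_eq_mul]
  | mem x hx =>
    obtain ⟨μ, hμ, rfl⟩ := hx
    rw [Finset.sum_eq_single ⟨μ, Finset.Nat.mem_antidiagonalTuple.mpr hμ⟩]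
    · simp
    · intro ν _ hν
      rw [Finsupp.single_apply, if_neg, zero_smul]
      rintro rfl
      exact hν rfl
    · simp

/-- The entries of the universal trace matrix in closed form. -/
def explicitTrace (η : ℂ) (hη : 0 < η.im) {n : ℕ} (m : ℕ) (Λ : Fin n → ℂ) (lam : ℂ)
    (μ μ' : Idx n m) (x : ℂ) : ℂ :=
  qpow η (-((m : ℂ) * (m + 1) / 2)) * (qpow η 1 - qpow η (-1)) ^ m * qpow η (lam * x) *
    transfer η hη Λ (qpow η (-(2 * x))) (PhiMulti η hη n Λ μ.1 lam (bv 0)) μ'.1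

theorem PhiMulti_bv_zero_mem (η : ℂ) (hη : 0 < η.im) {n m : ℕ} (Λ : Fin n → ℂ) (lam : ℂ)
    (μ : Idx n m) : PhiMulti η hη n Λ μ.1 lam (bv 0) ∈ totalLevel n m := by
  have := PhiMulti_bv_mem η hη Λ μ.1 lam 0
  rwa [zero_add, Finset.Nat.mem_antidiagonalTuple.mp μ.2] at this

theorem hasSum_traceTerm (η : ℂ) (hη : 0 < η.im) {n m : ℕ} {Λ : Fin n → ℂ}
    (hΛ : ∑ i, Λ i = 2 * m) (lam : ℂ) (μ μ' : Idx n m) {x : ℂ}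
    (hx : growthBound η m < ‖qpow η (2 * x)‖) :
    HasSum (traceTerm η hη m Λ lam μ μ' x) (explicitTrace η hη m Λ lam μ μ' x) := by
  have h2 := two_le_growthBound η m
  set y := qpow η (-(2 * x)) with hydef
  have hy : growthBound η m * ‖y‖ < 1 := by
    rw [hydef, qpow_neg, norm_inv, mul_inv_lt_iff₀ (by linarith), one_mul]
    exact hx
  have hy1 : 1 - y ≠ 0 := by
    intro h
    have : y = 1 := by linear_combination -h
    rw [this, norm_one] at hy
    linarith
  have hs := (hasSum_traceCoeff η hη hΛ hy (PhiMulti_bv_zero_mem η hη Λ lam μ) μ'.1).mul_left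
    (qpow η (-((m : ℂ) * (m + 1) / 2)) * (qpow η 1 - qpow η (-1)) ^ m *
      (qpow η (lam * x) * (1 - y)))
  -- The Weyl denominator `q^x - q^(-x)` together with the highest weight character cancels the
  -- factor `(1 - y)⁻¹` of the series and leaves `q^(lam x)`.
  have e1 : qpow η (lam * x) * (1 - y) = (qpow η x - qpow η (-x)) * qpow η ((lam - 1) * x) := by
    rw [hydef, mul_sub, sub_mul, mul_one, ← qpow_add, ← qpow_add, ← qpow_add]
    congr 2 <;> ring
  refine hs.of_eq (fun k => ?_) ?_
  · have e2 : qpow η ((lam - 1 - 2 * k) * x) = qpow η ((lam - 1) * x) * y ^ k := by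
      rw [hydef, ← qpow_nsmul, ← qpow_add]; congr 1; ring
    have e3 : diagCoeff (PhiMulti η hη n Λ μ.1 lam ∘ₗ (verma η hη (lam - 1)).K x) k
        = qpow η ((lam - 1 - 2 * k) * x) • vermaCoeff n k (PhiMulti η hη n Λ μ.1 lam (bv k)) := by
      rw [← map_smul, ← map_smul, ← onBasis_bv (fun k : ℕ => qpow η ((lam - 1 - 2 * k) * x) • bv k) k]
      rfl
    rw [traceTerm, e3, diagCoeff_PhiMulti, Finsupp.smul_apply, smul_eq_mul, e1, e2]
    ring
  · rw [explicitTrace, ← hydef]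
    field_simp

/-! ### Iterated residues -/

/-- On all sufficiently small circles the Cauchy integral formula gives the constant value `h a`. -/
theorem residue_eq_of_simple_pole {f h : ℂ → ℂ} {a : ℂ} (hh : AnalyticAt ℂ h a)
    (hf : ∀ᶠ z in 𝓝[≠] a, f z = h z / (z - a)) : residue f a = h a := by
  have h1 := hh.eventually_analyticAt
  rw [eventually_nhdsWithin_iff] at hf
  obtain ⟨r, hr, H⟩ := Metric.eventually_nhds_iff_ball.mp (h1.and hf)
  refine Tendsto.limUnder_eq (tendsto_const_nhds.congr' ?_)
  filter_upwards [Ioo_mem_nhdsGT hr] with s hs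
  have hsub : Metric.closedBall a s ⊆ Metric.ball a r := Metric.closedBall_subset_ball hs.2
  have hd : DifferentiableOn ℂ h (Metric.closedBall a s) := fun z hz =>
    (H z (hsub hz)).1.differentiableAt.differentiableWithinAt
  have e : (∮ z in C(a, s), f z) = ∮ z in C(a, s), (z - a)⁻¹ • h z := by
    refine circleIntegral.integral_congr hs.1.le fun z hz => ?_
    have hz' : z ∈ Metric.ball a r := hsub (Metric.sphere_subset_closedBall hz)
    have hne : z ≠ a := by
      rintro rfl
      simp at hz
      exact hs.1.ne hz
    rw [(H z hz').2 hne, smul_eq_mul, div_eq_inv_mul]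
  rw [e, hd.circleIntegral_sub_inv_smul (Metric.mem_ball_self hs.1), smul_eq_mul, ← mul_assoc,
    inv_mul_cancel₀ Complex.two_pi_I_ne_zero, one_mul]

/-- The two-variable factor of the density. -/
def pairFactor (η z w : ℂ) : ℂ :=
  (z - w) ^ 2 / ((qpow η 1 * z - qpow η (-1) * w) * (qpow η (-1) * z - qpow η 1 * w))

/-- The one-variable factor of the density. -/
def siteDensity (η : ℂ) {n : ℕ} (Λ : Fin n → ℂ) (z : ℂ) : ℂ :=
  (∏ k, ((z - qpow η (Λ k)) * (qpow η (Λ k) * z - 1))⁻¹) / z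

theorem Omega_div_eq (η : ℂ) {n m : ℕ} (Λ : Fin n → ℂ) (t : Fin m → ℂ) :
    Omega η Λ t / ∏ i, t i = (∏ i, siteDensity η Λ (t i)) *
      ∏ i, ∏ j ∈ Finset.Ioi i, pairFactor η (t i) (t j) := by
  simp only [Omega, siteDensity, pairFactor, Finset.prod_div_distrib]
  ring

/-- `r` is the successive product of the residues at the entries of the list, from the last
entry to the first one, all poles being simple. -/
def ResidueChain (η : ℂ) (P : ℂ → ℂ) : List ℂ → ℂ → Prop
  | [], r => r = 1
  | a :: l, r => ∃ (h : ℂ → ℂ) (r' : ℂ), AnalyticAt ℂ h a ∧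
      (∀ᶠ z in 𝓝[≠] a, P z * (l.map (pairFactor η z)).prod = h z / (z - a)) ∧
      ResidueChain η P l r' ∧ r = h a * r'

theorem analyticAt_pairFactor {η z w : ℂ} (h1 : z ≠ qpow η (-2) * w) (h2 : z ≠ qpow η 2 * w) :
    AnalyticAt ℂ (pairFactor η z) w := by
  have e1 : qpow η 2 = qpow η 1 * qpow η 1 := by rw [← qpow_add]; norm_num
  have e2 : qpow η (-2) = qpow η (-1) * qpow η (-1) := by rw [← qpow_add]; norm_num
  have e3 : qpow η 1 * qpow η (-1) = 1 := by rw [← qpow_add]; simp [qpow_zero]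
  refine AnalyticAt.div (by fun_prop) (by fun_prop) (mul_ne_zero ?_ ?_)
  · intro h
    apply h1
    rw [e2]
    linear_combination qpow η (-1) * h - z * e3
  · intro h
    apply h2
    rw [e1]
    linear_combination qpow η 1 * h - z * e3

/-- The inner residues are taken with the outer variable `z` fixed near, but not at, its pole. The
pair factors of `z` with the inner variables are then analytic at the remaining points and are
absorbed into `E`; this is why an arbitrary analytic weight `E` and a constant `c` are carried
through the induction. -/
theorem multiResidue_eq_of_residueChain {η : ℂ} {P : ℂ → ℂ} : ∀ {m : ℕ} {l : List ℂ} {r : ℂ}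
    (_ : l.length = m) (_ : ResidueChain η P l r) (E : ℂ → ℂ) (_ : ∀ a ∈ l, AnalyticAt ℂ E a)
    (c : ℂ), multiResidue m (fun t => c * ((∏ i, E (t i) * P (t i)) *
      ∏ i, ∏ j ∈ Finset.Ioi i, pairFactor η (t i) (t j))) (fun i => l.getD i 0)
        = c * ((l.map E).prod * r)
  | 0, [], r, _, hr, E, _, c => by
    have hr' : r = 1 := hr
    simp [multiResidue, hr']
  | m + 1, a :: l, r, hl, hr, E, hE, c => by
    obtain ⟨h, r', hh, hP, hc, rfl⟩ := hr
    have hl' : l.length = m := by simpa using hl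
    have hEa : AnalyticAt ℂ E a := hE a (by simp)
    have htail : Fin.tail (fun i : Fin (m + 1) => (a :: l).getD i 0)
        = fun i : Fin m => l.getD i 0 := by
      funext i; simp [Fin.tail]
    -- The singularities of the pair factors are at `z = q^(±2) w`. One of them may be `a` itself,
    -- as for neighbours in a string, so only a punctured neighbourhood is available.
    have hgood : ∀ᶠ z in 𝓝[≠] a, ∀ w ∈ l, z ≠ qpow η (-2) * w ∧ z ≠ qpow η 2 * w := by
      have hfin : ∀ b : ℂ, ∀ᶠ z in 𝓝[≠] a, z ≠ b := fun b => by
        by_cases hb : b = a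
        · rw [hb]; exact eventually_mem_nhdsWithin
        · exact eventually_nhdsWithin_of_eventually_nhds (eventually_ne_nhds (Ne.symm hb))
      have : ∀ w ∈ l.toFinset, ∀ᶠ z in 𝓝[≠] a, z ≠ qpow η (-2) * w ∧ z ≠ qpow η 2 * w :=
        fun w _ => (hfin _).and (hfin _)
      filter_upwards [(Finset.eventually_all l.toFinset).mpr this] with z hz w hw
      exact hz w (by simpa using hw)
    rw [multiResidue]
    have ha : (a :: l).getD ((0 : Fin (m + 1)) : ℕ) 0 = a := rfl
    rw [ha, htail]
    have key : residue (fun z => multiResidue m (fun t => c * ((∏ i, E ((Fin.cons z t :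
        Fin (m + 1) → ℂ) i) * P ((Fin.cons z t : Fin (m + 1) → ℂ) i)) *
      ∏ i, ∏ j ∈ Finset.Ioi i, pairFactor η ((Fin.cons z t : Fin (m + 1) → ℂ) i)
        ((Fin.cons z t : Fin (m + 1) → ℂ) j))) (fun i => l.getD i 0)) a
        = (fun z => c * E z * ((l.map E).prod * r') * h z) a := by
      refine residue_eq_of_simple_pole
        (h := fun z => c * E z * ((l.map E).prod * r') * h z) ?_ ?_
      · exact ((analyticAt_const.mul hEa).mul analyticAt_const).mul hh
      · filter_upwards [hP, hgood] with z hz hg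
        have e : (fun t : Fin m → ℂ => c * ((∏ i, E ((Fin.cons z t :
            Fin (m + 1) → ℂ) i) * P ((Fin.cons z t : Fin (m + 1) → ℂ) i)) *
          ∏ i, ∏ j ∈ Finset.Ioi i, pairFactor η ((Fin.cons z t : Fin (m + 1) → ℂ) i)
            ((Fin.cons z t : Fin (m + 1) → ℂ) j)))
          = fun t => (c * (E z * P z)) * ((∏ i, (pairFactor η z (t i) * E (t i)) * P (t i)) *
            ∏ i, ∏ j ∈ Finset.Ioi i, pairFactor η (t i) (t j)) := by
          funext t
          rw [Fin.prod_univ_succ, Fin.prod_univ_succ, Fin.prod_Ioi_zero]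
          simp only [Fin.prod_Ioi_succ, Fin.cons_zero, Fin.cons_succ, mul_assoc,
            Finset.prod_mul_distrib]
          ring
        rw [e, multiResidue_eq_of_residueChain hl' hc (fun w => pairFactor η z w * E w)
          (fun w hw => (analyticAt_pairFactor (hg w hw).1 (hg w hw).2).mul (hE w (by simp [hw])))]
        have e2 : (l.map fun w => pairFactor η z w * E w).prod
            = (l.map (pairFactor η z)).prod * (l.map E).prod := List.prod_map_mul
        rw [e2]
        linear_combination c * E z * (l.map E).prod * r' * hz
    rw [key]
    simp
    ring

/-! ### Strings -/

/-- The starting points of the strings; the zeroth string starts at `ε`. -/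
def stringBase (η : ℂ) {n : ℕ} (Λ : Fin n → ℂ) (ε : ℂ) : Fin (n + 1) → ℂ :=
  Fin.cons ε fun k => qpow η (-Λ k)

/-- The `s`-th point of the `k`-th string. -/
def gridPoint (η : ℂ) {n : ℕ} (B : Fin (n + 1) → ℂ) (k : Fin (n + 1)) (s : ℕ) : ℂ :=
  B k * qpow η (2 * s)

/-- Increase the `k`-th entry by one. -/
def bump {N : ℕ} (σ : Fin N → ℕ) (k : Fin N) : Fin N → ℕ := Function.update σ k (σ k + 1)

@[simp] theorem bump_same {N : ℕ} (σ : Fin N → ℕ) (k : Fin N) : bump σ k k = σ k + 1 := by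
  simp [bump]

theorem bump_of_ne {N : ℕ} (σ : Fin N → ℕ) {k l : Fin N} (h : l ≠ k) : bump σ k l = σ l := by
  simp [bump, h]

theorem sum_bump {N : ℕ} (σ : Fin N → ℕ) (k : Fin N) : ∑ l, bump σ k l = ∑ l, σ l + 1 := by
  rw [← Finset.add_sum_erase _ _ (Finset.mem_univ k), bump_same,
    ← Finset.add_sum_erase _ σ (Finset.mem_univ k),
    Finset.sum_congr rfl fun l hl => bump_of_ne σ (Finset.ne_of_mem_erase hl)]
  ring

/-- The points of all strings, of lengths `σ k`. -/
def gridList (η : ℂ) {n : ℕ} (B : Fin (n + 1) → ℂ) (σ : Fin (n + 1) → ℕ) : List ℂ :=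
  (List.finRange (n + 1)).flatMap fun k => (List.range (σ k)).reverse.map (gridPoint η B k)

theorem stringList_eq_gridList (η : ℂ) {n : ℕ} (Λ : Fin n → ℂ) (σ : Fin (n + 1) → ℕ) :
    stringList η Λ σ = gridList η (stringBase η Λ 0) σ := by
  rw [stringList, gridList, List.finRange_succ, List.flatMap_cons, List.flatMap_map]
  congr 1
  · symm
    rw [List.eq_replicate_iff]
    simp [gridPoint, stringBase]
  · refine List.flatMap_congr fun k _ => ?_
    simp only [List.bind_eq_flatMap, List.pure_def]
    rw [← List.map_eq_flatMap, List.map_map]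
    refine List.map_congr_left fun s _ => ?_
    rw [gridPoint, stringBase, Fin.cons_succ, ← qpow_add]
    rfl

theorem length_gridList (η : ℂ) {n : ℕ} (B : Fin (n + 1) → ℂ) (σ : Fin (n + 1) → ℕ) :
    (gridList η B σ).length = ∑ k, σ k := by
  simp [gridList, List.length_flatMap, Fin.sum_univ_def]

theorem mem_gridList {η : ℂ} {n : ℕ} {B : Fin (n + 1) → ℂ} {σ : Fin (n + 1) → ℕ} {z : ℂ} :
    z ∈ gridList η B σ ↔ ∃ k, ∃ s < σ k, gridPoint η B k s = z := by
  simp [gridList]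

theorem prod_map_gridList (η : ℂ) {n : ℕ} (B : Fin (n + 1) → ℂ) (σ : Fin (n + 1) → ℕ)
    (F : ℂ → ℂ) :
    ((gridList η B σ).map F).prod = ∏ k, ∏ s ∈ Finset.range (σ k), F (gridPoint η B k s) := by
  have h : ∀ (N : ℕ) (g : ℕ → ℂ), ((List.range N).map g).prod = ∏ s ∈ Finset.range N, g s := by
    intro N g
    induction N with
    | zero => simp
    | succ N ih => rw [List.range_succ, List.map_append, List.prod_append, ih,
        Finset.prod_range_succ]; simp
  rw [gridList, Fin.prod_univ_def]
  generalize List.finRange (n + 1) = L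
  induction L with
  | nil => simp
  | cons a L ih =>
    rw [List.flatMap_cons, List.map_append, List.prod_append, ih, List.map_cons, List.prod_cons,
      ← h, List.map_map, List.map_reverse, List.prod_reverse]
    rfl

theorem flatMap_eq_cons {α β : Type*} [LinearOrder α] {L : List α} (hL : L.Pairwise (· < ·))
    {f g : α → List β} {k : α} {b : β} (hk : k ∈ L) (hlt : ∀ l < k, f l = [])
    (hne : ∀ l ≠ k, g l = f l) (hg : g k = b :: f k) : L.flatMap g = b :: L.flatMap f := by
  induction L with
  | nil => simp at hk
  | cons a L ih =>
    rw [List.pairwise_cons] at hL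
    rw [List.flatMap_cons, List.flatMap_cons]
    rcases eq_or_ne a k with rfl | ha
    · rw [hg, List.cons_append]
      congr 2
      exact List.flatMap_congr fun l hl => hne l (hL.1 l hl).ne'
    · have hkL : k ∈ L := by simpa [ha.symm] using hk
      rw [ih hL.2 hkL, hne a ha, hlt a (hL.1 k hkL)]
      simp

/-- Strings are listed from the top down, so the outermost residue is taken at the top of the first
nonempty string. Peeling it off is the inductive step for residues. -/
theorem gridList_add_single (η : ℂ) {n : ℕ} (B : Fin (n + 1) → ℂ) (σ : Fin (n + 1) → ℕ)
    (k : Fin (n + 1)) (h : ∀ l < k, σ l = 0) :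
    gridList η B (bump σ k) = gridPoint η B k (σ k) :: gridList η B σ := by
  refine flatMap_eq_cons (List.pairwise_lt_finRange _) (List.mem_finRange k) ?_ ?_ ?_
  · intro l hl; simp [h l hl]
  · intro l hl; rw [bump_of_ne σ hl]
  · simp [List.range_succ]

theorem pairFactor_symm (η z w : ℂ) : pairFactor η z w = pairFactor η w z := by
  rw [pairFactor, pairFactor]
  congr 1 <;> ring

/-- The residue of the one-variable density at the next point of a string, taking into account
the factors of the points of the same string. -/
def gridWeight (η : ℂ) {n : ℕ} (Λ : Fin n → ℂ) (k : Fin (n + 1)) (s : ℕ) : ℂ :=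
  Fin.cases (qpow η (-∑ l, Λ l)) (fun j =>
    (fun z => (∏ l ∈ Finset.univ.erase j, ((z - qpow η (Λ l)) * (qpow η (Λ l) * z - 1))⁻¹) / z *
      ((z - qpow η (Λ j))⁻¹ * qpow η (-Λ j)) *
      ((z - z * qpow η (-2)) / (z - qpow η (-Λ j) * qpow η (-2))))
    (qpow η (-Λ j) * qpow η (2 * s))) k

/-- The iterated residue of the density at a collection of strings. -/
def gridResidue (η : ℂ) {n : ℕ} (Λ : Fin n → ℂ) (σ : Fin (n + 1) → ℕ) : ℂ :=
  (∏ k, ∏ s ∈ Finset.range (σ k), gridWeight η Λ k s) *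
    ∏ k, ∏ l ∈ Finset.Ioi k, ∏ s ∈ Finset.range (σ k), ∏ r ∈ Finset.range (σ l),
      pairFactor η (gridPoint η (stringBase η Λ 0) k s) (gridPoint η (stringBase η Λ 0) l r)

theorem prod_range_add_single {N : ℕ} (σ : Fin N → ℕ) (k : Fin N) (F : Fin N → ℕ → ℂ) (l : Fin N) :
    ∏ s ∈ Finset.range ((bump σ k) l), F l s
      = (∏ s ∈ Finset.range (σ l), F l s) * if l = k then F k (σ k) else 1 := by
  rcases eq_or_ne l k with rfl | h
  · simp [Finset.prod_range_succ]
  · simp [h, bump_of_ne σ h]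

/-- By the symmetry of `pairFactor` the formula holds for every string `k`, not only for the first
nonempty one. The functional equation needs it when each string in turn is enlarged. -/
theorem gridResidue_add_single (η : ℂ) {n : ℕ} (Λ : Fin n → ℂ) (σ : Fin (n + 1) → ℕ)
    (k : Fin (n + 1)) :
    gridResidue η Λ (bump σ k) = gridResidue η Λ σ * (gridWeight η Λ k (σ k) *
      ∏ l ∈ Finset.univ.erase k, ∏ r ∈ Finset.range (σ l),
        pairFactor η (gridPoint η (stringBase η Λ 0) k (σ k))
          (gridPoint η (stringBase η Λ 0) l r)) := by
  set X := fun k s => gridPoint η (stringBase η Λ 0) k s with hX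
  set H := fun l => ∏ r ∈ Finset.range (σ l), pairFactor η (X k (σ k)) (X l r) with hH
  have e1 : ∏ l, ∏ s ∈ Finset.range ((bump σ k) l), gridWeight η Λ l s
      = (∏ l, ∏ s ∈ Finset.range (σ l), gridWeight η Λ l s) * gridWeight η Λ k (σ k) := by
    simp only [prod_range_add_single, Finset.prod_mul_distrib]
    simp
  have e2 : ∀ a b : Fin (n + 1), a < b →
      ∏ s ∈ Finset.range ((bump σ k) a), ∏ r ∈ Finset.range ((bump σ k) b),
        pairFactor η (X a s) (X b r) = (∏ s ∈ Finset.range (σ a), ∏ r ∈ Finset.range (σ b),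
        pairFactor η (X a s) (X b r)) * ((if a = k then H b else 1) * if b = k then H a else 1) := by
    intro a b hab
    rw [prod_range_add_single σ k (fun a s => ∏ r ∈ Finset.range ((bump σ k) b),
        pairFactor η (X a s) (X b r))]
    simp only [fun a s => prod_range_add_single σ k (fun b r => pairFactor η (X a s) (X b r)) b,
      Finset.prod_mul_distrib]
    rw [mul_assoc]
    congr 1
    rw [mul_comm]
    rcases eq_or_ne a k with rfl | ha
    · simp [hab.ne', hH]
    · rcases eq_or_ne b k with rfl | hb
      · simp [ha, hH, pairFactor_symm η (X a _)]
      · simp [ha, hb]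
  have e3 : ∏ a, ∏ b ∈ Finset.Ioi a, ∏ s ∈ Finset.range ((bump σ k) a),
        ∏ r ∈ Finset.range ((bump σ k) b), pairFactor η (X a s) (X b r)
      = (∏ a, ∏ b ∈ Finset.Ioi a, ∏ s ∈ Finset.range (σ a), ∏ r ∈ Finset.range (σ b),
        pairFactor η (X a s) (X b r)) * ∏ l ∈ Finset.univ.erase k, H l := by
    rw [Finset.prod_congr rfl fun a _ => Finset.prod_congr rfl fun b hb =>
      e2 a b (Finset.mem_Ioi.mp hb)]
    simp only [Finset.prod_mul_distrib]
    congr 1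
    have h1 : ∏ a, ∏ b ∈ Finset.Ioi a, (if a = k then H b else 1) = ∏ b ∈ Finset.Ioi k, H b := by
      rw [Finset.prod_eq_single k]
      · simp
      · intro a _ ha; simp [ha]
      · simp
    have h2 : ∏ a, ∏ b ∈ Finset.Ioi a, (if b = k then H a else 1) = ∏ a ∈ Finset.Iio k, H a := by
      simp only [Finset.prod_ite_eq', Finset.mem_Ioi]
      rw [← Finset.prod_filter]
      congr 1
      ext; simp
    rw [h1, h2, mul_comm, ← Finset.prod_union]
    · congr 1
      ext l
      simp
    · exact Finset.disjoint_left.mpr fun a ha hb =>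
        (Finset.mem_Iio.mp ha).not_gt (Finset.mem_Ioi.mp hb)
  rw [gridResidue, e1, e3, gridResidue]
  ring

theorem pairFactor_mul {η z w : ℂ} (h1 : z ≠ w * qpow η (-2)) (h2 : z ≠ w * qpow η 2) :
    pairFactor η z w * ((z - w * qpow η (-2)) * (z - w * qpow η 2)) = (z - w) ^ 2 := by
  have e1 : qpow η 2 = qpow η 1 * qpow η 1 := by rw [← qpow_add]; norm_num
  have e2 : qpow η (-2) = qpow η (-1) * qpow η (-1) := by rw [← qpow_add]; norm_num
  have e3 : qpow η 1 * qpow η (-1) = 1 := by rw [← qpow_add]; simp [qpow_zero]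
  have e : (qpow η 1 * z - qpow η (-1) * w) * (qpow η (-1) * z - qpow η 1 * w)
      = (z - w * qpow η (-2)) * (z - w * qpow η 2) := by
    rw [e1, e2]
    linear_combination (z ^ 2 - w ^ 2 * (qpow η 1 * qpow η (-1))) * e3
  rw [pairFactor, e, div_mul_cancel₀]
  exact mul_ne_zero (sub_ne_zero.mpr h1) (sub_ne_zero.mpr h2)

/-- The product telescopes: the zeros of each pair factor are double, and its poles are one step
above and one step below, so along a string only the factors at the ends survive. -/
theorem prod_pairFactor_string {η z w : ℂ} : ∀ {S : ℕ} (_ : z ≠ w * qpow η (-2))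
    (_ : ∀ s ≤ S, z ≠ w * qpow η (2 * s)),
    (∏ s ∈ Finset.range S, pairFactor η z (w * qpow η (2 * s))) *
      ((z - w * qpow η (-2)) * (z - w * qpow η (2 * S)))
      = (z - w) * (z - w * qpow η (2 * S) * qpow η (-2))
  | 0, _, _ => by simp [qpow_zero]; ring
  | S + 1, h1, h => by
    have ih := prod_pairFactor_string h1 fun s hs => h s (hs.trans S.le_succ)
    have eS : w * qpow η (2 * S) * qpow η 2 = w * qpow η (2 * ((S + 1 : ℕ) : ℂ)) := by
      rw [mul_assoc, ← qpow_add]; congr 2; push_cast; ring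
    have eS' : w * qpow η (2 * ((S + 1 : ℕ) : ℂ)) * qpow η (-2) = w * qpow η (2 * S) := by
      rw [mul_assoc, ← qpow_add]; congr 2; push_cast; ring
    have hlow : z ≠ w * qpow η (2 * S) * qpow η (-2) := by
      rcases S with _ | S
      · simpa [qpow_zero] using h1
      · rw [mul_assoc, ← qpow_add]
        have := h S (by omega)
        convert this using 3
        push_cast; ring
    have hp := pairFactor_mul (w := w * qpow η (2 * S)) hlow (by rw [eS]; exact h _ le_rfl)
    rw [eS] at hp
    rw [eS', Finset.prod_range_succ]
    refine mul_right_cancel₀ (sub_ne_zero.mpr hlow) ?_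
    generalize w * qpow η (2 * ((S + 1 : ℕ) : ℂ)) = A at *
    generalize w * qpow η (2 * (S : ℂ)) = A' at *
    linear_combination (∏ s ∈ Finset.range S, pairFactor η z (w * qpow η (2 * s))) *
      (z - w * qpow η (-2)) * hp + (z - A') * ih

/-! ### Iterated residues at the strings for generic weights -/

section

theorem qpow_even_ne_one {η : ℂ} (hη : 0 < η.im) (k : ℕ) : qpow η (2 * ((k : ℂ) + 1)) ≠ 1 := by
  intro h
  apply qpow_natCast_ne hη k
  have h1 := qpow_ne_zero η ((k : ℂ) + 1)
  rw [two_mul, qpow_add] at h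
  rw [qpow_neg]
  exact eq_inv_of_mul_eq_one_left h

section generic

variable {η : ℂ} {n m : ℕ} {Λ : Fin n → ℂ}

theorem gridPoint_succ_ne_pole (hΛ : Λ ∈ genericWeights η n m) (k l : Fin n) {s : ℕ} (hs : s < m) :
    qpow η (-Λ k) * qpow η (2 * s) ≠ qpow η (Λ l) := by
  intro h
  refine hΛ.2.1 k l s hs ?_
  rw [qpow_add, ← h, ← mul_assoc, ← qpow_add, add_neg_cancel, qpow_zero, one_mul]

theorem gridPoint_ne_gridPoint (hΛ : Λ ∈ genericWeights η n m) {k l : Fin n} (hkl : k ≠ l)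
    {a b : ℤ} (h1 : a - b ≤ m) (h2 : b - a ≤ m) :
    qpow η (-Λ k) * qpow η (2 * a) ≠ qpow η (-Λ l) * qpow η (2 * b) := by
  intro h
  refine hΛ.2.2 k l hkl (a - b) (abs_le.mpr ⟨by omega, h1⟩) ?_
  push_cast
  have e : qpow η (2 * ((a : ℂ) - b)) = qpow η (2 * a) * qpow η (-(2 * b)) := by
    rw [← qpow_add]; congr 1; ring
  have e2 : qpow η (Λ k - Λ l) = qpow η (Λ k) * qpow η (-Λ l) := by
    rw [← qpow_add]; congr 1
  have e3 := qpow_mul_qpow_neg η (Λ k)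
  have e4 := qpow_mul_qpow_neg η (2 * (b : ℂ))
  rw [e, e2]
  linear_combination - qpow η (Λ k) * qpow η (-(2 * b)) * h
    + qpow η (2 * a) * qpow η (-(2 * b)) * e3 - qpow η (Λ k) * qpow η (-Λ l) * e4

theorem gridPoint_zero_left (k : ℕ) : gridPoint η (stringBase η Λ 0) 0 k = 0 := by
  simp [gridPoint, stringBase]

theorem gridPoint_succ (ε : ℂ) (j : Fin n) (s : ℕ) :
    gridPoint η (stringBase η Λ ε) j.succ s = qpow η (-Λ j) * qpow η (2 * s) := rfl

theorem pairFactor_zero_right {z : ℂ} (hz : z ≠ 0) : pairFactor η z 0 = 1 := by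
  have e3 : qpow η 1 * qpow η (-1) = 1 := by rw [← qpow_add]; simp [qpow_zero]
  have e : (qpow η 1 * z) * (qpow η (-1) * z) = z ^ 2 := by linear_combination z ^ 2 * e3
  simp only [pairFactor, mul_zero, sub_zero, e]
  exact div_self (pow_ne_zero 2 hz)

theorem qpow_two_mul_natCast_succ (η : ℂ) (s : ℕ) :
    qpow η (2 * ((s + 1 : ℕ) : ℂ)) = qpow η (2 * s) * qpow η 2 := by
  rw [← qpow_add]; congr 1; push_cast; ring

/-- Induction on the number of points, peeling off the top of the first nonempty string `k`. Pair
factors with other strings are analytic there by genericity, or because one of the two points is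
zero and the other is not. Those with the same string telescope: for `k ≥ 1` they move the simple
pole of the density from the bottom `q^(-Λ)` to the next free point, and for `k = 0` they are
identically `1`, leaving the pole of `1 / z`. -/
theorem residueChain_gridList (hη : 0 < η.im) (hΛ : Λ ∈ genericWeights η n m) :
    ∀ (N : ℕ) (σ : Fin (n + 1) → ℕ) (_ : ∑ k, σ k = N) (_ : N ≤ m),
    ResidueChain η (siteDensity η Λ) (gridList η (stringBase η Λ 0) σ) (gridResidue η Λ σ) := by
  intro N
  induction N with
  | zero =>
    intro σ hσ _
    have : σ = 0 := by
      funext k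
      exact (Finset.sum_eq_zero_iff.mp hσ) k (Finset.mem_univ k)
    subst this
    have e : gridList η (stringBase η Λ 0) (0 : Fin (n + 1) → ℕ) = [] := by
      rw [← List.length_eq_zero_iff, length_gridList]; simp
    rw [e]
    simp [ResidueChain, gridResidue]
  | succ N ih =>
    intro σ hσ hN
    have hex : ∃ k, σ k ≠ 0 := by
      by_contra! h
      simp [h] at hσ
    obtain ⟨k, hk, hmin⟩ : ∃ k, σ k ≠ 0 ∧ ∀ l < k, σ l = 0 := by
      obtain ⟨k, hk, hmin⟩ := WellFounded.has_min (wellFounded_lt (α := Fin (n + 1)))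
        {k | σ k ≠ 0} hex
      exact ⟨k, hk, fun l hl => by_contra fun h => hmin l h hl⟩
    obtain ⟨σ', rfl⟩ : ∃ σ', σ = bump σ' k := by
      refine ⟨Function.update σ k (σ k - 1), ?_⟩
      funext l
      rcases eq_or_ne l k with rfl | h
      · rw [bump_same, Function.update_self]; omega
      · rw [bump_of_ne _ h, Function.update_of_ne h]
    have hmin' : ∀ l < k, σ' l = 0 := fun l hl => by
      rw [← bump_of_ne σ' hl.ne]; exact hmin l hl
    rw [sum_bump] at hσ
    have hσ' : ∑ l, σ' l = N := by omega
    rw [gridList_add_single η _ σ' k hmin', gridResidue_add_single]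
    have hsplit : ∀ z, ((gridList η (stringBase η Λ 0) σ').map (pairFactor η z)).prod
        = (∏ s ∈ Finset.range (σ' k), pairFactor η z (gridPoint η (stringBase η Λ 0) k s)) *
          ∏ l ∈ Finset.univ.erase k, ∏ r ∈ Finset.range (σ' l),
            pairFactor η z (gridPoint η (stringBase η Λ 0) l r) := by
      intro z
      rw [prod_map_gridList, ← Finset.mul_prod_erase _ _ (Finset.mem_univ k)]
    have han : AnalyticAt ℂ (fun z => ∏ l ∈ Finset.univ.erase k, ∏ r ∈ Finset.range (σ' l),
        pairFactor η z (gridPoint η (stringBase η Λ 0) l r))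
        (gridPoint η (stringBase η Λ 0) k (σ' k)) := by
      refine Finset.analyticAt_fun_prod _ fun l hl => Finset.analyticAt_fun_prod _ fun r hr => ?_
      have hlk := Finset.ne_of_mem_erase hl
      have hr' := Finset.mem_range.mp hr
      have hle : σ' k + σ' l ≤ N := by
        rw [← hσ', ← Finset.add_sum_erase _ _ (Finset.mem_univ k)]
        exact Nat.add_le_add_left (Finset.single_le_sum (f := σ') (fun _ _ => Nat.zero_le _) hl) _
      -- If `k` is not the zeroth string, then the zeroth string is empty by the minimality of `k`
      -- and contributes no pair factor.
      have hl0 : l ≠ 0 := by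
        rintro rfl
        have := hmin' 0 ((Fin.zero_le k).lt_of_ne hlk)
        omega
      obtain ⟨l, rfl⟩ := Fin.exists_succ_eq.mpr hl0
      simp only [pairFactor_symm η _ (gridPoint η (stringBase η Λ 0) l.succ r)]
      -- The poles of the pair factor lie one step above and below. Since the two lengths add up to
      -- at most `N < m`, the exponents differ by at most `m` even after that step, and genericity
      -- applies.
      have key : ∀ d : ℤ, d = 1 ∨ d = -1 → gridPoint η (stringBase η Λ 0) l.succ r
          ≠ qpow η (2 * d) * gridPoint η (stringBase η Λ 0) k (σ' k) := by
        intro d hd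
        induction k using Fin.cases with
        | zero =>
          rw [gridPoint_zero_left, mul_zero, gridPoint_succ]
          exact mul_ne_zero (qpow_ne_zero _ _) (qpow_ne_zero _ _)
        | succ k =>
          have hlk' : l ≠ k := fun h => hlk (by rw [h])
          rw [gridPoint_succ, gridPoint_succ, mul_left_comm]
          have h := gridPoint_ne_gridPoint hΛ hlk' (a := r) (b := d + σ' k.succ) (by omega)
            (by omega)
          push_cast [mul_add, qpow_add] at h
          exact h
      refine analyticAt_pairFactor ?_ ?_
      · have := key (-1) (Or.inr rfl)
        simpa using this
      · have := key 1 (Or.inl rfl)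
        simpa using this
    have hfin : ∀ a b : ℂ, ∀ᶠ z in 𝓝[≠] a, z ≠ b := fun a b => by
      by_cases hb : b = a
      · rw [hb]; exact eventually_mem_nhdsWithin
      · exact eventually_nhdsWithin_of_eventually_nhds (eventually_ne_nhds (Ne.symm hb))
    have hc := ih σ' hσ' (by omega)
    induction k using Fin.cases with
    | zero =>
      refine ⟨fun z => (∏ k, ((z - qpow η (Λ k)) * (qpow η (Λ k) * z - 1))⁻¹) *
        ∏ l ∈ Finset.univ.erase 0, ∏ r ∈ Finset.range (σ' l),
          pairFactor η z (gridPoint η (stringBase η Λ 0) l r), _, ?_, ?_, hc, ?_⟩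
      · refine AnalyticAt.mul ?_ han
        refine Finset.analyticAt_fun_prod _ fun l _ => ?_
        rw [gridPoint_zero_left]
        refine AnalyticAt.inv (by fun_prop) ?_
        simp [qpow_ne_zero]
      · filter_upwards [hfin _ 0] with z hz
        rw [hsplit, siteDensity, gridPoint_zero_left, sub_zero]
        simp only [gridPoint_zero_left, pairFactor_zero_right hz, Finset.prod_const_one]
        ring
      · simp only [gridPoint_zero_left, gridWeight, Fin.cases_zero, zero_sub, mul_zero, mul_neg,
          mul_one, neg_neg, Finset.prod_inv_distrib]
        rw [qpow_neg]
        have : ∏ k, qpow η (Λ k) = qpow η (∑ k, Λ k) := by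
          simp only [qpow, Finset.mul_sum, Complex.exp_sum]
        rw [this]
        ring
    | succ j =>
      set S := σ' j.succ with hS
      have hSm : S < m := by
        have : S ≤ N := by
          rw [← hσ']; exact Finset.single_le_sum (f := σ') (fun _ _ => Nat.zero_le _) (Finset.mem_univ _)
        omega
      refine ⟨fun z => (∏ l ∈ Finset.univ.erase j, ((z - qpow η (Λ l)) *
          (qpow η (Λ l) * z - 1))⁻¹) / z * ((z - qpow η (Λ j))⁻¹ * qpow η (-Λ j)) *
          ((z - qpow η (-Λ j) * qpow η (2 * S) * qpow η (-2)) / (z - qpow η (-Λ j) * qpow η (-2))) *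
          ∏ l ∈ Finset.univ.erase j.succ, ∏ r ∈ Finset.range (σ' l),
          pairFactor η z (gridPoint η (stringBase η Λ 0) l r), _, ?_, ?_, hc, ?_⟩
      · refine AnalyticAt.mul ?_ han
        rw [gridPoint_succ]
        refine AnalyticAt.mul (AnalyticAt.mul (AnalyticAt.div ?_ analyticAt_id ?_)
          (AnalyticAt.mul (AnalyticAt.inv (by fun_prop) ?_) analyticAt_const))
          (AnalyticAt.div (by fun_prop) (by fun_prop) ?_)
        · refine Finset.analyticAt_fun_prod _ fun l hl => ?_
          have hlj := Finset.ne_of_mem_erase hl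
          refine AnalyticAt.inv (by fun_prop) (mul_ne_zero ?_ ?_)
          · exact sub_ne_zero.mpr (gridPoint_succ_ne_pole hΛ j l hSm)
          · intro h
            have h1 := gridPoint_ne_gridPoint hΛ hlj (a := 0) (b := S) (by omega) (by omega)
            apply h1
            have e := qpow_mul_qpow_neg η (Λ l)
            simp only [Int.cast_zero, mul_zero, qpow_zero, Int.cast_natCast]
            linear_combination - qpow η (-Λ l) * h + (qpow η (-Λ j) * qpow η (2 * S)) * e
        · exact mul_ne_zero (qpow_ne_zero _ _) (qpow_ne_zero _ _)
        · exact sub_ne_zero.mpr (gridPoint_succ_ne_pole hΛ j j hSm)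
        · rw [← mul_sub]
          refine mul_ne_zero (qpow_ne_zero _ _) (sub_ne_zero.mpr fun h => ?_)
          apply qpow_even_ne_one hη S
          have e : qpow η (2 * ((S : ℂ) + 1)) = qpow η (2 * S) * qpow η 2 := by
            rw [← qpow_add]; congr 1; ring
          rw [e, h, ← qpow_add]
          simp [qpow_zero]
      · have hall : ∀ᶠ z in 𝓝[≠] (gridPoint η (stringBase η Λ 0) j.succ S),
            ∀ s ∈ Finset.range (S + 1), z ≠ qpow η (-Λ j) * qpow η (2 * s) :=
          (Finset.eventually_all _).mpr fun s _ => hfin _ _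
        filter_upwards [hall, hfin _ (qpow η (-Λ j) * qpow η (-2))] with z hz hz2
        have hz3 : ∀ s ≤ S, z ≠ qpow η (-Λ j) * qpow η (2 * s) := fun s hs =>
          hz s (Finset.mem_range.mpr (by omega))
        have hp := prod_pairFactor_string hz2 hz3
        have h0 := hz3 0 (Nat.zero_le _)
        rw [hsplit, siteDensity, gridPoint_succ, ← Finset.mul_prod_erase _ _ (Finset.mem_univ j)]
        simp only [gridPoint_succ]
        have h4 := sub_ne_zero.mpr hz2
        have h5 := sub_ne_zero.mpr (hz3 S le_rfl)
        have h6 : z - qpow η (-Λ j) ≠ 0 := by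
          refine sub_ne_zero.mpr ?_
          simpa [qpow_zero] using h0
        have e7 : qpow η (Λ j) * z - 1 = qpow η (Λ j) * (z - qpow η (-Λ j)) := by
          rw [mul_sub, qpow_mul_qpow_neg]
        rw [← eq_div_iff (mul_ne_zero h4 h5)] at hp
        rw [hp, e7, mul_inv, mul_inv, ← qpow_neg]
        generalize qpow η (-Λ j) = L at *
        generalize qpow η (-2) = T at *
        generalize qpow η (2 * (S : ℂ)) = U at *
        generalize (∏ l ∈ Finset.univ.erase j, ((z - qpow η (Λ l)) * (qpow η (Λ l) * z - 1))⁻¹) = V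
        have h8 : (z - L)⁻¹ * (z - L) = 1 := inv_mul_cancel₀ h6
        -- Here `z - L` cancels the pole of the density at the bottom point, and `z - L * U` is the
        -- new simple pole.
        have e9 : (z - L) * (z - L * U * T) / ((z - L * T) * (z - L * U))
          = (z - L) * ((z - L * U * T) / (z - L * T) / (z - L * U)) := by
          field_simp
        rw [e9]
        linear_combination ((z - qpow η (Λ j))⁻¹ * L * V / z * ((z - L * U * T) / (z - L * T) / (z - L * U)) * (∏ l ∈ Finset.univ.erase j.succ, ∏ r ∈ Finset.range (σ' l),
          pairFactor η z (gridPoint η (stringBase η Λ 0) l r))) * h8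
      · simp only [gridWeight, Fin.cases_succ, gridPoint_succ]
        ring

end generic

end

/-! ### Extension of regular elements to coinciding points -/

section

namespace Shuffle

variable {η : ℂ}

/-- The extension of a regular element of the shuffle algebra to tuples with coinciding entries. -/
def extend (f : Shuffle η) (m : ℕ) : (Fin m → ℂ) → ℂ :=
  extendPoly fun t => f (Finset.univ.image t)

theorem IsRegular.exists_extend {f : Shuffle η} (hf : IsRegular f) (m : ℕ) :
    ∃ P : MvPolynomial (Fin m) ℂ, (∀ t, f.extend m t = MvPolynomial.eval t P) ∧
      ∀ t, Function.Injective t → f (Finset.univ.image t) = MvPolynomial.eval t P := by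
  obtain ⟨P, hP⟩ := hf m
  exact ⟨P, fun t => extendPoly_eq_eval hP t, hP⟩

theorem extend_of_injective {f : Shuffle η} (hf : IsRegular f) {m : ℕ} {t : Fin m → ℂ}
    (ht : Function.Injective t) : f.extend m t = f (Finset.univ.image t) := by
  obtain ⟨P, h1, h2⟩ := hf.exists_extend m
  rw [h1, h2 t ht]

theorem IsRegular.continuous_extend {f : Shuffle η} (hf : IsRegular f) (m : ℕ) :
    Continuous (f.extend m) := by
  obtain ⟨P, h1, -⟩ := hf.exists_extend m
  rw [funext h1]
  exact P.continuous_eval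

theorem extend_eq_of_tendsto {f : Shuffle η} (hf : IsRegular f) {m : ℕ} {ι : Type*} {F : Filter ι}
    {t : ι → Fin m → ℂ} {a : Fin m → ℂ} (ht : Tendsto t F (𝓝 a))
    (hinj : ∀ᶠ e in F, Function.Injective (t e)) :
    Tendsto (fun e => f (Finset.univ.image (t e))) F (𝓝 (f.extend m a)) := by
  refine (((hf.continuous_extend m).tendsto a).comp ht).congr' ?_
  filter_upwards [hinj] with e he
  exact extend_of_injective hf he

theorem extend_add {f g : Shuffle η} (hf : IsRegular f) (hg : IsRegular g) (m : ℕ)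
    (t : Fin m → ℂ) : (f + g).extend m t = f.extend m t + g.extend m t := by
  obtain ⟨P, h1, h2⟩ := hf.exists_extend m
  obtain ⟨Q, h3, h4⟩ := hg.exists_extend m
  rw [h1, h3, ← map_add]
  refine extendPoly_eq_eval (fun t ht => ?_) t
  rw [add_apply, h2 t ht, h4 t ht, map_add]

theorem extend_smul {f : Shuffle η} (hf : IsRegular f) (c : ℂ) (m : ℕ)
    (t : Fin m → ℂ) : (c • f).extend m t = c * f.extend m t := by
  obtain ⟨P, h1, h2⟩ := hf.exists_extend m
  rw [h1, ← MvPolynomial.smul_eval]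
  refine extendPoly_eq_eval (fun t ht => ?_) t
  rw [smul_apply, h2 t ht, MvPolynomial.smul_eval]

end Shuffle

/-! ### Evaluation at strings -/

variable {η : ℂ} {n : ℕ}

/-- The points of all strings, as a finite set. -/
def gridSet (η : ℂ) {n : ℕ} (B : Fin (n + 1) → ℂ) (σ : Fin (n + 1) → ℕ) : Finset ℂ :=
  (Finset.univ.sigma fun k => Finset.range (σ k)).image fun p => gridPoint η B p.1 p.2

/-- The first `m + 1` points of all strings are different. -/
def GridInjective (η : ℂ) {n : ℕ} (B : Fin (n + 1) → ℂ) (m : ℕ) : Prop :=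
  ∀ k l s r, s ≤ m → r ≤ m → gridPoint η B k s = gridPoint η B l r → k = l ∧ s = r

theorem GridInjective.injOn {B : Fin (n + 1) → ℂ} {m : ℕ} (h : GridInjective η B m)
    {σ : Fin (n + 1) → ℕ} (hσ : ∀ k, σ k ≤ m + 1) :
    Set.InjOn (fun p : (_ : Fin (n + 1)) × ℕ => gridPoint η B p.1 p.2)
      (Finset.univ.sigma fun k => Finset.range (σ k)) := by
  rintro ⟨k, s⟩ hs ⟨l, r⟩ hr e
  simp only [Finset.coe_sigma, Set.mem_sigma_iff, Finset.coe_univ, Set.mem_univ, true_and,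
    Finset.coe_range, Set.mem_Iio] at hs hr
  have hk := hσ k
  have hl := hσ l
  obtain ⟨rfl, rfl⟩ := h k l s r (by omega) (by omega) e
  rfl

theorem prod_gridSet {B : Fin (n + 1) → ℂ} {m : ℕ} (h : GridInjective η B m)
    {σ : Fin (n + 1) → ℕ} (hσ : ∀ k, σ k ≤ m + 1) (F : ℂ → ℂ) :
    ∏ z ∈ gridSet η B σ, F z = ∏ k, ∏ s ∈ Finset.range (σ k), F (gridPoint η B k s) := by
  rw [gridSet, Finset.prod_image (h.injOn hσ), Finset.prod_sigma]

theorem sum_gridSet {B : Fin (n + 1) → ℂ} {m : ℕ} (h : GridInjective η B m)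
    {σ : Fin (n + 1) → ℕ} (hσ : ∀ k, σ k ≤ m + 1) (F : ℂ → ℂ) :
    ∑ z ∈ gridSet η B σ, F z = ∑ k, ∑ s ∈ Finset.range (σ k), F (gridPoint η B k s) := by
  rw [gridSet, Finset.sum_image (h.injOn hσ), Finset.sum_sigma]

theorem mem_gridSet {B : Fin (n + 1) → ℂ} {σ : Fin (n + 1) → ℕ} {z : ℂ} :
    z ∈ gridSet η B σ ↔ ∃ k, ∃ s < σ k, gridPoint η B k s = z := by
  simp [gridSet]

theorem toFinset_gridList (B : Fin (n + 1) → ℂ) (σ : Fin (n + 1) → ℕ) :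
    (gridList η B σ).toFinset = gridSet η B σ := by
  ext z
  rw [List.mem_toFinset, mem_gridList, mem_gridSet]

theorem gridSet_bump (B : Fin (n + 1) → ℂ) (σ : Fin (n + 1) → ℕ) (k : Fin (n + 1)) :
    gridSet η B (bump σ k) = insert (gridPoint η B k (σ k)) (gridSet η B σ) := by
  ext z
  rw [Finset.mem_insert, mem_gridSet, mem_gridSet]
  constructor
  · rintro ⟨l, s, hs, rfl⟩
    rcases eq_or_ne l k with rfl | h
    · rw [bump_same] at hs
      rcases Nat.lt_succ_iff_lt_or_eq.mp hs with hs | rfl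
      · exact Or.inr ⟨l, s, hs, rfl⟩
      · exact Or.inl rfl
    · rw [bump_of_ne _ h] at hs
      exact Or.inr ⟨l, s, hs, rfl⟩
  · rintro (rfl | ⟨l, s, hs, rfl⟩)
    · exact ⟨k, σ k, by simp, rfl⟩
    · refine ⟨l, s, ?_, rfl⟩
      rcases eq_or_ne l k with rfl | h
      · rw [bump_same]; omega
      · rwa [bump_of_ne _ h]

theorem GridInjective.notMem {B : Fin (n + 1) → ℂ} {m : ℕ} (h : GridInjective η B m)
    {σ : Fin (n + 1) → ℕ} (hσ : ∀ k, σ k ≤ m) (k : Fin (n + 1)) :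
    gridPoint η B k (σ k) ∉ gridSet η B σ := by
  intro hm
  obtain ⟨l, s, hs, e⟩ := mem_gridSet.mp hm
  have := hσ l
  obtain ⟨rfl, rfl⟩ := h l k s (σ k) (by omega) (hσ k) e
  exact lt_irrefl _ hs

/-- The strings as a point of `ℂ^m`. -/
def gridTuple (η : ℂ) {n : ℕ} (m : ℕ) (B : Fin (n + 1) → ℂ) (σ : Fin (n + 1) → ℕ) : Fin m → ℂ :=
  fun i => (gridList η B σ).getD i 0

theorem image_getD {l : List ℂ} {m : ℕ} (hl : l.length = m) :
    Finset.univ.image (fun i : Fin m => l.getD i 0) = l.toFinset := by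
  subst hl
  ext z
  simp only [Finset.mem_image, Finset.mem_univ, true_and, List.mem_toFinset, List.mem_iff_getElem]
  constructor
  · rintro ⟨i, rfl⟩
    exact ⟨i, i.2, by simp⟩
  · rintro ⟨i, hi, rfl⟩
    exact ⟨⟨i, hi⟩, by simp [hi]⟩

theorem image_gridTuple {m : ℕ} (B : Fin (n + 1) → ℂ) {σ : Fin (n + 1) → ℕ} (hσ : ∑ k, σ k = m) :
    Finset.univ.image (gridTuple η m B σ) = gridSet η B σ := by
  rw [← toFinset_gridList]
  exact image_getD (by rw [length_gridList, hσ])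

theorem GridInjective.gridTuple_injective {B : Fin (n + 1) → ℂ} {m p : ℕ}
    (h : GridInjective η B m) {σ : Fin (n + 1) → ℕ} (hσ : ∑ k, σ k = p) (hp : p ≤ m + 1) :
    Function.Injective (gridTuple η p B σ) := by
  have hle : ∀ k, σ k ≤ m + 1 := fun k =>
    (Finset.single_le_sum (f := σ) (fun _ _ => Nat.zero_le _) (Finset.mem_univ k)).trans
      (by omega)
  have h2 : (Finset.univ.image (gridTuple η p B σ)).card = p := by
    rw [image_gridTuple B hσ, gridSet, Finset.card_image_of_injOn (h.injOn hle), Finset.card_sigma]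
    simpa using hσ
  have := Finset.card_image_iff.mp (h2.trans (by simp : p = (Finset.univ : Finset (Fin p)).card))
  exact Set.injOn_univ.mp (by simpa using this)

theorem continuous_gridTuple (m : ℕ) (Λ : Fin n → ℂ) (σ : Fin (n + 1) → ℕ) :
    Continuous fun ε => gridTuple η m (stringBase η Λ ε) σ := by
  refine continuous_pi fun i => ?_
  set L : List (Fin (n + 1) × ℕ) := (List.finRange (n + 1)).flatMap fun k =>
    (List.range (σ k)).reverse.map fun s => (k, s) with hL
  have e : ∀ ε, gridList η (stringBase η Λ ε) σ
      = L.map fun p => gridPoint η (stringBase η Λ ε) p.1 p.2 := by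
    intro ε
    rw [hL, List.map_flatMap, gridList]
    refine List.flatMap_congr fun k _ => ?_
    rw [List.map_map]
    rfl
  have hc : ∀ k s, Continuous fun ε => gridPoint η (stringBase η Λ ε) k s := by
    intro k s
    refine Fin.cases ?_ (fun j => ?_) k
    · simp only [gridPoint, stringBase, Fin.cons_zero]
      fun_prop
    · simp only [gridPoint_succ]
      fun_prop
  simp only [gridTuple, e]
  by_cases hi : (i : ℕ) < L.length
  · simp only [List.getD_eq_getElem?_getD, List.getElem?_map, List.getElem?_eq_getElem hi,
      Option.map_some, Option.getD_some]
    exact hc _ _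
  · simp only [List.getD_eq_getElem?_getD, List.getElem?_map,
      List.getElem?_eq_none (not_lt.mp hi), Option.map_none, Option.getD_none]
    exact continuous_const

theorem stringPoint_eq_gridTuple (m : ℕ) (Λ : Fin n → ℂ) (σ : Fin (n + 1) → ℕ) :
    stringPoint η m Λ σ = gridTuple η m (stringBase η Λ 0) σ := by
  funext i
  rw [stringPoint, stringList_eq_gridList, gridTuple]

theorem qpow_even_injective (hη : 0 < η.im) {s r : ℕ}
    (h : qpow η (2 * (s : ℂ)) = qpow η (2 * (r : ℂ))) : s = r := by
  have aux : ∀ {a b : ℕ}, a < b → qpow η (2 * (a : ℂ)) ≠ qpow η (2 * (b : ℂ)) := by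
    intro a b hab he
    obtain ⟨d, rfl⟩ := Nat.exists_eq_add_of_lt hab
    apply qpow_even_ne_one hη d
    have : qpow η (2 * ((a + d + 1 : ℕ) : ℂ)) = qpow η (2 * a) * qpow η (2 * ((d : ℂ) + 1)) := by
      rw [← qpow_add]; congr 1; push_cast; ring
    rw [this] at he
    exact (mul_right_eq_self₀.mp he.symm).resolve_right (qpow_ne_zero _ _)
  rcases lt_trichotomy s r with h1 | h1 | h1
  · exact absurd h (aux h1)
  · exact h1
  · exact absurd h.symm (aux h1)

/-- The zeroth string consists of equal zeros, where elements of the shuffle algebra cannot be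
evaluated as functions of sets. Spreading it to `ε, ε q², ε q⁴, ...` makes all points distinct, and
formulas are then transported to `ε → 0`. -/
theorem eventually_gridInjective (hη : 0 < η.im) {m : ℕ} {Λ : Fin n → ℂ}
    (hΛ : Λ ∈ genericWeights η n m) :
    ∀ᶠ ε in 𝓝[≠] (0 : ℂ), GridInjective η (stringBase η Λ ε) m := by
  have h1 : ∀ x ∈ Finset.range (m + 1) ×ˢ Finset.range (m + 1) ×ˢ (Finset.univ : Finset (Fin n)),
      ∀ᶠ ε in 𝓝[≠] (0 : ℂ),
      ε * qpow η (2 * (x.1 : ℂ)) ≠ qpow η (-Λ x.2.2) * qpow η (2 * (x.2.1 : ℂ)) := by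
    intro x _
    refine eventually_nhdsWithin_of_eventually_nhds ?_
    have hc : ContinuousAt (fun ε : ℂ => ε * qpow η (2 * (x.1 : ℂ))) 0 := by fun_prop
    refine hc.eventually_ne ?_
    rw [zero_mul]
    exact (mul_ne_zero (qpow_ne_zero _ _) (qpow_ne_zero _ _)).symm
  filter_upwards [(Finset.eventually_all _).mpr h1, eventually_mem_nhdsWithin] with ε hε h0
  have hε' : ∀ (j : Fin n) s r, s ≤ m → r ≤ m →
      ε * qpow η (2 * (s : ℂ)) ≠ qpow η (-Λ j) * qpow η (2 * (r : ℂ)) := fun j s r hs hr =>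
    hε (s, r, j) (by simp; omega)
  intro k l s r hs hr
  refine Fin.cases ?_ (fun j => ?_) k <;> refine Fin.cases ?_ (fun i => ?_) l
  · intro e
    exact ⟨rfl, qpow_even_injective hη (mul_left_cancel₀ h0 e)⟩
  · intro e
    exact absurd e (hε' i s r hs hr)
  · intro e
    exact absurd e.symm (hε' j r s hr hs)
  · intro e
    rcases eq_or_ne j i with rfl | hji
    · exact ⟨rfl, qpow_even_injective hη (mul_left_cancel₀ (qpow_ne_zero _ _) e)⟩
    · exact absurd e (by
        have := gridPoint_ne_gridPoint hΛ hji (a := s) (b := r) (by omega) (by omega)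
        simp only [Int.cast_natCast] at this
        exact this)

theorem tendsto_gridSet (hη : 0 < η.im) {m p : ℕ} {Λ : Fin n → ℂ} (hΛ : Λ ∈ genericWeights η n m)
    {σ : Fin (n + 1) → ℕ} (hσ : ∑ k, σ k = p) (hp : p ≤ m) {f : Shuffle η}
    (hf : Shuffle.IsRegular f) :
    Tendsto (fun ε => f (gridSet η (stringBase η Λ ε) σ)) (𝓝[≠] (0 : ℂ))
      (𝓝 (f.extend p (stringPoint η p Λ σ))) := by
  rw [stringPoint_eq_gridTuple]
  simp only [← image_gridTuple _ hσ]
  refine Shuffle.extend_eq_of_tendsto hf ?_ ?_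
  · exact ((continuous_gridTuple p Λ σ).tendsto 0).mono_left nhdsWithin_le_nhds
  · filter_upwards [eventually_gridInjective hη hΛ] with ε hε
    exact hε.gridTuple_injective hσ (by omega)

/-- This zero is what restricts shuffle products with a letter, evaluated at strings, to the ends of
the strings. -/
theorem crossFactor_eq_zero {η a b : ℂ} (h : b = a * qpow η 2) : crossFactor η a b = 0 := by
  have e : qpow η (-1) * qpow η 2 = qpow η 1 := by rw [← qpow_add]; norm_num
  rw [crossFactor, h]
  rw [show qpow η 1 * a - qpow η (-1) * (a * qpow η 2) = 0 by linear_combination -a * e, zero_div]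

theorem gridPoint_add_one (B : Fin (n + 1) → ℂ) (k : Fin (n + 1)) (s : ℕ) :
    gridPoint η B k (s + 1) = gridPoint η B k s * qpow η 2 := by
  rw [gridPoint, qpow_two_mul_natCast_succ, gridPoint, mul_assoc]

/-- Decrease the `k`-th entry by one. -/
def unbump {N : ℕ} (σ : Fin N → ℕ) (k : Fin N) : Fin N → ℕ := Function.update σ k (σ k - 1)

theorem bump_unbump {N : ℕ} {σ : Fin N → ℕ} {k : Fin N} (h : σ k ≠ 0) :
    bump (unbump σ k) k = σ := by
  funext l
  rcases eq_or_ne l k with rfl | hl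
  · rw [bump_same, unbump, Function.update_self]; omega
  · rw [bump_of_ne _ hl, unbump, Function.update_of_ne hl]

theorem unbump_bump {N : ℕ} (σ : Fin N → ℕ) (k : Fin N) : unbump (bump σ k) k = σ := by
  funext l
  rcases eq_or_ne l k with rfl | hl
  · simp [unbump]
  · rw [unbump, Function.update_of_ne hl, bump_of_ne _ hl]

/-- In a shuffle product with a letter on the left only the top points of the strings
contribute. -/
theorem letter_mul_gridSet {B : Fin (n + 1) → ℂ} {m : ℕ} (h : GridInjective η B m)
    {σ : Fin (n + 1) → ℕ} (hσ : ∀ k, σ k ≤ m) (p : ℂ → ℂ) (f : Shuffle η) :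
    (Shuffle.letter η p * f) (gridSet η B σ) = ∑ k, if σ k = 0 then 0 else
      p (gridPoint η B k (unbump σ k k)) * f (gridSet η B (unbump σ k)) *
        ∏ l, ∏ r ∈ Finset.range (unbump σ k l),
          crossFactor η (gridPoint η B k (unbump σ k k)) (gridPoint η B l r) := by
  rw [Shuffle.letter_mul, sum_gridSet h (fun k => (hσ k).trans m.le_succ)]
  refine Finset.sum_congr rfl fun k _ => ?_
  split_ifs with hk
  · rw [hk]; simp
  · obtain ⟨σ', rfl⟩ : ∃ σ', σ = bump σ' k := ⟨_, (bump_unbump hk).symm⟩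
    rw [unbump_bump, bump_same, Finset.sum_range_succ, Finset.sum_eq_zero, zero_add]
    · have hσ' : ∀ k, σ' k ≤ m := fun l => by
        have := hσ l
        rcases eq_or_ne l k with rfl | hl
        · rw [bump_same] at this; omega
        · rwa [bump_of_ne _ hl] at this
      rw [gridSet_bump, Finset.erase_insert (h.notMem hσ' k),
        prod_gridSet h fun k => (hσ' k).trans m.le_succ]
    -- A point that is not the top of its string leaves its successor in the remaining set, and the
    -- cross factor of the two vanishes.
    · intro s hs
      have hs' := Finset.mem_range.mp hs
      have hm := hσ k
      rw [bump_same] at hm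
      rw [Finset.prod_eq_zero (i := gridPoint η B k (s + 1)), mul_zero]
      · refine Finset.mem_erase.mpr ⟨fun e => ?_, mem_gridSet.mpr ⟨k, s + 1, ?_, rfl⟩⟩
        · have := (h k k (s + 1) s (by omega) (by omega) e).2
          omega
        · rw [bump_same]; omega
      · exact crossFactor_eq_zero (gridPoint_add_one B k s)

/-- Removing the bottom of the zeroth string leaves a string of the same kind based at `ε q²`. The
change of base is harmless in the limit. -/
theorem gridSet_bump_zero (Λ : Fin n → ℂ) (ε : ℂ) (σ : Fin (n + 1) → ℕ) :
    gridSet η (stringBase η Λ ε) (bump σ 0)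
      = insert ε (gridSet η (stringBase η Λ (ε * qpow η 2)) σ) := by
  have e0 : ∀ s, gridPoint η (stringBase η Λ ε) 0 (s + 1)
      = gridPoint η (stringBase η Λ (ε * qpow η 2)) 0 s := by
    intro s
    rw [gridPoint_add_one]
    simp only [gridPoint, stringBase, Fin.cons_zero]
    ring
  ext z
  rw [Finset.mem_insert, mem_gridSet, mem_gridSet]
  constructor
  · rintro ⟨l, s, hs, rfl⟩
    induction l using Fin.cases with
    | zero =>
      rcases s with _ | s
      · left; simp [gridPoint, stringBase, qpow_zero]
      · right
        rw [bump_same] at hs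
        exact ⟨0, s, by omega, (e0 s).symm⟩
    | succ j =>
      rw [bump_of_ne _ (Fin.succ_ne_zero j)] at hs
      exact Or.inr ⟨j.succ, s, hs, rfl⟩
  · rintro (rfl | ⟨l, s, hs, rfl⟩)
    · exact ⟨0, 0, by simp, by simp [gridPoint, stringBase, qpow_zero]⟩
    · induction l using Fin.cases with
      | zero => exact ⟨0, s + 1, by rw [bump_same]; omega, e0 s⟩
      | succ j => exact ⟨j.succ, s, by rwa [bump_of_ne _ (Fin.succ_ne_zero j)], rfl⟩

/-- In a shuffle product with a letter on the right which vanishes at the bottom points of the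
strings, only the bottom point of the zeroth string contributes. -/
theorem mul_letter_gridSet {m : ℕ} {Λ : Fin n → ℂ} {ε : ℂ}
    (h : GridInjective η (stringBase η Λ ε) m)
    (h' : GridInjective η (stringBase η Λ (ε * qpow η 2)) m)
    {σ : Fin (n + 1) → ℕ} (hσ : ∀ k, σ k ≤ m) {p : ℂ → ℂ} (hp : ∀ k, p (qpow η (-Λ k)) = 0)
    (f : Shuffle η) :
    (f * Shuffle.letter η p) (gridSet η (stringBase η Λ ε) σ) = if σ 0 = 0 then 0 else
      p ε * f (gridSet η (stringBase η Λ (ε * qpow η 2)) (unbump σ 0)) *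
        ∏ l, ∏ r ∈ Finset.range (unbump σ 0 l),
          crossFactor η (gridPoint η (stringBase η Λ (ε * qpow η 2)) l r) ε := by
  have hb : ∀ k, gridPoint η (stringBase η Λ ε) k 0 = stringBase η Λ ε k := by
    intro k; simp [gridPoint, qpow_zero]
  -- The bottoms of the other strings are zeros of `p`. Every higher point leaves its predecessor in
  -- the remaining set, and their cross factor vanishes.
  have hz : ∀ k, ∀ s < σ k, (k = 0 → s ≠ 0) →
      p (gridPoint η (stringBase η Λ ε) k s) *
      f ((gridSet η (stringBase η Λ ε) σ).erase (gridPoint η (stringBase η Λ ε) k s)) *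
      ∏ y ∈ (gridSet η (stringBase η Λ ε) σ).erase (gridPoint η (stringBase η Λ ε) k s),
        crossFactor η y (gridPoint η (stringBase η Λ ε) k s) = 0 := by
    intro k s hs hks
    rcases s with _ | s
    · obtain ⟨j, rfl⟩ := Fin.exists_succ_eq.mpr fun hk : k = 0 => hks hk rfl
      rw [hb, stringBase, Fin.cons_succ, hp, zero_mul, zero_mul]
    · have := hσ k
      rw [Finset.prod_eq_zero (i := gridPoint η (stringBase η Λ ε) k s), mul_zero]
      · refine Finset.mem_erase.mpr ⟨fun e => ?_, mem_gridSet.mpr ⟨k, s, by omega, rfl⟩⟩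
        have := (h k k s (s + 1) (by omega) (by omega) e).2
        omega
      · exact crossFactor_eq_zero (gridPoint_add_one _ k s)
  rw [Shuffle.mul_letter, sum_gridSet h (fun k => (hσ k).trans m.le_succ), Fin.sum_univ_succ,
    Finset.sum_eq_zero (s := (Finset.univ : Finset (Fin n))), add_zero]
  · split_ifs with h0
    · rw [h0]; simp
    · obtain ⟨σ', rfl⟩ : ∃ σ', σ = bump σ' 0 := ⟨_, (bump_unbump h0).symm⟩
      have hσ' : ∀ k, σ' k ≤ m := fun l => by
        have := hσ l
        rcases eq_or_ne l 0 with rfl | hl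
        · rw [bump_same] at this; omega
        · rwa [bump_of_ne _ hl] at this
      have hnot : ε ∉ gridSet η (stringBase η Λ (ε * qpow η 2)) σ' := by
        intro hm
        obtain ⟨l, s, hs, e⟩ := mem_gridSet.mp hm
        have hl := hσ l
        induction l using Fin.cases with
        | zero =>
          rw [bump_same] at hl
          have e' : gridPoint η (stringBase η Λ ε) 0 (s + 1) = gridPoint η (stringBase η Λ ε) 0 0 := by
            rw [hb, gridPoint_add_one]
            simp only [gridPoint, stringBase, Fin.cons_zero] at e ⊢
            linear_combination e
          have := (h 0 0 (s + 1) 0 (by omega) (by omega) e').2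
          omega
        | succ j =>
          rw [bump_of_ne _ (Fin.succ_ne_zero j)] at hl
          have e' : gridPoint η (stringBase η Λ ε) j.succ s = gridPoint η (stringBase η Λ ε) 0 0 := by
            rw [hb, gridPoint_succ, ← gridPoint_succ (ε * qpow η 2), e]
            rfl
          exact Fin.succ_ne_zero j (h _ _ _ _ (by omega) (by omega) e').1
      rw [unbump_bump, bump_same, Finset.sum_eq_single 0]
      · have e0 : gridPoint η (stringBase η Λ ε) 0 0 = ε := by rw [hb]; rfl
        rw [e0, gridSet_bump_zero, Finset.erase_insert hnot,
          prod_gridSet h' fun k => (hσ' k).trans m.le_succ]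
      · intro s hs hs0
        exact hz 0 s (by simpa using hs) fun _ => hs0
      · intro hc
        exact absurd (Finset.mem_range.mpr (Nat.succ_pos _)) hc
  · intro j _
    exact Finset.sum_eq_zero fun s hs =>
      hz j.succ s (Finset.mem_range.mp hs) fun hj => absurd hj (Fin.succ_ne_zero j)

end

/-! ### Shuffle products with a letter at degenerate strings -/

section

variable {η : ℂ} {n : ℕ}

theorem crossFactor_mul_qpow (hη : 0 < η.im) {a : ℂ} (ha : a ≠ 0) (s : ℕ) :
    crossFactor η (a * qpow η (2 * ((s : ℂ) + 1))) a
      = qnum η ((s + 1 : ℕ) + 1) / qnum η ((s : ℂ) + 1) := by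
  have h1 := q_sub_ne_zero hη
  have h2 := sub_ne_zero.mpr (qpow_natCast_ne hη s)
  have e1 : qpow η (2 * ((s : ℂ) + 1)) = qpow η ((s : ℂ) + 1) * qpow η ((s : ℂ) + 1) := by
    rw [← qpow_add]; congr 1; ring
  have e2 : qpow η (((s + 1 : ℕ) : ℂ) + 1) = qpow η ((s : ℂ) + 1) * qpow η 1 := by
    rw [← qpow_add]; congr 1; push_cast; ring
  have e3 : qpow η (-(((s + 1 : ℕ) : ℂ) + 1)) = qpow η (-((s : ℂ) + 1)) * qpow η (-1) := by
    rw [← qpow_add]; congr 1; push_cast; ring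
  have e4 := qpow_mul_qpow_neg η ((s : ℂ) + 1)
  have e5 := qpow_mul_qpow_neg η 1
  rw [crossFactor, qnum, qnum, e1, e2, e3, div_div_div_cancel_right₀ h1]
  generalize qpow η ((s : ℂ) + 1) = u at *
  generalize qpow η (-((s : ℂ) + 1)) = v at *
  have h3 : a * (u * u) - a ≠ 0 := by
    have : a * (u * u) - a = a * u * (u - v) := by linear_combination a * e4
    rw [this]
    refine mul_ne_zero (mul_ne_zero ha ?_) h2
    rintro rfl
    simp at e4
  rw [div_eq_div_iff h3 h2]
  linear_combination (qpow η (-1) * a * u - qpow η 1 * a * u) * e4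

/-- Each factor is a quotient `[s + 2] / [s + 1]`, so the product telescopes. By homogeneity it does
not depend on `a`, and it therefore passes to the limit of a string shrinking to `0`. -/
theorem prod_crossFactor_bottom (hη : 0 < η.im) {a : ℂ} (ha : a ≠ 0) (S : ℕ) :
    ∏ s ∈ Finset.range S, crossFactor η (a * qpow η (2 * ((s : ℂ) + 1))) a
      = qnum η ((S : ℂ) + 1) := by
  induction S with
  | zero => simp [qnum_one hη]
  | succ S ih =>
    rw [Finset.prod_range_succ, ih, crossFactor_mul_qpow hη ha, mul_div_cancel₀]
    exact qnum_succ_ne_zero hη S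

theorem prod_crossFactor_top (hη : 0 < η.im) {a : ℂ} (ha : a ≠ 0) (S : ℕ) :
    ∏ s ∈ Finset.range S, crossFactor η (a * qpow η (2 * (S : ℂ))) (a * qpow η (2 * (s : ℂ)))
      = qnum η ((S : ℂ) + 1) := by
  rw [← prod_crossFactor_bottom hη (one_ne_zero) S, ← Finset.prod_range_reflect]
  refine Finset.prod_congr rfl fun s hs => ?_
  have hs' := Finset.mem_range.mp hs
  obtain ⟨r, rfl⟩ := Nat.exists_eq_add_of_lt hs'
  have e : s + r + 1 - 1 - s = r := by omega
  have e2 : a * qpow η (2 * ((s + r + 1 : ℕ) : ℂ))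
      = (a * qpow η (2 * (r : ℂ))) * qpow η (2 * ((s : ℂ) + 1)) := by
    rw [mul_assoc, ← qpow_add]; congr 2; push_cast; ring
  rw [e, e2, crossFactor_mul_qpow hη (mul_ne_zero ha (qpow_ne_zero _ _)),
    crossFactor_mul_qpow hη one_ne_zero]

theorem continuousAt_crossFactor {ι : Type*} [TopologicalSpace ι] {u v : ι → ℂ} {e : ι}
    (hu : ContinuousAt u e) (hv : ContinuousAt v e) (h : u e ≠ v e) :
    ContinuousAt (fun i => crossFactor η (u i) (v i)) e :=
  ContinuousAt.div (by fun_prop) (by fun_prop) (sub_ne_zero.mpr h)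

theorem continuous_gridPoint (Λ : Fin n → ℂ) (k : Fin (n + 1)) (s : ℕ) :
    Continuous fun ε => gridPoint η (stringBase η Λ ε) k s := by
  refine Fin.cases ?_ (fun j => ?_) k
  · simp only [gridPoint, stringBase, Fin.cons_zero]
    fun_prop
  · simp only [gridPoint_succ]
    fun_prop

theorem gridPoint_succ_ne_zero (ε : ℂ) (Λ : Fin n → ℂ) (j : Fin n) (s : ℕ) :
    gridPoint η (stringBase η Λ ε) j.succ s ≠ 0 :=
  mul_ne_zero (qpow_ne_zero _ _) (qpow_ne_zero _ _)

/-- The coefficient with which the top point of the `k`-th string contributes to a shuffle product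
with a letter on the left. -/
def topCoeff (η : ℂ) {n : ℕ} (Λ : Fin n → ℂ) (p : ℂ → ℂ) (σ : Fin (n + 1) → ℕ)
    (k : Fin (n + 1)) : ℂ :=
  p (gridPoint η (stringBase η Λ 0) k (σ k)) * qnum η ((σ k : ℂ) + 1) *
    ∏ l ∈ Finset.univ.erase k, ∏ r ∈ Finset.range (σ l),
      crossFactor η (gridPoint η (stringBase η Λ 0) k (σ k)) (gridPoint η (stringBase η Λ 0) l r)

theorem gridPoint_zero_ne {m : ℕ} {Λ : Fin n → ℂ} (hΛ : Λ ∈ genericWeights η n m)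
    {k l : Fin (n + 1)} (hkl : k ≠ l) {s r : ℕ} (hs : s ≤ m) (hr : r ≤ m) :
    gridPoint η (stringBase η Λ 0) k s ≠ gridPoint η (stringBase η Λ 0) l r := by
  induction k using Fin.cases with
  | zero =>
    obtain ⟨j, rfl⟩ := Fin.exists_succ_eq.mpr hkl.symm
    rw [gridPoint_zero_left]
    exact (gridPoint_succ_ne_zero 0 Λ j r).symm
  | succ i =>
    induction l using Fin.cases with
    | zero =>
      rw [gridPoint_zero_left]
      exact gridPoint_succ_ne_zero 0 Λ i s
    | succ j =>
      have := gridPoint_ne_gridPoint hΛ (fun h : i = j => hkl (by rw [h])) (a := s) (b := r)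
        (by omega) (by omega)
      simp only [Int.cast_natCast] at this
      exact this

theorem le_of_sum_eq {N p : ℕ} {σ : Fin N → ℕ} (h : ∑ k, σ k = p) (k : Fin N) : σ k ≤ p :=
  h ▸ Finset.single_le_sum (f := σ) (fun _ _ => Nat.zero_le _) (Finset.mem_univ k)

theorem sum_unbump {N p : ℕ} {σ : Fin N → ℕ} {k : Fin N} (hk : σ k ≠ 0)
    (h : ∑ k, σ k = p + 1) : ∑ l, unbump σ k l = p := by
  have := sum_bump (unbump σ k) k
  rw [bump_unbump hk] at this
  omega

/-- This is the limit `ε → 0` of `letter_mul_gridSet`. Cross factors within a string give a quantum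
number independent of `ε`; those between different strings are continuous at `ε = 0` because such
points stay apart for generic weights. -/
theorem extend_letter_mul (hη : 0 < η.im) {m p : ℕ} {Λ : Fin n → ℂ} (hΛ : Λ ∈ genericWeights η n m)
    {σ : Fin (n + 1) → ℕ} (hσ : ∑ k, σ k = p + 1) (hp : p + 1 ≤ m) {a : ℂ → ℂ} (ha : Continuous a)
    {f : Shuffle η} (hf : Shuffle.IsRegular f)
    (haf : Shuffle.IsRegular (Shuffle.letter η a * f)) :
    (Shuffle.letter η a * f).extend (p + 1) (stringPoint η (p + 1) Λ σ)
      = ∑ k, if σ k = 0 then 0 else topCoeff η Λ a (unbump σ k) k *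
          f.extend p (stringPoint η p Λ (unbump σ k)) := by
  refine tendsto_nhds_unique (tendsto_gridSet hη hΛ hσ hp haf) ?_
  have h1 : ∀ᶠ ε in 𝓝[≠] (0 : ℂ), (∑ k, if σ k = 0 then 0 else
      a (gridPoint η (stringBase η Λ ε) k (unbump σ k k)) *
        f (gridSet η (stringBase η Λ ε) (unbump σ k)) * (qnum η ((unbump σ k k : ℂ) + 1) *
        ∏ l ∈ Finset.univ.erase k, ∏ r ∈ Finset.range (unbump σ k l),
          crossFactor η (gridPoint η (stringBase η Λ ε) k (unbump σ k k))
            (gridPoint η (stringBase η Λ ε) l r)))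
      = (Shuffle.letter η a * f) (gridSet η (stringBase η Λ ε) σ) := by
    filter_upwards [eventually_gridInjective hη hΛ, eventually_mem_nhdsWithin] with ε hε h0
    rw [letter_mul_gridSet hε fun k => (le_of_sum_eq hσ k).trans hp]
    refine Finset.sum_congr rfl fun k _ => ?_
    split_ifs with hk
    · rfl
    · rw [← Finset.mul_prod_erase _ _ (Finset.mem_univ k)]
      simp only [gridPoint]
      rw [prod_crossFactor_top hη]
      induction k using Fin.cases with
      | zero => exact h0
      | succ j => exact qpow_ne_zero _ _
  refine Tendsto.congr' h1 (tendsto_finsetSum _ fun k _ => ?_)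
  split_ifs with hk
  · exact tendsto_const_nhds
  · have hs := sum_unbump hk hσ
    have hlim := tendsto_gridSet hη hΛ hs (by omega) hf
    have e : topCoeff η Λ a (unbump σ k) k * f.extend p (stringPoint η p Λ (unbump σ k))
        = a (gridPoint η (stringBase η Λ 0) k (unbump σ k k)) *
          f.extend p (stringPoint η p Λ (unbump σ k)) * (qnum η ((unbump σ k k : ℂ) + 1) *
          ∏ l ∈ Finset.univ.erase k, ∏ r ∈ Finset.range (unbump σ k l),
          crossFactor η (gridPoint η (stringBase η Λ 0) k (unbump σ k k))
            (gridPoint η (stringBase η Λ 0) l r)) := by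
      rw [topCoeff]; ring
    rw [e]
    refine ((((ha.comp (continuous_gridPoint Λ k _)).tendsto 0).mono_left
      nhdsWithin_le_nhds).mul hlim).mul (tendsto_const_nhds.mul ?_)
    refine tendsto_finsetProd _ fun l hl => tendsto_finsetProd _ fun r hr => ?_
    refine ContinuousAt.tendsto (f := fun ε => crossFactor η (gridPoint η (stringBase η Λ ε) k
      (unbump σ k k)) (gridPoint η (stringBase η Λ ε) l r)) ?_ |>.mono_left nhdsWithin_le_nhds
    refine continuousAt_crossFactor (continuous_gridPoint Λ k _).continuousAt
      (continuous_gridPoint Λ l _).continuousAt ?_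
    have h2 := le_of_sum_eq hs k
    have h3 := le_of_sum_eq hs l
    have h4 := Finset.mem_range.mp hr
    exact gridPoint_zero_ne hΛ (Finset.ne_of_mem_erase hl).symm (by omega) (by omega)

/-- This is the limit `ε → 0` of `mul_letter_gridSet`. Each cross factor of a nonzero point with the
vanishing bottom point tends to `q`; the remaining zeroth string is based at `ε q²`, which also
tends to `0`. -/
theorem extend_mul_letter (hη : 0 < η.im) {m p : ℕ} {Λ : Fin n → ℂ} (hΛ : Λ ∈ genericWeights η n m)
    {σ : Fin (n + 1) → ℕ} (hσ : ∑ k, σ k = p + 1) (hp : p + 1 ≤ m) {b : ℂ → ℂ} (hb : Continuous b)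
    (hb0 : ∀ k, b (qpow η (-Λ k)) = 0)
    {f : Shuffle η} (hf : Shuffle.IsRegular f)
    (hfb : Shuffle.IsRegular (f * Shuffle.letter η b)) :
    (f * Shuffle.letter η b).extend (p + 1) (stringPoint η (p + 1) Λ σ)
      = if σ 0 = 0 then 0 else b 0 * (qnum η ((unbump σ 0 0 : ℂ) + 1) *
          ∏ j : Fin n, qpow η 1 ^ unbump σ 0 j.succ) *
          f.extend p (stringPoint η p Λ (unbump σ 0)) := by
  refine tendsto_nhds_unique (tendsto_gridSet hη hΛ hσ hp hfb) ?_
  have hscale : Tendsto (fun ε : ℂ => ε * qpow η 2) (𝓝[≠] 0) (𝓝[≠] 0) := by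
    refine tendsto_nhdsWithin_iff.mpr ⟨?_, ?_⟩
    · have : Tendsto (fun ε : ℂ => ε * qpow η 2) (𝓝 0) (𝓝 0) := by
        have hc : Continuous fun ε : ℂ => ε * qpow η 2 := by fun_prop
        simpa using hc.tendsto 0
      exact this.mono_left nhdsWithin_le_nhds
    · filter_upwards [eventually_mem_nhdsWithin] with ε h0
      exact mul_ne_zero h0 (qpow_ne_zero _ _)
  have h1 : ∀ᶠ ε in 𝓝[≠] (0 : ℂ), (if σ 0 = 0 then 0 else
      b ε * (qnum η ((unbump σ 0 0 : ℂ) + 1) * ∏ j : Fin n, ∏ r ∈ Finset.range (unbump σ 0 j.succ),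
          crossFactor η (gridPoint η (stringBase η Λ 0) j.succ r) ε) *
        f (gridSet η (stringBase η Λ (ε * qpow η 2)) (unbump σ 0)))
      = (f * Shuffle.letter η b) (gridSet η (stringBase η Λ ε) σ) := by
    filter_upwards [eventually_gridInjective hη hΛ,
      hscale.eventually (eventually_gridInjective hη hΛ), eventually_mem_nhdsWithin] with ε hε hε' h0
    rw [mul_letter_gridSet hε hε' (fun k => (le_of_sum_eq hσ k).trans hp) hb0]
    split_ifs with hk
    · rfl
    · rw [Fin.prod_univ_succ]
      have : ∏ r ∈ Finset.range (unbump σ 0 0),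
          crossFactor η (gridPoint η (stringBase η Λ (ε * qpow η 2)) 0 r) ε
          = qnum η ((unbump σ 0 0 : ℂ) + 1) := by
        rw [← prod_crossFactor_bottom hη h0]
        refine Finset.prod_congr rfl fun r _ => ?_
        congr 1
        simp only [gridPoint, stringBase, Fin.cons_zero]
        rw [mul_assoc, ← qpow_add]
        congr 2
        ring
      rw [this]
      simp only [gridPoint_succ]
      ring
  refine Tendsto.congr' h1 ?_
  split_ifs with hk
  · exact tendsto_const_nhds
  · have hs := sum_unbump hk hσ
    refine (((hb.tendsto 0).mono_left nhdsWithin_le_nhds).mul (tendsto_const_nhds.mul ?_)).mul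
      ((tendsto_gridSet hη hΛ hs (by omega) hf).comp hscale)
    refine tendsto_finsetProd _ fun j _ => ?_
    rw [← Finset.card_range (unbump σ 0 j.succ), ← Finset.prod_const, Finset.card_range]
    refine tendsto_finsetProd _ fun r _ => ?_
    rw [← crossFactor_zero_right η (gridPoint_succ_ne_zero 0 Λ j r)]
    exact (continuousAt_crossFactor continuousAt_const continuousAt_id
      (gridPoint_succ_ne_zero 0 Λ j r)).tendsto.mono_left nhdsWithin_le_nhds

/-- The combinatorial coefficient of the zeroth string. -/
def zeroCoeff (η : ℂ) (s : ℕ) : ℂ := qpow η ((s : ℂ) * ((s : ℂ) - 1) / 2) / qfact η s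

theorem pairing_eq_sum (hη : 0 < η.im) {m : ℕ} {Λ : Fin n → ℂ} (hΛ : Λ ∈ genericWeights η n m)
    (f g : (Fin m → ℂ) → ℂ) :
    pairing η Λ f g = ∑ σ ∈ Finset.Nat.antidiagonalTuple (n + 1) m,
      zeroCoeff η (σ 0) * gridResidue η Λ σ * f (stringPoint η m Λ σ) *
        g (stringPoint η m Λ σ) := by
  refine Finset.sum_congr rfl fun σ hσ => ?_
  have hσ' := Finset.Nat.mem_antidiagonalTuple.mp hσ
  have h := multiResidue_eq_of_residueChain (m := m)
    (by rw [length_gridList, hσ']) (residueChain_gridList hη hΛ m σ hσ' le_rfl)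
    (fun _ => 1) (fun _ _ => analyticAt_const) 1
  have e : multiResidue m (fun t => Omega η Λ t / ∏ i, t i) (stringPoint η m Λ σ)
      = gridResidue η Λ σ := by
    rw [stringPoint_eq_gridTuple]
    simp only [Omega_div_eq]
    simp only [one_mul, List.map_const', List.prod_replicate, one_pow] at h
    exact h
  rw [e, zeroCoeff]
  ring

end

section

variable {η : ℂ} {n : ℕ}

/-! ### Weight functions as shuffle products -/

namespace Shuffle

theorem prod_block_apply_image (p : Fin n → ℂ → ℂ) (μ : Fin n → ℕ) {m : ℕ} {t : Fin m → ℂ}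
    (ht : Function.Injective t) :
    (List.ofFn fun k => block η (p k) (μ k)).prod (Finset.univ.image t)
      = ∑ c ∈ partitions μ, (∏ i, ∏ j, if c i < c j then crossFactor η (t i) (t j) else 1) *
        ∏ i, p (c i) (t i) := by
  rw [prod_ofFn_apply_image _ t ht, partitions, Finset.sum_filter]
  refine Finset.sum_congr rfl fun c _ => ?_
  simp only [block_apply, Finset.card_image_of_injective _ ht, Finset.prod_image ht.injOn]
  split_ifs with h
  · rw [Finset.prod_congr rfl fun k _ => if_pos (h k)]
    congr 1
    rw [← Finset.prod_fiberwise (Finset.univ : Finset (Fin m)) c]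
    refine Finset.prod_congr rfl fun k _ => Finset.prod_congr rfl fun i hi => ?_
    rw [(Finset.mem_filter.mp hi).2]
  · push Not at h
    obtain ⟨k, hk⟩ := h
    rw [Finset.prod_eq_zero (Finset.mem_univ k) (if_neg hk), mul_zero]

/-- The dual weight functions have their cross factors in the opposite order of sites, so they are
shuffle products of the blocks taken from the last site to the first. -/
theorem prod_block_rev_apply_image (p : Fin n → ℂ → ℂ) (μ : Fin n → ℕ) {m : ℕ} {t : Fin m → ℂ}
    (ht : Function.Injective t) :
    (List.ofFn fun k => block η (p (Fin.rev k)) (μ (Fin.rev k))).prod (Finset.univ.image t)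
      = ∑ c ∈ partitions μ, (∏ i, ∏ j, if c j < c i then crossFactor η (t i) (t j) else 1) *
        ∏ i, p (c i) (t i) := by
  rw [prod_block_apply_image (fun k => p (Fin.rev k)) (fun k => μ (Fin.rev k)) ht]
  refine Finset.sum_nbij' (fun c i => Fin.rev (c i)) (fun c i => Fin.rev (c i)) ?_ ?_ ?_ ?_ ?_
  · intro c hc
    simp only [partitions, Finset.mem_filter, Finset.mem_univ, true_and] at hc ⊢
    intro k
    simpa [Fin.rev_eq_iff] using hc (Fin.rev k)
  · intro c hc
    simp only [partitions, Finset.mem_filter, Finset.mem_univ, true_and] at hc ⊢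
    intro k
    simpa [Fin.rev_eq_iff] using hc (Fin.rev k)
  · intro c _; simp
  · intro c _; simp
  · intro c _
    simp only [Fin.rev_lt_rev]

theorem isRegular_prod {N : ℕ} {f : Fin N → Shuffle η} (hf : ∀ k, IsRegular (f k)) :
    IsRegular (List.ofFn f).prod := by
  have : (List.ofFn f).prod ∈ regular η := by
    refine list_prod_mem fun g hg => ?_
    obtain ⟨k, rfl⟩ := List.mem_ofFn.mp hg
    exact hf k
  exact this

end Shuffle

/-! ### The dual weight function as a polynomial in one variable -/

open Polynomial in
theorem coeff_prod_linear {ι : Type*} [Fintype ι] (a b : ι → ℂ) :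
    (∏ i, (C (a i) * X - C (b i))).natDegree ≤ Fintype.card ι ∧
    (∏ i, (C (a i) * X - C (b i))).coeff (Fintype.card ι) = ∏ i, a i := by
  have h : ∀ i, (C (a i) * X - C (b i)).natDegree ≤ 1 := fun i => by
    refine (natDegree_sub_le _ _).trans (max_le ?_ (by simp))
    exact (natDegree_C_mul_le _ _).trans natDegree_X_le
  constructor
  · refine (natDegree_prod_le _ _).trans ?_
    refine (Finset.sum_le_sum fun i _ => h i).trans ?_
    simp
  · have := coeff_prod_of_natDegree_le (s := Finset.univ) (fun i => C (a i) * X - C (b i)) 1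
      (fun i _ => h i)
    rw [mul_one, Finset.card_univ] at this
    rw [this]
    refine Finset.prod_congr rfl fun i _ => ?_
    simp [coeff_C]

theorem prod_split {M : Type*} [CommMonoid M] (k : Fin n) (f : Fin n → M) :
    ∏ l, f l = f k * ((∏ l ∈ Finset.Ioi k, f l) * ∏ l ∈ Finset.Iio k, f l) := by
  rw [← Finset.mul_prod_erase _ _ (Finset.mem_univ k), ← Finset.prod_union]
  · congr 2
    ext l
    simp only [Finset.mem_erase, Finset.mem_univ, and_true, Finset.mem_union, Finset.mem_Ioi,
      Finset.mem_Iio]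
    exact ⟨fun h => (lt_or_gt_of_ne h).symm, fun h => h.elim (fun h => h.ne') fun h => h.ne⟩
  · exact Finset.disjoint_left.mpr fun a ha hb =>
      (Finset.mem_Iio.mp hb).not_gt (Finset.mem_Ioi.mp ha)

/-- The one-variable factor of the dual weight function. -/
def dualLetter (η : ℂ) (μ : Fin n → ℕ) (x : ℂ) (Λ : Fin n → ℂ) (k : Fin n) (z : ℂ) : ℂ :=
  (qpow η (-x + μ k + ∑ l ∈ Finset.Iic k, (Λ l - 2 * μ l)) * z
      - qpow η (x + μ k + ∑ l ∈ Finset.Ici k, (Λ l - 2 * μ l))) *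
    (∏ l ∈ Finset.Ioi k, (qpow η (Λ l) * z - 1)) * ∏ l ∈ Finset.Iio k, (z - qpow η (Λ l))

/-- The dual weight function as an element of the shuffle algebra. -/
def dualWeight (η : ℂ) (μ : Fin n → ℕ) (x : ℂ) (Λ : Fin n → ℂ) : Shuffle η :=
  weightPrefactor η (∑ k, μ k) μ • (List.ofFn fun k : Fin n =>
    Shuffle.block η (dualLetter η μ x Λ (Fin.rev k)) (μ (Fin.rev k))).prod

theorem isRegular_dualWeight (μ : Fin n → ℕ) (x : ℂ) (Λ : Fin n → ℂ) :
    Shuffle.IsRegular (dualWeight η μ x Λ) := by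
  refine Shuffle.IsRegular.smul _ (Shuffle.isRegular_prod fun k => ?_)
  have := Shuffle.isRegular_block (η := η) ((Polynomial.C
      (qpow η (-x + μ k.rev + ∑ l ∈ Finset.Iic k.rev, (Λ l - 2 * μ l))) * Polynomial.X
      - Polynomial.C (qpow η (x + μ k.rev + ∑ l ∈ Finset.Ici k.rev, (Λ l - 2 * μ l)))) *
    (∏ l ∈ Finset.Ioi k.rev, (Polynomial.C (qpow η (Λ l)) * Polynomial.X - 1)) *
    ∏ l ∈ Finset.Iio k.rev, (Polynomial.X - Polynomial.C (qpow η (Λ l)))) (μ k.rev)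
  simp only [Polynomial.eval_mul, Polynomial.eval_sub, Polynomial.eval_C,
    Polynomial.eval_X, Polynomial.eval_one, Polynomial.eval_prod] at this
  exact this

theorem dualWeight_apply_image (μ : Fin n → ℕ) (x : ℂ) (Λ : Fin n → ℂ) {m : ℕ}
    (hμ : ∑ k, μ k = m) {t : Fin m → ℂ} (ht : Function.Injective t) :
    dualWeight η μ x Λ (Finset.univ.image t) = weightPrefactor η m μ * ∑ c ∈ partitions μ,
      (∏ i, ∏ j, if c j < c i then crossFactor η (t i) (t j) else 1) *
        ∏ i, dualLetter η μ x Λ (c i) (t i) := by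
  rw [dualWeight, Shuffle.smul_apply, Shuffle.prod_block_rev_apply_image _ _ ht, hμ]

theorem extendPoly_congr {m : ℕ} {f g : (Fin m → ℂ) → ℂ} {P : MvPolynomial (Fin m) ℂ}
    (hg : ∀ t, Function.Injective t → g t = MvPolynomial.eval t P)
    (h : ∀ t, Function.Injective t → f t = g t) : extendPoly f = extendPoly g := by
  funext t
  rw [extendPoly_eq_eval hg, extendPoly_eq_eval fun t ht => (h t ht).trans (hg t ht)]

theorem dualWeightW_eq_extend (μ : Fin n → ℕ) (x : ℂ) (Λ : Fin n → ℂ) {m : ℕ}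
    (hμ : ∑ k, μ k = m) : dualWeightW η μ x Λ = (dualWeight η μ x Λ).extend m := by
  obtain ⟨P, -, hP⟩ := (isRegular_dualWeight (η := η) μ x Λ).exists_extend m
  refine extendPoly_congr hP fun t ht => ?_
  rw [dualWeight_apply_image μ x Λ hμ ht]
  rfl

theorem qpow_sum {ι : Type*} (s : Finset ι) (f : ι → ℂ) :
    qpow η (∑ i ∈ s, f i) = ∏ i ∈ s, qpow η (f i) := by
  simp only [qpow, Finset.mul_sum, Complex.exp_sum]

/-- The numerator of the contribution of a coloring to the dual weight function, as a polynomial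
in the first variable. -/
theorem exists_numerator (μ : Fin n → ℕ) (x : ℂ) (Λ : Fin n → ℂ) {p : ℕ} (t : Fin p → ℂ)
    {c : Fin (p + 1) → Fin n} (hc : c ∈ partitions μ) :
    ∃ N : Polynomial ℂ, N.natDegree ≤ n + p ∧
      (∀ z, (∀ j, z ≠ t j) → N.eval z = ((∏ i, ∏ j, if c j < c i then
          crossFactor η ((Fin.cons z t : Fin (p + 1) → ℂ) i) ((Fin.cons z t : Fin (p + 1) → ℂ) j)
          else 1) * ∏ i, dualLetter η μ x Λ (c i) ((Fin.cons z t : Fin (p + 1) → ℂ) i)) *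
          ∏ j, (z - t j)) ∧
      N.coeff (n + p) * ∏ j, (-t j) = (-1) ^ n * qpow η (-(2 * x)) * N.eval 0 := by
  set k := c 0 with hk
  set u := qpow η (-x + μ k + ∑ l ∈ Finset.Iic k, (Λ l - 2 * μ l)) with hu
  set w := qpow η (x + μ k + ∑ l ∈ Finset.Ici k, (Λ l - 2 * μ l)) with hw
  -- The cross factor of the first variable `z` with a point `t_j` of color `l` is `(q^F z - q^(-F)
  -- t_j) / (z - t_j)`, whichever of the two arguments comes first; equal colors give no factor.
  set F : Fin n → ℂ := fun l => if l < k then 1 else if k < l then -1 else 0 with hF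
  -- The one-variable factor at `z` is the product of the `n` linear forms `a l * z - b l`, the one
  -- with `l = k` carrying the dependence on `x`.
  set a : Fin n → ℂ := fun l => if l < k then 1 else if k < l then qpow η (Λ l) else u with ha
  set b : Fin n → ℂ := fun l => if l < k then qpow η (Λ l) else if k < l then 1 else w with hb
  set rest := (∏ i : Fin p, ∏ j : Fin p, if c j.succ < c i.succ then crossFactor η (t i) (t j) else 1)
    * ∏ i : Fin p, dualLetter η μ x Λ (c i.succ) (t i) with hrest
  have e5 := qpow_mul_qpow_neg η 1
  set N1 : Polynomial ℂ := ∏ l, (Polynomial.C (a l) * Polynomial.X - Polynomial.C (b l)) with hN1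
  set N2 : Polynomial ℂ := ∏ j : Fin p, (Polynomial.C (qpow η (F (c j.succ))) * Polynomial.X -
    Polynomial.C (qpow η (-F (c j.succ)) * t j)) with hN2
  obtain ⟨d1, l1⟩ := coeff_prod_linear a b
  obtain ⟨d2, l2⟩ := coeff_prod_linear (fun j : Fin p => qpow η (F (c j.succ)))
    (fun j => qpow η (-F (c j.succ)) * t j)
  rw [Fintype.card_fin] at d1 l1 d2 l2
  have hletter : ∀ z, N1.eval z = dualLetter η μ x Λ k z := by
    intro z
    rw [hN1, Polynomial.eval_prod, prod_split k, dualLetter, mul_assoc]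
    congr 1
    · simp [ha, hb, hu, hw]
    · congr 1
      · refine Finset.prod_congr rfl fun l hl => ?_
        have hl := Finset.mem_Ioi.mp hl
        simp [ha, hb, hl, hl.not_gt]
      · refine Finset.prod_congr rfl fun l hl => ?_
        have hl := Finset.mem_Iio.mp hl
        simp [ha, hb, hl]
  refine ⟨Polynomial.C rest * (N1 * N2), ?_, ?_, ?_⟩
  · refine (Polynomial.natDegree_C_mul_le _ _).trans ?_
    exact Polynomial.natDegree_mul_le.trans (Nat.add_le_add d1 d2)
  · intro z hz
    have h2 : N2.eval z = ((∏ j : Fin p, if c j.succ < k then crossFactor η z (t j) else 1) *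
        ∏ i : Fin p, if k < c i.succ then crossFactor η (t i) z else 1) * ∏ j, (z - t j) := by
      rw [hN2, Polynomial.eval_prod, ← Finset.prod_mul_distrib, ← Finset.prod_mul_distrib]
      refine Finset.prod_congr rfl fun j _ => ?_
      have h1 := sub_ne_zero.mpr (hz j)
      have h3 := sub_ne_zero.mpr (hz j).symm
      simp only [hF, crossFactor]
      rcases lt_trichotomy (c j.succ) k with h | h | h
      · simp only [h, h.not_gt, if_true, if_false]
        simp only [Polynomial.eval_sub, Polynomial.eval_mul, Polynomial.eval_C, Polynomial.eval_X]
        rw [mul_one, div_mul_cancel₀ _ h1]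
      · simp [h, qpow_zero]
      · simp only [h, h.not_gt, if_true, if_false, neg_neg]
        simp only [Polynomial.eval_sub, Polynomial.eval_mul, Polynomial.eval_C, Polynomial.eval_X]
        rw [one_mul, ← neg_sub (t j) z, mul_neg, div_mul_cancel₀ _ h3]
        ring
    rw [Polynomial.eval_mul, Polynomial.eval_mul, Polynomial.eval_C, h2, hletter]
    simp only [Fin.prod_univ_succ, Fin.cons_zero, Fin.cons_succ, lt_irrefl, if_false, one_mul,
      ← hk, Finset.prod_mul_distrib, hrest]
    ring
  · have hcoef : (N1 * N2).coeff (n + p) = (∏ l, a l) * ∏ j : Fin p, qpow η (F (c j.succ)) := by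
      rw [Polynomial.coeff_mul_add_eq_of_natDegree_le d1 d2, l1, l2]
    have hz1 : N1.eval 0 = (-1) ^ n * ∏ l, b l := by
      simp [hN1, Polynomial.eval_prod, Finset.prod_neg]
    have hz2 : N2.eval 0 = ∏ j : Fin p, (qpow η (-F (c j.succ)) * (-t j)) := by
      simp [hN2, Polynomial.eval_prod]
    have hsum : ∑ j : Fin p, F (c j.succ)
        = ∑ l ∈ Finset.Iio k, (μ l : ℂ) - ∑ l ∈ Finset.Ioi k, (μ l : ℂ) := by
      have h0 : ∑ i, F (c i) = ∑ j : Fin p, F (c j.succ) := by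
        rw [Fin.sum_univ_succ, ← hk]; simp [hF]
      rw [← h0, ← Finset.sum_fiberwise (Finset.univ : Finset (Fin (p + 1))) c]
      have h1 : ∀ l, ∑ i ∈ Finset.univ.filter (fun i => c i = l), F (c i) = μ l * F l := by
        intro l
        rw [Finset.sum_congr rfl fun i hi => by rw [(Finset.mem_filter.mp hi).2],
          Finset.sum_const, (Finset.mem_filter.mp hc).2 l, nsmul_eq_mul]
      rw [Finset.sum_congr rfl fun l _ => h1 l, ← Finset.sum_filter_add_sum_filter_not _ (· < k)]
      rw [sub_eq_add_neg]
      congr 1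
      · have : Finset.univ.filter (· < k) = Finset.Iio k := by ext; simp
        rw [this]
        refine Finset.sum_congr rfl fun l hl => ?_
        simp [hF, Finset.mem_Iio.mp hl]
      · rw [← Finset.sum_neg_distrib]
        symm
        refine Finset.sum_subset_zero_on_sdiff ?_ ?_ ?_
        · intro l hl
          simpa using (Finset.mem_Ioi.mp hl).le
        · intro l hl
          have : l = k := by
            simp only [Finset.mem_sdiff, Finset.mem_filter, Finset.mem_univ, true_and,
              Finset.mem_Ioi, not_lt] at hl
            exact le_antisymm hl.2 hl.1
          simp [hF, this]
        · intro l hl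
          have := Finset.mem_Ioi.mp hl
          simp [hF, this, this.not_gt]
    have hA : ∏ l, a l = u * qpow η (∑ l ∈ Finset.Ioi k, Λ l) := by
      rw [prod_split k, qpow_sum]
      rw [Finset.prod_congr rfl fun l hl => show a l = qpow η (Λ l) by
        have := Finset.mem_Ioi.mp hl; simp [ha, this, this.not_gt]]
      rw [Finset.prod_eq_one (s := Finset.Iio k) fun l hl => by simp [ha, Finset.mem_Iio.mp hl]]
      simp [ha]
    have hB : ∏ l, b l = w * qpow η (∑ l ∈ Finset.Iio k, Λ l) := by
      rw [prod_split k, qpow_sum]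
      rw [Finset.prod_congr rfl fun l hl => show b l = 1 by
        have := Finset.mem_Ioi.mp hl; simp [hb, this, this.not_gt]]
      rw [Finset.prod_congr (s₁ := Finset.Iio k) rfl fun l hl => show b l = qpow η (Λ l) by
        simp [hb, Finset.mem_Iio.mp hl]]
      simp [hb]
    -- Both sides have the exponent `-x + ∑ Λ - ∑ μ`. It does not depend on the color `k` of the
    -- first variable, which is why the relation survives summation over colorings.
    have hexp : u * qpow η (∑ l ∈ Finset.Ioi k, Λ l) * qpow η (∑ j : Fin p, F (c j.succ))
        = qpow η (-(2 * x)) * (w * qpow η (∑ l ∈ Finset.Iio k, Λ l)) *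
          qpow η (-∑ j : Fin p, F (c j.succ)) := by
      rw [hsum, hu, hw]
      simp only [← qpow_add]
      congr 1
      rw [← Finset.Iio_insert, ← Finset.Ioi_insert, Finset.sum_insert (by simp),
        Finset.sum_insert (by simp)]
      simp only [Finset.sum_sub_distrib, ← Finset.mul_sum]
      ring
    have hsign : ((-1 : ℂ) ^ n) * (-1) ^ n = 1 := by rw [← mul_pow]; simp
    rw [Polynomial.coeff_C_mul, Polynomial.eval_mul, Polynomial.eval_mul, Polynomial.eval_C, hcoef,
      hz1, hz2, hA, hB, Finset.prod_mul_distrib, ← qpow_sum, ← qpow_sum,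
      Finset.sum_neg_distrib]
    linear_combination rest * (∏ j, (-t j)) * hexp
      - rest * (∏ j, (-t j)) * (qpow η (-(2 * x)) * (w * qpow η (∑ l ∈ Finset.Iio k, Λ l)) *
          qpow η (-∑ j : Fin p, F (c j.succ))) * hsign

/-- By regularity the function of the inserted point is a polynomial `G`. The numerators of all
colorings add up to `G` times `M = ∏ (z - t_j)`, which bounds the degree of `G`. The relation
between extreme coefficients holds for each numerator, and it descends to `G` because `M` is monic
with a nonzero constant term, as `0 ∉ T`. -/
theorem exists_insert_polynomial (μ : Fin n → ℕ) (x : ℂ) (Λ : Fin n → ℂ) {p : ℕ}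
    (hμ : ∑ k, μ k = p + 1) {T : Finset ℂ} (hT : T.card = p) (h0 : (0 : ℂ) ∉ T) :
    ∃ G : Polynomial ℂ, G.natDegree ≤ n ∧
      (∀ z ∉ T, dualWeight η μ x Λ (insert z T) = G.eval z) ∧
      G.coeff n = (-1) ^ n * qpow η (-(2 * x)) * G.eval 0 := by
  obtain ⟨t, ht, rfl⟩ : ∃ t : Fin p → ℂ, Function.Injective t ∧ Finset.univ.image t = T := by
    refine ⟨fun i => (T.equivFinOfCardEq hT).symm i,
      Subtype.val_injective.comp (Equiv.injective _), ?_⟩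
    ext z
    simp only [Finset.mem_image, Finset.mem_univ, true_and]
    constructor
    · rintro ⟨i, rfl⟩; exact ((T.equivFinOfCardEq hT).symm i).2
    · intro hz; exact ⟨T.equivFinOfCardEq hT ⟨z, hz⟩, by simp⟩
  have hmem : ∀ z, z ∉ Finset.univ.image t ↔ ∀ j, z ≠ t j := by
    intro z
    simp [eq_comm]
  have ht0 : ∏ j, (-t j) ≠ 0 := Finset.prod_ne_zero_iff.mpr fun j _ =>
    neg_ne_zero.mpr ((hmem 0).mp h0 j).symm
  obtain ⟨P, -, hP⟩ := (isRegular_dualWeight (η := η) μ x Λ).exists_extend (p + 1)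
  choose N hN1 hN2 hN3 using fun c : {c // c ∈ partitions (m := p + 1) μ} =>
    exists_numerator (η := η) μ x Λ t c.2
  set Nt : Polynomial ℂ := Polynomial.C (weightPrefactor η (p + 1) μ) *
    ∑ c ∈ (partitions (m := p + 1) μ).attach, N c with hNt
  set G : Polynomial ℂ := MvPolynomial.aeval
    (Fin.cons Polynomial.X fun j => Polynomial.C (t j) : Fin (p + 1) → Polynomial ℂ) P with hG
  set M : Polynomial ℂ := ∏ j, (Polynomial.X - Polynomial.C (t j)) with hM
  have hGe : ∀ z, G.eval z = MvPolynomial.eval (Fin.cons z t : Fin (p + 1) → ℂ) P := by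
    intro z
    rw [hG, ← Polynomial.coe_evalRingHom, MvPolynomial.aeval_def, MvPolynomial.hom_eval₂,
      ← MvPolynomial.eval₂_id]
    congr 1
    · ext; simp
    · funext i
      refine Fin.cases ?_ (fun j => ?_) i <;> simp
  have hval : ∀ z ∉ Finset.univ.image t,
      dualWeight η μ x Λ (insert z (Finset.univ.image t)) = G.eval z ∧
      Nt.eval z = G.eval z * M.eval z := by
    intro z hz
    have hinj : Function.Injective (Fin.cons z t : Fin (p + 1) → ℂ) := by
      refine Fin.cons_injective_iff.mpr ⟨?_, ht⟩
      rintro ⟨j, hj⟩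
      exact (hmem z).mp hz j hj.symm
    have himg : insert z (Finset.univ.image t)
        = Finset.univ.image (Fin.cons z t : Fin (p + 1) → ℂ) := by
      ext w
      simp [Fin.exists_fin_succ, eq_comm]
    have h1 : dualWeight η μ x Λ (insert z (Finset.univ.image t)) = G.eval z := by
      rw [himg, hGe, hP _ hinj]
    refine ⟨h1, ?_⟩
    rw [← h1, himg, dualWeight_apply_image μ x Λ hμ hinj, ← Finset.sum_attach, hNt, hM,
      Polynomial.eval_mul, Polynomial.eval_C, Polynomial.eval_finsetSum, Polynomial.eval_prod,
      mul_assoc, Finset.sum_mul]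
    congr 1
    refine Finset.sum_congr rfl fun c _ => ?_
    rw [hN2 c z ((hmem z).mp hz)]
    simp
  have hMmonic : M.Monic := Polynomial.monic_prod_of_monic _ _ fun j _ => Polynomial.monic_X_sub_C _
  have hMdeg : M.natDegree = p := by
    rw [hM, Polynomial.natDegree_prod_of_monic _ _ fun j _ => Polynomial.monic_X_sub_C _]
    simp
  have hNG : Nt = G * M := by
    refine Polynomial.eq_of_infinite_eval_eq _ _ ?_
    refine ((Finset.univ.image t).finite_toSet.infinite_compl).mono fun z hz => ?_
    change Nt.eval z = (G * M).eval z
    rw [Polynomial.eval_mul (p := G)]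
    exact (hval z (by simpa using hz)).2
  have hNdeg : Nt.natDegree ≤ n + p := by
    refine (Polynomial.natDegree_C_mul_le _ _).trans ?_
    exact Polynomial.natDegree_sum_le_of_forall_le _ _ fun c _ => hN1 c
  have hGdeg : G.natDegree ≤ n := by
    rcases eq_or_ne G 0 with h | h
    · simp [h]
    · rw [hNG, Polynomial.natDegree_mul h hMmonic.ne_zero, hMdeg] at hNdeg
      omega
  refine ⟨G, hGdeg, fun z hz => (hval z hz).1, ?_⟩
  have hMc : M.coeff p = 1 := by rw [← hMdeg]; exact hMmonic
  have hc : G.coeff n = Nt.coeff (n + p) := by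
    rw [hNG, Polynomial.coeff_mul_add_eq_of_natDegree_le hGdeg hMdeg.le, hMc, mul_one]
  have hM0 : M.eval 0 = ∏ j, (-t j) := by simp [hM, Polynomial.eval_prod]
  have he : G.eval 0 * ∏ j, (-t j) = Nt.eval 0 := by
    rw [hNG, Polynomial.eval_mul, hM0]
  refine mul_right_cancel₀ ht0 ?_
  rw [hc, mul_assoc, he, hNt, Polynomial.coeff_C_mul, Polynomial.eval_mul, Polynomial.eval_C,
    Polynomial.eval_finsetSum, Polynomial.finsetSum_coeff, mul_assoc, Finset.sum_mul,
    Finset.sum_congr rfl fun c _ => hN3 c, ← Finset.mul_sum]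
  ring

/-- Lagrange interpolation at `n + 1` nodes recovers the coefficient of degree `n` of a polynomial
of degree at most `n`, and that coefficient is known from the value at `0`. -/
theorem sum_insert_div (μ : Fin n → ℕ) (x : ℂ) (Λ : Fin n → ℂ) {p : ℕ}
    (hμ : ∑ k, μ k = p + 1) {T : Finset ℂ} (hT : T.card = p) (h0 : (0 : ℂ) ∉ T)
    {z : Fin (n + 1) → ℂ} (hz : Function.Injective z) (hzT : ∀ k, z k ∉ T) :
    ∑ k, dualWeight η μ x Λ (insert (z k) T) / ∏ l ∈ Finset.univ.erase k, (z k - z l)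
      = (-1) ^ n * qpow η (-(2 * x)) * dualWeight η μ x Λ (insert 0 T) := by
  obtain ⟨G, h1, h2, h3⟩ := exists_insert_polynomial (η := η) μ x Λ hμ hT h0
  have h4 := Lagrange.coeff_eq_sum (s := Finset.univ) (v := z) hz.injOn (P := G)
    (by
      rw [Finset.card_univ, Fintype.card_fin]
      exact Polynomial.degree_le_natDegree.trans_lt (by exact_mod_cast Nat.lt_succ_of_le h1))
  rw [Finset.card_univ, Fintype.card_fin, Nat.add_sub_cancel, h3, ← h2 0 h0] at h4
  rw [h4]
  exact Finset.sum_congr rfl fun k _ => by rw [h2 _ (hzT k)]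

end

section

variable {η : ℂ} {n : ℕ}

/-! ### The functional equation of the pairing -/

theorem gridTuple_bump_zero (p : ℕ) (Λ : Fin n → ℂ) (σ : Fin (n + 1) → ℕ) :
    gridTuple η (p + 1) (stringBase η Λ 0) (bump σ 0)
      = Fin.cons 0 (gridTuple η p (stringBase η Λ 0) σ) := by
  have h := gridList_add_single η (stringBase η Λ 0) σ 0 fun l hl => absurd hl (Fin.not_lt_zero l)
  funext i
  rw [gridTuple, h, gridPoint_zero_left]
  refine Fin.cases ?_ (fun j => ?_) i
  · simp
  · simp [gridTuple]

theorem card_gridSet {B : Fin (n + 1) → ℂ} {m p : ℕ} (h : GridInjective η B m)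
    {σ : Fin (n + 1) → ℕ} (hσ : ∑ k, σ k = p) (hp : p ≤ m) : (gridSet η B σ).card = p := by
  rw [gridSet, Finset.card_image_of_injOn (h.injOn fun k => (le_of_sum_eq hσ k).trans (by omega)),
    Finset.card_sigma]
  simpa using hσ

theorem gridPoint_ne_zero {ε : ℂ} (hε : ε ≠ 0) (Λ : Fin n → ℂ) (k : Fin (n + 1)) (s : ℕ) :
    gridPoint η (stringBase η Λ ε) k s ≠ 0 := by
  refine mul_ne_zero ?_ (qpow_ne_zero _ _)
  refine Fin.cases hε (fun j => ?_) k
  exact qpow_ne_zero _ _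

/-- This is the limit `ε → 0` of `sum_insert_div`, the nodes being the next free points of the `n +
1` strings. On the right the inserted point is exactly `0`, and the configuration tends to the one
with the zeroth string enlarged. -/
theorem sum_extend_bump (hη : 0 < η.im) {m p : ℕ} {Λ : Fin n → ℂ} (hΛ : Λ ∈ genericWeights η n m)
    (μ : Fin n → ℕ) (x : ℂ) (hμ : ∑ k, μ k = p + 1) {σ : Fin (n + 1) → ℕ} (hσ : ∑ k, σ k = p)
    (hp : p + 1 ≤ m) :
    ∑ k, (dualWeight η μ x Λ).extend (p + 1) (stringPoint η (p + 1) Λ (bump σ k)) /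
        ∏ l ∈ Finset.univ.erase k, (gridPoint η (stringBase η Λ 0) k (σ k) -
          gridPoint η (stringBase η Λ 0) l (σ l))
      = (-1) ^ n * qpow η (-(2 * x)) *
        (dualWeight η μ x Λ).extend (p + 1) (stringPoint η (p + 1) Λ (bump σ 0)) := by
  have hg := isRegular_dualWeight (η := η) μ x Λ
  have hle := le_of_sum_eq hσ
  have hev := eventually_gridInjective hη hΛ
  have hnot : ∀ᶠ ε in 𝓝[≠] (0 : ℂ), (0 : ℂ) ∉ gridSet η (stringBase η Λ ε) σ := by
    filter_upwards [eventually_mem_nhdsWithin] with ε h0 hm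
    obtain ⟨l, s, -, e⟩ := mem_gridSet.mp hm
    exact gridPoint_ne_zero h0 Λ l s e
  have hR : Tendsto (fun ε => dualWeight η μ x Λ (insert 0 (gridSet η (stringBase η Λ ε) σ)))
      (𝓝[≠] (0 : ℂ)) (𝓝 ((dualWeight η μ x Λ).extend (p + 1)
        (stringPoint η (p + 1) Λ (bump σ 0)))) := by
    rw [stringPoint_eq_gridTuple, gridTuple_bump_zero]
    have himg : ∀ ε, insert 0 (gridSet η (stringBase η Λ ε) σ) = Finset.univ.image
        (Fin.cons 0 (gridTuple η p (stringBase η Λ ε) σ) : Fin (p + 1) → ℂ) := by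
      intro ε
      rw [← image_gridTuple _ hσ]
      ext w
      simp [Fin.exists_fin_succ, eq_comm]
    simp only [himg]
    refine Shuffle.extend_eq_of_tendsto hg ?_ ?_
    · refine Tendsto.mono_left ?_ nhdsWithin_le_nhds
      have hc : Continuous fun ε =>
          (Fin.cons 0 (gridTuple η p (stringBase η Λ ε) σ) : Fin (p + 1) → ℂ) :=
        Continuous.finCons continuous_const (continuous_gridTuple p Λ σ)
      exact hc.tendsto 0
    · filter_upwards [hev, hnot] with ε hε h0
      refine Fin.cons_injective_iff.mpr ⟨?_, hε.gridTuple_injective hσ (by omega)⟩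
      rintro ⟨j, hj⟩
      apply h0
      rw [← image_gridTuple _ hσ]
      exact Finset.mem_image.mpr ⟨j, Finset.mem_univ _, hj⟩
  refine tendsto_nhds_unique ?_ (hR.const_mul _)
  have h1 : ∀ᶠ ε in 𝓝[≠] (0 : ℂ), ∑ k, dualWeight η μ x Λ (gridSet η (stringBase η Λ ε) (bump σ k)) /
        ∏ l ∈ Finset.univ.erase k, (gridPoint η (stringBase η Λ ε) k (σ k) -
          gridPoint η (stringBase η Λ ε) l (σ l))
      = (-1) ^ n * qpow η (-(2 * x)) *
        dualWeight η μ x Λ (insert 0 (gridSet η (stringBase η Λ ε) σ)) := by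
    filter_upwards [hev, hnot] with ε hε h0
    rw [← sum_insert_div μ x Λ hμ (card_gridSet hε hσ (by omega)) h0
      (z := fun k => gridPoint η (stringBase η Λ ε) k (σ k))]
    · simp only [gridSet_bump]
    · intro k l hkl
      have := hle k
      have := hle l
      exact (hε k l _ _ (by omega) (by omega) hkl).1
    · intro k
      exact hε.notMem (fun k => (hle k).trans (by omega)) k
  refine Tendsto.congr' h1 (tendsto_finsetSum _ fun k _ => ?_)
  refine (tendsto_gridSet hη hΛ (by rw [sum_bump, hσ]) hp hg).div ?_ ?_
  · refine tendsto_finsetProd _ fun l _ => ?_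
    exact (((continuous_gridPoint Λ k _).sub (continuous_gridPoint Λ l _)).tendsto 0).mono_left
      nhdsWithin_le_nhds
  · refine Finset.prod_ne_zero_iff.mpr fun l hl => sub_ne_zero.mpr ?_
    have := hle k
    have := hle l
    exact gridPoint_zero_ne hΛ (Finset.ne_of_mem_erase hl).symm (by omega) (by omega)

/-- One pole of `pairFactor` is cancelled by the numerator of `crossFactor`: their product at a
point `v` is `q (z - v) / (z - q² v)`, which telescopes along the string. -/
theorem prod_pairFactor_mul_crossFactor {z w : ℂ} : ∀ {S : ℕ} (_ : z ≠ w * qpow η (-2))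
    (_ : ∀ s ≤ S, z ≠ w * qpow η (2 * s)),
    (∏ s ∈ Finset.range S, pairFactor η z (w * qpow η (2 * s))) *
      ∏ s ∈ Finset.range S, crossFactor η z (w * qpow η (2 * s))
      = qpow η 1 ^ S * ((z - w) / (z - w * qpow η (2 * S)))
  | 0, _, h => by
    have := h 0 le_rfl
    simp only [Nat.cast_zero, mul_zero, qpow_zero, mul_one] at this ⊢
    simp [div_self (sub_ne_zero.mpr this)]
  | S + 1, h1, h => by
    have ih := prod_pairFactor_mul_crossFactor h1 fun s hs => h s (hs.trans S.le_succ)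
    have hw := h S S.le_succ
    have hw' := h (S + 1) le_rfl
    have eS : w * qpow η (2 * ((S + 1 : ℕ) : ℂ)) = w * qpow η (2 * S) * qpow η 2 := by
      rw [qpow_two_mul_natCast_succ, mul_assoc]
    have hlow : z ≠ w * qpow η (2 * S) * qpow η (-2) := by
      rcases S with _ | S
      · simpa [qpow_zero] using h1
      · have := h S (by omega)
        rw [qpow_two_mul_natCast_succ, mul_assoc, mul_assoc, ← qpow_add]
        simpa [qpow_zero] using this
    rw [Finset.prod_range_succ, Finset.prod_range_succ, mul_mul_mul_comm, ih]
    rw [eS] at hw' ⊢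
    generalize w * qpow η (2 * (S : ℂ)) = v at *
    have e1 : qpow η 2 = qpow η 1 * qpow η 1 := by rw [← qpow_add]; norm_num
    have e2 : qpow η (-2) = qpow η (-1) * qpow η (-1) := by rw [← qpow_add]; norm_num
    have e3 : qpow η 1 * qpow η (-1) = 1 := by rw [← qpow_add]; simp [qpow_zero]
    have h5 : qpow η 1 * z - qpow η (-1) * v ≠ 0 := by
      intro h
      apply hlow
      rw [e2]
      linear_combination qpow η (-1) * h - z * e3
    have h6 : z - v ≠ 0 := sub_ne_zero.mpr hw
    have h7 : z - v * qpow η 2 ≠ 0 := sub_ne_zero.mpr hw'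
    have h8 : qpow η (-1) * z - qpow η 1 * v = qpow η (-1) * (z - v * qpow η 2) := by
      rw [e1]; linear_combination (v * qpow η 1) * e3
    have h9 : qpow η (-1) ≠ 0 := qpow_ne_zero _ _
    rw [pairFactor, crossFactor, h8, pow_succ (qpow η 1) S]
    generalize qpow η 1 ^ S = Q
    have e4 : qpow η 1 = (qpow η (-1))⁻¹ := eq_inv_of_mul_eq_one_left e3
    generalize qpow η 1 * z - qpow η (-1) * v = a at *
    rw [e4]
    generalize qpow η (-1) = u at *
    generalize z - v * qpow η 2 = b at *
    field_simp

theorem zeroCoeff_succ (hη : 0 < η.im) (s : ℕ) :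
    zeroCoeff η (s + 1) * qnum η ((s : ℂ) + 1) = zeroCoeff η s * qpow η 1 ^ s := by
  have h1 := qnum_succ_ne_zero hη s
  have h2 := qfact_ne_zero hη s
  have e : qpow η (((s + 1 : ℕ) : ℂ) * (((s + 1 : ℕ) : ℂ) - 1) / 2)
      = qpow η ((s : ℂ) * ((s : ℂ) - 1) / 2) * qpow η 1 ^ s := by
    rw [← qpow_natCast, ← qpow_add]; congr 1; push_cast; ring
  rw [zeroCoeff, zeroCoeff, e, qfact_succ]
  field_simp

/-- The lower letter cancels the poles of the density at `q^(Λ_l)`, the differences to the bottoms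
of the other strings cancel the remaining ones including `1 / z`, and the quantum number cancels the
self-interaction of the string. What is left is independent of the position, up to `q^S`. -/
theorem gridWeight_mul (hη : 0 < η.im) {m : ℕ} {Λ : Fin n → ℂ} (hΛ : Λ ∈ genericWeights η n m)
    (j : Fin n) {S : ℕ} (hS : S < m) :
    gridWeight η Λ j.succ S * ((∏ l, (qpow η (-Λ j) * qpow η (2 * S) - qpow η (Λ l))) *
      qnum η ((S : ℂ) + 1)) * ∏ l ∈ Finset.univ.erase j.succ,
        (qpow η (-Λ j) * qpow η (2 * S) - stringBase η Λ 0 l)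
      = qpow η (-∑ l, Λ l) * qpow η 1 ^ S := by
  have hprod : ∏ l ∈ Finset.univ.erase j.succ,
        (qpow η (-Λ j) * qpow η (2 * S) - stringBase η Λ 0 l)
      = qpow η (-Λ j) * qpow η (2 * S) * ∏ l ∈ Finset.univ.erase j,
        (qpow η (-Λ j) * qpow η (2 * S) - qpow η (-Λ l)) := by
    have : (Finset.univ.erase j.succ : Finset (Fin (n + 1)))
        = insert 0 ((Finset.univ.erase j).map (Fin.succEmb n)) := by
      ext l
      refine Fin.cases ?_ (fun i => ?_) l
      · simp [(Fin.succ_ne_zero j).symm]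
      · simp [Fin.succ_ne_zero]
    rw [this, Finset.prod_insert (by simp [Fin.succ_ne_zero]), Finset.prod_map]
    simp [stringBase]
  have hsum : qpow η (-∑ l, Λ l) = qpow η (-Λ j) * ∏ l ∈ Finset.univ.erase j, qpow η (-Λ l) := by
    rw [← Finset.sum_neg_distrib, qpow_sum, ← Finset.mul_prod_erase _ _ (Finset.mem_univ j)]
  have hb0 : qpow η (-Λ j) * qpow η (2 * S) ≠ 0 := mul_ne_zero (qpow_ne_zero _ _) (qpow_ne_zero _ _)
  have hpole := fun l => sub_ne_zero.mpr (gridPoint_succ_ne_pole hΛ j l hS)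
  have hq : (qpow η (-Λ j) * qpow η (2 * S) - qpow η (-Λ j) * qpow η (2 * S) * qpow η (-2)) /
      (qpow η (-Λ j) * qpow η (2 * S) - qpow η (-Λ j) * qpow η (-2)) * qnum η ((S : ℂ) + 1)
      = qpow η 1 ^ S := by
    have h1 := qpow_ne_zero η (-Λ j)
    have e1 : qpow η (2 * (S : ℂ)) = qpow η 1 ^ S * qpow η 1 ^ S := by
      rw [← qpow_natCast, ← qpow_add]; congr 1; ring
    have e2 : qpow η (-2) = qpow η (-1) * qpow η (-1) := by rw [← qpow_add]; norm_num
    have e3 : qpow η 1 * qpow η (-1) = 1 := by rw [← qpow_add]; simp [qpow_zero]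
    have e4 : qpow η ((S : ℂ) + 1) = qpow η 1 ^ S * qpow η 1 := by
      rw [← qpow_natCast, ← qpow_add]
    have h2 := q_sub_ne_zero hη
    have h3 := sub_ne_zero.mpr (qpow_natCast_ne hη S)
    rw [qnum]
    rw [qpow_neg η ((S : ℂ) + 1), e4] at h3 ⊢
    rw [e1, e2]
    have h4 := qpow_ne_zero η 1
    have e5 : qpow η (-1) = (qpow η 1)⁻¹ := qpow_neg η 1
    rw [e5] at h2 ⊢
    generalize qpow η (-Λ j) = L at *
    generalize qpow η 1 = q at *
    have h6 : q ^ S ≠ 0 := pow_ne_zero _ h4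
    generalize q ^ S = Q at *
    have h7 : L * (Q * Q) - L * (q⁻¹ * q⁻¹) = L * Q * q⁻¹ * (Q * q - (Q * q)⁻¹) := by
      field_simp
    have h8 : L * (Q * Q) - L * (Q * Q) * (q⁻¹ * q⁻¹) = L * Q * Q * q⁻¹ * (q - q⁻¹) := by
      field_simp
    rw [h7, h8]
    generalize q - q⁻¹ = A at *
    generalize Q * q - (Q * q)⁻¹ = D at *
    field_simp
  have hfac : (∏ l ∈ Finset.univ.erase j, ((qpow η (-Λ j) * qpow η (2 * S) - qpow η (Λ l)) *
      (qpow η (Λ l) * (qpow η (-Λ j) * qpow η (2 * S)) - 1))⁻¹) *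
      ((∏ l ∈ Finset.univ.erase j, (qpow η (-Λ j) * qpow η (2 * S) - qpow η (Λ l))) *
      ∏ l ∈ Finset.univ.erase j, (qpow η (-Λ j) * qpow η (2 * S) - qpow η (-Λ l)))
      = ∏ l ∈ Finset.univ.erase j, qpow η (-Λ l) := by
    rw [← Finset.prod_mul_distrib, ← Finset.prod_mul_distrib]
    refine Finset.prod_congr rfl fun l hl => ?_
    have h1 := hpole l
    have e := qpow_mul_qpow_neg η (Λ l)
    have h2 : qpow η (-Λ j) * qpow η (2 * S) - qpow η (-Λ l) ≠ 0 := by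
      refine sub_ne_zero.mpr fun h => ?_
      have := gridPoint_ne_gridPoint hΛ (Finset.ne_of_mem_erase hl) (a := 0) (b := S) (by omega)
        (by omega)
      simp only [Int.cast_zero, mul_zero, qpow_zero, mul_one, Int.cast_natCast] at this
      exact this h.symm
    have h3 : qpow η (Λ l) * (qpow η (-Λ j) * qpow η (2 * S)) - 1
        = qpow η (Λ l) * (qpow η (-Λ j) * qpow η (2 * S) - qpow η (-Λ l)) := by
      rw [mul_sub, e]
    rw [h3, qpow_neg η (Λ l)] at *
    have h4 := qpow_ne_zero η (Λ l)
    generalize qpow η (-Λ j) * qpow η (2 * S) - qpow η (Λ l) = A at *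
    generalize qpow η (-Λ j) * qpow η (2 * S) - (qpow η (Λ l))⁻¹ = A' at *
    generalize qpow η (Λ l) = A'' at *
    field_simp
  simp only [gridWeight, Fin.cases_succ]
  rw [hprod, hsum, ← hq, ← hfac,
    ← Finset.mul_prod_erase _ (fun l => qpow η (-Λ j) * qpow η (2 * S) - qpow η (Λ l))
      (Finset.mem_univ j)]
  have h5 := hpole j
  generalize qpow η (-Λ j) * qpow η (2 * (S : ℂ)) = b at *
  generalize (b - b * qpow η (-2)) / (b - qpow η (-Λ j) * qpow η (-2)) = D
  generalize (∏ l ∈ Finset.univ.erase j, ((b - qpow η (Λ l)) * (qpow η (Λ l) * b - 1))⁻¹) = V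
  generalize b - qpow η (Λ j) = A at *
  field_simp

end

/-! ### Residues against the Lagrange denominators -/

section

variable {η : ℂ} {n : ℕ}

/-- `∏ (z - q^Λ_l)`. -/
def lowerLetter (η : ℂ) (Λ : Fin n → ℂ) (z : ℂ) : ℂ := ∏ l, (z - qpow η (Λ l))

/-- `∏ (q^Λ_l z - 1)`. -/
def upperLetter (η : ℂ) (Λ : Fin n → ℂ) (z : ℂ) : ℂ := ∏ l, (qpow η (Λ l) * z - 1)

theorem prod_string_factor {m p : ℕ} {Λ : Fin n → ℂ} (hΛ : Λ ∈ genericWeights η n m)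
    {σ : Fin (n + 1) → ℕ} (hσ : ∑ k, σ k = p) (hp : p + 1 ≤ m) {k l : Fin (n + 1)} (hkl : k ≠ l) :
    (∏ r ∈ Finset.range (σ l), pairFactor η (gridPoint η (stringBase η Λ 0) k (σ k))
      (gridPoint η (stringBase η Λ 0) l r)) *
      ∏ r ∈ Finset.range (σ l), crossFactor η (gridPoint η (stringBase η Λ 0) k (σ k))
        (gridPoint η (stringBase η Λ 0) l r)
      = qpow η 1 ^ σ l * ((gridPoint η (stringBase η Λ 0) k (σ k) - stringBase η Λ 0 l) /
        (gridPoint η (stringBase η Λ 0) k (σ k) - gridPoint η (stringBase η Λ 0) l (σ l))) := by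
  have hk := le_of_sum_eq hσ k
  have hl := le_of_sum_eq hσ l
  refine prod_pairFactor_mul_crossFactor (w := stringBase η Λ 0 l) ?_ fun s hs =>
    gridPoint_zero_ne hΛ hkl (by omega) (by omega)
  induction l using Fin.cases with
  | zero =>
    obtain ⟨i, rfl⟩ := Fin.exists_succ_eq.mpr hkl
    simp only [stringBase, Fin.cons_zero, zero_mul]
    exact gridPoint_succ_ne_zero 0 Λ i _
  | succ j =>
    induction k using Fin.cases with
    | zero =>
      rw [gridPoint_zero_left]
      exact (mul_ne_zero (qpow_ne_zero _ _) (qpow_ne_zero _ _)).symm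
    | succ i =>
      have := gridPoint_ne_gridPoint hΛ (fun h : i = j => hkl (by rw [h])) (a := σ i.succ) (b := -1)
        (by omega) (by omega)
      simp only [Int.cast_natCast, Int.cast_neg, Int.cast_one, mul_neg, mul_one] at this
      exact this

/-- The contribution of enlarging the string `k` depends on `k` only through the product of
differences of next free points. This is exactly the denominator in `sum_extend_bump`. -/
theorem gridResidue_mul_topCoeff (hη : 0 < η.im) {m p : ℕ} {Λ : Fin n → ℂ}
    (hΛ : Λ ∈ genericWeights η n m) {σ : Fin (n + 1) → ℕ} (hσ : ∑ k, σ k = p) (hp : p + 1 ≤ m)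
    (k : Fin (n + 1)) :
    zeroCoeff η (bump σ k 0) * gridResidue η Λ (bump σ k) * topCoeff η Λ (lowerLetter η Λ) σ k
      = zeroCoeff η (σ 0) * gridResidue η Λ σ * (qpow η 1 ^ p * qpow η (-∑ l, Λ l)) /
        ∏ l ∈ Finset.univ.erase k, (gridPoint η (stringBase η Λ 0) k (σ k) -
          gridPoint η (stringBase η Λ 0) l (σ l)) := by
  set X := gridPoint η (stringBase η Λ 0) with hX
  have hcross : (∏ l ∈ Finset.univ.erase k, ∏ r ∈ Finset.range (σ l),
        pairFactor η (X k (σ k)) (X l r)) * ∏ l ∈ Finset.univ.erase k, ∏ r ∈ Finset.range (σ l),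
        crossFactor η (X k (σ k)) (X l r)
      = (∏ l ∈ Finset.univ.erase k, qpow η 1 ^ σ l) *
        ((∏ l ∈ Finset.univ.erase k, (X k (σ k) - stringBase η Λ 0 l)) /
        ∏ l ∈ Finset.univ.erase k, (X k (σ k) - X l (σ l))) := by
    rw [← Finset.prod_mul_distrib, ← Finset.prod_div_distrib, ← Finset.prod_mul_distrib]
    exact Finset.prod_congr rfl fun l hl =>
      prod_string_factor hΛ hσ hp (Finset.ne_of_mem_erase hl).symm
  have hpow : qpow η 1 ^ p = qpow η 1 ^ σ k * ∏ l ∈ Finset.univ.erase k, qpow η 1 ^ σ l := by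
    rw [Finset.mul_prod_erase _ (fun l => qpow η 1 ^ σ l) (Finset.mem_univ k), Finset.prod_pow_eq_pow_sum, hσ]
  -- For `k = 0` the quantum number is absorbed by the combinatorial coefficient of the zeroth
  -- string (`zeroCoeff_succ`); for the other strings it is absorbed in `gridWeight_mul`.
  have hmain : zeroCoeff η (bump σ k 0) * (gridWeight η Λ k (σ k) *
      (lowerLetter η Λ (X k (σ k)) * qnum η ((σ k : ℂ) + 1)) *
      ∏ l ∈ Finset.univ.erase k, (X k (σ k) - stringBase η Λ 0 l))
      = zeroCoeff η (σ 0) * (qpow η (-∑ l, Λ l) * qpow η 1 ^ σ k) := by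
    induction k using Fin.cases with
    | zero =>
      rw [bump_same, hX, gridPoint_zero_left, gridWeight, Fin.cases_zero]
      have h1 : (Finset.univ.erase (0 : Fin (n + 1))) = Finset.univ.map (Fin.succEmb n) := by
        ext l
        refine Fin.cases ?_ (fun i => ?_) l <;> simp [Fin.succ_ne_zero]
      have h2 : lowerLetter η Λ 0 * ∏ l ∈ Finset.univ.erase (0 : Fin (n + 1)),
          (0 - stringBase η Λ 0 l) = 1 := by
        rw [h1, Finset.prod_map, lowerLetter, ← Finset.prod_mul_distrib]
        refine Finset.prod_eq_one fun l _ => ?_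
        simp only [stringBase, Fin.coe_succEmb, Fin.cons_succ, zero_sub, neg_mul_neg]
        exact qpow_mul_qpow_neg η _
      linear_combination (zeroCoeff η (σ 0 + 1) * qnum η ((σ 0 : ℂ) + 1) * qpow η (-∑ l, Λ l)) * h2 +
        qpow η (-∑ l, Λ l) * zeroCoeff_succ hη (σ 0)
    | succ j =>
      have hj := le_of_sum_eq hσ j.succ
      rw [bump_of_ne _ (Fin.succ_ne_zero j).symm]
      congr 1
      exact gridWeight_mul hη hΛ j (by omega)
  rw [gridResidue_add_single, topCoeff, hpow]
  rw [← hX]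
  generalize (∏ l ∈ Finset.univ.erase k, ∏ r ∈ Finset.range (σ l),
        pairFactor η (X k (σ k)) (X l r)) = A at *
  generalize (∏ l ∈ Finset.univ.erase k, ∏ r ∈ Finset.range (σ l),
        crossFactor η (X k (σ k)) (X l r)) = B at *
  generalize (∏ l ∈ Finset.univ.erase k, (X k (σ k) - X l (σ l))) = D at *
  generalize (∏ l ∈ Finset.univ.erase k, (X k (σ k) - stringBase η Λ 0 l)) = H at *
  generalize ∏ l ∈ Finset.univ.erase k, qpow η 1 ^ σ l = J at *
  rw [div_eq_mul_inv] at hcross ⊢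
  linear_combination (zeroCoeff η (bump σ k 0) * gridResidue η Λ σ * gridWeight η Λ k (σ k) *
    lowerLetter η Λ (X k (σ k)) * qnum η ((σ k : ℂ) + 1)) * hcross
    + gridResidue η Λ σ * J * D⁻¹ * hmain

theorem gridResidue_mul_bottom (hη : 0 < η.im) (Λ : Fin n → ℂ) {p : ℕ}
    {σ : Fin (n + 1) → ℕ} (hσ : ∑ k, σ k = p) :
    zeroCoeff η (bump σ 0 0) * gridResidue η Λ (bump σ 0) *
        (upperLetter η Λ 0 * (qnum η ((σ 0 : ℂ) + 1) * ∏ j : Fin n, qpow η 1 ^ σ j.succ))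
      = zeroCoeff η (σ 0) * gridResidue η Λ σ * (qpow η 1 ^ p * qpow η (-∑ l, Λ l)) *
        (-1) ^ n := by
  have hpow : qpow η 1 ^ p = qpow η 1 ^ σ 0 * ∏ j : Fin n, qpow η 1 ^ σ j.succ := by
    rw [← Fin.prod_univ_succ fun l => qpow η 1 ^ σ l, Finset.prod_pow_eq_pow_sum, hσ]
  have h1 : ∏ l ∈ Finset.univ.erase (0 : Fin (n + 1)), ∏ r ∈ Finset.range (σ l),
      pairFactor η (gridPoint η (stringBase η Λ 0) 0 (σ 0)) (gridPoint η (stringBase η Λ 0) l r)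
      = 1 := by
    refine Finset.prod_eq_one fun l hl => Finset.prod_eq_one fun r _ => ?_
    obtain ⟨j, rfl⟩ := Fin.exists_succ_eq.mpr (Finset.ne_of_mem_erase hl)
    rw [gridPoint_zero_left, pairFactor_symm]
    exact pairFactor_zero_right (gridPoint_succ_ne_zero 0 Λ j r)
  have h2 : upperLetter η Λ 0 = (-1) ^ n := by simp [upperLetter]
  rw [gridResidue_add_single, h1, h2, bump_same, gridWeight, Fin.cases_zero, hpow]
  linear_combination (gridResidue η Λ σ * qpow η (-∑ l, Λ l) * (-1) ^ n *
    ∏ j : Fin n, qpow η 1 ^ σ j.succ) * zeroCoeff_succ hη (σ 0)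

theorem sum_antidiagonalTuple_succ {N p : ℕ} (k : Fin N) (F : (Fin N → ℕ) → ℂ) :
    ∑ σ ∈ Finset.Nat.antidiagonalTuple N (p + 1), (if σ k = 0 then 0 else F (unbump σ k))
      = ∑ σ ∈ Finset.Nat.antidiagonalTuple N p, F σ := by
  have : ∑ σ ∈ Finset.Nat.antidiagonalTuple N (p + 1), (if σ k = 0 then 0 else F (unbump σ k))
      = ∑ σ ∈ (Finset.Nat.antidiagonalTuple N (p + 1)).filter fun σ => σ k ≠ 0,
        F (unbump σ k) := by
    rw [Finset.sum_filter]
    exact Finset.sum_congr rfl fun σ _ => by by_cases h : σ k = 0 <;> simp [h]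
  rw [this]
  refine Finset.sum_nbij' (fun σ => unbump σ k) (fun σ => bump σ k) ?_ ?_ ?_ ?_ ?_
  · intro σ hσ
    obtain ⟨h1, h2⟩ := Finset.mem_filter.mp hσ
    exact Finset.Nat.mem_antidiagonalTuple.mpr
      (sum_unbump h2 (Finset.Nat.mem_antidiagonalTuple.mp h1))
  · intro σ hσ
    refine Finset.mem_filter.mpr ⟨Finset.Nat.mem_antidiagonalTuple.mpr ?_, by simp⟩
    rw [sum_bump, Finset.Nat.mem_antidiagonalTuple.mp hσ]
  · intro σ hσ
    exact bump_unbump (Finset.mem_filter.mp hσ).2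
  · intro σ _
    exact unbump_bump σ k
  · intro σ _
    rfl

/-- Both sides become sums over configurations of one point fewer. On the left each string is
enlarged in turn with the weights of a Lagrange sum; on the right only the zeroth string is
enlarged. For each configuration the two are equal by `sum_extend_bump`. -/
theorem pairing_lower_mul (hη : 0 < η.im) {m : ℕ} {Λ : Fin n → ℂ} (hΛ : Λ ∈ genericWeights η n m)
    {μ : Fin n → ℕ} (hμ : ∑ k, μ k = m) (x : ℂ) {f : Shuffle η} (hf : Shuffle.IsRegular f)
    (hl : Shuffle.IsRegular (Shuffle.letter η (lowerLetter η Λ)))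
    (hu : Shuffle.IsRegular (Shuffle.letter η (upperLetter η Λ))) :
    pairing (m := m) η Λ ((Shuffle.letter η (lowerLetter η Λ) * f).extend m)
        ((dualWeight η μ x Λ).extend m)
      = qpow η (-(2 * x)) * pairing (m := m) η Λ
        ((f * Shuffle.letter η (upperLetter η Λ)).extend m) ((dualWeight η μ x Λ).extend m) := by
  have hlf := hl.mul hf
  have hfu := hf.mul hu
  rw [pairing_eq_sum hη hΛ, pairing_eq_sum hη hΛ]
  -- Without points both products vanish on the empty set, since they contain a letter.
  rcases m with _ | p
  · have h0 : ∀ t : Fin 0 → ℂ, (Shuffle.letter η (lowerLetter η Λ) * f).extend 0 t = 0 := by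
      intro t
      rw [Shuffle.extend_of_injective hlf (Function.injective_of_subsingleton t),
        Shuffle.letter_mul]
      simp
    have h1 : ∀ t : Fin 0 → ℂ, (f * Shuffle.letter η (upperLetter η Λ)).extend 0 t = 0 := by
      intro t
      rw [Shuffle.extend_of_injective hfu (Function.injective_of_subsingleton t),
        Shuffle.mul_letter]
      simp
    simp [h0, h1]
  set g := dualWeight η μ x Λ with hg
  have hlc : Continuous (lowerLetter η Λ) := by unfold lowerLetter; fun_prop
  have huc : Continuous (upperLetter η Λ) := by unfold upperLetter; fun_prop
  have hu0 : ∀ k, upperLetter η Λ (qpow η (-Λ k)) = 0 := fun k =>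
    Finset.prod_eq_zero (Finset.mem_univ k) (by rw [qpow_mul_qpow_neg, sub_self])
  -- A configuration of `p + 1` points with a distinguished nonempty string is the same as a
  -- configuration of `p` points with a string to be enlarged.
  have e1 : ∑ σ ∈ Finset.Nat.antidiagonalTuple (n + 1) (p + 1), zeroCoeff η (σ 0) *
        gridResidue η Λ σ * (Shuffle.letter η (lowerLetter η Λ) * f).extend (p + 1)
          (stringPoint η (p + 1) Λ σ) * g.extend (p + 1) (stringPoint η (p + 1) Λ σ)
      = ∑ σ ∈ Finset.Nat.antidiagonalTuple (n + 1) p, ∑ k, zeroCoeff η (bump σ k 0) *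
        gridResidue η Λ (bump σ k) * topCoeff η Λ (lowerLetter η Λ) σ k *
          f.extend p (stringPoint η p Λ σ) *
          g.extend (p + 1) (stringPoint η (p + 1) Λ (bump σ k)) := by
    rw [Finset.sum_comm, ← Finset.sum_congr rfl fun k _ => sum_antidiagonalTuple_succ k (fun σ =>
        zeroCoeff η (bump σ k 0) * gridResidue η Λ (bump σ k) * topCoeff η Λ (lowerLetter η Λ) σ k *
          f.extend p (stringPoint η p Λ σ) *
          g.extend (p + 1) (stringPoint η (p + 1) Λ (bump σ k))),
      Finset.sum_comm]
    refine Finset.sum_congr rfl fun σ hσ => ?_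
    rw [extend_letter_mul hη hΛ (Finset.Nat.mem_antidiagonalTuple.mp hσ) le_rfl hlc hf hlf,
      Finset.mul_sum, Finset.sum_mul]
    refine Finset.sum_congr rfl fun k _ => ?_
    split_ifs with hk
    · simp
    · rw [bump_unbump hk]; ring
  have e2 : ∑ σ ∈ Finset.Nat.antidiagonalTuple (n + 1) (p + 1), zeroCoeff η (σ 0) *
        gridResidue η Λ σ * (f * Shuffle.letter η (upperLetter η Λ)).extend (p + 1)
          (stringPoint η (p + 1) Λ σ) * g.extend (p + 1) (stringPoint η (p + 1) Λ σ)
      = ∑ σ ∈ Finset.Nat.antidiagonalTuple (n + 1) p, zeroCoeff η (bump σ 0 0) *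
        gridResidue η Λ (bump σ 0) * (upperLetter η Λ 0 * (qnum η ((σ 0 : ℂ) + 1) *
          ∏ j : Fin n, qpow η 1 ^ σ j.succ)) * f.extend p (stringPoint η p Λ σ) *
          g.extend (p + 1) (stringPoint η (p + 1) Λ (bump σ 0)) := by
    rw [← sum_antidiagonalTuple_succ 0 (fun σ => zeroCoeff η (bump σ 0 0) *
        gridResidue η Λ (bump σ 0) * (upperLetter η Λ 0 * (qnum η ((σ 0 : ℂ) + 1) *
          ∏ j : Fin n, qpow η 1 ^ σ j.succ)) * f.extend p (stringPoint η p Λ σ) *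
          g.extend (p + 1) (stringPoint η (p + 1) Λ (bump σ 0)))]
    refine Finset.sum_congr rfl fun σ hσ => ?_
    rw [extend_mul_letter hη hΛ (Finset.Nat.mem_antidiagonalTuple.mp hσ) le_rfl huc hu0 hf hfu]
    split_ifs with hk
    · simp
    · rw [bump_unbump hk]; ring
  rw [e1, e2, Finset.mul_sum]
  refine Finset.sum_congr rfl fun σ hσ => ?_
  have hσ' := Finset.Nat.mem_antidiagonalTuple.mp hσ
  rw [gridResidue_mul_bottom hη Λ hσ']
  have h3 := sum_extend_bump hη hΛ μ x hμ hσ' le_rfl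
  rw [← hg] at h3
  rw [show qpow η (-(2 * x)) * (zeroCoeff η (σ 0) * gridResidue η Λ σ *
      (qpow η 1 ^ p * qpow η (-∑ l, Λ l)) * (-1) ^ n * f.extend p (stringPoint η p Λ σ) *
      g.extend (p + 1) (stringPoint η (p + 1) Λ (bump σ 0)))
      = zeroCoeff η (σ 0) * gridResidue η Λ σ * (qpow η 1 ^ p * qpow η (-∑ l, Λ l)) *
        f.extend p (stringPoint η p Λ σ) * ((-1) ^ n * qpow η (-(2 * x)) *
        g.extend (p + 1) (stringPoint η (p + 1) Λ (bump σ 0))) by ring, ← h3, Finset.mul_sum]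
  refine Finset.sum_congr rfl fun k _ => ?_
  rw [gridResidue_mul_topCoeff hη hΛ hσ' le_rfl]
  ring

end

section

variable {η : ℂ} {n : ℕ}

/-! ### The chain of letters -/

theorem isRegular_letter {f : ℂ → ℂ} (P : Polynomial ℂ) (h : ∀ z, f z = P.eval z) :
    Shuffle.IsRegular (Shuffle.letter η f) := by
  rw [funext h]
  exact Shuffle.isRegular_block P 1

/-- The common factor of the letters of a site. -/
def siteLetter (η : ℂ) (Λ : Fin n → ℂ) (k : Fin n) (z : ℂ) : ℂ :=
  (∏ l ∈ Finset.Iio k, (qpow η (Λ l) * z - 1)) * ∏ l ∈ Finset.Ioi k, (z - qpow η (Λ l))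

/-- `siteLetter` as a polynomial. -/
def sitePoly (η : ℂ) (Λ : Fin n → ℂ) (k : Fin n) : Polynomial ℂ :=
  (∏ l ∈ Finset.Iio k, (Polynomial.C (qpow η (Λ l)) * Polynomial.X - 1)) *
    ∏ l ∈ Finset.Ioi k, (Polynomial.X - Polynomial.C (qpow η (Λ l)))

theorem eval_sitePoly (Λ : Fin n → ℂ) (k : Fin n) (z : ℂ) :
    (sitePoly η Λ k).eval z = siteLetter η Λ k z := by
  simp only [sitePoly, siteLetter, Polynomial.eval_mul, Polynomial.eval_sub, Polynomial.eval_C,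
    Polynomial.eval_X, Polynomial.eval_one, Polynomial.eval_prod]

/-- `∏_{l < k} (q^Λ_l z - 1) ∏_{l ≥ k} (z - q^Λ_l)`. -/
def wallLetter (η : ℂ) (Λ : Fin n → ℂ) (k : Fin (n + 1)) (z : ℂ) : ℂ :=
  ∏ l : Fin n, if l.castSucc < k then qpow η (Λ l) * z - 1 else z - qpow η (Λ l)

theorem wallLetter_castSucc (Λ : Fin n → ℂ) (k : Fin n) (z : ℂ) :
    wallLetter η Λ k.castSucc z = (z - qpow η (Λ k)) * siteLetter η Λ k z := by
  rw [wallLetter, prod_split k, siteLetter, mul_comm (∏ l ∈ Finset.Iio k, (qpow η (Λ l) * z - 1))]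
  congr 1
  · simp
  · congr 1
    · exact Finset.prod_congr rfl fun l hl => by
        simp [(Finset.mem_Ioi.mp hl).not_gt]
    · exact Finset.prod_congr rfl fun l hl => by
        simp [Finset.mem_Iio.mp hl]

theorem wallLetter_succ (Λ : Fin n → ℂ) (k : Fin n) (z : ℂ) :
    wallLetter η Λ k.succ z = (qpow η (Λ k) * z - 1) * siteLetter η Λ k z := by
  rw [wallLetter, prod_split k, siteLetter, mul_comm (∏ l ∈ Finset.Iio k, (qpow η (Λ l) * z - 1))]
  congr 1
  · simp
  · congr 1
    · exact Finset.prod_congr rfl fun l hl => by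
        rw [if_neg]
        rw [Fin.castSucc_lt_succ_iff]
        exact (Finset.mem_Ioi.mp hl).not_ge
    · exact Finset.prod_congr rfl fun l hl => by
        rw [if_pos]
        rw [Fin.castSucc_lt_succ_iff]
        exact (Finset.mem_Iio.mp hl).le

theorem wallLetter_zero (Λ : Fin n → ℂ) : wallLetter η Λ 0 = lowerLetter η Λ := by
  funext z
  simp [wallLetter, lowerLetter]

theorem wallLetter_last (Λ : Fin n → ℂ) : wallLetter η Λ (Fin.last n) = upperLetter η Λ := by
  funext z
  simp [wallLetter, upperLetter, Fin.castSucc_lt_last]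

theorem isRegular_wallLetter (Λ : Fin n → ℂ) (k : Fin (n + 1)) :
    Shuffle.IsRegular (Shuffle.letter η (wallLetter η Λ k)) := by
  refine isRegular_letter (∏ l : Fin n, if l.castSucc < k then
    Polynomial.C (qpow η (Λ l)) * Polynomial.X - 1 else Polynomial.X - Polynomial.C (qpow η (Λ l)))
    fun z => ?_
  rw [Polynomial.eval_prod]
  refine Finset.prod_congr rfl fun l _ => ?_
  split_ifs <;> simp

/-- The chain of sites realized by letters of the shuffle algebra. -/
def letterChain (η : ℂ) (Λ : Fin n → ℂ) : SiteChain η Λ (Shuffle.regular η) where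
  X k := ⟨Shuffle.letter η fun z => z * siteLetter η Λ k z,
    isRegular_letter (Polynomial.X * sitePoly η Λ k) fun z => by
      rw [Polynomial.eval_mul, Polynomial.eval_X, eval_sitePoly]⟩
  Y k := ⟨Shuffle.letter η (siteLetter η Λ k),
    isRegular_letter (sitePoly η Λ k) fun z => by rw [eval_sitePoly]⟩
  g k := ⟨Shuffle.letter η (wallLetter η Λ k), isRegular_wallLetter Λ k⟩
  comm k := Subtype.ext (Shuffle.letter_X_mul_letter_Y _)
  left k := by
    refine Subtype.ext ?_
    change Shuffle.letter η _ = Shuffle.letter η _ - qpow η (Λ k) • Shuffle.letter η _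
    rw [← Shuffle.letter_smul, ← Shuffle.letter_sub]
    congr 1
    funext z
    simp only [Pi.sub_apply, Pi.smul_apply, smul_eq_mul, wallLetter_castSucc]
    ring
  right k := by
    refine Subtype.ext ?_
    change Shuffle.letter η _ = qpow η (Λ k) • Shuffle.letter η _ - Shuffle.letter η _
    rw [← Shuffle.letter_smul, ← Shuffle.letter_sub]
    congr 1
    funext z
    simp only [Pi.sub_apply, Pi.smul_apply, smul_eq_mul, wallLetter_succ]
    ring

theorem prod_ofFn_smul {A : Type*} [Ring A] [Algebra ℂ A] : ∀ {N : ℕ} (a : Fin N → ℂ)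
    (f : Fin N → A), (List.ofFn fun k => a k • f k).prod = (∏ k, a k) • (List.ofFn f).prod
  | 0, a, f => by simp
  | N + 1, a, f => by
    rw [List.ofFn_succ, List.ofFn_succ, List.prod_cons, List.prod_cons,
      prod_ofFn_smul (fun k => a k.succ) fun k => f k.succ, Fin.prod_univ_succ,
      smul_mul_smul_comm]

theorem Shuffle.block_const_mul (c : ℂ) (p : ℂ → ℂ) (k : ℕ) :
    Shuffle.block η (fun z => c * p z) k = c ^ k • Shuffle.block η p k := by
  ext S
  rw [Shuffle.smul_apply, Shuffle.block_apply, Shuffle.block_apply]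
  split_ifs with h
  · rw [Finset.prod_mul_distrib, Finset.prod_const, h]
  · rw [mul_zero]

theorem coe_prod_ofFn {N : ℕ} (f : Fin N → Shuffle.regular η) :
    (((List.ofFn f).prod : Shuffle.regular η) : Shuffle η)
      = (List.ofFn fun k => (f k : Shuffle η)).prod := by
  rw [← Subalgebra.coe_val, map_list_prod, List.map_ofFn]
  rfl

/-- The one-variable factor of the weight function `W_μ`. -/
def weightLetter (η : ℂ) (μ : Fin n → ℕ) (lam : ℂ) (Λ : Fin n → ℂ) (k : Fin n) (z : ℂ) : ℂ :=
  (qpow η (-lam + μ k + ∑ l ∈ Finset.Ici k, (Λ l - 2 * μ l)) * z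
      - qpow η (lam + μ k + ∑ l ∈ Finset.Iic k, (Λ l - 2 * μ l))) * siteLetter η Λ k z

/-- The factor of each site is a power of a single letter, hence `[μ_k]!` times a block. Its
exponents become those of `W_μ` through `∑ (Λ - 2μ) = 0`, which exchanges the sum over `l > k` for
the sum over `l ≤ k`. -/
theorem coe_chainFactor (hη : 0 < η.im) {m : ℕ} {Λ : Fin n → ℂ} (hΛ : ∑ i, Λ i = 2 * m)
    {μ : Fin n → ℕ} (hμ : ∑ k, μ k = m) (lam : ℂ) :
    (((letterChain η Λ).chainFactor μ lam : Shuffle.regular η) : Shuffle η)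
      = (∏ k, qfact η (μ k)) • (List.ofFn fun k =>
        Shuffle.block η (weightLetter η μ lam Λ k) (μ k)).prod := by
  rw [SiteChain.chainFactor, coe_prod_ofFn, ← prod_ofFn_smul]
  congr 2
  funext k
  have htot : ∑ l ∈ Finset.Iic k, (Λ l - 2 * (μ l : ℂ))
      = -∑ l ∈ Finset.Ioi k, (Λ l - 2 * (μ l : ℂ)) := by
    have h1 : ∑ l, (Λ l - 2 * (μ l : ℂ)) = 0 := by
      rw [Finset.sum_sub_distrib, ← Finset.mul_sum, hΛ, ← hμ]; push_cast; ring
    have h2 : ∑ l ∈ Finset.Iic k, (Λ l - 2 * (μ l : ℂ)) + ∑ l ∈ Finset.Ioi k, (Λ l - 2 * (μ l : ℂ))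
        = 0 := by
      rw [← h1, ← Finset.sum_filter_add_sum_filter_not Finset.univ (· ≤ k)]
      congr 1
      · congr 1; ext; simp
      · congr 1; ext; simp
    linear_combination h2
  have e : ((SiteChain.siteFactor η (lam - ∑ l ∈ Finset.Ioi k, (Λ l - 2 * μ l)) (Λ k) (μ k)
      ((letterChain η Λ).X k) ((letterChain η Λ).Y k) : Shuffle.regular η) : Shuffle η)
      = (qpow η (-(lam - ∑ l ∈ Finset.Ioi k, (Λ l - 2 * μ l) - Λ k + 2 * μ k) + μ k) •
          Shuffle.letter η (fun z => z * siteLetter η Λ k z) -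
        qpow η (lam - ∑ l ∈ Finset.Ioi k, (Λ l - 2 * μ l) + μ k) •
          Shuffle.letter η (siteLetter η Λ k)) ^ μ k := rfl
  rw [e, ← Shuffle.letter_smul, ← Shuffle.letter_smul, ← Shuffle.letter_sub, Shuffle.letter_pow hη]
  congr 2
  funext z
  simp only [Pi.sub_apply, Pi.smul_apply, smul_eq_mul, weightLetter]
  rw [htot, ← Finset.Ioi_insert, Finset.sum_insert (by simp),
    show -(lam - ∑ l ∈ Finset.Ioi k, (Λ l - 2 * μ l) - Λ k + 2 * μ k) + (μ k : ℂ)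
      = -lam + μ k + (Λ k - 2 * μ k + ∑ l ∈ Finset.Ioi k, (Λ l - 2 * μ l)) by ring,
    show lam - ∑ l ∈ Finset.Ioi k, (Λ l - 2 * μ l) + (μ k : ℂ)
      = lam + μ k + -∑ l ∈ Finset.Ioi k, (Λ l - 2 * μ l) by ring]
  ring

theorem extend_chainFactor (hη : 0 < η.im) {m : ℕ} {Λ : Fin n → ℂ} (hΛ : ∑ i, Λ i = 2 * m)
    {μ : Fin n → ℕ} (hμ : ∑ k, μ k = m) (lam : ℂ) (t : Fin m → ℂ) :
    Shuffle.extend ((letterChain η Λ).chainFactor μ lam : Shuffle η) m t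
      = qfact η m * weightW η μ lam Λ t := by
  have hreg := ((letterChain η Λ).chainFactor μ lam).2
  have hm := qfact_ne_zero hη m
  rw [← inv_mul_eq_iff_eq_mul₀ hm, ← Shuffle.extend_smul hreg]
  obtain ⟨P, -, hP⟩ := (Shuffle.IsRegular.smul (qfact η m)⁻¹ hreg).exists_extend m
  refine congrFun (extendPoly_congr hP fun t ht => ?_).symm t
  rw [coe_chainFactor hη hΛ hμ, Shuffle.smul_apply, Shuffle.smul_apply,
    Shuffle.prod_block_apply_image _ _ ht, ← mul_assoc, weightPrefactor, div_eq_inv_mul]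
  simp only [weightLetter, siteLetter, mul_assoc]

theorem sum_mul_sum_Iic (f : Fin n → ℂ) :
    2 * ∑ k, f k * ∑ l ∈ Finset.Iic k, f l = (∑ k, f k) ^ 2 + ∑ k, f k ^ 2 := by
  have h1 : ∑ k, f k * ∑ l ∈ Finset.Iic k, f l = ∑ k, ∑ l, if l ≤ k then f k * f l else 0 := by
    refine Finset.sum_congr rfl fun k _ => ?_
    rw [Finset.mul_sum, ← Finset.sum_filter]
    congr 1
    ext; simp
  have h2 : ∑ k, f k * ∑ l ∈ Finset.Iic k, f l = ∑ k, ∑ l, if k ≤ l then f k * f l else 0 := by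
    rw [h1, Finset.sum_comm]
    refine Finset.sum_congr rfl fun k _ => Finset.sum_congr rfl fun l _ => ?_
    rw [mul_comm]
  have h3 : ∑ k, f k ^ 2 = ∑ k, ∑ l, if k = l then f k * f l else 0 := by
    refine Finset.sum_congr rfl fun k _ => ?_
    simp [pow_two]
  rw [two_mul]
  nth_rewrite 1 [h1]
  rw [h2, h3, pow_two, Finset.sum_mul_sum, ← Finset.sum_add_distrib, ← Finset.sum_add_distrib]
  refine Finset.sum_congr rfl fun k _ => ?_
  rw [← Finset.sum_add_distrib, ← Finset.sum_add_distrib]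
  refine Finset.sum_congr rfl fun l _ => ?_
  rcases lt_trichotomy k l with h | rfl | h
  · simp [h.le, h.not_ge, h.ne]
  · simp
  · simp [h.le, h.not_ge, h.ne']

/-- The exponents match because `∑ μ_k (μ_k - 1) / 2 = ∑_k μ_k ∑_(l ≤ k) μ_l - m (m + 1) / 2`. This
explains both the powers of `q` in `ω_μ` and the prefactor of the trace matrix. -/
theorem prod_dualCoeff {m : ℕ} {μ : Fin n → ℕ} (hμ : ∑ k, μ k = m) :
    ∏ k, dualCoeff η (μ k) = qpow η (-((m : ℂ) * (m + 1) / 2)) * (qpow η 1 - qpow η (-1)) ^ m *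
      ∏ k, qpow η (∑ l ∈ Finset.Iic k, (μ l : ℂ)) ^ μ k := by
  have h1 : ∏ k, qpow η (∑ l ∈ Finset.Iic k, (μ l : ℂ)) ^ μ k
      = qpow η (∑ k, (μ k : ℂ) * ∑ l ∈ Finset.Iic k, (μ l : ℂ)) := by
    rw [qpow_sum]
    exact Finset.prod_congr rfl fun k _ => (qpow_nsmul η _ _).symm
  have hm : (m : ℂ) = ∑ k, (μ k : ℂ) := by rw [← hμ]; push_cast; rfl
  rw [h1]
  simp only [dualCoeff, Finset.prod_mul_distrib, Finset.prod_pow_eq_pow_sum, hμ, ← qpow_sum]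
  rw [mul_right_comm, ← qpow_add]
  congr 2
  have h2 := sum_mul_sum_Iic fun k => (μ k : ℂ)
  rw [← Finset.sum_div]
  have h3 : ∑ k, (μ k : ℂ) * ((μ k : ℂ) - 1) = ∑ k, (μ k : ℂ) ^ 2 - m := by
    rw [hm, ← Finset.sum_sub_distrib]
    exact Finset.sum_congr rfl fun k _ => by ring
  rw [← hm] at h2
  rw [h3]
  linear_combination (-1 / 2 : ℂ) * h2

theorem coe_dualMap_single (hη : 0 < η.im) {m : ℕ} (Λ : Fin n → ℂ) {μ : Fin n → ℕ}
    (hμ : ∑ k, μ k = m) :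
    (((letterChain η Λ).dualMap (Finsupp.single μ 1) : Shuffle.regular η) : Shuffle η)
      = (qpow η (-((m : ℂ) * (m + 1) / 2)) * (qpow η 1 - qpow η (-1)) ^ m * ∏ k, qfact η (μ k)) •
        (List.ofFn fun k => Shuffle.block η (fun z => qpow η (∑ l ∈ Finset.Iic k, (μ l : ℂ)) *
          (z * siteLetter η Λ k z)) (μ k)).prod := by
  rw [SiteChain.dualMap_single, coe_prod_ofFn]
  have e : ∀ k, ((dualCoeff η (μ k) • (letterChain η Λ).X k ^ μ k : Shuffle.regular η) : Shuffle η)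
      = (dualCoeff η (μ k) * qfact η (μ k)) •
        Shuffle.block η (fun z => z * siteLetter η Λ k z) (μ k) := by
    intro k
    have : ((dualCoeff η (μ k) • (letterChain η Λ).X k ^ μ k : Shuffle.regular η) : Shuffle η)
      = dualCoeff η (μ k) • Shuffle.letter η (fun z => z * siteLetter η Λ k z) ^ μ k := rfl
    rw [this, Shuffle.letter_pow hη, smul_smul]
  simp only [e, Shuffle.block_const_mul]
  rw [prod_ofFn_smul, prod_ofFn_smul, smul_smul, Finset.prod_mul_distrib,
    prod_dualCoeff hμ]
  congr 1
  ring

theorem extend_dualMap_single (hη : 0 < η.im) {m : ℕ} (Λ : Fin n → ℂ)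
    {μ : Fin n → ℕ} (hμ : ∑ k, μ k = m) (t : Fin m → ℂ) :
    Shuffle.extend ((letterChain η Λ).dualMap (Finsupp.single μ 1) : Shuffle η) m t
      = qfact η m * (qpow η (-((m : ℂ) * (m + 1) / 2)) * (qpow η 1 - qpow η (-1)) ^ m) *
        omega η μ Λ t := by
  have hreg := ((letterChain η Λ).dualMap (Finsupp.single μ 1)).2
  have hm := qfact_ne_zero hη m
  have hc : qfact η m * (qpow η (-((m : ℂ) * (m + 1) / 2)) * (qpow η 1 - qpow η (-1)) ^ m) ≠ 0 :=
    mul_ne_zero hm (mul_ne_zero (qpow_ne_zero _ _) (pow_ne_zero _ (q_sub_ne_zero hη)))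
  rw [← inv_mul_eq_iff_eq_mul₀ hc, ← Shuffle.extend_smul hreg]
  obtain ⟨P, -, hP⟩ := (Shuffle.IsRegular.smul (qfact η m * (qpow η (-((m : ℂ) * (m + 1) / 2)) *
    (qpow η 1 - qpow η (-1)) ^ m))⁻¹ hreg).exists_extend m
  refine congrFun (extendPoly_congr hP fun t ht => ?_).symm t
  rw [coe_dualMap_single hη Λ hμ, Shuffle.smul_apply, Shuffle.smul_apply,
    Shuffle.prod_block_apply_image _ _ ht, weightPrefactor]
  have e : ∀ M K a S : ℂ, M * K ≠ 0 → (M * K)⁻¹ * (K * a * S) = a / M * S := by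
    intro M K a S h
    have := left_ne_zero_of_mul h
    have := right_ne_zero_of_mul h
    field_simp
  rw [e _ _ _ _ hc]
  simp only [siteLetter, mul_assoc]

end

section

variable {η : ℂ} {n : ℕ}

/-! ### The identity at generic weights -/

theorem pairing_add_left {m : ℕ} (Λ : Fin n → ℂ) (f f' g : (Fin m → ℂ) → ℂ) :
    pairing η Λ (f + f') g = pairing η Λ f g + pairing η Λ f' g := by
  rw [pairing, pairing, pairing, ← Finset.sum_add_distrib]
  refine Finset.sum_congr rfl fun σ _ => ?_
  rw [Pi.add_apply]
  ring

theorem pairing_smul_left {m : ℕ} (Λ : Fin n → ℂ) (c : ℂ) (f g : (Fin m → ℂ) → ℂ) :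
    pairing η Λ (c • f) g = c * pairing η Λ f g := by
  rw [pairing, pairing, Finset.mul_sum]
  refine Finset.sum_congr rfl fun σ _ => ?_
  rw [Pi.smul_apply, smul_eq_mul]
  ring

/-- The pairing with a fixed function as a functional on the regular part of the shuffle
algebra. -/
def pairingFunctional (η : ℂ) (m : ℕ) (Λ : Fin n → ℂ) (g : (Fin m → ℂ) → ℂ) :
    Shuffle.regular η →ₗ[ℂ] ℂ where
  toFun f := pairing η Λ (Shuffle.extend (f : Shuffle η) m) g
  map_add' f f' := by
    rw [← pairing_add_left]
    congr 1
    funext t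
    exact Shuffle.extend_add f.2 f'.2 m t
  map_smul' c f := by
    rw [RingHom.id_apply, smul_eq_mul, ← pairing_smul_left]
    congr 1
    funext t
    exact Shuffle.extend_smul f.2 c m t

theorem pairingFunctional_apply (m : ℕ) (Λ : Fin n → ℂ) (g : (Fin m → ℂ) → ℂ)
    (f : Shuffle.regular η) :
    pairingFunctional η m Λ g f = pairing η Λ (Shuffle.extend (f : Shuffle η) m) g := rfl

theorem vermaMap_bv_zero {A : Type*} [Ring A] [Algebra ℂ A] (a : A) :
    SiteChain.vermaMap η a (bv 0) = 1 := by
  simp [SiteChain.vermaMap, qfact]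

/-- The pairing composed with `theta` satisfies the trace recursion with `y = q^(-2x)`. Evaluating
`eq_transfer_of_functional` on the image of the highest weight vector gives `W_μ` on one side and
the `ω_ν`, weighted by trace entries, on the other; the common factor `[m]!` cancels. -/
theorem residueQKZB_eq (hη : 0 < η.im) {m : ℕ} {Λ : Fin n → ℂ} (hΛ : Λ ∈ genericWeights η n m)
    (lam : ℂ) {x : ℂ}
    (hx : ∀ j < m, 1 - qpow η (-(2 * ((j : ℂ) + 1))) * qpow η (-(2 * x)) ≠ 0) :
    residueQKZB η m lam x Λ
      = Matrix.of (fun μ μ' => explicitTrace η hη m Λ lam μ μ' x) * residueQKZ η m x Λ := by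
  ext μ μ'
  have hμ := Finset.Nat.mem_antidiagonalTuple.mp μ.2
  have hμ' := Finset.Nat.mem_antidiagonalTuple.mp μ'.2
  set g := (dualWeight η μ'.1 x Λ).extend m with hg
  have hgW : dualWeightW η μ'.1 x Λ = g := dualWeightW_eq_extend μ'.1 x Λ hμ'
  have hm := qfact_ne_zero hη m
  set C := letterChain η Λ with hC
  set τ := pairingFunctional η m Λ g ∘ₗ C.theta with hτ
  -- The two operators are multiplication by the last wall on the right and by the first wall on the
  -- left, so this is the functional equation of the pairing.
  have hrec : ∀ i w, qpow η (-(2 * x)) * τ (totalF η hη Λ (bv i ⊗ₜ w))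
      = τ (lowering η (bv i) ⊗ₜ w) := by
    intro i w
    rw [hτ, LinearMap.comp_apply, LinearMap.comp_apply, SiteChain.theta_totalF hη,
      SiteChain.theta_lowering hη, pairingFunctional_apply, pairingFunctional_apply]
    have h0 : ((C.g 0 : Shuffle.regular η) : Shuffle η)
        = Shuffle.letter η (lowerLetter η Λ) := by rw [← wallLetter_zero]; rfl
    have h1 : ((C.g (Fin.last n) : Shuffle.regular η) : Shuffle η)
        = Shuffle.letter η (upperLetter η Λ) := by rw [← wallLetter_last]; rfl
    rw [Subalgebra.coe_mul, Subalgebra.coe_mul, h0, h1]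
    refine (pairing_lower_mul hη hΛ hμ' x (C.theta (bv i ⊗ₜ w)).2 ?_ ?_).symm
    · rw [← h0]; exact (C.g 0).2
    · rw [← h1]; exact (C.g (Fin.last n)).2
  have hmem := PhiMulti_bv_zero_mem η hη Λ lam μ
  have key := eq_transfer_of_functional η hη hΛ.1 hx τ hrec hmem
  have hL : τ (PhiMulti η hη n Λ μ.1 lam (bv 0))
      = qfact η m * pairing η Λ (weightW η μ.1 lam Λ) g := by
    rw [hτ, LinearMap.comp_apply, SiteChain.theta_PhiMulti hη, vermaMap_bv_zero, mul_one,
      pairingFunctional_apply, ← pairing_smul_left]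
    congr 1
    funext t
    exact extend_chainFactor hη hΛ.1 hμ lam t
  have hR : ∀ ν : Idx n m, τ (bv 0 ⊗ₜ Finsupp.single ν.1 1)
      = qfact η m * (qpow η (-((m : ℂ) * (m + 1) / 2)) * (qpow η 1 - qpow η (-1)) ^ m) *
        pairing η Λ (omega η ν.1 Λ) g := by
    intro ν
    rw [hτ, LinearMap.comp_apply, SiteChain.theta_tmul, vermaMap_bv_zero, one_mul,
      pairingFunctional_apply, ← pairing_smul_left]
    congr 1
    funext t
    exact extend_dualMap_single hη Λ (Finset.Nat.mem_antidiagonalTuple.mp ν.2) t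
  rw [hL, eq_sum_of_mem_dualLevel (transfer_mem η hη Λ _ hmem), TensorProduct.tmul_sum, map_sum]
    at key
  simp only [TensorProduct.tmul_smul, map_smul, smul_eq_mul, hR] at key
  simp only [Matrix.mul_apply, residueQKZB, residueQKZ, Matrix.of_apply, hgW]
  refine mul_left_cancel₀ hm ?_
  rw [mul_left_comm, key, Finset.mul_sum, Finset.mul_sum]
  refine Finset.sum_congr rfl fun ν _ => ?_
  rw [explicitTrace]
  ring

end

section

variable {η : ℂ} {n : ℕ}

/-! ### The trace function -/

theorem analyticAt_qpow_mul (η c x : ℂ) : AnalyticAt ℂ (fun z => qpow η (c * z)) x := by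
  unfold qpow
  fun_prop

/-- The closed form of the trace matrix has no pole at `x`. -/
def IsTraceRegular (η : ℂ) (m : ℕ) (x : ℂ) : Prop :=
  ∀ j < m, 1 - qpow η (-(2 * ((j : ℂ) + 1))) * qpow η (-(2 * x)) ≠ 0

theorem analyticAt_qpow_neg_two_mul (η x : ℂ) : AnalyticAt ℂ (fun z => qpow η (-(2 * z))) x := by
  unfold qpow
  fun_prop

theorem analyticAt_traceDenominator (η : ℂ) (i : ℕ) (x : ℂ) :
    AnalyticAt ℂ (fun z => qfact η i * ∏ j ∈ Finset.range i,
      (1 - qpow η (-(2 * ((j : ℂ) + 1))) * qpow η (-(2 * z)))) x :=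
  analyticAt_const.mul <| Finset.analyticAt_fun_prod _ fun _ _ =>
    analyticAt_const.sub (analyticAt_const.mul (analyticAt_qpow_neg_two_mul η x))

theorem meromorphicAt_transfer (hη : 0 < η.im) {m : ℕ} (Λ : Fin n → ℂ)
    {v : VermaSpace ⊗[ℂ] DualTensor n} (hv : v ∈ totalLevel n m) (ν : Fin n → ℕ) (x : ℂ) :
    MeromorphicAt (fun z => transfer η hη Λ (qpow η (-(2 * z))) v ν) x := by
  induction hv using Submodule.span_induction with
  | zero => simp
  | add a b _ _ ha hb => simp only [map_add, Finsupp.add_apply]; exact ha.fun_add hb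
  | smul c a _ ha =>
    simp only [map_smul, Finsupp.smul_apply, smul_eq_mul]
    exact (MeromorphicAt.const c x).fun_mul ha
  | mem v hv =>
    obtain ⟨i, μ, hi, rfl⟩ := hv
    simp only [transfer_bv, Finsupp.smul_apply, smul_eq_mul, traceRatio]
    exact ((((analyticAt_qpow_neg_two_mul η x).pow i).meromorphicAt.div
      (analyticAt_traceDenominator η i x).meromorphicAt).mul (MeromorphicAt.const _ x))

theorem analyticAt_transfer (hη : 0 < η.im) {m : ℕ} (Λ : Fin n → ℂ)
    {v : VermaSpace ⊗[ℂ] DualTensor n} (hv : v ∈ totalLevel n m) (ν : Fin n → ℕ) {x : ℂ}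
    (hx : IsTraceRegular η m x) :
    AnalyticAt ℂ (fun z => transfer η hη Λ (qpow η (-(2 * z))) v ν) x := by
  induction hv using Submodule.span_induction with
  | zero => simpa using analyticAt_const
  | add a b _ _ ha hb => simp only [map_add, Finsupp.add_apply]; exact ha.fun_add hb
  | smul c a _ ha =>
    simp only [map_smul, Finsupp.smul_apply, smul_eq_mul]
    exact analyticAt_const.fun_mul ha
  | mem v hv =>
    obtain ⟨i, μ, hi, rfl⟩ := hv
    simp only [transfer_bv, Finsupp.smul_apply, smul_eq_mul, traceRatio]
    refine (((analyticAt_qpow_neg_two_mul η x).pow i).div (analyticAt_traceDenominator η i x)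
      (mul_ne_zero (qfact_ne_zero hη i) ?_)).mul analyticAt_const
    exact Finset.prod_ne_zero_iff.mpr fun j hj => hx j (by
      have := Finset.mem_range.mp hj; omega)

theorem meromorphic_explicitTrace (hη : 0 < η.im) (m : ℕ) (Λ : Fin n → ℂ) (lam : ℂ)
    (μ μ' : Idx n m) : Meromorphic (explicitTrace η hη m Λ lam μ μ') := fun x =>
  ((MeromorphicAt.const _ x).mul (analyticAt_qpow_mul η lam x).meromorphicAt).mul
    (meromorphicAt_transfer hη Λ (PhiMulti_bv_zero_mem η hη Λ lam μ) μ'.1 x)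

theorem analyticAt_explicitTrace (hη : 0 < η.im) {m : ℕ} (Λ : Fin n → ℂ) (lam : ℂ)
    (μ μ' : Idx n m) {x : ℂ} (hx : IsTraceRegular η m x) :
    AnalyticAt ℂ (explicitTrace η hη m Λ lam μ μ') x :=
  (analyticAt_const.mul (analyticAt_qpow_mul η lam x)).mul
    (analyticAt_transfer hη Λ (PhiMulti_bv_zero_mem η hη Λ lam μ) μ'.1 hx)

theorem isTraceRegular_of_growthBound_lt {m : ℕ} {x : ℂ}
    (hx : growthBound η m < ‖qpow η (2 * x)‖) : IsTraceRegular η m x := by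
  intro j hj h
  have h1 := norm_lt_growthBound η hj
  have h2 : qpow η (-(2 * ((j : ℂ) + 1))) = qpow η (2 * x) := by
    rw [qpow_neg η (2 * x)] at h
    have := qpow_ne_zero η (2 * x)
    field_simp at h
    linear_combination -h
  rw [h2] at h1
  linarith

theorem exists_lt_norm_qpow (hη : 0 < η.im) (R : ℝ) : ∃ x : ℂ, R < ‖qpow η (2 * x)‖ := by
  obtain ⟨t, ht⟩ := (Real.tendsto_exp_atTop.eventually_gt_atTop R).exists
  have h1 : η ≠ 0 := by rintro rfl; simp at hη
  refine ⟨t / (2 * Real.pi * Complex.I * η), ?_⟩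
  have h2 : (Real.pi : ℂ) ≠ 0 := by exact_mod_cast Real.pi_ne_zero
  have e : Real.pi * Complex.I * η * (2 * (t / (2 * Real.pi * Complex.I * η))) = (t : ℂ) := by
    have := Complex.I_ne_zero
    field_simp
  rw [qpow, e, Complex.norm_exp, Complex.ofReal_re]
  exact ht

theorem isTraceFunction_explicitTrace (hη : 0 < η.im) {m : ℕ} {Λ : Fin n → ℂ}
    (hΛ : ∑ i, Λ i = 2 * m) (lam : ℂ) (μ μ' : Idx n m) :
    IsTraceFunction η hη m Λ lam μ μ' (explicitTrace η hη m Λ lam μ μ') :=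
  ⟨meromorphic_explicitTrace hη m Λ lam μ μ', growthBound η m,
    fun _ hx => hasSum_traceTerm η hη hΛ lam μ μ' hx⟩

/-- The identity theorem: by connectedness of `ℂ`, infinite order of the difference at one point
propagates to all points. -/
theorem eventuallyEq_nhdsNE_of_meromorphic {f g : ℂ → ℂ} (hf : Meromorphic f)
    (hg : Meromorphic g) {a : ℂ} (h : f =ᶠ[𝓝 a] g) (x : ℂ) : f =ᶠ[𝓝[≠] x] g := by
  have hd : Meromorphic (f - g) := fun z => (hf z).sub (hg z)
  have ha : meromorphicOrderAt (f - g) a = ⊤ := by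
    rw [meromorphicOrderAt_eq_top_iff]
    filter_upwards [h.filter_mono nhdsWithin_le_nhds] with z hz
    simp [hz]
  have hx : meromorphicOrderAt (f - g) x = ⊤ := by
    by_contra hne
    exact hd.exists_meromorphicOrderAt_ne_top_iff_forall.mp ⟨x, hne⟩ a ha
  filter_upwards [meromorphicOrderAt_eq_top_iff.mp hx] with z hz
  exact sub_eq_zero.mp hz

theorem IsTraceFunction.eventuallyEq (hη : 0 < η.im) {m : ℕ} {Λ : Fin n → ℂ} {lam : ℂ}
    {μ μ' : Idx n m} {f g : ℂ → ℂ} (hf : IsTraceFunction η hη m Λ lam μ μ' f)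
    (hg : IsTraceFunction η hη m Λ lam μ μ' g) (x : ℂ) : f =ᶠ[𝓝[≠] x] g := by
  obtain ⟨hf1, R, hR⟩ := hf
  obtain ⟨hg1, S, hS⟩ := hg
  obtain ⟨a, ha⟩ := exists_lt_norm_qpow hη (max R S)
  refine eventuallyEq_nhdsNE_of_meromorphic hf1 hg1 (a := a) ?_ x
  have hc : ContinuousAt (fun z => ‖qpow η (2 * z)‖) a :=
    (analyticAt_qpow_mul η 2 a).continuousAt.norm
  filter_upwards [hc.eventually_const_lt ha] with z hz
  exact (hR z ((le_max_left _ _).trans_lt hz)).unique (hS z ((le_max_right _ _).trans_lt hz))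

/-- The function chosen in the definition is arbitrary, but any two trace functions agree in
punctured neighbourhoods by the identity theorem, so the normal form is compared with the closed
form. -/
theorem traceFunction_spec (hη : 0 < η.im) {m : ℕ} {Λ : Fin n → ℂ}
    (hΛ : ∑ i, Λ i = 2 * m) (lam : ℂ) (μ μ' : Idx n m) :
    MeromorphicNFOn (traceFunction η hη m Λ lam μ μ') Set.univ ∧ ∀ x : ℂ,
      traceFunction η hη m Λ lam μ μ' =ᶠ[𝓝[≠] x] explicitTrace η hη m Λ lam μ μ' := by
  have hex : ∃ f, IsTraceFunction η hη m Λ lam μ μ' f :=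
    ⟨_, isTraceFunction_explicitTrace hη hΛ lam μ μ'⟩
  have hf := hex.choose_spec
  have hm : MeromorphicOn hex.choose Set.univ := meromorphicOn_univ.mpr hf.1
  rw [traceFunction, dif_pos hex]
  refine ⟨meromorphicNFOn_toMeromorphicNFOn _ _, fun x => ?_⟩
  exact (hm.toMeromorphicNFOn_eq_self_on_nhdsNE (Set.mem_univ x)).trans
    (hf.eventuallyEq hη (isTraceFunction_explicitTrace hη hΛ lam μ μ') x)

theorem traceFunction_eq_explicitTrace (hη : 0 < η.im) {m : ℕ} {Λ : Fin n → ℂ}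
    (hΛ : ∑ i, Λ i = 2 * m) (lam : ℂ) (μ μ' : Idx n m) {x : ℂ} (hx : IsTraceRegular η m x) :
    traceFunction η hη m Λ lam μ μ' x = explicitTrace η hη m Λ lam μ μ' x := by
  obtain ⟨h1, h2⟩ := traceFunction_spec hη hΛ lam μ μ'
  exact (((h1 (Set.mem_univ x)).eventuallyEq_nhdsNE_iff_eventuallyEq_nhds
    (analyticAt_explicitTrace hη Λ lam μ μ' hx).meromorphicNFAt).mp (h2 x)).self_of_nhds

theorem isTraceFunction_traceFunction (hη : 0 < η.im) {m : ℕ} {Λ : Fin n → ℂ}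
    (hΛ : ∑ i, Λ i = 2 * m) (lam : ℂ) (μ μ' : Idx n m) :
    IsTraceFunction η hη m Λ lam μ μ' (traceFunction η hη m Λ lam μ μ') := by
  refine ⟨fun x => ((traceFunction_spec hη hΛ lam μ μ').1 (Set.mem_univ x)).meromorphicAt,
    growthBound η m, fun x hx => ?_⟩
  rw [traceFunction_eq_explicitTrace hη hΛ lam μ μ' (isTraceRegular_of_growthBound_lt hx)]
  exact hasSum_traceTerm η hη hΛ lam μ μ' hx

end

section

/-! ### Algebraically continuous families of vectors -/

section ContinuousFamily

variable {P : Type*} [TopologicalSpace P]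
variable {V W : Type*} [AddCommMonoid V] [Module ℂ V] [AddCommMonoid W] [Module ℂ W]

/-- The families of vectors which are finite linear combinations of fixed vectors, with continuous
coefficients. -/
def continuousFamilies (P V : Type*) [TopologicalSpace P] [AddCommMonoid V] [Module ℂ V] :
    Submodule ℂ (P → V) :=
  Submodule.span ℂ {F | ∃ c : P → ℂ, Continuous c ∧ ∃ e : V, F = fun x => c x • e}

/-- A family of linear maps which sends fixed vectors to continuous families. -/
def IsContinuousLinearFamily (L : P → V →ₗ[ℂ] W) : Prop :=
  ∀ e, (fun x => L x e) ∈ continuousFamilies P W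

theorem zero_mem_continuousFamilies : (fun _ : P => (0 : V)) ∈ continuousFamilies P V :=
  zero_mem _

theorem add_mem_continuousFamilies {F G : P → V} (hF : F ∈ continuousFamilies P V)
    (hG : G ∈ continuousFamilies P V) : (fun x => F x + G x) ∈ continuousFamilies P V :=
  add_mem hF hG

theorem const_smul_mem_continuousFamilies (a : ℂ) {F : P → V}
    (hF : F ∈ continuousFamilies P V) : (fun x => a • F x) ∈ continuousFamilies P V :=
  Submodule.smul_mem _ a hF

theorem smul_mem_continuousFamilies {c : P → ℂ} (hc : Continuous c) {F : P → V}
    (hF : F ∈ continuousFamilies P V) : (fun x => c x • F x) ∈ continuousFamilies P V := by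
  induction hF using Submodule.span_induction with
  | mem F hF =>
    obtain ⟨d, hd, e, rfl⟩ := hF
    exact Submodule.subset_span ⟨fun x => c x * d x, hc.mul hd, e, by simp only [smul_smul]⟩
  | zero => simpa using zero_mem_continuousFamilies
  | add F G _ _ hF hG => simpa only [Pi.add_apply, smul_add] using add_mem_continuousFamilies hF hG
  | smul a F _ hF =>
    simpa only [Pi.smul_apply, smul_comm _ a] using
      const_smul_mem_continuousFamilies a hF

theorem const_mem_continuousFamilies (e : V) : (fun _ : P => e) ∈ continuousFamilies P V :=
  Submodule.subset_span ⟨fun _ => 1, continuous_const, e, by simp⟩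

theorem continuous_apply_of_mem {α : Type*} {F : P → α →₀ ℂ}
    (hF : F ∈ continuousFamilies P (α →₀ ℂ)) (a : α) : Continuous fun x => F x a := by
  induction hF using Submodule.span_induction with
  | mem F hF =>
    obtain ⟨d, hd, e, rfl⟩ := hF
    exact hd.mul continuous_const
  | zero => exact continuous_const
  | add F G _ _ hF hG => exact hF.add hG
  | smul b F _ hF => exact continuous_const.mul hF

namespace IsContinuousLinearFamily

theorem const (A : V →ₗ[ℂ] W) : IsContinuousLinearFamily fun _ : P => A :=
  fun e => const_mem_continuousFamilies (A e)

/-- The infinite-dimensional spaces carry no chosen topology. Continuity is expressed by finitely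
many fixed vectors with continuous coefficients, and this property is stable under application,
composition and tensor products. -/
theorem apply_mem {L : P → V →ₗ[ℂ] W} (hL : IsContinuousLinearFamily L) {F : P → V}
    (hF : F ∈ continuousFamilies P V) : (fun x => L x (F x)) ∈ continuousFamilies P W := by
  induction hF using Submodule.span_induction with
  | mem F hF =>
    obtain ⟨d, hd, e, rfl⟩ := hF
    simpa only [map_smul] using smul_mem_continuousFamilies hd (hL e)
  | zero => simpa using zero_mem_continuousFamilies
  | add F G _ _ hF hG => simpa only [Pi.add_apply, map_add] using add_mem_continuousFamilies hF hG
  | smul a F _ hF => simpa only [Pi.smul_apply, map_smul] using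
      const_smul_mem_continuousFamilies a hF

theorem comp {U : Type*} [AddCommMonoid U] [Module ℂ U] {L : P → V →ₗ[ℂ] W} {M : P → U →ₗ[ℂ] V}
    (hL : IsContinuousLinearFamily L) (hM : IsContinuousLinearFamily M) :
    IsContinuousLinearFamily fun x => L x ∘ₗ M x :=
  fun e => hL.apply_mem (hM e)

theorem add {L M : P → V →ₗ[ℂ] W} (hL : IsContinuousLinearFamily L)
    (hM : IsContinuousLinearFamily M) : IsContinuousLinearFamily fun x => L x + M x :=
  fun e => add_mem (hL e) (hM e)

theorem pow {L : P → Module.End ℂ V}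
    (hL : IsContinuousLinearFamily L) (k : ℕ) :
    IsContinuousLinearFamily fun x => L x ^ k := by
  induction k with
  | zero => simpa only [pow_zero] using const 1
  | succ k ih => simp only [pow_succ]; exact ih.comp hL

theorem onBasis {f : P → ℕ → V} (hf : ∀ k, (fun x => f x k) ∈ continuousFamilies P V) :
    IsContinuousLinearFamily fun x => Finsupp.linearCombination ℂ (f x) := by
  intro e
  induction e using Finsupp.induction_linear with
  | zero => simpa using zero_mem_continuousFamilies
  | add a b ha hb => simpa only [map_add] using add_mem_continuousFamilies ha hb
  | single k c =>
    simp only [Finsupp.linearCombination_single]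
    exact Submodule.smul_mem _ c (hf k)

theorem tmul_mem {F : P → V} {G : P → W} (hF : F ∈ continuousFamilies P V)
    (hG : G ∈ continuousFamilies P W) : (fun x => F x ⊗ₜ[ℂ] G x) ∈ continuousFamilies P (V ⊗[ℂ] W) := by
  have h : ∀ e : V, IsContinuousLinearFamily fun _ : P => TensorProduct.mk ℂ V W e :=
    fun e => const _
  induction hF using Submodule.span_induction with
  | mem F hF =>
    obtain ⟨d, hd, e, rfl⟩ := hF
    simpa only [← TensorProduct.smul_tmul', TensorProduct.mk_apply] using
      smul_mem_continuousFamilies hd ((h e).apply_mem hG)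
  | zero => simpa using zero_mem_continuousFamilies
  | add F G _ _ hF hG => simpa only [Pi.add_apply, TensorProduct.add_tmul] using add_mem_continuousFamilies hF hG
  | smul a F _ hF =>
    simpa only [Pi.smul_apply, ← TensorProduct.smul_tmul'] using
      const_smul_mem_continuousFamilies a hF

theorem of_tmul {U : Type*} [AddCommMonoid U] [Module ℂ U] {L : P → V ⊗[ℂ] W →ₗ[ℂ] U}
    (h : ∀ v w, (fun x => L x (v ⊗ₜ w)) ∈ continuousFamilies P U) :
    IsContinuousLinearFamily L := by
  intro z
  induction z using TensorProduct.induction_on with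
  | zero => simpa using zero_mem_continuousFamilies
  | tmul v w => exact h v w
  | add a b ha hb => simpa only [map_add] using add_mem_continuousFamilies ha hb

theorem map {V' W' : Type*} [AddCommMonoid V'] [Module ℂ V'] [AddCommMonoid W'] [Module ℂ W']
    {A : P → V →ₗ[ℂ] V'} {B : P → W →ₗ[ℂ] W'} (hA : IsContinuousLinearFamily A)
    (hB : IsContinuousLinearFamily B) :
    IsContinuousLinearFamily fun x => TensorProduct.map (A x) (B x) :=
  of_tmul fun v w => tmul_mem (hA v) (hB w)

end IsContinuousLinearFamily

end ContinuousFamily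

/-! ### Continuity of the trace matrix in the weights -/

section

variable {P : Type*} [TopologicalSpace P] {η : ℂ}

theorem _root_.Continuous.qpow {f : P → ℂ} (hf : Continuous f) :
    Continuous fun x => qpow η (f x) := by
  unfold HyperQKZ.qpow
  fun_prop

theorem _root_.Continuous.qnum {f : P → ℂ} (hf : Continuous f) :
    Continuous fun x => qnum η (f x) :=
  (hf.qpow.sub hf.neg.qpow).div_const _

theorem _root_.Continuous.qpoch {f : P → ℂ} (hf : Continuous f) (k : ℕ) :
    Continuous fun x => qpoch η (f x) k :=
  continuous_finsetProd _ fun _ _ => (hf.add continuous_const).qnum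

theorem smul_const_mem {V : Type*} [AddCommMonoid V] [Module ℂ V] {c : P → ℂ} (hc : Continuous c)
    (e : V) : (fun x => c x • e) ∈ continuousFamilies P V :=
  smul_mem_continuousFamilies hc (const_mem_continuousFamilies e)

theorem isContinuousLinearFamily_dualVerma_K (hη : 0 < η.im) {L : P → ℂ} (hL : Continuous L)
    (z : ℂ) : IsContinuousLinearFamily fun x => (dualVerma η hη (L x)).K z :=
  .onBasis fun _ => smul_const_mem ((hL.sub continuous_const).mul continuous_const).qpow _

theorem isContinuousLinearFamily_dualVerma_F (hη : 0 < η.im) {L : P → ℂ} (hL : Continuous L) :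
    IsContinuousLinearFamily fun x => (dualVerma η hη (L x)).F :=
  .onBasis fun _ => smul_const_mem (hL.sub continuous_const).qnum _

theorem isContinuousLinearFamily_dualK (hη : 0 < η.im) : ∀ {n : ℕ} {Λ : P → Fin n → ℂ},
    Continuous Λ → IsContinuousLinearFamily fun x => dualK η hη n (Λ x)
  | 0, _, _ => .const 1
  | n + 1, Λ, h => (IsContinuousLinearFamily.const _).comp <| .comp
      (.map (isContinuousLinearFamily_dualVerma_K hη (by fun_prop) _)
        (isContinuousLinearFamily_dualK hη (n := n) (Λ := fun x => Fin.tail (Λ x))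
          (by unfold Fin.tail; fun_prop))) (.const _)

theorem isContinuousLinearFamily_dualF (hη : 0 < η.im) : ∀ {n : ℕ} {Λ : P → Fin n → ℂ},
    Continuous Λ → IsContinuousLinearFamily fun x => dualF η hη n (Λ x)
  | 0, _, _ => .const 0
  | n + 1, Λ, h => by
    have ht : Continuous fun x => Fin.tail (Λ x) := by unfold Fin.tail; fun_prop
    exact (IsContinuousLinearFamily.const _).comp <| .comp
      (.add (.map (isContinuousLinearFamily_dualVerma_F hη (by fun_prop))
        (isContinuousLinearFamily_dualK hη ht))
        (.map (.const 1) (isContinuousLinearFamily_dualF hη ht))) (.const _)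

theorem singularVector_mem (hη : 0 < η.im) {L lam : P → ℂ} (hL : Continuous L)
    (hlam : Continuous lam) (m : ℕ) :
    (fun x => singularVector η hη (L x) m (lam x)) ∈
      continuousFamilies P (VermaSpace ⊗[ℂ] VermaSpace) := by
  have e : (fun x => singularVector η hη (L x) m (lam x)) = ∑ i ∈ Finset.range (m + 1), fun x =>
      (qpow η (i * (lam x - L x + 2 * m - i)) * qpoch η (-lam x + L x - 2 * m + i + 1) (m - i)) •
      (bv i ⊗ₜ[ℂ] ((∏ s ∈ Finset.range i, qnum η ((m - s : ℕ) : ℂ)) • bv (m - i))) := by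
    funext x
    simp only [singularVector, dualVerma_E_pow, Finset.sum_apply]
  rw [e]
  refine sum_mem fun i _ => smul_const_mem (Continuous.mul ?_ ?_) _
  · exact Continuous.qpow (by fun_prop)
  · exact Continuous.qpoch (by fun_prop) _

theorem isContinuousLinearFamily_Phi (hη : 0 < η.im) {L lam : P → ℂ} (hL : Continuous L)
    (hlam : Continuous lam) (m : ℕ) :
    IsContinuousLinearFamily fun x => Phi η hη (L x) m (lam x) := by
  have hF : IsContinuousLinearFamily fun x => pairF η hη (L x) :=
    .add (.map (.const _) (isContinuousLinearFamily_dualVerma_K hη hL _))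
      (.map (.const _) (isContinuousLinearFamily_dualVerma_F hη hL))
  exact .onBasis fun k => Submodule.smul_mem _ _ ((hF.pow k).apply_mem
    (singularVector_mem hη hL hlam m))

theorem isContinuousLinearFamily_PhiMulti (hη : 0 < η.im) (lam : ℂ) : ∀ {n : ℕ}
    {Λ : P → Fin n → ℂ} (μ : Fin n → ℕ), Continuous Λ →
    IsContinuousLinearFamily fun x => PhiMulti η hη n (Λ x) μ lam
  | 0, _, _, _ => .const _
  | n + 1, Λ, μ, h => by
    have ht : Continuous fun x => Fin.tail (Λ x) := by unfold Fin.tail; fun_prop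
    refine (IsContinuousLinearFamily.const _).comp <| .comp (.const _) <| .comp ?_
      (isContinuousLinearFamily_PhiMulti hη lam (Fin.tail μ) ht)
    exact .map (isContinuousLinearFamily_Phi hη (by fun_prop) (by fun_prop) _) (.const _)

/-- The denominators depend on `y` but not on the weights, so for fixed `y` only the operators `F`
vary. -/
theorem isContinuousLinearFamily_transfer (hη : 0 < η.im) {n : ℕ} {Λ : P → Fin n → ℂ}
    (h : Continuous Λ) (y : ℂ) : IsContinuousLinearFamily fun x => transfer η hη (Λ x) y := by
  refine .of_tmul fun v w => ?_
  induction v using Finsupp.induction_linear with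
  | zero => simpa using zero_mem_continuousFamilies
  | add a b ha hb => simpa only [TensorProduct.add_tmul, map_add] using add_mem_continuousFamilies ha hb
  | single k c =>
    have e : ∀ x, transfer η hη (Λ x) y (Finsupp.single k c ⊗ₜ w)
        = c • traceRatio η k y • (dualF η hη n (Λ x) ^ k) w := by
      intro x
      rw [← transfer_bv, ← map_smul, TensorProduct.smul_tmul', Finsupp.smul_single, smul_eq_mul,
        mul_one]
    simp only [e]
    exact Submodule.smul_mem _ _ (Submodule.smul_mem _ _
      ((isContinuousLinearFamily_dualF hη h).pow k w))

theorem continuous_explicitTrace (hη : 0 < η.im) {n : ℕ} (m : ℕ) (lam : ℂ) (μ μ' : Idx n m)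
    (x : ℂ) : Continuous fun Λ : Fin n → ℂ => explicitTrace η hη m Λ lam μ μ' x :=
  continuous_const.mul <| continuous_apply_of_mem
    ((isContinuousLinearFamily_transfer hη continuous_id _).apply_mem
      (isContinuousLinearFamily_PhiMulti hη lam μ.1 continuous_id (bv 0))) μ'.1

end

end

section

variable {η : ℂ} {n : ℕ}

/-! ### Dependence of the hypergeometric matrices on `x` -/

/-- The span of the functions `q^((2 r - k) x)`, `0 ≤ r ≤ k`. -/
def laurentSpan (η : ℂ) (k : ℕ) : Submodule ℂ (ℂ → ℂ) :=
  Submodule.span ℂ ((fun (r : ℕ) (x : ℂ) => qpow η ((2 * r - k) * x)) '' Set.Iic k)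

/-- A finite-dimensional subspace is closed for pointwise convergence. Hence a pointwise limit of
Laurent polynomials in `q^x` of bounded degree is again one, and continuity in `x` survives limits
in the weights without any uniformity. -/
theorem isClosed_laurentSpan (η : ℂ) (k : ℕ) : IsClosed (laurentSpan η k : Set (ℂ → ℂ)) := by
  have : FiniteDimensional ℂ (laurentSpan η k) :=
    FiniteDimensional.span_of_finite ℂ ((Set.finite_Iic k).image _)
  exact Submodule.closed_of_finiteDimensional _

theorem continuous_of_mem_laurentSpan {k : ℕ} {f : ℂ → ℂ} (hf : f ∈ laurentSpan η k) :
    Continuous f := by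
  induction hf using Submodule.span_induction with
  | mem f hf =>
    obtain ⟨r, -, rfl⟩ := hf
    exact (continuous_const.mul continuous_id).qpow
  | zero => exact continuous_const
  | add f g _ _ hf hg => exact hf.add hg
  | smul a f _ hf => exact continuous_const.mul hf

theorem linear_mul_mem_laurentSpan {k : ℕ} {f : ℂ → ℂ} (hf : f ∈ laurentSpan η k) (a b t : ℂ) :
    (fun x => (qpow η (-x + a) * t - qpow η (x + b)) * f x) ∈ laurentSpan η (k + 1) := by
  induction hf using Submodule.span_induction with
  | mem f hf =>
    obtain ⟨r, hr, rfl⟩ := hf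
    have h0 : (fun x : ℂ => qpow η ((2 * (r : ℂ) - (k + 1 : ℕ)) * x)) ∈ laurentSpan η (k + 1) :=
      Submodule.subset_span ⟨r, Set.mem_Iic.mpr (by have := Set.mem_Iic.mp hr; omega), rfl⟩
    have h1 : (fun x : ℂ => qpow η ((2 * ((r + 1 : ℕ) : ℂ) - (k + 1 : ℕ)) * x)) ∈
        laurentSpan η (k + 1) :=
      Submodule.subset_span ⟨r + 1, Set.mem_Iic.mpr (by have := Set.mem_Iic.mp hr; omega), rfl⟩
    convert sub_mem (Submodule.smul_mem _ (qpow η a * t) h0) (Submodule.smul_mem _ (qpow η b) h1)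
      using 1
    funext x
    have e0 : (2 * (r : ℂ) - (k + 1 : ℕ)) * x = -x + (2 * r - k) * x := by push_cast; ring
    have e1 : (2 * ((r + 1 : ℕ) : ℂ) - (k + 1 : ℕ)) * x = x + (2 * r - k) * x := by
      push_cast; ring
    simp only [Pi.sub_apply, Pi.smul_apply, smul_eq_mul, e0, e1, qpow_add]
    ring
  | zero =>
    simp only [Pi.zero_apply, mul_zero]
    exact zero_mem _
  | add f g _ _ hf hg =>
    convert add_mem hf hg using 1
    funext x
    simp only [Pi.add_apply, mul_add]
  | smul c f _ hf =>
    convert Submodule.smul_mem _ c hf using 1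
    funext x
    simp only [Pi.smul_apply, smul_eq_mul]
    ring

theorem prod_linear_mem_laurentSpan {ι : Type*} (s : Finset ι) (a b t : ι → ℂ) :
    (fun x => ∏ i ∈ s, (qpow η (-x + a i) * t i - qpow η (x + b i))) ∈ laurentSpan η s.card := by
  classical
  induction s using Finset.induction_on with
  | empty =>
    refine Submodule.subset_span ⟨0, by simp, ?_⟩
    funext x
    simp [qpow_zero]
  | insert i s hi ih =>
    rw [Finset.card_insert_of_notMem hi]
    simp only [Finset.prod_insert hi]
    exact linear_mul_mem_laurentSpan ih _ _ _

/-- At distinct points each coloring contributes a product of `m` factors linear in `q^x` and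
`q^(-x)`. Other points are reached by a limit, the space being closed. -/
theorem dualWeightW_mem_laurentSpan {m : ℕ} (μ : Fin n → ℕ) (hμ : ∑ k, μ k = m) (Λ : Fin n → ℂ)
    (t : Fin m → ℂ) : (fun x => dualWeightW η μ x Λ t) ∈ laurentSpan η m := by
  have hinj : ∀ t : Fin m → ℂ, Function.Injective t →
      (fun x => dualWeightW η μ x Λ t) ∈ laurentSpan η m := by
    intro t ht
    have e : (fun x => dualWeightW η μ x Λ t) = weightPrefactor η m μ • ∑ c ∈ partitions μ,
        ((∏ i, ∏ j, if c j < c i then crossFactor η (t i) (t j) else 1) *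
          ∏ i, ((∏ l ∈ Finset.Ioi (c i), (qpow η (Λ l) * t i - 1)) *
            ∏ l ∈ Finset.Iio (c i), (t i - qpow η (Λ l)))) • fun x =>
        ∏ i, (qpow η (-x + (μ (c i) + ∑ l ∈ Finset.Iic (c i), (Λ l - 2 * μ l))) * t i
          - qpow η (x + (μ (c i) + ∑ l ∈ Finset.Ici (c i), (Λ l - 2 * μ l)))) := by
      funext x
      rw [dualWeightW_eq_extend μ x Λ hμ, Shuffle.extend_of_injective (isRegular_dualWeight μ x Λ) ht,
        dualWeight_apply_image μ x Λ hμ ht]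
      simp only [Pi.smul_apply, Finset.sum_apply, smul_eq_mul]
      congr 1
      refine Finset.sum_congr rfl fun c _ => ?_
      rw [mul_assoc]
      congr 1
      rw [← Finset.prod_mul_distrib]
      refine Finset.prod_congr rfl fun i _ => ?_
      rw [dualLetter, ← add_assoc, ← add_assoc]
      ring
    rw [e]
    refine Submodule.smul_mem _ _ (sum_mem fun c _ => Submodule.smul_mem _ _ ?_)
    simpa using prod_linear_mem_laurentSpan (η := η) (Finset.univ : Finset (Fin m))
      (fun i => μ (c i) + ∑ l ∈ Finset.Iic (c i), (Λ l - 2 * μ l))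
      (fun i => μ (c i) + ∑ l ∈ Finset.Ici (c i), (Λ l - 2 * μ l)) t
  have hcl : t ∈ closure {t : Fin m → ℂ | Function.Injective t} := dense_injective m t
  obtain ⟨u, hu, hlim⟩ := mem_closure_iff_seq_limit.mp hcl
  refine (isClosed_laurentSpan η m).mem_of_tendsto (b := atTop)
    (f := fun k x => dualWeightW η μ x Λ (u k)) (tendsto_pi_nhds.mpr fun x => ?_)
    (Eventually.of_forall fun k => hinj (u k) (hu k))
  simp only [dualWeightW_eq_extend μ x Λ hμ]
  exact (((isRegular_dualWeight μ x Λ).continuous_extend m).tendsto t).comp hlim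

theorem pairing_dualWeightW_mem_laurentSpan {m : ℕ} (μ : Fin n → ℕ) (hμ : ∑ k, μ k = m)
    (Λ : Fin n → ℂ) (f : (Fin m → ℂ) → ℂ) :
    (fun x => pairing η Λ f (dualWeightW η μ x Λ)) ∈ laurentSpan η m := by
  have e : (fun x => pairing η Λ f (dualWeightW η μ x Λ))
      = ∑ σ ∈ Finset.Nat.antidiagonalTuple (n + 1) m,
        (qpow η ((σ 0 : ℂ) * ((σ 0 : ℂ) - 1) / 2) / qfact η (σ 0) * f (stringPoint η m Λ σ) *
          multiResidue m (fun t => Omega η Λ t / ∏ i, t i) (stringPoint η m Λ σ)) •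
        fun x => dualWeightW η μ x Λ (stringPoint η m Λ σ) := by
    funext x
    simp only [pairing, Pi.smul_apply, Finset.sum_apply, smul_eq_mul]
    exact Finset.sum_congr rfl fun σ _ => by ring
  rw [e]
  exact sum_mem fun σ _ => Submodule.smul_mem _ _ (dualWeightW_mem_laurentSpan μ hμ Λ _)

/-! ### Limits at special weights -/

/-- The point is moved along a line in the hyperplane. Each excluded equation either fails for small
nonzero parameters, because its left side varies with nonzero derivative, or fails identically on
the hyperplane. -/
theorem mem_closure_genericWeights (hη : 0 < η.im) {m : ℕ} (hn : 0 < n) {Λ : Fin n → ℂ}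
    (hΛ : ∑ i, Λ i = 2 * m) : Λ ∈ closure (genericWeights η n m) := by
  obtain ⟨N, rfl⟩ : ∃ N, n = N + 1 := ⟨n - 1, by omega⟩
  set w : Fin N → ℕ := fun i => i + 1 with hw
  -- The direction `(-(1 + ... + N), 1, ..., N)` has sum zero and distinct entries.
  set v : Fin (N + 1) → ℂ := Fin.cons (-((∑ i, w i : ℕ) : ℂ)) (fun i => (w i : ℂ)) with hv
  have hv0 : v 0 = -((∑ i, w i : ℕ) : ℂ) := rfl
  have hvs : ∀ i, v (Fin.succ i) = (w i : ℂ) := fun i => rfl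
  have hsum : ∑ i, v i = 0 := by
    rw [Fin.sum_univ_succ, hv0]
    simp [hvs]
  have hderiv : ∀ A B c : ℂ, B ≠ 0 → ∀ᶠ e in 𝓝[≠] (0 : ℂ), qpow η (A + e * B) ≠ c := by
    intro A B c hB
    have h1 : η ≠ 0 := by rintro rfl; simp at hη
    have h2 : (Real.pi : ℂ) ≠ 0 := by exact_mod_cast Real.pi_ne_zero
    have hd : HasDerivAt (fun e : ℂ => qpow η (A + e * B))
        (qpow η (A + 0 * B) * (Real.pi * Complex.I * η * (1 * B))) 0 :=
      ((((hasDerivAt_id (0 : ℂ)).mul_const B).const_add A).const_mul _).cexp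
    exact hd.eventually_ne (mul_ne_zero (qpow_ne_zero _ _) (by simp [h1, h2, hB]))
  -- The sum of two entries can vanish only for one or two sites. There `Λ_j + Λ_k` is forced to be
  -- `4m` or `2m` by the hyperplane, and `q^(2p)` with `p ≥ m` differs from all `q^(2s)` with `s <
  -- m`.
  have hpair : ∀ j k : Fin (N + 1), v j + v k ≠ 0 ∨ ∀ L : Fin (N + 1) → ℂ, ∑ i, L i = 2 * m →
      ∃ p : ℕ, m ≤ p ∧ L j + L k = 2 * p := by
    have hz : ∀ k : Fin N, v 0 + v k.succ ≠ 0 ∨ ∀ L : Fin (N + 1) → ℂ, ∑ i, L i = 2 * m →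
        ∃ p : ℕ, m ≤ p ∧ L 0 + L k.succ = 2 * p := by
      intro k
      by_cases he : Finset.univ.erase k = (∅ : Finset (Fin N))
      · right
        intro L hL
        refine ⟨m, le_rfl, ?_⟩
        rw [← hL, Fin.sum_univ_succ, ← Finset.add_sum_erase _ _ (Finset.mem_univ k), he]
        simp
      · left
        rw [hv0, hvs, ← Finset.add_sum_erase _ _ (Finset.mem_univ k)]
        intro h
        have h' : ((∑ i ∈ Finset.univ.erase k, w i : ℕ) : ℂ) = 0 := by
          push_cast at h ⊢
          linear_combination -h
        obtain ⟨i, hi⟩ := Finset.nonempty_iff_ne_empty.mpr he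
        have := Finset.sum_eq_zero_iff.mp (Nat.cast_eq_zero.mp h') i hi
        simp [hw] at this
    intro j k
    rcases Fin.eq_zero_or_eq_succ j with rfl | ⟨j, rfl⟩ <;>
      rcases Fin.eq_zero_or_eq_succ k with rfl | ⟨k, rfl⟩
    · rcases isEmpty_or_nonempty (Fin N) with hN | ⟨⟨i⟩⟩
      · right
        intro L hL
        rw [Fin.sum_univ_succ] at hL
        refine ⟨2 * m, by omega, ?_⟩
        simp at hL
        rw [hL]
        push_cast
        ring
      · left
        rw [hv0]
        intro h
        have h' : ((∑ i, w i : ℕ) : ℂ) = 0 := by linear_combination -h / 2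
        have := Finset.sum_eq_zero_iff.mp (Nat.cast_eq_zero.mp h') i (Finset.mem_univ i)
        simp [hw] at this
    · exact hz k
    · simpa only [add_comm] using hz j
    · left
      rw [hvs, hvs]
      norm_cast
  have hdiff : ∀ j k : Fin (N + 1), j ≠ k → v j - v k ≠ 0 := by
    intro j k hjk
    rw [sub_ne_zero]
    have hz : ∀ k : Fin N, v 0 ≠ v k.succ := by
      intro k h
      rw [hv0, hvs] at h
      have h' : ((∑ i, w i + w k : ℕ) : ℂ) = 0 := by push_cast at h ⊢; linear_combination -h
      have := Nat.cast_eq_zero.mp h'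
      simp [hw] at this
    rcases Fin.eq_zero_or_eq_succ j with rfl | ⟨j, rfl⟩ <;>
      rcases Fin.eq_zero_or_eq_succ k with rfl | ⟨k, rfl⟩
    · exact absurd rfl hjk
    · exact hz k
    · exact (hz j).symm
    · rw [hvs, hvs]
      intro h
      have := Nat.cast_injective h
      refine hjk (congrArg Fin.succ (Fin.ext ?_))
      simpa [hw] using this
  have hline : ∀ e : ℂ, ∑ i, (Λ i + e * v i) = 2 * m := by
    intro e
    rw [Finset.sum_add_distrib, ← Finset.mul_sum, hsum, hΛ, mul_zero, add_zero]
  have htend : Tendsto (fun (e : ℂ) i => Λ i + e * v i) (𝓝[≠] 0) (𝓝 Λ) := by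
    have : Continuous fun (e : ℂ) i => Λ i + e * v i := by fun_prop
    simpa using (this.tendsto 0).mono_left nhdsWithin_le_nhds
  refine mem_closure_of_tendsto htend ?_
  have hA : ∀ᶠ e in 𝓝[≠] (0 : ℂ), ∀ j k : Fin (N + 1), ∀ s ∈ Finset.range m,
      qpow η (Λ j + e * v j + (Λ k + e * v k)) ≠ qpow η (2 * s) := by
    refine eventually_all.mpr fun j => eventually_all.mpr fun k =>
      (eventually_all_finset _).mpr fun s hs => ?_
    rcases hpair j k with h | h
    · filter_upwards [hderiv (Λ j + Λ k) _ (qpow η (2 * s)) h] with e he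
      convert he using 2
      ring
    · refine Eventually.of_forall fun e => ?_
      obtain ⟨p, hp, hL⟩ := h (fun i => Λ i + e * v i) (hline e)
      obtain ⟨d, rfl⟩ := Nat.exists_eq_add_of_lt ((Finset.mem_range.mp hs).trans_le hp)
      rw [hL]
      intro h2
      refine qpow_even_ne_one hη d ?_
      have e1 : (2 * ((s + d + 1 : ℕ) : ℂ)) = 2 * s + 2 * ((d : ℂ) + 1) := by push_cast; ring
      rw [e1, qpow_add] at h2
      exact mul_left_cancel₀ (qpow_ne_zero η (2 * s)) (by rw [h2, mul_one])
  have hB : ∀ᶠ e in 𝓝[≠] (0 : ℂ), ∀ j k : Fin (N + 1), j ≠ k → ∀ s ∈ Finset.Icc (-m : ℤ) m,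
      qpow η (Λ j + e * v j - (Λ k + e * v k)) ≠ qpow η (2 * s) := by
    refine eventually_all.mpr fun j => eventually_all.mpr fun k =>
      eventually_imp_distrib_left.mpr fun hjk => (eventually_all_finset _).mpr fun s hs => ?_
    filter_upwards [hderiv (Λ j - Λ k) _ (qpow η (2 * s)) (hdiff j k hjk)] with e he
    convert he using 2
    ring
  filter_upwards [hA, hB] with e h1 h2
  refine ⟨hline e, fun j k s hs => h1 j k s (Finset.mem_range.mpr hs), fun j k hjk s hs =>
    h2 j k hjk s (Finset.mem_Icc.mpr (abs_le.mp hs))⟩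

/-- Along some filter of generic weights, a regular family tends to its value. -/
theorem exists_filter_tendsto_extendFrom (hη : 0 < η.im) {m : ℕ} (hn : 0 < n) {Λ : Fin n → ℂ}
    (hΛ : ∑ i, Λ i = 2 * m) : ∃ l : Filter (Fin n → ℂ), l.NeBot ∧ l ≤ 𝓝 Λ ∧
      genericWeights η n m ∈ l ∧
      (∀ x, IsRegularAt η m (fun x => residueQKZ η m x) Λ →
        Tendsto (residueQKZ η m x) l (𝓝 (qKZ η m x Λ))) ∧
      ∀ lam x, IsRegularAt η m (fun x => residueQKZB η m lam x) Λ →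
        Tendsto (residueQKZB η m lam x) l (𝓝 (qKZB η m lam x Λ)) := by
  by_cases hg : Λ ∈ genericWeights η n m
  -- At a generic point the matrices are the residue sums themselves. The principal filter makes
  -- continuity of these sums in the weights unnecessary.
  · refine ⟨pure Λ, inferInstance, pure_le_nhds Λ, hg, fun x _ => ?_, fun lam x _ => ?_⟩
    · rw [qKZ, if_pos hg]
      exact tendsto_pure_nhds _ _
    · rw [qKZB, if_pos hg]
      exact tendsto_pure_nhds _ _
  · refine ⟨𝓝[genericWeights η n m] Λ,
      mem_closure_iff_nhdsWithin_neBot.mp (mem_closure_genericWeights hη hn hΛ),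
      nhdsWithin_le_nhds, self_mem_nhdsWithin, fun x h => ?_, fun lam x h => ?_⟩
    · rw [qKZ, if_neg hg]
      exact tendsto_extendFrom ((h.resolve_left hg) x)
    · rw [qKZB, if_neg hg]
      exact tendsto_extendFrom ((h.resolve_left hg) x)

theorem eventually_isTraceRegular (hη : 0 < η.im) (m : ℕ) (x : ℂ) :
    ∀ᶠ y in 𝓝[≠] x, IsTraceRegular η m y := by
  have h1 : η ≠ 0 := by rintro rfl; simp at hη
  have h2 : (Real.pi : ℂ) ≠ 0 := by exact_mod_cast Real.pi_ne_zero
  have h : ∀ᶠ y in 𝓝[≠] x, ∀ j ∈ Finset.range m,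
      1 - qpow η (-(2 * ((j : ℂ) + 1))) * qpow η (-(2 * y)) ≠ 0 := by
    refine (eventually_all_finset _).mpr fun j _ => ?_
    have hd : HasDerivAt (fun y : ℂ => qpow η (-(2 * y)))
        (qpow η (-(2 * x)) * (Real.pi * Complex.I * η * -(2 * 1))) x :=
      (((hasDerivAt_id x).const_mul 2).neg.const_mul _).cexp
    filter_upwards [hd.eventually_ne (mul_ne_zero (qpow_ne_zero _ _) (by simp [h1, h2]))
      (c := (qpow η (-(2 * ((j : ℂ) + 1))))⁻¹)] with y hy h0
    exact hy (eq_inv_of_mul_eq_one_right (sub_eq_zero.mp h0).symm)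
  filter_upwards [h] with y hy j hj
  exact hy j (Finset.mem_range.mpr hj)

/-- The identity at generic weights passes to the limit along one filter that serves both
hypergeometric matrices, while the trace matrix converges because its closed form is continuous in
the weights. -/
theorem qKZB_eq_of_isTraceRegular (hη : 0 < η.im) {m : ℕ} (hn : 0 < n) {Λ : Fin n → ℂ}
    (hΛ : ∑ i, Λ i = 2 * m) (lam : ℂ) (h1 : IsRegularAt η m (fun x => residueQKZ η m x) Λ)
    (h2 : IsRegularAt η m (fun x => residueQKZB η m lam x) Λ) {x : ℂ} (hx : IsTraceRegular η m x) :
    qKZB η m lam x Λ = traceMatrix η hη m Λ lam x * qKZ η m x Λ := by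
  obtain ⟨l, hl, hle, hgen, hA, hB⟩ := exists_filter_tendsto_extendFrom hη hn hΛ
  have hT : Tendsto (fun L => Matrix.of fun μ μ' => explicitTrace η hη m L lam μ μ' x) l
      (𝓝 (traceMatrix η hη m Λ lam x)) := by
    refine tendsto_pi_nhds.mpr fun μ => tendsto_pi_nhds.mpr fun μ' => ?_
    have := ((continuous_explicitTrace hη m lam μ μ' x).tendsto Λ).mono_left hle
    rwa [← traceFunction_eq_explicitTrace hη hΛ lam μ μ' hx] at this
  refine tendsto_nhds_unique (hB lam x h2) ?_
  refine (((continuous_fst.matrix_mul continuous_snd).tendsto _).comp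
    (hT.prodMk_nhds (hA x h1))).congr' ?_
  filter_upwards [hgen] with L hL
  exact (residueQKZB_eq hη hL lam hx).symm

theorem continuous_qKZ (hη : 0 < η.im) {m : ℕ} (hn : 0 < n) {Λ : Fin n → ℂ}
    (hΛ : ∑ i, Λ i = 2 * m) (h : IsRegularAt η m (fun x => residueQKZ η m x) Λ) :
    Continuous fun x => qKZ η m x Λ := by
  obtain ⟨l, hl, -, -, hA, -⟩ := exists_filter_tendsto_extendFrom hη hn hΛ
  refine continuous_matrix fun μ μ' => continuous_of_mem_laurentSpan (η := η) (k := m) ?_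
  refine (isClosed_laurentSpan η m).mem_of_tendsto (b := l)
    (f := fun L x => residueQKZ η m x L μ μ') (tendsto_pi_nhds.mpr fun x => ?_)
    (Eventually.of_forall fun L => ?_)
  · exact tendsto_pi_nhds.mp (tendsto_pi_nhds.mp (hA x h) μ) μ'
  · exact pairing_dualWeightW_mem_laurentSpan μ'.1 (Finset.Nat.mem_antidiagonalTuple.mp μ'.2) L _

theorem continuous_qKZB (hη : 0 < η.im) {m : ℕ} (hn : 0 < n) {Λ : Fin n → ℂ}
    (hΛ : ∑ i, Λ i = 2 * m) (lam : ℂ) (h : IsRegularAt η m (fun x => residueQKZB η m lam x) Λ) :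
    Continuous fun x => qKZB η m lam x Λ := by
  obtain ⟨l, hl, -, -, -, hB⟩ := exists_filter_tendsto_extendFrom hη hn hΛ
  refine continuous_matrix fun μ μ' => ?_
  -- Without the factor `q^(lam x)` the entry is a limit of Laurent polynomials in `q^x`, so the
  -- closed-span argument applies.
  have hc : Continuous fun x => qpow η (-(lam * x)) * qKZB η m lam x Λ μ μ' := by
    refine continuous_of_mem_laurentSpan (η := η) (k := m) ?_
    refine (isClosed_laurentSpan η m).mem_of_tendsto (b := l)
      (f := fun L x => qpow η (-(lam * x)) * residueQKZB η m lam x L μ μ')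
      (tendsto_pi_nhds.mpr fun x => ?_) (Eventually.of_forall fun L => ?_)
    · exact (tendsto_pi_nhds.mp (tendsto_pi_nhds.mp (hB lam x h) μ) μ').const_mul _
    · simp only [residueQKZB, Matrix.of_apply, ← mul_assoc, ← qpow_add, neg_add_cancel, qpow_zero,
        one_mul]
      exact pairing_dualWeightW_mem_laurentSpan μ'.1 (Finset.Nat.mem_antidiagonalTuple.mp μ'.2) L _
  have hq : Continuous fun x => qpow η (lam * x) := (continuous_const.mul continuous_id).qpow
  refine (hq.fun_mul hc).congr fun x => ?_
  rw [← mul_assoc, ← qpow_add, add_neg_cancel, qpow_zero, one_mul]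

/-- A denominator of the closed form may vanish at `x` although the trace matrix has no pole there.
Such points are isolated, and both sides are continuous at `x`, so the identity extends from the
punctured neighbourhood. -/
theorem qKZB_eq_traceMatrix_mul (hη : 0 < η.im) {m : ℕ} (hn : 0 < n) {Λ : Fin n → ℂ}
    (hΛ : ∑ i, Λ i = 2 * m) (lam : ℂ) (h1 : IsRegularAt η m (fun x => residueQKZ η m x) Λ)
    (h2 : IsRegularAt η m (fun x => residueQKZB η m lam x) Λ) {x : ℂ}
    (hx : ∀ μ μ' : Idx n m, ContinuousAt (fun y => traceMatrix η hη m Λ lam y μ μ') x) :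
    qKZB η m lam x Λ = traceMatrix η hη m Λ lam x * qKZ η m x Λ := by
  have hT : ContinuousAt (fun y => traceMatrix η hη m Λ lam y) x :=
    continuousAt_pi.mpr fun μ => continuousAt_pi.mpr fun μ' => hx μ μ'
  have hR : Tendsto (fun y => traceMatrix η hη m Λ lam y * qKZ η m y Λ) (𝓝[≠] x)
      (𝓝 (traceMatrix η hη m Λ lam x * qKZ η m x Λ)) :=
    ((continuous_fst.matrix_mul continuous_snd).tendsto _).comp <|
      (hT.tendsto.prodMk_nhds (continuous_qKZ hη hn hΛ h1).continuousAt.tendsto).mono_left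
        nhdsWithin_le_nhds
  refine tendsto_nhds_unique
    (((continuous_qKZB hη hn hΛ lam h2).tendsto x).mono_left nhdsWithin_le_nhds) (hR.congr' ?_)
  filter_upwards [eventually_isTraceRegular hη m x] with y hy
  exact (qKZB_eq_of_isTraceRegular hη hn hΛ lam h1 h2 hy).symm

end

end HyperQKZ

end

theorem theorem4p5 (η : ℂ) (hη : 0 < η.im) (n m : ℕ) (hn : 0 < n)
    (Λ : Fin n → ℂ) (hΛ : ∑ i, Λ i = 2 * m) (lam : ℂ) :
    (∀ μ μ' : HyperQKZ.Idx n m, HyperQKZ.IsTraceFunction η hη m Λ lam μ μ'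
        fun x => HyperQKZ.traceMatrix η hη m Λ lam x μ μ') ∧
    (HyperQKZ.IsRegularAt η m (fun x => HyperQKZ.residueQKZ η m x) Λ →
      HyperQKZ.IsRegularAt η m (fun x => HyperQKZ.residueQKZB η m lam x) Λ →
      ∀ x : ℂ,
        (∀ μ μ' : HyperQKZ.Idx n m,
          AnalyticAt ℂ (fun y => HyperQKZ.traceMatrix η hη m Λ lam y μ μ') x) →
        HyperQKZ.qKZB η m lam x Λ =
          HyperQKZ.traceMatrix η hη m Λ lam x * HyperQKZ.qKZ η m x Λ) :=
  ⟨fun μ μ' => HyperQKZ.isTraceFunction_traceFunction hη hΛ lam μ μ',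
    fun h1 h2 _ hx => HyperQKZ.qKZB_eq_traceMatrix_mul hη hn hΛ lam h1 h2
      fun μ μ' => (hx μ μ').continuousAt⟩
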